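/- **Networks.** Let $G$ be a finite directed graph (loops and multiple edges allowed) drawn without crossings in an annulus $r\le |z|\le R$, with $n$ vertices on the boundary circles (the edges being transversal to the circles there) and all other vertices and all edges inside. Each boundary vertex is a source (exactly one edge, outgoing) or a sink (exactly one edge, incoming); each internal vertex has degree $3$ and has exactly one incoming or exactly one outgoing edge. A cut $\rho$ is a simple curve from a base point on the inner circle to a base point on the outer circle, both distinct from the boundary vertices and $\rho$ transversal to the circles there. Edges and cut are drawn as polygonal curves in general position: the cut avoids vertices and corners of edges, edges avoid the corners of the cut, and edges and cut cross transversally. For an edge $e$, $\operatorname{ind}(e)$ is the algebraic intersection number of $e$ and $\rho$ (a crossing counts $1$ if the tangents of $e$ and $\rho$, in this order, form a positive basis, and $-1$ otherwise). Boundary vertices are labelled $b_1,\dots,b_{n_1}$ counterclockwise on the outer circle and $b_{n_1+1},\dots,b_n$ clockwise on the inner circle, in both cases starting after the base point of the cut. Let $I$ be the set of indices of sources and $k=|I|$. Each edge $e$ has a nonzero weight $w_e$ in a field $K$ (for example $K=\mathbb R$, or $K=\mathbb Q(x_1,\dots,x_d)$). **Weights of paths.** For a path $P$ from a source $b_i$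 to a sink $b_j$ let $C_P$ be the closed curve obtained by adding to $P$: the counterclockwise arc from $b_j$ to $b_i$ if both lie on the same circle; otherwise the counterclockwise arc from $b_j$ to the base point of the cut, then the cut, then the counterclockwise arc from the other base point to $b_i$. Its concordance number $c(C_P)\in\mathbb Z/2$ is the parity of the number of times the direction of the tangent of $C_P$ passes through a generic direction $l$ (at a corner: $l$ lies in the interior of the cone spanned by the two directions); it does not depend on $l$. The weight of $P$ is $(-1)^{c(C_P)-1}\prod_{e\in P}\bar w_e$ with $\bar w_e=w_e\lambda^{\operatorname{ind}(e)}$. **Boundary measurements.** $M(i,j)$ is the sum of the weights of all paths from $b_i$ to $b_j$; as a formal power series in the $\bar w_e$ over $\mathbb Z$ it is a rational function, and it is evaluated at $\bar w_e=w_e\lambda^{\operatorname{ind}(e)}$ to an element of $K(\lambda)$ wherever this rational function is regular. Let $\widetilde X_N$ be the $k\times n$ matrix over $K(\lambda)$, with rows indexed by $I$, whose columns indexed by $I$ form the identity matrix and whose $(i,j)$-entry for a sink $b_j$ is $(-1)^{s(i,j)}M(i,j)$, where $s(i,j)$ is the number of elements of $I$ strictly between $\min\{i,j\}$ and $\max\{i,j\}$.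 Its row space $X_N(w)$, a $k$-dimensional subspace of $K(\lambda)^n$ (a rational function of $\lambda$ with values in the Grassmannian $G_k(n)$), is the Grassmannian boundary measurement. **Path reversal.** For a simple path $P$ from $b_i$ to $b_j$ let $N^P$ be obtained from $N$ by changing the direction of every edge of $P$, and let $R^P$ replace $w_e$ by $1/w_e$ for $e\in P$. Let $t^P=1$ if $b_i,b_j$ lie on the same circle and $t^P=-1$ otherwise; $S_1$ is the identity and $S_{-1}$ takes $X(\lambda)$ to $X(-\lambda)$. **Theorem.** Let $w$ be nonzero edge weights at which all boundary measurements of $N$ are regular, and let $P$ be a simple path from a source $b_i$ to a sink $b_j$ that does not meet the cut and for which $M(i,j)$ is not identically zero (as an element of $K(\lambda)$ at $w$). Then all boundary measurements of $N^P$ are regular at $R^P(w)$, and $$S_{t^P}\bigl(X_N(w)\bigr)=X_{N^P}\bigl(R^P(w)\bigr).$$ -/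

import Mathlib

open scoped nonZeroDivisors

noncomputable section

namespace AnnularNet

/-! ### Plane geometry -/

/-- The determinant of the pair `(u, v)` of plane vectors; it is positive exactly when `(u, v)` is a
positively oriented basis, and zero exactly when `u` and `v` are collinear. -/
def cross (u v : ℂ) : ℝ := u.re * v.im - u.im * v.re

/-- The scalar product of two plane vectors. -/
def dot (u v : ℂ) : ℝ := u.re * v.re + u.im * v.im

/-- The angle in `[0, 2π)` by which the ray of `z` has to be turned counterclockwise in order to
reach the ray of `x`. -/
def ccw (z x : ℂ) : ℝ := toIcoMod Real.two_pi_pos 0 (x.arg - z.arg)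

/-- An oriented polygonal curve, with the consecutive points `pt 0, …, pt len`. The values `pt k`
with `k > len` are irrelevant. -/
structure Polyline where
  len : ℕ
  pt : ℕ → ℂ

namespace Polyline

/-- The same curve with the opposite orientation. -/
def rev (γ : Polyline) : Polyline := ⟨γ.len, fun k => γ.pt (γ.len - k)⟩

/-- The direction of the `k`-th segment. -/
def dir (γ : Polyline) (k : ℕ) : ℂ := γ.pt (k + 1) - γ.pt k

/-- The `k`-th segment without its endpoints. -/
def openSeg (γ : Polyline) (k : ℕ) : Set ℂ := openSegment ℝ (γ.pt k) (γ.pt (k + 1))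

/-- The set of points of the curve. -/
def carrier (γ : Polyline) : Set ℂ := ⋃ k < γ.len, segment ℝ (γ.pt k) (γ.pt (k + 1))

/-- `pt k` is one of the two endpoints of the curve. -/
def IsEnd (γ : Polyline) (k : ℕ) : Prop := k = 0 ∨ k = γ.len

open Classical in
/-- The algebraic intersection number of `γ` and `δ` (for curves that meet transversally, at inner
points of their segments): an intersection point contributes `1` if the tangents of `γ` and `δ`, in
this order, form a positively oriented basis, and `-1` otherwise. -/
def ind (γ δ : Polyline) : ℤ :=
  ∑ k ∈ Finset.range γ.len, ∑ m ∈ Finset.range δ.len,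
    if (γ.openSeg k ∩ δ.openSeg m).Nonempty then
      (SignType.sign (cross (γ.dir k) (δ.dir m)) : ℤ) else 0

end Polyline

/-- The curves `γ i` are simple and meet each other at common endpoints only (a single curve may
be closed): no two of their open segments meet, no point of the lists lies on an open
segment, and points of the lists coincide only if they are the same entry or both are endpoints of
their curves. -/
structure IsEmbeddedFamily {ι : Type*} (γ : ι → Polyline) : Prop where
  len_pos : ∀ i, 0 < (γ i).len
  pt_inj : ∀ i j k m, k ≤ (γ i).len → m ≤ (γ j).len → (γ i).pt k = (γ j).pt m →
    (i = j ∧ k = m) ∨ ((γ i).IsEnd k ∧ (γ j).IsEnd m)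
  pt_notMem : ∀ i j k m, k ≤ (γ i).len → m < (γ j).len → (γ i).pt k ∉ (γ j).openSeg m
  seg_disjoint : ∀ i j k m, k < (γ i).len → m < (γ j).len → (i ≠ j ∨ k ≠ m) →
    Disjoint ((γ i).openSeg k) ((γ j).openSeg m)

/-! ### The concordance number of a closed curve -/

/-- A piece of a piecewise smooth curve: the straight segment from `a` to `b`, or the
counterclockwise arc from `z` to `w` of a circle with centre `0`. -/
inductive Piece where
  | seg (a b : ℂ)
  | arc (z w : ℂ)

namespace Piece

/-- The tangent vector at the starting point of a piece. -/
def tStart : Piece → ℂ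
  | seg a b => b - a
  | arc z _ => Complex.I * z

/-- The tangent vector at the final point of a piece. -/
def tEnd : Piece → ℂ
  | seg a b => b - a
  | arc _ w => Complex.I * w

open Classical in
/-- The number of inner points of a piece at which the tangent has the direction `l`: along a
counterclockwise arc the tangent turns counterclockwise from `tStart` to `tEnd`. -/
def inner (l : ℂ) : Piece → ZMod 2
  | seg _ _ => 0
  | arc z w => if 0 < ccw (Complex.I * z) l ∧ ccw (Complex.I * z) l < ccw (Complex.I * z) (Complex.I * w)
      then 1 else 0

end Piece

/-- The pieces of a polygonal curve. -/
def Polyline.pieces (γ : Polyline) : List Piece :=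
  (List.range γ.len).map fun k => Piece.seg (γ.pt k) (γ.pt (k + 1))

open Classical in
/-- The contribution `c_l(d, d')` of a corner with incoming direction `d` and outgoing direction
`d'`: it is `1` if `l` belongs to the interior of the cone spanned by `d` and `d'`, and `0` otherwise
(`l` is not collinear to `d` or `d'`). -/
def corner (l d d' : ℂ) : ZMod 2 :=
  if ∃ a b : ℝ, 0 < a ∧ 0 < b ∧ l = a * d + b * d' then 1 else 0

/-- The number `c_l(C)` of the closed curve `C`, given by the cyclic list of its pieces. -/
def concordanceAlong (l : ℂ) (C : List Piece) : ZMod 2 :=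
  (C.map (Piece.inner l)).sum +
    ((C.zip (C.rotate 1)).map fun pq => corner l pq.1.tEnd pq.2.tStart).sum

/-- The line with directing vector `l` is admissible for `C`: it is not collinear to a segment of `C`
or to a tangent of `C` at an endpoint of an arc. -/
def Generic (C : List Piece) (l : ℂ) : Prop :=
  l ≠ 0 ∧ ∀ p ∈ C, cross p.tStart l ≠ 0 ∧ cross p.tEnd l ≠ 0

/-- The concordance number `c(C)`: the common value of `c_l(C)` for all admissible `l`. See
`concordance_eq` for the independence of `l`. -/
def concordance (C : List Piece) : ZMod 2 :=
  concordanceAlong (Classical.epsilon (Generic C)) C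

theorem ccw_eq (z x : ℂ) :
    ccw z x = if z.arg ≤ x.arg then x.arg - z.arg else x.arg - z.arg + 2 * Real.pi := by
  have h1 := Complex.neg_pi_lt_arg z
  have h2 := Complex.arg_le_pi z
  have h3 := Complex.neg_pi_lt_arg x
  have h4 := Complex.arg_le_pi x
  unfold ccw
  split_ifs with h
  · rw [toIcoMod_eq_self]
    constructor <;> linarith
  · rw [← toIcoMod_add_right, toIcoMod_eq_self]
    push Not at h
    constructor <;> linarith

theorem cross_eq_sin (z x : ℂ) : cross z x = ‖z‖ * ‖x‖ * Real.sin (x.arg - z.arg) := by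
  rw [Real.sin_sub]
  have a1 := Complex.norm_mul_cos_arg z
  have a2 := Complex.norm_mul_sin_arg z
  have a3 := Complex.norm_mul_cos_arg x
  have a4 := Complex.norm_mul_sin_arg x
  unfold cross
  rw [← a1, ← a2, ← a3, ← a4]; ring

theorem cross_eq_sin_ccw (z x : ℂ) : cross z x = ‖z‖ * ‖x‖ * Real.sin (ccw z x) := by
  rw [cross_eq_sin, ccw_eq]
  split_ifs
  · rfl
  · rw [Real.sin_add_two_pi]

theorem cross_eq_sin_ccw_sub (d l x : ℂ) :
    cross l x = ‖l‖ * ‖x‖ * Real.sin (ccw d x - ccw d l) := by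
  rw [cross_eq_sin, ccw_eq, ccw_eq]
  split_ifs
  · ring_nf
  · rw [← Real.sin_sub_two_pi]; ring_nf
  · rw [← Real.sin_add_two_pi]; ring_nf
  · ring_nf

theorem arg_ne_of_cross_ne {z x : ℂ} (h : cross z x ≠ 0) : z.arg ≠ x.arg := by
  intro h'
  apply h
  rw [cross_eq_sin, h']; simp

theorem mem_cone_iff {d d' l : ℂ} (hd : d ≠ 0) (hd' : d' ≠ 0) (hl : l ≠ 0)
    (h0 : 0 < ccw d d') (h1 : ccw d d' < Real.pi) :
    (∃ a b : ℝ, 0 < a ∧ 0 < b ∧ l = a * d + b * d') ↔ 0 < ccw d l ∧ ccw d l < ccw d d' := by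
  have nd : 0 < ‖d‖ := norm_pos_iff.2 hd
  have nd' : 0 < ‖d'‖ := norm_pos_iff.2 hd'
  have nl : 0 < ‖l‖ := norm_pos_iff.2 hl
  have hD : 0 < cross d d' := by
    rw [cross_eq_sin_ccw]
    have := Real.sin_pos_of_pos_of_lt_pi h0 h1
    positivity
  have hr : 0 ≤ ccw d l ∧ ccw d l < 2 * Real.pi := by
    have := toIcoMod_mem_Ico Real.two_pi_pos 0 (l.arg - d.arg)
    simpa [ccw] using this
  have step : (∃ a b : ℝ, 0 < a ∧ 0 < b ∧ l = a * d + b * d') ↔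
      0 < cross d l ∧ 0 < cross l d' := by
    constructor
    · rintro ⟨a, b, ha, hb, rfl⟩
      have e1 : cross d (a * d + b * d') = b * cross d d' := by simp [cross]; ring
      have e2 : cross (a * d + b * d') d' = a * cross d d' := by simp [cross]; ring
      rw [e1, e2]
      constructor <;> positivity
    · rintro ⟨p, q⟩
      refine ⟨cross l d' / cross d d', cross d l / cross d d', by positivity, by positivity, ?_⟩
      have hne := hD.ne'
      apply Complex.ext
      · simp
        field_simp
        simp [cross]; ring
      · simp
        field_simp
        simp [cross]; ring
  rw [step, cross_eq_sin_ccw d l, cross_eq_sin_ccw_sub d l d']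
  constructor
  · rintro ⟨p, q⟩
    have p' : 0 < Real.sin (ccw d l) := pos_of_mul_pos_right p (by positivity)
    have q' : 0 < Real.sin (ccw d d' - ccw d l) := pos_of_mul_pos_right q (by positivity)
    have k1 : 0 < ccw d l := by
      rcases hr.1.lt_or_eq with h | h
      · exact h
      · rw [← h] at p'; simp at p'
    have k2 : ccw d l < Real.pi := by
      by_contra! h
      have := Real.sin_nonneg_of_nonneg_of_le_pi (x := ccw d l - Real.pi) (by linarith)
        (by linarith)
      rw [Real.sin_sub_pi] at this
      linarith
    refine ⟨k1, ?_⟩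
    by_contra! h
    have := Real.sin_nonpos_of_nonpos_of_neg_pi_le (x := ccw d d' - ccw d l) (by linarith)
      (by linarith)
    linarith
  · rintro ⟨p, q⟩
    have s1 := Real.sin_pos_of_pos_of_lt_pi p (by linarith)
    have s2 := Real.sin_pos_of_pos_of_lt_pi (x := ccw d d' - ccw d l) (by linarith) (by linarith)
    constructor <;> positivity

open Classical in
/-- The indicator of the open counterclockwise sector from `z` to `w`. -/
def sector (z w x : ℂ) : ZMod 2 := if 0 < ccw z x ∧ ccw z x < ccw z w then 1 else 0

theorem sector_exchange {t t' l m : ℂ} (h1 : t.arg ≠ l.arg) (h2 : t.arg ≠ m.arg)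
    (h3 : t'.arg ≠ l.arg) (h4 : t'.arg ≠ m.arg) :
    sector t t' l + sector t t' m = sector l m t + sector l m t' := by
  have two : (1 : ZMod 2) + 1 = 0 := by decide
  have a1 := Complex.neg_pi_lt_arg t
  have a2 := Complex.arg_le_pi t
  have b1 := Complex.neg_pi_lt_arg t'
  have b2 := Complex.arg_le_pi t'
  have c1 := Complex.neg_pi_lt_arg l
  have c2 := Complex.arg_le_pi l
  have d1 := Complex.neg_pi_lt_arg m
  have d2 := Complex.arg_le_pi m
  unfold sector
  simp only [ccw_eq]
  rcases h1.lt_or_gt with h1 | h1 <;> rcases h2.lt_or_gt with h2 | h2 <;>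
  rcases h3.lt_or_gt with h3 | h3 <;> rcases h4.lt_or_gt with h4 | h4 <;>
  rcases le_total t.arg t'.arg with h5 | h5 <;>
  rcases le_total l.arg m.arg with h6 | h6 <;>
  grind

theorem corner_comm (l d d' : ℂ) : corner l d d' = corner l d' d := by
  unfold corner
  congr 1
  apply propext
  constructor <;>
  · rintro ⟨a, b, ha, hb, h⟩
    exact ⟨b, a, hb, ha, by rw [h, add_comm]⟩

theorem corner_eq_sector {l d d' : ℂ} (hd : d ≠ 0) (hd' : d' ≠ 0) (hl : l ≠ 0)
    (h0 : 0 < ccw d d') (h1 : ccw d d' < Real.pi) : corner l d d' = sector d d' l := by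
  unfold corner sector
  simp only [mem_cone_iff hd hd' hl h0 h1]

/-- The directions of `d` and `d'` are not opposite (and both are defined). -/
def NoCusp (d d' : ℂ) : Prop := d ≠ 0 ∧ d' ≠ 0 ∧ ccw d d' ≠ Real.pi

theorem corner_exchange {l m d d' : ℂ} (h : NoCusp d d') (hl : l ≠ 0) (hm : m ≠ 0)
    (h1 : cross d l ≠ 0) (h2 : cross d m ≠ 0) (h3 : cross d' l ≠ 0) (h4 : cross d' m ≠ 0) :
    corner l d d' + corner m d d' = sector l m d + sector l m d' := by
  obtain ⟨hd, hd', hc⟩ := h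
  have e1 := arg_ne_of_cross_ne h1
  have e2 := arg_ne_of_cross_ne h2
  have e3 := arg_ne_of_cross_ne h3
  have e4 := arg_ne_of_cross_ne h4
  have two : ∀ x : ZMod 2, x + x = 0 := by decide
  by_cases heq : d.arg = d'.arg
  · have aux : ∀ k : ℂ, cross d k ≠ 0 → corner k d d' = 0 := by
      intro k hk
      unfold corner
      rw [if_neg]
      rintro ⟨a, b, -, -, rfl⟩
      apply hk
      have z : cross d d' = 0 := by rw [cross_eq_sin, heq]; simp
      have : cross d (a * d + b * d') = b * cross d d' := by simp [cross]; ring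
      rw [this, z, mul_zero]
    have s : sector l m d = sector l m d' := by simp only [sector, ccw_eq, heq]
    rw [aux l h1, aux m h2, s, two, two]
  · have p1 := Complex.neg_pi_lt_arg d
    have p2 := Complex.arg_le_pi d
    have p3 := Complex.neg_pi_lt_arg d'
    have p4 := Complex.arg_le_pi d'
    have hpos : 0 < ccw d d' := by rw [ccw_eq]; grind
    have hpos' : 0 < ccw d' d := by rw [ccw_eq]; grind
    have hsum : ccw d d' + ccw d' d = 2 * Real.pi := by rw [ccw_eq, ccw_eq]; grind
    rcases lt_or_gt_of_ne hc with hlt | hgt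
    · rw [corner_eq_sector hd hd' hl hpos hlt, corner_eq_sector hd hd' hm hpos hlt,
        sector_exchange e1 e2 e3 e4]
    · have hlt : ccw d' d < Real.pi := by linarith
      rw [corner_comm l, corner_comm m, corner_eq_sector hd' hd hl hpos' hlt,
        corner_eq_sector hd' hd hm hpos' hlt, sector_exchange e3 e4 e1 e2, add_comm]

/-- `c_l(C)` does not depend on the admissible direction `l`, for a closed curve without cusps. -/
theorem concordanceAlong_eq {C : List Piece}
    (hC : ∀ pq ∈ C.zip (C.rotate 1), NoCusp pq.1.tEnd pq.2.tStart) {l m : ℂ}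
    (hl : Generic C l) (hm : Generic C m) : concordanceAlong l C = concordanceAlong m C := by
  have two : ∀ x : ZMod 2, x + x = 0 := by decide
  have arcs : (C.map (Piece.inner l)).sum + (C.map (Piece.inner m)).sum =
      (C.map fun p => sector l m p.tStart).sum + (C.map fun p => sector l m p.tEnd).sum := by
    rw [← List.sum_map_add, ← List.sum_map_add]
    congr 1
    apply List.map_congr_left
    intro p hp
    cases p with
    | seg a b => simp [Piece.inner, Piece.tStart, Piece.tEnd, two]
    | arc z w =>
      exact sector_exchange (arg_ne_of_cross_ne (hl.2 _ hp).1) (arg_ne_of_cross_ne (hm.2 _ hp).1)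
        (arg_ne_of_cross_ne (hl.2 _ hp).2) (arg_ne_of_cross_ne (hm.2 _ hp).2)
  have corners : ((C.zip (C.rotate 1)).map fun pq => corner l pq.1.tEnd pq.2.tStart).sum +
      ((C.zip (C.rotate 1)).map fun pq => corner m pq.1.tEnd pq.2.tStart).sum =
      (C.map fun p => sector l m p.tEnd).sum + (C.map fun p => sector l m p.tStart).sum := by
    rw [← List.sum_map_add]
    have e : ((C.zip (C.rotate 1)).map fun pq =>
        corner l pq.1.tEnd pq.2.tStart + corner m pq.1.tEnd pq.2.tStart) =
        (C.zip (C.rotate 1)).map fun pq => sector l m pq.1.tEnd + sector l m pq.2.tStart := by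
      apply List.map_congr_left
      rintro ⟨p, q⟩ hpq
      have hp : p ∈ C := (List.of_mem_zip hpq).1
      have hq : q ∈ C := List.mem_rotate.1 (List.of_mem_zip hpq).2
      exact corner_exchange (hC _ hpq) hl.1 hm.1 (hl.2 p hp).2 (hm.2 p hp).2 (hl.2 q hq).1
        (hm.2 q hq).1
    rw [e, List.sum_map_add]
    have f1 : (C.zip (C.rotate 1)).map (fun pq => sector l m pq.1.tEnd) =
        C.map fun p => sector l m p.tEnd := by
      conv_rhs => rw [← List.map_fst_zip (l₁ := C) (l₂ := C.rotate 1) (by simp)]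
      rw [List.map_map]; rfl
    have f2 : (C.zip (C.rotate 1)).map (fun pq => sector l m pq.2.tStart) =
        (C.rotate 1).map fun p => sector l m p.tStart := by
      conv_rhs => rw [← List.map_snd_zip (l₁ := C) (l₂ := C.rotate 1) (by simp)]
      rw [List.map_map]; rfl
    rw [f1, f2, ((List.rotate_perm C 1).map _).sum_eq]
  have key : ∀ a b c d s e : ZMod 2, a + b = s + e → c + d = e + s → a + c = b + d := by decide
  exact key _ _ _ _ _ _ arcs corners

/-- For a closed curve without cusps, the concordance number may be computed along any admissible
direction. -/
theorem concordance_eq {C : List Piece}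
    (hC : ∀ pq ∈ C.zip (C.rotate 1), NoCusp pq.1.tEnd pq.2.tStart) {l : ℂ}
    (hl : Generic C l) : concordance C = concordanceAlong l C :=
  concordanceAlong_eq hC (Classical.epsilon_spec ⟨l, hl⟩) hl

/-! ### Networks -/

/-- The data of a directed graph drawn in the annulus `r ≤ |z| ≤ R`, together with a cut.
The boundary vertices are `b_i`, `i : Fin n`, the first `n₁` of them on the outer circle; `V₀` is the
set of internal vertices and `E` the set of edges (multiple edges and loops are allowed).
Edges and the cut are drawn as polygonal curves. -/
structure AnnularGraph (n : ℕ) (V₀ E : Type*) where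
  n₁ : ℕ
  r : ℝ
  R : ℝ
  pos : Fin n ⊕ V₀ → ℂ
  src : E → Fin n ⊕ V₀
  tgt : E → Fin n ⊕ V₀
  curve : E → Polyline
  cut : Polyline

namespace AnnularGraph

variable {n : ℕ} {V₀ E : Type*}

/-- The number of edges that leave the vertex `v`. -/
def outDeg (N : AnnularGraph n V₀ E) (v : Fin n ⊕ V₀) : ℕ := {e | N.src e = v}.ncard

/-- The number of edges that enter the vertex `v`. -/
def inDeg (N : AnnularGraph n V₀ E) (v : Fin n ⊕ V₀) : ℕ := {e | N.tgt e = v}.ncard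

/-- The base point of the cut on the inner circle. -/
def baseInner (N : AnnularGraph n V₀ E) : ℂ := N.cut.pt 0

/-- The base point of the cut on the outer circle. -/
def baseOuter (N : AnnularGraph n V₀ E) : ℂ := N.cut.pt N.cut.len

/-- The boundary vertex `b_i` is a source: one outgoing edge and no incoming edges. -/
def IsSource (N : AnnularGraph n V₀ E) (i : Fin n) : Prop :=
  N.outDeg (Sum.inl i) = 1 ∧ N.inDeg (Sum.inl i) = 0

/-- The boundary vertex `b_i` is a sink: one incoming edge and no outgoing edges. -/
def IsSink (N : AnnularGraph n V₀ E) (i : Fin n) : Prop :=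
  N.outDeg (Sum.inl i) = 0 ∧ N.inDeg (Sum.inl i) = 1

/-- The boundary vertex `b_i` lies on the outer circle. -/
def OnOuter (N : AnnularGraph n V₀ E) (i : Fin n) : Prop := (i : ℕ) < N.n₁

/-- The data describe a perfect planar graph in an annulus with a cut, drawn in general position
with respect to the cut. -/
structure IsPerfect (N : AnnularGraph n V₀ E) : Prop where
  r_pos : 0 < N.r
  r_lt_R : N.r < N.R
  n₁_le : N.n₁ ≤ n
  /-- Each boundary vertex is a source or a sink. -/
  boundary_degree : ∀ i : Fin n, N.IsSource i ∨ N.IsSink i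
  /-- Each internal vertex has degree `3` and is white or black. -/
  internal_degree : ∀ v : V₀,
    (N.inDeg (Sum.inr v) = 1 ∧ N.outDeg (Sum.inr v) = 2) ∨
    (N.inDeg (Sum.inr v) = 2 ∧ N.outDeg (Sum.inr v) = 1)
  /-- The graph is drawn without crossings. -/
  pos_injective : Function.Injective N.pos
  curve_start : ∀ e, (N.curve e).pt 0 = N.pos (N.src e)
  curve_end : ∀ e, (N.curve e).pt (N.curve e).len = N.pos (N.tgt e)
  embedded : IsEmbeddedFamily N.curve
  /-- The boundary vertices lie on the boundary circles, the rest of the graph inside. -/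
  pos_outer : ∀ i : Fin n, N.OnOuter i → ‖N.pos (Sum.inl i)‖ = N.R
  pos_inner : ∀ i : Fin n, ¬ N.OnOuter i → ‖N.pos (Sum.inl i)‖ = N.r
  curve_mem : ∀ e, ∀ z ∈ (N.curve e).carrier,
    (N.r < ‖z‖ ∧ ‖z‖ < N.R) ∨ ∃ i : Fin n, z = N.pos (Sum.inl i)
  /-- Edges meet the boundary circles transversally. -/
  src_transversal : ∀ e, ∀ i : Fin n, N.src e = Sum.inl i →
    dot (N.pos (Sum.inl i)) ((N.curve e).dir 0) ≠ 0
  tgt_transversal : ∀ e, ∀ i : Fin n, N.tgt e = Sum.inl i →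
    dot (N.pos (Sum.inl i)) ((N.curve e).dir ((N.curve e).len - 1)) ≠ 0
  /-- The cut is a simple curve in the annulus from the inner to the outer circle. -/
  cut_simple : IsEmbeddedFamily (fun _ : Unit => N.cut)
  cut_start : ‖N.baseInner‖ = N.r
  cut_end : ‖N.baseOuter‖ = N.R
  cut_mem : ∀ z ∈ N.cut.carrier,
    (N.r < ‖z‖ ∧ ‖z‖ < N.R) ∨ z = N.baseInner ∨ z = N.baseOuter
  cut_start_transversal : dot N.baseInner (N.cut.dir 0) ≠ 0
  cut_end_transversal : dot N.baseOuter (N.cut.dir (N.cut.len - 1)) ≠ 0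
  /-- The cut avoids the vertices of the graph and the corners of its edges, and crosses the edges
  transversally at inner points of segments. -/
  pt_notMem_cut : ∀ e k, k ≤ (N.curve e).len → (N.curve e).pt k ∉ N.cut.carrier
  cut_pt_notMem : ∀ e m, m ≤ N.cut.len → N.cut.pt m ∉ (N.curve e).carrier
  cut_transversal : ∀ e k m, k < (N.curve e).len → m < N.cut.len →
    ((N.curve e).openSeg k ∩ N.cut.openSeg m).Nonempty →
    cross ((N.curve e).dir k) (N.cut.dir m) ≠ 0
  /-- The labelling: counterclockwise on the outer circle and clockwise on the inner circle,
  starting in both cases after the base point of the cut. -/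
  label_outer : ∀ i j : Fin n, i < j → N.OnOuter j →
    ccw N.baseOuter (N.pos (Sum.inl i)) < ccw N.baseOuter (N.pos (Sum.inl j))
  label_inner : ∀ i j : Fin n, i < j → ¬ N.OnOuter i →
    ccw N.baseInner (N.pos (Sum.inl j)) < ccw N.baseInner (N.pos (Sum.inl i))

/-! ### Paths and their weights -/

/-- The list `p` of edges is a path from the boundary vertex `b_i` to the boundary vertex `b_j`. -/
def IsPath (N : AnnularGraph n V₀ E) (i j : Fin n) (p : List E) : Prop :=
  p.IsChain (fun e f => N.tgt e = N.src f) ∧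
    p.head?.map N.src = some (Sum.inl i) ∧ p.getLast?.map N.tgt = some (Sum.inl j)

/-- The list of vertices that are visited by a path. -/
def pathVertices (N : AnnularGraph n V₀ E) (p : List E) : List (Fin n ⊕ V₀) :=
  p.map N.src ++ (p.getLast?.map N.tgt).toList

/-- The path visits no vertex twice. -/
def IsSimplePath (N : AnnularGraph n V₀ E) (p : List E) : Prop := (N.pathVertices p).Nodup

/-- No edge of the path meets the cut. -/
def AvoidsCut (N : AnnularGraph n V₀ E) (p : List E) : Prop :=
  ∀ e ∈ p, Disjoint (N.curve e).carrier N.cut.carrier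

open Classical in
/-- The curve that closes a path from `b_i` to `b_j`. If both lie on the same circle, it goes from
`b_j` counterclockwise to `b_i`; otherwise it goes from `b_j` counterclockwise to the base point of
the cut, follows the cut to the other base point, and goes counterclockwise to `b_i`. -/
def closing (N : AnnularGraph n V₀ E) (i j : Fin n) : List Piece :=
  if N.OnOuter i ↔ N.OnOuter j then [Piece.arc (N.pos (Sum.inl j)) (N.pos (Sum.inl i))]
  else if N.OnOuter j then
    Piece.arc (N.pos (Sum.inl j)) N.baseOuter ::
      (N.cut.rev.pieces ++ [Piece.arc N.baseInner (N.pos (Sum.inl i))])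
  else
    Piece.arc (N.pos (Sum.inl j)) N.baseInner ::
      (N.cut.pieces ++ [Piece.arc N.baseOuter (N.pos (Sum.inl i))])

/-- The closed curve `C_P` of a path `P` from `b_i` to `b_j`. -/
def closedCurve (N : AnnularGraph n V₀ E) (i j : Fin n) (p : List E) : List Piece :=
  p.flatMap (fun e => (N.curve e).pieces) ++ N.closing i j

/-- The sign `(-1)^{c(C_P) - 1}` in the weight of a path. -/
def pathSign (N : AnnularGraph n V₀ E) (i j : Fin n) (p : List E) : ℤ :=
  (((-1 : ℤˣ) ^ (concordance (N.closedCurve i j p) - 1) : ℤˣ) : ℤ)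

open Classical in
/-- The boundary measurement `M(i, j)` as a formal power series in the modified edge weights: the sum
over all paths `P` from `b_i` to `b_j` of the signed monomials `(-1)^{c(C_P) - 1} ∏_{e ∈ P} x_e`.
(`m.toMultiset.lists` consists of the finitely many lists of edges with monomial `m`.) -/
def measSeries (N : AnnularGraph n V₀ E) (i j : Fin n) : MvPowerSeries E ℤ := fun m =>
  ∑ p ∈ (Multiset.lists (Finsupp.toMultiset m)).toFinset with N.IsPath i j p, N.pathSign i j p

end AnnularGraph

/-! ### Values of rational power series -/

/-- The power series `f` is the expansion of a rational function that is regular at the point `v`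
and takes the value `x` there. -/
def HasRatValue {E F : Type*} [Field F] (f : MvPowerSeries E ℤ) (v : E → F) (x : F) : Prop :=
  ∃ p q : MvPolynomial E ℤ, (q : MvPowerSeries E ℤ) * f = (p : MvPowerSeries E ℤ) ∧
    MvPolynomial.aeval v q ≠ 0 ∧ x = MvPolynomial.aeval v p / MvPolynomial.aeval v q

theorem HasRatValue.unique {E F : Type*} [Field F] {f : MvPowerSeries E ℤ} {v : E → F} {x y : F}
    (hx : HasRatValue f v x) (hy : HasRatValue f v y) : x = y := by
  obtain ⟨p, q, h, hq, rfl⟩ := hx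
  obtain ⟨p', q', h', hq', rfl⟩ := hy
  have key : p * q' = p' * q := by
    apply MvPolynomial.coe_injective
    push_cast
    rw [← h, ← h']; ring
  rw [div_eq_div_iff hq hq', ← map_mul, ← map_mul, key]

open Classical in
/-- The value of a rational power series at a point (`0` if it is not regular there). -/
def ratValue {E F : Type*} [Field F] (f : MvPowerSeries E ℤ) (v : E → F) : F :=
  if h : ∃ x, HasRatValue f v x then h.choose else 0

/-! ### The Grassmannian boundary measurement map -/

/-- The space of loops in the Grassmannians of `K^n`: a rational function of one variable with values
in the Grassmannian `G_k(n)` is a `k`-dimensional subspace of the `n`-dimensional coordinate space over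
the field of rational functions, namely the row space of a `k × n` matrix representative. -/
abbrev LoopGrassmannian (K : Type*) [Field K] (n : ℕ) : Type _ :=
  Submodule (RatFunc K) (Fin n → RatFunc K)

/-- The substitution `λ ↦ -λ` in rational functions. -/
def negVar (K : Type*) [Field K] : RatFunc K →ₐ[K] RatFunc K :=
  RatFunc.mapAlgHom (Polynomial.algEquivAevalNegX : Polynomial K ≃ₐ[K] Polynomial K).toAlgHom
    (nonZeroDivisors_le_comap_nonZeroDivisors_of_injective _
      (Polynomial.algEquivAevalNegX : Polynomial K ≃ₐ[K] Polynomial K).injective)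

/-- The map `X(λ) ↦ X(-λ)` on loops in the Grassmannian. -/
def negLoop {K : Type*} [Field K] {n : ℕ} (W : LoopGrassmannian K n) : LoopGrassmannian K n :=
  Submodule.span (RatFunc K) ((fun x j => negVar K (x j)) '' (W : Set (Fin n → RatFunc K)))

namespace AnnularGraph

variable {n : ℕ} {V₀ E : Type*} {K : Type*} [Field K]

/-- The modified edge weights `w_e λ^{ind(e)}`. -/
def modWeight (N : AnnularGraph n V₀ E) (w : E → K) (e : E) : RatFunc K :=
  RatFunc.C (w e) * RatFunc.X ^ ((N.curve e).ind N.cut)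

/-- The boundary measurement `M(i, j)` at the edge weights `w`, a rational function of `λ`. -/
def meas (N : AnnularGraph n V₀ E) (w : E → K) (i j : Fin n) : RatFunc K :=
  ratValue (N.measSeries i j) (N.modWeight w)

/-- The edge weights `w` belong to the domain of definition of the boundary measurement map: each
boundary measurement is, as a rational function of the modified edge weights, regular at `w`. -/
def Regular (N : AnnularGraph n V₀ E) (w : E → K) : Prop :=
  ∀ i j, N.IsSource i → N.IsSink j → ∃ x, HasRatValue (N.measSeries i j) (N.modWeight w) x

/-- The number of sources strictly between `b_i` and `b_j` in the linear order of the labels. -/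
def between (N : AnnularGraph n V₀ E) (i j : Fin n) : ℕ :=
  {t : Fin n | N.IsSource t ∧ min i j < t ∧ t < max i j}.ncard

open Classical in
/-- The matrix with the identity matrix in the columns of the sources and
`(-1)^{s(i, j)} M(i, j)` in the columns of the sinks. -/
def extMatrix (N : AnnularGraph n V₀ E) (w : E → K) :
    Matrix {i : Fin n // N.IsSource i} (Fin n) (RatFunc K) :=
  Matrix.of fun i j =>
    if N.IsSource j then (if (i : Fin n) = j then 1 else 0)
    else (-1) ^ N.between i j * N.meas w i j

/-- The Grassmannian boundary measurement map: the row space of `extMatrix`. -/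
def grassMeas (N : AnnularGraph n V₀ E) (w : E → K) : LoopGrassmannian K n :=
  Submodule.span (RatFunc K) (Set.range (N.extMatrix w).row)

/-- The dimension of the row space is the number `k` of sources. -/
theorem finrank_grassMeas (N : AnnularGraph n V₀ E) (w : E → K) :
    Module.finrank (RatFunc K) (N.grassMeas w) = {i : Fin n | N.IsSource i}.ncard := by
  classical
  have hli : LinearIndependent (RatFunc K) (N.extMatrix w).row := by
    rw [Fintype.linearIndependent_iff]
    intro g hg i
    have h := congrFun hg (i : Fin n)
    simpa [Finset.sum_apply, Matrix.row, extMatrix, i.2, Subtype.coe_inj] using h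
  rw [grassMeas, finrank_span_eq_card hli, Set.ncard_eq_toFinset_card', Fintype.card_subtype]
  congr 1
  ext i
  simp

/-! ### Path reversal -/

open Classical in
/-- The graph `N^P`: each edge of `P` changes its direction. -/
def reverse (N : AnnularGraph n V₀ E) (P : List E) : AnnularGraph n V₀ E where
  n₁ := N.n₁
  r := N.r
  R := N.R
  pos := N.pos
  src e := if e ∈ P then N.tgt e else N.src e
  tgt e := if e ∈ P then N.src e else N.tgt e
  curve e := if e ∈ P then (N.curve e).rev else N.curve e
  cut := N.cut

open Classical in
/-- The map `S_{t^P}` for a path from `b_i` to `b_j`: the identity if `b_i` and `b_j` lie on the same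
circle, and `X(λ) ↦ X(-λ)` otherwise. -/
def loopTwist (N : AnnularGraph n V₀ E) (i j : Fin n) (W : LoopGrassmannian K n) :
    LoopGrassmannian K n :=
  if N.OnOuter i ↔ N.OnOuter j then W else negLoop W

end AnnularGraph

open Classical in
/-- The path reversal map `R^P` on edge weights: the weights of the edges of `P` are inverted. -/
def reverseWeights {E K : Type*} [Field K] (P : List E) (w : E → K) : E → K :=
  fun e => if e ∈ P then (w e)⁻¹ else w e

end AnnularNet

end

noncomputable section

namespace AnnularNet

/-! ### Half-angle directions -/

/-! The sign of a path is a rotation number. If each corner of a closed curve contributes the unit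
complex number with half the angle of turning (`halfDir`), and each arc does the same for its
tangent, the product is 1 or -1, and it is the parity of the concordance number
(`parity_concordance`): a square root of the tangent direction, cut at a generic direction `l`,
changes its sign exactly when the tangent passes `l`. Halves of rotations multiply along a path, and
the closing curve contributes factors that belong to the two ends separately, apart from a sign that
depends on their order. Together with the signs of the matrix entries these factors are collected in
`gauge`. So the signed weight of a path is, up to a quotient of two gauges, a product of local
factors (`pathSign_eq`).

Therefore the boundary measurements are the response of a linear system with one value per edge
(`IsState`), solved by Cramer's rule (`exists_response`). The boundary values of its solutions,
divided by the gauges, are the balanced vectors `c`. They satisfy `c a = -∑ A a b * c b`, where `A`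
is the signed matrix of measurements; these are the equations of the annihilator of the row space in
question. It is thus enough to show that the balanced vectors of the network, with suitably twisted
weights, remain balanced after the reversal of the path (`Balanced.reverse`).

The geometric heart is a function that tells the two sides of the closed curve of the path apart.
Instead of an appeal to the Jordan curve theorem it is given by a formula: the product of the
half-angles under which the segments of the path are seen from `z`, times an explicit square root in
the annulus (`background`). The square of this product is constant, so the product is locally
constant away from the path. If both ends lie on one circle, the explicit root exists in the whole
annulus. If they lie on different circles, it would contain a root of the direction of `z`, which
winds around the annulus; the root is then cut open along the cut. Along an edge the side changes by
`(-1) ^ ind`, which is the effect of replacing `λ` by `-λ`. This is the origin of the map `S_{-1}`.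

A state is multiplied by this function on the edges off the path, while on the path the values at
the two ends of each edge are exchanged. The result is a state of the reversed network
(`IsState.reverse`). At the vertices of the path this rests on local identities between half-angles
(`sideRoot_out`, `sideRoot_in`); at the boundary the sign depends on the cyclic order of the labels
(`sideVal_bd`), and it matches the changes of the gauges.

The rest is algebra. The new coefficients arise from the old ones by solving the equation of `i` for
the variable `j` (`eq_pivot`), which does not change the row space (`span_pivot`). The geometry
proves this for complex weights in general position. Hence it is an identity of polynomials and,
since the measurements are power series with integral coefficients, an identity over the integers
(`reverse_measSeries`), which can be evaluated over any field. The hypothesis that `M(i, j)` is not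
zero keeps the pivot denominators from vanishing, and this yields the regularity of the new
measurements. -/

/-- The unit vector whose argument is half of the principal argument of `z`. -/
def halfDir (z : ℂ) : ℂ := Complex.exp (((z.arg / 2 : ℝ) : ℂ) * Complex.I)

theorem exp_arg {z : ℂ} (hz : z ≠ 0) : Complex.exp (z.arg * Complex.I) = z / ‖z‖ := by
  have h : (‖z‖ : ℂ) ≠ 0 := by simpa using hz
  rw [eq_div_iff h, mul_comm]
  exact Complex.norm_mul_exp_arg_mul_I z

theorem halfDir_sq {z : ℂ} (hz : z ≠ 0) : halfDir z ^ 2 = z / ‖z‖ := by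
  rw [← exp_arg hz, halfDir, ← Complex.exp_nat_mul]
  congr 1; push_cast; ring

theorem halfDir_ne_zero (z : ℂ) : halfDir z ≠ 0 := Complex.exp_ne_zero _

theorem halfDir_congr_arg {z w : ℂ} (h : z.arg = w.arg) : halfDir z = halfDir w := by
  rw [halfDir, h, halfDir]

theorem halfDir_real_mul {r : ℝ} (hr : 0 < r) (z : ℂ) : halfDir (r * z) = halfDir z :=
  halfDir_congr_arg (Complex.arg_real_mul z hr)

/-- Inversion negates the principal argument except on the negative axis, where the argument π is
kept. -/
theorem halfDir_mul_inv {z : ℂ} (hz : z ∈ Complex.slitPlane) : halfDir z * halfDir z⁻¹ = 1 := by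
  have h := Complex.mem_slitPlane_iff_arg.1 hz
  rw [halfDir, halfDir, Complex.arg_inv, if_neg h.1, ← Complex.exp_add]
  rw [← Complex.exp_zero]; congr 1; push_cast; ring

theorem halfDir_inv {z : ℂ} (hz : z ∈ Complex.slitPlane) : halfDir z⁻¹ = (halfDir z)⁻¹ :=
  eq_inv_of_mul_eq_one_right (halfDir_mul_inv hz)

theorem continuousOn_halfDir : ContinuousOn halfDir Complex.slitPlane := by
  intro z hz
  apply ContinuousAt.continuousWithinAt
  have := Complex.continuousAt_arg hz
  unfold halfDir
  fun_prop

/-- In the upper half plane negation lowers the principal argument by π, hence its half by a quarter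
turn; in the lower half plane it raises it. These opposite factors produce the sign change at a
crossing and the change of `gauge` at the ends of a reversed path. -/
theorem halfDir_neg_of_im_pos {z : ℂ} (hz : 0 < z.im) :
    halfDir (-z) = -Complex.I * halfDir z := by
  rw [halfDir, halfDir, Complex.arg_neg_eq_arg_sub_pi_of_im_pos hz]
  have : ((((z.arg - Real.pi) / 2 : ℝ) : ℂ) * Complex.I) =
      (-(Real.pi / 2 * Complex.I)) + ((z.arg / 2 : ℝ) : ℂ) * Complex.I := by push_cast; ring
  rw [this, Complex.exp_add, Complex.exp_neg, Complex.exp_pi_div_two_mul_I, Complex.inv_I]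

theorem halfDir_neg_of_im_neg {z : ℂ} (hz : z.im < 0) :
    halfDir (-z) = Complex.I * halfDir z := by
  have h := halfDir_neg_of_im_pos (z := -z) (by simpa using hz)
  rw [neg_neg] at h
  rw [h, ← mul_assoc]; simp

/-- For `z` in the right half plane, a quarter turn of `z` turns `halfDir z` by an eighth turn. -/
theorem halfDir_I_mul_of_re_pos {z : ℂ} (hz : 0 < z.re) :
    halfDir (Complex.I * z) = halfDir Complex.I * halfDir z := by
  have h0 : z ≠ 0 := by rintro rfl; simp at hz
  have h := abs_lt.1 (Complex.abs_arg_lt_pi_div_two_iff.2 (Or.inl hz))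
  have ha : (Complex.I * z).arg = Complex.I.arg + z.arg := by
    apply (Complex.arg_mul_eq_add_arg_iff Complex.I_ne_zero h0).2
    rw [Complex.arg_I]
    constructor <;> linarith [Real.pi_pos]
  rw [halfDir, ha, halfDir, halfDir, ← Complex.exp_add]
  congr 1; push_cast; ring

theorem halfDir_neg_I_mul_of_re_pos {z : ℂ} (hz : 0 < z.re) :
    halfDir (-Complex.I * z) = halfDir (-Complex.I) * halfDir z := by
  have h0 : z ≠ 0 := by rintro rfl; simp at hz
  have h := abs_lt.1 (Complex.abs_arg_lt_pi_div_two_iff.2 (Or.inl hz))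
  have ha : (-Complex.I * z).arg = (-Complex.I).arg + z.arg := by
    apply (Complex.arg_mul_eq_add_arg_iff (neg_ne_zero.2 Complex.I_ne_zero) h0).2
    rw [Complex.arg_neg_I]
    constructor <;> linarith [Real.pi_pos]
  rw [halfDir, ha, halfDir, halfDir, ← Complex.exp_add]
  congr 1; push_cast; ring

theorem halfDir_I_sq : halfDir Complex.I * halfDir Complex.I = Complex.I := by
  rw [← sq, halfDir_sq Complex.I_ne_zero]; simp

theorem halfDir_neg_I_sq : halfDir (-Complex.I) * halfDir (-Complex.I) = -Complex.I := by
  rw [← sq, halfDir_sq (neg_ne_zero.2 Complex.I_ne_zero)]; simp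

/-! ### The concordance number as a total turning -/

theorem ccw_mem (z x : ℂ) : 0 ≤ ccw z x ∧ ccw z x < 2 * Real.pi := by
  have := toIcoMod_mem_Ico Real.two_pi_pos 0 (x.arg - z.arg)
  simpa [ccw] using this

theorem arg_div_eq_ccw {z x : ℂ} (hz : z ≠ 0) (hx : x ≠ 0) :
    (x / z).arg = if ccw z x ≤ Real.pi then ccw z x else ccw z x - 2 * Real.pi := by
  have h := ccw_mem z x
  have e : (x / z).arg = toIocMod Real.two_pi_pos (-Real.pi) (ccw z x) := by
    have hzn : 0 < ‖z‖ := norm_pos_iff.2 hz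
    have hxn : 0 < ‖x‖ := norm_pos_iff.2 hx
    have e1 : x / z = ((‖x‖ / ‖z‖ : ℝ) : ℂ) * Complex.exp (((ccw z x : ℝ) : ℂ) * Complex.I) := by
      have e2 : Complex.exp (((ccw z x : ℝ) : ℂ) * Complex.I) =
          Complex.exp (((x.arg - z.arg : ℝ) : ℂ) * Complex.I) := by
        rw [ccw_eq]
        split_ifs
        · rfl
        · push_cast
          rw [add_mul, Complex.exp_add, Complex.exp_two_pi_mul_I, mul_one]
      rw [e2]
      push_cast
      rw [sub_mul, Complex.exp_sub]
      conv_lhs => rw [← Complex.norm_mul_exp_arg_mul_I x, ← Complex.norm_mul_exp_arg_mul_I z]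
      rw [mul_div_mul_comm]
    rw [e1, Complex.arg_real_mul _ (by positivity), Complex.arg_exp_mul_I]
  rw [e]
  have pp := Real.pi_pos
  split_ifs with h'
  · rw [toIocMod_eq_self]; constructor <;> linarith
  · rw [← toIocMod_sub, toIocMod_eq_self]
    push Not at h'
    constructor <;> linarith

/-- Opposite directions have a quotient of argument π. The slit plane is also where `halfDir` is
continuous and compatible with inversion, so later statements use this form. -/
theorem noCusp_of_mem_slitPlane {d d' : ℂ} (h : d' / d ∈ Complex.slitPlane) : NoCusp d d' := by
  have h0 := Complex.slitPlane_ne_zero h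
  have h1 : d ≠ 0 := by rintro rfl; simp at h0
  have h2 : d' ≠ 0 := by rintro rfl; simp at h0
  refine ⟨h1, h2, fun h3 => ?_⟩
  have := (Complex.mem_slitPlane_iff_arg.1 h).1
  rw [arg_div_eq_ccw h1 h2, if_pos h3.le] at this
  exact this h3

/-- A unit square root of the direction of `d`, up to a constant factor; it jumps at the
direction `l`. -/
def rootFrom (l d : ℂ) : ℂ := Complex.exp (((ccw l d / 2 : ℝ) : ℂ) * Complex.I)

/-- The sign of a residue modulo `2`. -/
def parity (c : ZMod 2) : ℂ := if c = 0 then 1 else -1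

theorem parity_add (c d : ZMod 2) : parity (c + d) = parity c * parity d := by
  have h : ∀ x : ZMod 2, x = 0 ∨ x = 1 := by decide
  have h1 : (1 : ZMod 2) + 1 = 0 := by decide
  rcases h c with rfl | rfl <;> rcases h d with rfl | rfl <;> simp [parity, h1]

theorem parity_zero : parity 0 = 1 := by simp [parity]

theorem parity_one : parity 1 = -1 := by simp [parity]

/-- The angle from `l` grows by `ccw d d'` along the arc unless the arc passes `l`; then 2π is
subtracted, and half of it is the sign that `sector` records. -/
theorem rootFrom_arc {l d d' : ℂ} (h1 : d.arg ≠ l.arg) (h2 : d'.arg ≠ l.arg) :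
    rootFrom l d' = parity (sector d d' l) * rootFrom l d *
      Complex.exp (((ccw d d' / 2 : ℝ) : ℂ) * Complex.I) := by
  have a1 := Complex.neg_pi_lt_arg d
  have a2 := Complex.arg_le_pi d
  have b1 := Complex.neg_pi_lt_arg d'
  have b2 := Complex.arg_le_pi d'
  have c1 := Complex.neg_pi_lt_arg l
  have c2 := Complex.arg_le_pi l
  unfold rootFrom
  by_cases h : sector d d' l = 1
  · have : ccw l d' = ccw l d + ccw d d' - 2 * Real.pi := by
      unfold sector at h
      have h' : 0 < ccw d l ∧ ccw d l < ccw d d' := by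
        by_contra hc; rw [if_neg hc] at h; exact absurd h (by decide)
      simp only [ccw_eq] at h' ⊢
      grind
    rw [h, parity_one, this, mul_assoc, ← Complex.exp_add]
    have e : (((ccw l d + ccw d d' - 2 * Real.pi) / 2 : ℝ) : ℂ) * Complex.I =
      (((ccw l d / 2 : ℝ) : ℂ) * Complex.I + ((ccw d d' / 2 : ℝ) : ℂ) * Complex.I) -
        Real.pi * Complex.I := by push_cast; ring
    rw [e, Complex.exp_sub, Complex.exp_pi_mul_I]
    ring
  · have : ccw l d' = ccw l d + ccw d d' := by
      unfold sector at h
      have h' : ¬ (0 < ccw d l ∧ ccw d l < ccw d d') := by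
        intro hc; rw [if_pos hc] at h; exact h rfl
      simp only [ccw_eq] at h' ⊢
      grind
    have h0 : sector d d' l = 0 := by
      unfold sector at h ⊢
      split_ifs at h ⊢ <;> simp_all
    rw [h0, parity_zero, this, one_mul, ← Complex.exp_add]
    congr 1; push_cast; ring

/-- A corner is an arc of less than half a turn. If it turns clockwise, the arc from `d'` back to
`d` is used, and `d' / d` has a negative argument. -/
theorem rootFrom_corner {l d d' : ℂ} (h : NoCusp d d') (hl : l ≠ 0)
    (h1 : cross d l ≠ 0) (h2 : cross d' l ≠ 0) :
    rootFrom l d' = parity (corner l d d') * rootFrom l d * halfDir (d' / d) := by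
  obtain ⟨hd, hd', hc⟩ := id h
  have e1 := arg_ne_of_cross_ne h1
  have e2 := arg_ne_of_cross_ne h2
  have p1 := Complex.neg_pi_lt_arg d
  have p2 := Complex.arg_le_pi d
  have p3 := Complex.neg_pi_lt_arg d'
  have p4 := Complex.arg_le_pi d'
  by_cases heq : d.arg = d'.arg
  · have aux : corner l d d' = 0 := by
      unfold corner
      rw [if_neg]
      rintro ⟨a, b, -, -, rfl⟩
      apply h1
      have z : cross d d' = 0 := by rw [cross_eq_sin, heq]; simp
      have : cross d (a * d + b * d') = b * cross d d' := by simp [cross]; ring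
      rw [this, z, mul_zero]
    have c0 : ccw d d' = 0 := by rw [ccw_eq, heq]; simp
    rw [aux, parity_zero, halfDir, arg_div_eq_ccw hd hd', c0, if_pos Real.pi_pos.le]
    simp [rootFrom, ccw_eq, heq]
  · have hpos : 0 < ccw d d' := by rw [ccw_eq]; grind
    have hpos' : 0 < ccw d' d := by rw [ccw_eq]; grind
    have hsum : ccw d d' + ccw d' d = 2 * Real.pi := by rw [ccw_eq, ccw_eq]; grind
    rcases lt_or_gt_of_ne hc with hlt | hgt
    · rw [corner_eq_sector hd hd' hl hpos hlt, rootFrom_arc e1 e2, halfDir, arg_div_eq_ccw hd hd',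
        if_pos hlt.le]
    · have hlt : ccw d' d < Real.pi := by linarith
      rw [corner_comm l, corner_eq_sector hd' hd hl hpos' hlt, rootFrom_arc (d := d') (d' := d) e2 e1,
        halfDir, arg_div_eq_ccw hd hd', if_neg (by linarith)]
      have e3 : ccw d d' - 2 * Real.pi = - ccw d' d := by linarith
      rw [e3]
      have sq : parity (sector d' d l) * parity (sector d' d l) = 1 := by
        unfold parity; split_ifs <;> simp
      have ex : Complex.exp (((ccw d' d / 2 : ℝ) : ℂ) * Complex.I) *
          Complex.exp (((-ccw d' d / 2 : ℝ) : ℂ) * Complex.I) = 1 := by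
        rw [← Complex.exp_add, ← Complex.exp_zero]; congr 1; push_cast; ring
      linear_combination (-rootFrom l d') * sq - rootFrom l d' * parity (sector d' d l) ^ 2 * ex

namespace Piece

/-- Half of the rotation of the tangent along a piece, as a unit complex number. -/
def halfTurn : Piece → ℂ
  | seg _ _ => 1
  | arc z w => Complex.exp (((ccw (Complex.I * z) (Complex.I * w) / 2 : ℝ) : ℂ) * Complex.I)

end Piece

/-- Half of the rotation of the tangent along the curve that consists of the piece `p` followed by
the pieces of a list, including the corners but not the rotation along `p`. -/
def turnAfter : Piece → List Piece → ℂ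
  | _, [] => 1
  | p, q :: l => halfDir (q.tStart / p.tEnd) * q.halfTurn * turnAfter q l

/-- The concatenation of the pieces has no cusps. -/
def Smooth : Piece → List Piece → Prop
  | _, [] => True
  | p, q :: l => NoCusp p.tEnd q.tStart ∧ Smooth q l

theorem smooth_iff_zip (p q : Piece) (l : List Piece) :
    (∀ pq ∈ (p :: l).zip (l ++ [q]), NoCusp pq.1.tEnd pq.2.tStart) ↔ Smooth p (l ++ [q]) := by
  induction l generalizing p with
  | nil => simp [Smooth]
  | cons a l ih => 
    simp only [List.cons_append, List.zip_cons_cons, List.forall_mem_cons, Smooth]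
    rw [ih]

/-- Telescoping: each corner and each piece multiplies `rootFrom l` by its half turn, with a sign
exactly when the tangent passes `l`. -/
theorem rootFrom_turnAfter {l : ℂ} (hl : l ≠ 0) (p q : Piece) (L : List Piece)
    (hs : Smooth p (L ++ [q]))
    (hg : ∀ x ∈ p :: (L ++ [q]), cross x.tStart l ≠ 0 ∧ cross x.tEnd l ≠ 0) :
    rootFrom l q.tEnd = rootFrom l p.tEnd *
      parity (((L ++ [q]).map (Piece.inner l)).sum +
        (((p :: L).zip (L ++ [q])).map fun pq => corner l pq.1.tEnd pq.2.tStart).sum) *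
      turnAfter p (L ++ [q]) := by
  have step : ∀ x : Piece, (cross x.tStart l ≠ 0 ∧ cross x.tEnd l ≠ 0) → 
      rootFrom l x.tEnd = parity (x.inner l) * rootFrom l x.tStart * x.halfTurn := by
    intro x hx
    cases x with
    | seg a b => simp [Piece.inner, Piece.halfTurn, parity_zero, Piece.tEnd, Piece.tStart]
    | arc z w => 
      exact rootFrom_arc (arg_ne_of_cross_ne hx.1) (arg_ne_of_cross_ne hx.2)
  induction L generalizing p with
  | nil =>
    simp only [List.nil_append, Smooth, and_true, List.forall_mem_cons] at hs hg
    simp only [List.nil_append, List.map_cons, List.map_nil, List.sum_cons, List.sum_nil, add_zero,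
      List.zip_cons_cons, List.zip_nil_right, turnAfter, mul_one]
    rw [step q hg.2.1, rootFrom_corner hs hl hg.1.2 hg.2.1.1, parity_add]
    ring
  | cons a L ih =>
    simp only [List.cons_append, Smooth, List.forall_mem_cons] at hs hg
    have := ih a hs.2 (by simp only [List.forall_mem_cons]; exact hg.2)
    rw [this, step a hg.2.1, rootFrom_corner hs.1 hl hg.1.2 hg.2.1.1]
    simp only [List.cons_append, List.map_cons, List.sum_cons, List.zip_cons_cons, turnAfter,
      parity_add]
    ring

theorem exists_generic (C : List Piece) (hC : ∀ p ∈ C, p.tStart ≠ 0 ∧ p.tEnd ≠ 0) :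
    ∃ l, Generic C l := by
  have aux : ∀ L : List ℂ, (∀ d ∈ L, d ≠ 0) → ∃ S : Set ℝ, S.Finite ∧
      ∀ t ∉ S, ∀ d ∈ L, cross d ⟨1, t⟩ ≠ 0 := by
    intro L hL
    induction L with
    | nil => exact ⟨∅, Set.finite_empty, by simp⟩
    | cons d L ih =>
      obtain ⟨S, hS, h⟩ := ih fun d hd => hL d (List.mem_cons_of_mem _ hd)
      -- `cross d ⟨1, t⟩` equals `d.re * t - d.im` and vanishes for this `t` only. If `d.re = 0`, it
      -- is the nonzero constant `-d.im`, so the default value of the division does no harm.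
      refine ⟨insert (d.im / d.re) S, hS.insert _, fun t ht x hx => ?_⟩
      rw [Set.mem_insert_iff, not_or] at ht
      rcases List.mem_cons.1 hx with rfl | hx
      · intro h0
        simp only [cross, mul_one] at h0
        by_cases hre : x.re = 0
        · have : x.im = 0 := by rw [hre] at h0; linarith
          exact hL x (List.mem_cons_self) (Complex.ext hre this)
        · exact ht.1 (by field_simp; linarith)
      · exact h t ht.2 x hx
  obtain ⟨S, hS, h⟩ := aux (C.map Piece.tStart ++ C.map Piece.tEnd) (by
    intro d hd
    rcases List.mem_append.1 hd with hd | hd <;> obtain ⟨p, hp, rfl⟩ := List.mem_map.1 hd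
    · exact (hC p hp).1
    · exact (hC p hp).2)
  obtain ⟨t, ht⟩ := hS.exists_notMem
  refine ⟨⟨1, t⟩, fun h0 => by simpa using congrArg Complex.re h0, fun p hp => ⟨?_, ?_⟩⟩
  · exact h t ht _ (List.mem_append_left _ (List.mem_map_of_mem hp))
  · exact h t ht _ (List.mem_append_right _ (List.mem_map_of_mem hp))

/-- The sign of the concordance number of a closed curve without cusps is half of its total
rotation. -/
theorem parity_concordance (p : Piece) (L : List Piece) (hs : Smooth p (L ++ [p])) :
    parity (concordance (p :: L)) = turnAfter p (L ++ [p]) := by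
  have hr : (p :: L).rotate 1 = L ++ [p] := by simp
  have hc : ∀ pq ∈ (p :: L).zip ((p :: L).rotate 1), NoCusp pq.1.tEnd pq.2.tStart := by
    rw [hr]; exact (smooth_iff_zip p p L).2 hs
  have hne : ∀ x ∈ p :: L, x.tStart ≠ 0 ∧ x.tEnd ≠ 0 := by
    intro x hx
    have f1 : x ∈ ((p :: L).zip ((p :: L).rotate 1)).map Prod.fst := by
      rw [List.map_fst_zip (by simp)]; exact hx
    have f2 : x ∈ ((p :: L).zip ((p :: L).rotate 1)).map Prod.snd := by
      rw [List.map_snd_zip (by simp)]; exact List.mem_rotate.2 hx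
    obtain ⟨a, ha, rfl⟩ := List.mem_map.1 f1
    obtain ⟨b, hb, hb'⟩ := List.mem_map.1 f2
    exact ⟨hb' ▸ (hc b hb).2.1, (hc a ha).1⟩
  obtain ⟨l, hl⟩ := exists_generic _ hne
  have key := rootFrom_turnAfter hl.1 p p L hs (by
    intro x hx
    apply hl.2 x
    simp only [List.mem_cons, List.mem_append, List.not_mem_nil, or_false] at hx ⊢
    tauto)
  rw [concordance_eq hc hl]
  have hperm : ((p :: L).map (Piece.inner l)).sum = ((L ++ [p]).map (Piece.inner l)).sum := by
    simp [add_comm]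
  rw [concordanceAlong, hperm, hr]
  have h0 : rootFrom l p.tEnd ≠ 0 := Complex.exp_ne_zero _
  rw [mul_assoc] at key
  -- The list returns to its first piece, so `rootFrom l` is the same at both ends and cancels: the
  -- sign times the half turning is 1.
  have key' := mul_left_cancel₀ h0 ((mul_one _).trans key)
  have sq : ∀ c, parity c * parity c = 1 := by intro c; unfold parity; split_ifs <;> simp
  have := sq (((L ++ [p]).map (Piece.inner l)).sum +
        (((p :: L).zip (L ++ [p])).map fun pq => corner l pq.1.tEnd pq.2.tStart).sum)
  linear_combination (parity (((L ++ [p]).map (Piece.inner l)).sum +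
    (((p :: L).zip (L ++ [p])).map fun pq => corner l pq.1.tEnd pq.2.tStart).sum)) * key' +
    turnAfter p (L ++ [p]) * this

end AnnularNet

end

noncomputable section

namespace AnnularNet

open Filter Topology

/-! ### Unit directions -/

/-- The direction of a nonzero complex number. -/
def unitDir (z : ℂ) : ℂ := z / ‖z‖

theorem unitDir_mul (z w : ℂ) : unitDir (z * w) = unitDir z * unitDir w := by
  simp [unitDir, mul_div_mul_comm]

theorem unitDir_inv (z : ℂ) : unitDir z⁻¹ = (unitDir z)⁻¹ := by
  simp [unitDir, div_eq_mul_inv, mul_comm]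

theorem unitDir_div (z w : ℂ) : unitDir (z / w) = unitDir z / unitDir w := by
  rw [div_eq_mul_inv, unitDir_mul, unitDir_inv, div_eq_mul_inv]

theorem unitDir_neg (z : ℂ) : unitDir (-z) = -unitDir z := by
  simp [unitDir, neg_div]

theorem unitDir_ne_zero {z : ℂ} (hz : z ≠ 0) : unitDir z ≠ 0 := by
  simp [unitDir, hz]

theorem unitDir_of_pos {r : ℝ} (hr : 0 < r) : unitDir (r : ℂ) = 1 := by
  have : (r : ℂ) ≠ 0 := by exact_mod_cast hr.ne'
  simp [unitDir, abs_of_pos hr, this]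

theorem halfDir_mul_self {z : ℂ} (hz : z ≠ 0) : halfDir z * halfDir z = unitDir z := by
  rw [← sq, halfDir_sq hz]; rfl

/-- A continuous choice between two opposite nonzero numbers cannot switch. Every comparison of
square roots at distant points rests on this. -/
theorem IsPreconnected.eq_of_sq_const {X : Type*} [TopologicalSpace X] {S : Set X}
    (hS : IsPreconnected S) {f : X → ℂ} (hf : ContinuousOn f S) {c : ℂ} (hc : c ≠ 0)
    (h : ∀ x ∈ S, f x * f x = c) {x y : X} (hx : x ∈ S) (hy : y ∈ S) : f x = f y := by
  have hy0 : f y ≠ 0 := by intro h0; apply hc; rw [← h y hy, h0, zero_mul]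
  exact hS.eq_of_sq_eq hf (continuousOn_const (c := f y))
    (fun z hz => by simp only [Pi.pow_apply, sq]; rw [h z hz, h y hy])
    (fun _ => hy0) hy rfl hx

/-! ### The half-angle of a chord, seen from a point -/

/-- Half of the angle at which the segment from `c` to `c'` is seen from `z`. -/
def sight (c c' z : ℂ) : ℂ := halfDir ((c' - z) / (c - z))

theorem sight_ne_zero (c c' z : ℂ) : sight c c' z ≠ 0 := halfDir_ne_zero _

/-- If the quotient is `-r` with `r ≥ 0`, then `z` is the convex combination of `c` and `c'` with
weights `r / (1 + r)` and `1 / (1 + r)`. So the branch cut of `halfDir` pulls back to the chord. -/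
theorem div_mem_slitPlane_of_notMem_segment {c c' z : ℂ} (h : z ∉ segment ℝ c c') :
    (c' - z) / (c - z) ∈ Complex.slitPlane := by
  have hz : c - z ≠ 0 := by
    intro h0; apply h; rw [← sub_eq_zero.1 h0]; exact left_mem_segment ℝ _ _
  by_contra hn
  rw [Complex.mem_slitPlane_iff, not_or, not_lt, not_not] at hn
  apply h
  set r : ℝ := -((c' - z) / (c - z)).re with hr
  have e1 : (c' - z) / (c - z) = -(r : ℂ) := by
    apply Complex.ext <;> simp [hr, hn.2]
  have e2 : c' - z = -(r : ℂ) * (c - z) := by rw [← e1]; field_simp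
  have r0 : 0 ≤ r := by rw [hr]; linarith [hn.1]
  have r1 : (1 + r : ℝ) ≠ 0 := by positivity
  have r1' : (1 + r : ℂ) ≠ 0 := by exact_mod_cast r1
  refine ⟨r / (1 + r), 1 / (1 + r), by positivity, by positivity, by field_simp; ring, ?_⟩
  simp only [Complex.real_smul]
  push_cast
  field_simp
  linear_combination e2

theorem continuousOn_sight (c c' : ℂ) : ContinuousOn (sight c c') (segment ℝ c c')ᶜ := by
  unfold sight
  refine continuousOn_halfDir.comp ?_ fun z hz => div_mem_slitPlane_of_notMem_segment hz
  refine ContinuousOn.div (by fun_prop) (by fun_prop) fun z hz h0 => hz ?_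
  rw [← sub_eq_zero.1 h0]; exact left_mem_segment ℝ _ _

theorem continuousAt_sight {c c' z : ℂ} (h : z ∉ segment ℝ c c') : ContinuousAt (sight c c') z := by
  apply (continuousOn_sight c c').continuousAt
  have : IsClosed (segment ℝ c c') := by
    rw [segment_eq_image]
    exact ((isCompact_Icc).image (by fun_prop)).isClosed
  exact this.isOpen_compl.mem_nhds h

theorem sight_mul_self {c c' z : ℂ} (h : z ≠ c) (h' : z ≠ c') :
    sight c c' z * sight c c' z = unitDir (c' - z) / unitDir (c - z) := by
  rw [sight, halfDir_mul_self (div_ne_zero (sub_ne_zero.2 h'.symm) (sub_ne_zero.2 h.symm)),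
    unitDir_div]

open Classical in
/-- The limit of `sight c c'` at `v` along the ray from `v` in the direction `u`. -/
def sightDir (c c' v u : ℂ) : ℂ :=
  if v = c' then halfDir (u / (c' - c)) else if v = c then halfDir (-(c' - c) / u) else sight c c' v

/-- The ray from `v` in the direction `u` starts outside of the segment from `c` to `c'`, except
possibly for its initial point. -/
def Leaves (c c' v u : ℂ) : Prop :=
  (v = c' → u / (c' - c) ∈ Complex.slitPlane) ∧ (v = c → -(c' - c) / u ∈ Complex.slitPlane) ∧
    (v ≠ c' → v ≠ c → v ∉ segment ℝ c c')

theorem tendsto_curve (v : ℂ) {u : ℝ → ℂ} {u₀ : ℂ} (hu : Tendsto u (𝓝[>] 0) (𝓝 u₀)) :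
    Tendsto (fun t : ℝ => v + t * u t) (𝓝[>] 0) (𝓝 v) := by
  have h1 : Tendsto (fun t : ℝ => (t : ℂ)) (𝓝[>] 0) (𝓝 ((0 : ℝ) : ℂ)) :=
    (Complex.continuous_ofReal.tendsto 0).mono_left nhdsWithin_le_nhds
  have := (tendsto_const_nhds (x := v)).add (h1.mul hu)
  simpa using this

theorem tendsto_ray (v u : ℂ) : Tendsto (fun t : ℝ => v + t * u) (𝓝[>] 0) (𝓝 v) :=
  tendsto_curve v tendsto_const_nhds

/-- `sightDir` is the limit along each curve from `v` that starts in the direction `u₀`. -/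
theorem tendsto_sight_curve {c c' v u₀ : ℂ} {u : ℝ → ℂ} (hcc : c ≠ c') (hu₀ : u₀ ≠ 0)
    (hu : Tendsto u (𝓝[>] 0) (𝓝 u₀)) (h : Leaves c c' v u₀) :
    Tendsto (fun t : ℝ => sight c c' (v + t * u t)) (𝓝[>] 0) (𝓝 (sightDir c c' v u₀)) := by
  have hpos : ∀ᶠ t : ℝ in 𝓝[>] 0, 0 < t := self_mem_nhdsWithin
  have hne : ∀ᶠ t : ℝ in 𝓝[>] 0, u t ≠ 0 := hu.eventually_ne hu₀
  unfold sightDir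
  split_ifs with h1 h2
  · subst h1
    -- At an end of the chord the quotient has no useful limit. `halfDir` ignores positive factors,
    -- so a factor `t` may be removed from it, and the rest converges.
    have e : ∀ᶠ t : ℝ in 𝓝[>] 0, halfDir (u t / ((v - c) + t * u t)) = sight c v (v + t * u t) := by
      filter_upwards [hpos] with t ht
      rw [sight, ← halfDir_real_mul ht]
      congr 1
      rw [← neg_div_neg_eq, ← mul_div_assoc]
      congr 1 <;> ring
    refine Tendsto.congr' e ?_
    have hl : ContinuousAt halfDir (u₀ / (v - c)) :=
      continuousOn_halfDir.continuousAt (Complex.isOpen_slitPlane.mem_nhds (h.1 rfl))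
    refine hl.tendsto.comp ?_
    exact hu.div (tendsto_curve _ hu) (sub_ne_zero.2 hcc.symm)
  · subst h2
    have e : ∀ᶠ t : ℝ in 𝓝[>] 0,
        halfDir ((-(c' - v) + t * u t) / u t) = sight v c' (v + t * u t) := by
      filter_upwards [hpos, hne] with t ht hne
      have ht' : (t : ℂ) ≠ 0 := by exact_mod_cast ht.ne'
      rw [sight]
      conv_rhs => rw [← halfDir_real_mul ht]
      congr 1
      field_simp
      ring
    refine Tendsto.congr' e ?_
    have hl : ContinuousAt halfDir (-(c' - v) / u₀) :=
      continuousOn_halfDir.continuousAt (Complex.isOpen_slitPlane.mem_nhds (h.2.1 rfl))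
    refine hl.tendsto.comp ?_
    exact (tendsto_curve _ hu).div hu hu₀
  · exact (continuousAt_sight (h.2.2 h1 h2)).tendsto.comp (tendsto_curve v hu)

theorem tendsto_sight {c c' v u : ℂ} (hcc : c ≠ c') (hu : u ≠ 0) (h : Leaves c c' v u) :
    Tendsto (fun t : ℝ => sight c c' (v + t * u)) (𝓝[>] 0) (𝓝 (sightDir c c' v u)) :=
  tendsto_sight_curve hcc hu tendsto_const_nhds h

/-! ### Crossing a segment -/

theorem im_div_eq_cross (x y : ℂ) : (x / y).im = cross y x / Complex.normSq y := by
  rw [Complex.div_im, cross]; ring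

theorem exists_lineMap_of_mem_openSegment {a b z : ℂ} (h : z ∈ openSegment ℝ a b) :
    ∃ t : ℝ, 0 < t ∧ t < 1 ∧ z = a + t * (b - a) := by
  obtain ⟨s, t, hs, ht, hst, rfl⟩ := h
  refine ⟨t, ht, by linarith, ?_⟩
  have : (s : ℂ) + t = 1 := by exact_mod_cast hst
  simp only [Complex.real_smul]
  linear_combination a * this

theorem exists_lineMap_of_mem_segment {a b z : ℂ} (h : z ∈ segment ℝ a b) :
    ∃ t : ℝ, 0 ≤ t ∧ t ≤ 1 ∧ z = a + t * (b - a) := by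
  obtain ⟨s, t, hs, ht, hst, rfl⟩ := h
  refine ⟨t, ht, by linarith, ?_⟩
  have : (s : ℂ) + t = 1 := by exact_mod_cast hst
  simp only [Complex.real_smul]
  linear_combination a * this

theorem lineMap_mem_openSegment {a b : ℂ} {t : ℝ} (h0 : 0 < t) (h1 : t < 1) :
    a + t * (b - a) ∈ openSegment ℝ a b := by
  refine ⟨1 - t, t, by linarith, h0, by ring, ?_⟩
  simp only [Complex.real_smul]; push_cast; ring

theorem mem_openSegment_of_mem_segment {a b z : ℂ} (h : z ∈ segment ℝ a b) (ha : z ≠ a)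
    (hb : z ≠ b) : z ∈ openSegment ℝ a b :=
  mem_openSegment_of_ne_left_right ha.symm hb.symm h

theorem segment_disjoint_of_openSegment {a b c c' : ℂ} (ha : a ∉ segment ℝ c c')
    (hb : b ∉ segment ℝ c c') (hc : c ∉ segment ℝ a b) (hc' : c' ∉ segment ℝ a b)
    (h : ¬ (openSegment ℝ a b ∩ openSegment ℝ c c').Nonempty) {z : ℂ}
    (hz : z ∈ segment ℝ a b) : z ∉ segment ℝ c c' := by
  intro hz'
  apply h
  refine ⟨z, mem_openSegment_of_mem_segment hz ?_ ?_, mem_openSegment_of_mem_segment hz' ?_ ?_⟩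
  all_goals rintro rfl; contradiction

open Classical in
/-- Along a segment from `a` to `b`, the half-angle of a chord has a continuous branch, which
changes its sign exactly when the segment crosses the chord. -/
theorem exists_branch_sight {a b c c' : ℂ} (ha : a ∉ segment ℝ c c')
    (hb : b ∉ segment ℝ c c') (hc : c ∉ segment ℝ a b) (hc' : c' ∉ segment ℝ a b)
    (h : (openSegment ℝ a b ∩ openSegment ℝ c c').Nonempty → cross (b - a) (c' - c) ≠ 0) :
    ∃ k : ℂ → ℂ, ContinuousOn k (segment ℝ a b) ∧
      (∃ s : ℂ, s ≠ 0 ∧ ∀ z ∈ segment ℝ a b, k z * k z = s * (unitDir (c' - z) / unitDir (c - z))) ∧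
      k a = sight c c' a ∧
      k b = (if (openSegment ℝ a b ∩ openSegment ℝ c c').Nonempty then -1 else 1) * sight c c' b := by
  have nc : ∀ z ∈ segment ℝ a b, z ≠ c := by rintro z hz rfl; exact hc hz
  have nc' : ∀ z ∈ segment ℝ a b, z ≠ c' := by rintro z hz rfl; exact hc' hz
  split_ifs with hX
  · have hX' := h hX
    obtain ⟨z0, hz0, hz0'⟩ := hX
    obtain ⟨t0, h0, h1, ht0⟩ := exists_lineMap_of_mem_openSegment hz0
    obtain ⟨s0, g0, g1, hs0⟩ := exists_lineMap_of_mem_openSegment hz0'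
    -- Twice the signed area of the triangle formed by the moving point and the chord: it is affine
    -- in `t` and vanishes at the crossing.
    have hcr : ∀ t : ℝ, cross (c - (a + t * (b - a))) (c' - (a + t * (b - a))) =
        (t0 - t) * cross (b - a) (c' - c) := by
      intro t
      have e1 : cross (c - (a + t0 * (b - a))) (c' - (a + t0 * (b - a))) = 0 := by
        rw [← ht0, hs0]; simp [cross]; ring
      have e2 : cross (c - (a + t * (b - a))) (c' - (a + t * (b - a))) -
        cross (c - (a + t0 * (b - a))) (c' - (a + t0 * (b - a))) =
        (t0 - t) * cross (b - a) (c' - c) := by simp [cross]; ring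
      rw [← e2, e1, sub_zero]
    have him : ∀ t : ℝ, ((c' - (a + t * (b - a))) / (c - (a + t * (b - a)))).im =
        (t0 - t) * cross (b - a) (c' - c) / Complex.normSq (c - (a + t * (b - a))) := by
      intro t; rw [im_div_eq_cross, hcr]
    -- At the crossing the chord is seen under the angle π, elsewhere the quotient is not real. So
    -- the negated quotient avoids the branch cut along the whole segment.
    have hslit : ∀ z ∈ segment ℝ a b, -((c' - z) / (c - z)) ∈ Complex.slitPlane := by
      intro z hz
      obtain ⟨t, -, -, rfl⟩ := exists_lineMap_of_mem_segment hz
      have hn : 0 < Complex.normSq (c - (a + t * (b - a))) :=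
        Complex.normSq_pos.2 (sub_ne_zero.2 (nc _ hz).symm)
      by_cases htt : t = t0
      · subst htt
        rw [← ht0] at hn ⊢
        left
        have e : (c' - z0) / (c - z0) = -(((1 - s0) / s0 : ℝ) : ℂ) := by
          have hne : c - z0 ≠ 0 := Complex.normSq_pos.1 hn
          have hs : (s0 : ℂ) ≠ 0 := by exact_mod_cast g0.ne'
          rw [div_eq_iff hne, hs0]; push_cast; field_simp; ring
        rw [e, neg_neg, Complex.ofReal_re]
        exact div_pos (by linarith) g0
      · right
        rw [Complex.neg_im, him]
        have : t0 - t ≠ 0 := sub_ne_zero.2 (Ne.symm htt)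
        exact neg_ne_zero.2 (div_ne_zero (mul_ne_zero this hX') hn.ne')
    have hma := left_mem_segment ℝ a b
    have hmb := right_mem_segment ℝ a b
    -- The root of the negated quotient, rescaled so that it agrees with `sight` at `a`.
    refine ⟨fun z => sight c c' a / halfDir (-((c' - a) / (c - a))) *
      halfDir (-((c' - z) / (c - z))), ?_, ?_, ?_, ?_⟩
    · refine continuousOn_const.mul (continuousOn_halfDir.comp ?_ hslit)
      refine (ContinuousOn.div (by fun_prop) (by fun_prop) fun z hz => ?_).neg
      exact sub_ne_zero.2 (nc z hz).symm
    · refine ⟨-(sight c c' a / halfDir (-((c' - a) / (c - a)))) ^ 2, ?_, fun z hz => ?_⟩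
      · exact neg_ne_zero.2 (pow_ne_zero _ (div_ne_zero (sight_ne_zero _ _ _) (halfDir_ne_zero _)))
      · have := halfDir_mul_self (Complex.slitPlane_ne_zero (hslit z hz))
        rw [unitDir_neg, unitDir_div] at this
        linear_combination (sight c c' a / halfDir (-((c' - a) / (c - a)))) ^ 2 * this
    · field_simp [halfDir_ne_zero]
    · have ia := him 0
      have ib := him 1
      simp only [Complex.ofReal_zero, zero_mul, add_zero, Complex.ofReal_one, one_mul,
        add_sub_cancel, sub_zero] at ia ib
      have na : 0 < Complex.normSq (c - a) :=
        Complex.normSq_pos.2 (sub_ne_zero.2 (nc _ hma).symm)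
      have nb : 0 < Complex.normSq (c - b) :=
        Complex.normSq_pos.2 (sub_ne_zero.2 (nc _ hmb).symm)
      have hsa := sight_ne_zero c c' a
      -- The quotient lies in opposite half planes at `a` and at `b`, so the negation costs `I` at
      -- one end and `-I` at the other; the ratio of these is -1.
      rcases lt_or_gt_of_ne hX' with hX' | hX'
      · have ia' : ((c' - a) / (c - a)).im < 0 := by
          rw [ia]; exact div_neg_of_neg_of_pos (mul_neg_of_pos_of_neg h0 hX') na
        have ib' : 0 < ((c' - b) / (c - b)).im := by
          rw [ib]; exact div_pos (mul_pos_of_neg_of_neg (by linarith) hX') nb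
        simp only []
        rw [halfDir_neg_of_im_neg ia', halfDir_neg_of_im_pos ib']
        change sight c c' a / (Complex.I * sight c c' a) * (-Complex.I * sight c c' b) = _
        have := Complex.I_ne_zero
        field_simp
      · have ia' : 0 < ((c' - a) / (c - a)).im := by
          rw [ia]; exact div_pos (mul_pos h0 hX') na
        have ib' : ((c' - b) / (c - b)).im < 0 := by
          rw [ib]; exact div_neg_of_neg_of_pos (mul_neg_of_neg_of_pos (by linarith) hX') nb
        simp only []
        rw [halfDir_neg_of_im_pos ia', halfDir_neg_of_im_neg ib']
        change sight c c' a / (-Complex.I * sight c c' a) * (Complex.I * sight c c' b) = _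
        have := Complex.I_ne_zero
        field_simp
  · have hd : ∀ z ∈ segment ℝ a b, z ∉ segment ℝ c c' := fun z hz =>
      segment_disjoint_of_openSegment ha hb hc hc' hX hz
    refine ⟨sight c c', (continuousOn_sight c c').mono hd, ⟨1, one_ne_zero, fun z hz => ?_⟩, rfl,
      by rw [one_mul]⟩
    rw [sight_mul_self (nc z hz) (nc' z hz), one_mul]

/-- The directions of two segments that start at the same point and do not overlap. -/
theorem neg_div_mem_slitPlane_of_disjoint {v a b : ℂ} (ha : a ≠ v) (hb : b ≠ v)
    (h : Disjoint (openSegment ℝ v a) (openSegment ℝ v b)) :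
    -((a - v) / (b - v)) ∈ Complex.slitPlane := by
  by_contra hn
  rw [Complex.mem_slitPlane_iff, not_or, not_lt, not_not, Complex.neg_re, Complex.neg_im,
    neg_eq_zero] at hn
  set r : ℝ := ((a - v) / (b - v)).re with hr
  have hb' : b - v ≠ 0 := sub_ne_zero.2 hb
  have e1 : (a - v) / (b - v) = (r : ℂ) := by apply Complex.ext <;> simp [hr, hn.2]
  have e2 : a - v = r * (b - v) := by rw [← e1]; field_simp
  have r0 : 0 ≤ r := by linarith [hn.1]
  -- The same point has the parameter `1 / (2 * (1 + r))` on one segment and `r / (2 * (1 + r))` on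
  -- the other; both are less than 1.
  have s0 : 0 < 1 / (2 * (1 + r)) := by positivity
  have s1 : 1 / (2 * (1 + r)) < 1 := by rw [div_lt_one (by positivity)]; linarith
  have rpos : 0 < r := by
    rcases r0.lt_or_eq with h | h
    · exact h
    · rw [← h] at e2; simp at e2; exact absurd (sub_eq_zero.1 e2) ha
  refine Set.disjoint_left.1 h (lineMap_mem_openSegment s0 s1) ?_
  have : v + ((1 / (2 * (1 + r)) : ℝ) : ℂ) * (a - v) = v + ((r / (2 * (1 + r)) : ℝ) : ℂ) * (b - v) := by
    rw [e2]; push_cast; ring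
  rw [this]
  apply lineMap_mem_openSegment (by positivity)
  rw [div_lt_one (by positivity)]; linarith

/-! ### Crossing parity of polygonal curves -/

open Classical in
/-- The sign of the number of intersections of a segment and a polygonal curve. -/
def segSign (a b : ℂ) (δ : Polyline) : ℂ :=
  ∏ m ∈ Finset.range δ.len, if (openSegment ℝ a b ∩ δ.openSeg m).Nonempty then -1 else 1

/-- A transversal crossing contributes 1 or -1 to the index, and as an exponent of -1 both have the
same effect. -/
theorem neg_one_zpow_ind {γ δ : Polyline}
    (h : ∀ k m, k < γ.len → m < δ.len → (γ.openSeg k ∩ δ.openSeg m).Nonempty →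
      cross (γ.dir k) (δ.dir m) ≠ 0) :
    (-1 : ℂ) ^ (γ.ind δ) = ∏ k ∈ Finset.range γ.len, segSign (γ.pt k) (γ.pt (k + 1)) δ := by
  classical
  unfold Polyline.ind segSign
  have hs : ∀ (s : Finset ℕ) (f : ℕ → ℤ), (-1 : ℂ) ^ (∑ k ∈ s, f k) = ∏ k ∈ s, (-1 : ℂ) ^ (f k) := by
    intro s f
    induction s using Finset.induction_on with
    | empty => simp
    | insert a s ha ih => rw [Finset.sum_insert ha, Finset.prod_insert ha, zpow_add₀ (by norm_num), ih]
  rw [hs]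
  refine Finset.prod_congr rfl fun k hk => ?_
  rw [hs]
  refine Finset.prod_congr rfl fun m hm => ?_
  change (-1 : ℂ) ^ (if (γ.openSeg k ∩ δ.openSeg m).Nonempty then _ else _ : ℤ) =
    if (γ.openSeg k ∩ δ.openSeg m).Nonempty then -1 else 1
  split_ifs with hX
  · have := h k m (Finset.mem_range.1 hk) (Finset.mem_range.1 hm) hX
    rcases lt_or_gt_of_ne this with h' | h'
    · rw [sign_neg h']; norm_num
    · rw [sign_pos h']; norm_num
  · simp

/-! ### Points of a disc, seen from its boundary -/

theorem re_one_sub_pos {x : ℂ} (h : ‖x‖ ≤ 1) (h1 : x ≠ 1) : 0 < (1 - x).re := by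
  rw [Complex.sub_re, Complex.one_re, sub_pos]
  rcases lt_or_ge x.re 1 with h' | h'
  · exact h'
  · exfalso; apply h1
    have h2 : x.re * x.re + x.im * x.im ≤ 1 := by
      have := Complex.sq_norm x
      rw [Complex.normSq_apply] at this
      rw [← this]; exact pow_le_one₀ (norm_nonneg _) h
    have h3 : x.im = 0 := by nlinarith
    have h4 : x.re = 1 := by nlinarith
    exact Complex.ext (by simp [h4]) (by simp [h3])

/-- Seen from a boundary point, the closed disc lies in a half plane. Hence `halfDir (1 - z / b)` is
a continuous root on the whole disc without `b`. -/
theorem one_sub_div_mem {z b : ℂ} (hb : b ≠ 0) (h : ‖z‖ ≤ ‖b‖) (h1 : z ≠ b) :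
    0 < (1 - z / b).re := by
  apply re_one_sub_pos
  · rw [norm_div]; exact div_le_one_of_le₀ h (norm_nonneg _)
  · intro h'; rw [div_eq_one_iff_eq hb] at h'; exact h1 h'

end AnnularNet

end

noncomputable section

namespace AnnularNet

/-! ### Reversed polygonal curves -/

namespace Polyline

theorem rev_dir (γ : Polyline) {k : ℕ} (hk : k < γ.len) :
    γ.rev.dir k = -γ.dir (γ.len - 1 - k) := by
  have e1 : γ.len - (k + 1) = γ.len - 1 - k := by omega
  have e2 : γ.len - k = γ.len - 1 - k + 1 := by omega
  simp only [dir, rev, e1, e2]; ring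

theorem rev_openSeg (γ : Polyline) {k : ℕ} (hk : k < γ.len) :
    γ.rev.openSeg k = γ.openSeg (γ.len - 1 - k) := by
  have e1 : γ.len - (k + 1) = γ.len - 1 - k := by omega
  have e2 : γ.len - k = γ.len - 1 - k + 1 := by omega
  simp only [openSeg, rev, e1, e2]
  exact openSegment_symm ℝ _ _

theorem rev_carrier (γ : Polyline) : γ.rev.carrier = γ.carrier := by
  have aux : ∀ γ : Polyline, γ.carrier ⊆ γ.rev.carrier := by
    intro γ z hz
    simp only [carrier, Set.mem_iUnion] at hz ⊢
    obtain ⟨k, hk, hz⟩ := hz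
    refine ⟨γ.len - 1 - k, by simp only [rev]; omega, ?_⟩
    have e1 : γ.len - (γ.len - 1 - k + 1) = k := by omega
    have e2 : γ.len - (γ.len - 1 - k) = k + 1 := by omega
    simp only [rev, e1, e2]
    rwa [segment_symm]
  refine Set.Subset.antisymm (fun z hz => ?_) (aux γ)
  have := aux γ.rev hz
  simp only [carrier, Set.mem_iUnion] at this ⊢
  obtain ⟨k, hk, hz⟩ := this
  simp only [rev] at hk hz
  refine ⟨k, hk, ?_⟩
  have e1 : γ.len - (γ.len - k) = k := by omega
  have e2 : γ.len - (γ.len - (k + 1)) = k + 1 := by omega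
  rwa [e1, e2] at hz

theorem segment_subset_carrier (γ : Polyline) {k : ℕ} (hk : k < γ.len) :
    segment ℝ (γ.pt k) (γ.pt (k + 1)) ⊆ γ.carrier := by
  intro z hz
  simp only [carrier, Set.mem_iUnion]
  exact ⟨k, hk, hz⟩

theorem pt_mem_carrier (γ : Polyline) (h0 : 0 < γ.len) {k : ℕ} (hk : k ≤ γ.len) :
    γ.pt k ∈ γ.carrier := by
  rcases hk.lt_or_eq with h | h
  · exact γ.segment_subset_carrier h (left_mem_segment ℝ _ _)
  · have : k = (k - 1) + 1 := by omega
    rw [this]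
    exact γ.segment_subset_carrier (k := k - 1) (by omega) (right_mem_segment ℝ _ _)

end Polyline

open Classical in
/-- Reversing some of the curves. -/
theorem IsEmbeddedFamily.rev {ι : Type*} {γ : ι → Polyline} (h : IsEmbeddedFamily γ)
    (s : ι → Prop) : IsEmbeddedFamily fun i => if s i then (γ i).rev else γ i := by
  have hpt : ∀ i k, k ≤ (γ i).len → ∃ k', k' ≤ (γ i).len ∧
      (k' = if s i then (γ i).len - k else k) ∧
      (if s i then (γ i).rev else γ i).pt k = (γ i).pt k' := by
    intro i k hk
    by_cases hs : s i
    · exact ⟨(γ i).len - k, by omega, by rw [if_pos hs], by rw [if_pos hs]; rfl⟩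
    · exact ⟨k, hk, by rw [if_neg hs], by rw [if_neg hs]⟩
  have hseg : ∀ i k, k < (γ i).len → ∃ k', k' < (γ i).len ∧
      (k' = if s i then (γ i).len - 1 - k else k) ∧
      (if s i then (γ i).rev else γ i).openSeg k = (γ i).openSeg k' := by
    intro i k hk
    by_cases hs : s i
    · exact ⟨(γ i).len - 1 - k, by omega, by rw [if_pos hs],
        by rw [if_pos hs]; exact (γ i).rev_openSeg hk⟩
    · exact ⟨k, hk, by rw [if_neg hs], by rw [if_neg hs]⟩
  have hlen : ∀ i, (if s i then (γ i).rev else γ i).len = (γ i).len := by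
    intro i; split_ifs <;> rfl
  refine ⟨fun i => by rw [hlen]; exact h.len_pos i, ?_, ?_, ?_⟩
  · intro i j k m hk hm he
    simp only [hlen] at hk hm
    obtain ⟨k', hk', ek, ek'⟩ := hpt i k hk
    obtain ⟨m', hm', em, em'⟩ := hpt j m hm
    rw [ek', em'] at he
    rcases h.pt_inj i j k' m' hk' hm' he with ⟨rfl, hkm⟩ | ⟨h1, h2⟩
    · left
      refine ⟨rfl, ?_⟩
      split_ifs at ek em <;> omega
    · right
      simp only [Polyline.IsEnd, hlen] at h1 h2 ⊢
      split_ifs at ek em <;> omega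
  · intro i j k m hk hm
    simp only [hlen] at hk hm
    obtain ⟨k', hk', ek, ek'⟩ := hpt i k hk
    obtain ⟨m', hm', em, em'⟩ := hseg j m hm
    simp only [ek', em']
    exact h.pt_notMem i j k' m' hk' hm'
  · intro i j k m hk hm hne
    simp only [hlen] at hk hm
    obtain ⟨k', hk', ek, ek'⟩ := hseg i k hk
    obtain ⟨m', hm', em, em'⟩ := hseg j m hm
    simp only [ek', em']
    refine h.seg_disjoint i j k' m' hk' hm' ?_
    by_cases hij : i = j
    · subst hij
      right
      have : k ≠ m := by tauto
      split_ifs at ek em <;> omega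
    · exact Or.inl hij

namespace IsEmbeddedFamily

variable {ι : Type*} {γ : ι → Polyline}

theorem pt_ne_succ (h : IsEmbeddedFamily γ) {i : ι} {k : ℕ} (hk : k < (γ i).len) :
    (γ i).pt k ≠ (γ i).pt (k + 1) := by
  intro he
  apply h.pt_notMem i i k k hk.le hk
  rw [Polyline.openSeg, ← he, openSegment_same]; rfl

theorem dir_ne_zero (h : IsEmbeddedFamily γ) {i : ι} {k : ℕ} (hk : k < (γ i).len) :
    (γ i).dir k ≠ 0 := sub_ne_zero.2 (h.pt_ne_succ hk).symm

/-- A cusp would make the two segments overlap near their common corner. -/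
theorem noCusp_interior (h : IsEmbeddedFamily γ) {i : ι} {k : ℕ} (hk : k + 1 < (γ i).len) :
    (γ i).dir (k + 1) / (γ i).dir k ∈ Complex.slitPlane := by
  have := neg_div_mem_slitPlane_of_disjoint (v := (γ i).pt (k + 1)) (a := (γ i).pt (k + 1 + 1))
    (b := (γ i).pt k) (h.pt_ne_succ hk).symm (h.pt_ne_succ (by omega)) (by
      rw [openSegment_symm ℝ ((γ i).pt (k + 1)) ((γ i).pt k)]
      exact h.seg_disjoint i i (k + 1) k hk (by omega) (Or.inr (by omega)))
  rw [← div_neg, neg_sub] at this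
  exact this

theorem noCusp_succ (h : IsEmbeddedFamily γ) {i j : ι}
    (hij : (γ i).pt (γ i).len = (γ j).pt 0) :
    (γ j).dir 0 / (γ i).dir ((γ i).len - 1) ∈ Complex.slitPlane := by
  have hi := h.len_pos i
  have hj := h.len_pos j
  have e : (γ i).len - 1 + 1 = (γ i).len := by omega
  have n1 := h.pt_ne_succ hj
  have n2 := h.pt_ne_succ (i := i) (k := (γ i).len - 1) (by omega)
  rw [e] at n2
  have := neg_div_mem_slitPlane_of_disjoint (v := (γ j).pt 0) (a := (γ j).pt (0 + 1))
    (b := (γ i).pt ((γ i).len - 1)) n1.symm (by rw [← hij]; exact n2) (by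
      rw [openSegment_symm ℝ _ ((γ i).pt ((γ i).len - 1)), ← hij]
      -- For a loop the first and the last segment are different, since a curve with a single
      -- segment is not closed.
      have := h.seg_disjoint j i 0 ((γ i).len - 1) hj (by omega) (by
        by_contra hc
        push Not at hc
        obtain ⟨rfl, hc⟩ := hc
        have : (γ j).len = 1 := by omega
        rw [this] at hij
        exact n1 hij.symm)
      simp only [Polyline.openSeg, e] at this
      rwa [← hij] at this)
  rw [← div_neg, neg_sub] at this
  simp only [Polyline.dir, e]
  rw [hij]
  exact this

theorem noCusp_start (h : IsEmbeddedFamily γ) {i j : ι} (hne : i ≠ j)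
    (hij : (γ i).pt 0 = (γ j).pt 0) :
    -((γ i).dir 0 / (γ j).dir 0) ∈ Complex.slitPlane := by
  have hi := h.len_pos i
  have hj := h.len_pos j
  have n1 := h.pt_ne_succ hi
  have n2 := h.pt_ne_succ hj
  have := neg_div_mem_slitPlane_of_disjoint (v := (γ j).pt 0) (a := (γ i).pt (0 + 1))
    (b := (γ j).pt (0 + 1)) (by rw [← hij]; exact n1.symm) n2.symm (by
      have := h.seg_disjoint i j 0 0 hi hj (Or.inl hne)
      simp only [Polyline.openSeg] at this
      rwa [hij] at this)
  simp only [Polyline.dir]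
  rw [hij]
  exact this

theorem noCusp_end (h : IsEmbeddedFamily γ) {i j : ι} (hne : i ≠ j)
    (hij : (γ i).pt (γ i).len = (γ j).pt (γ j).len) :
    -((γ i).dir ((γ i).len - 1) / (γ j).dir ((γ j).len - 1)) ∈ Complex.slitPlane := by
  have hi := h.len_pos i
  have hj := h.len_pos j
  have e : (γ i).len - 1 + 1 = (γ i).len := by omega
  have e' : (γ j).len - 1 + 1 = (γ j).len := by omega
  have n1 := h.pt_ne_succ (i := i) (k := (γ i).len - 1) (by omega)
  have n2 := h.pt_ne_succ (i := j) (k := (γ j).len - 1) (by omega)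
  rw [e] at n1
  rw [e'] at n2
  have := neg_div_mem_slitPlane_of_disjoint (v := (γ j).pt (γ j).len) (a := (γ i).pt ((γ i).len - 1))
    (b := (γ j).pt ((γ j).len - 1)) (by rw [← hij]; exact n1) n2 (by
      have := h.seg_disjoint i j ((γ i).len - 1) ((γ j).len - 1) (by omega) (by omega) (Or.inl hne)
      simp only [Polyline.openSeg, e, e'] at this
      rw [openSegment_symm, openSegment_symm ℝ ((γ j).pt ((γ j).len - 1))] at this
      rwa [hij] at this)
  simp only [Polyline.dir, e, e']
  rw [hij]
  rwa [← neg_div_neg_eq, neg_sub, neg_sub] at this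

end IsEmbeddedFamily

namespace AnnularGraph

variable {n : ℕ} {V₀ E : Type*}

/-! ### Directions of the edges at their ends -/

/-- The direction in which an edge starts. -/
def dirS (N : AnnularGraph n V₀ E) (e : E) : ℂ := (N.curve e).dir 0

/-- The direction in which an edge ends. -/
def dirT (N : AnnularGraph n V₀ E) (e : E) : ℂ := (N.curve e).dir ((N.curve e).len - 1)

section Perfect

variable {N : AnnularGraph n V₀ E} (hN : N.IsPerfect)

include hN

theorem IsPerfect.dirS_ne_zero (e : E) : N.dirS e ≠ 0 :=
  hN.embedded.dir_ne_zero (hN.embedded.len_pos e)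

theorem IsPerfect.dirT_ne_zero (e : E) : N.dirT e ≠ 0 :=
  hN.embedded.dir_ne_zero (i := e) (by have := hN.embedded.len_pos e; omega)

theorem IsPerfect.slit_succ {e f : E} (h : N.tgt e = N.src f) :
    N.dirS f / N.dirT e ∈ Complex.slitPlane :=
  hN.embedded.noCusp_succ (i := e) (j := f) (by rw [hN.curve_end, hN.curve_start, h])

theorem IsPerfect.slit_src {e f : E} (hne : e ≠ f) (h : N.src e = N.src f) :
    -(N.dirS e / N.dirS f) ∈ Complex.slitPlane :=
  hN.embedded.noCusp_start hne (by rw [hN.curve_start, hN.curve_start, h])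

theorem IsPerfect.slit_tgt {e f : E} (hne : e ≠ f) (h : N.tgt e = N.tgt f) :
    -(N.dirT e / N.dirT f) ∈ Complex.slitPlane :=
  hN.embedded.noCusp_end hne (by rw [hN.curve_end, hN.curve_end, h])

end Perfect

/-! ### Combinatorics of simple paths -/

section Path

variable {N : AnnularGraph n V₀ E} {i j : Fin n} {P : List E}

theorem IsPath.ne_nil (hP : N.IsPath i j P) : P ≠ [] := by
  rintro rfl; simpa using hP.2.1

/-- Two readings of the list of visited vertices. Comparing them carries simplicity over to the
targets and provides the edges of the path before and after a vertex. -/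
theorem IsPath.map_src_append (hP : N.IsPath i j P) :
    P.map N.src ++ [Sum.inl j] = Sum.inl i :: P.map N.tgt := by
  have aux : ∀ (P : List E) (e : E), (e :: P).IsChain (fun e f => N.tgt e = N.src f) →
      ∀ v, (e :: P).getLast?.map N.tgt = some v →
      (e :: P).map N.src ++ [v] = N.src e :: (e :: P).map N.tgt := by
    intro P
    induction P with
    | nil => intro e _ v hv; simpa using hv.symm
    | cons f P ih =>
      intro e hc v hv
      rw [List.isChain_cons_cons] at hc
      have := ih f hc.2 v (by simpa using hv)
      rw [List.map_cons, List.cons_append, this, List.map_cons (l := f :: P), hc.1]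
  obtain ⟨hc, hh, hl⟩ := hP
  cases P with
  | nil => simp at hh
  | cons e P =>
    rw [aux P e hc _ hl]
    simp only [List.head?_cons, Option.map_some, Option.some.injEq] at hh
    rw [hh]

theorem IsPath.pathVertices_eq (hP : N.IsPath i j P) :
    N.pathVertices P = P.map N.src ++ [Sum.inl j] := by
  rw [pathVertices, hP.2.2]; rfl

variable (hP : N.IsPath i j P) (hs : N.IsSimplePath P)

include hP hs

theorem IsPath.nodup_src : (P.map N.src ++ [Sum.inl j]).Nodup := by
  have := hs
  rwa [IsSimplePath, hP.pathVertices_eq] at this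

theorem IsPath.nodup_tgt : (Sum.inl i :: P.map N.tgt).Nodup := by
  rw [← hP.map_src_append]; exact hP.nodup_src hs

theorem IsPath.nodup : P.Nodup := (List.Nodup.of_append_left (hP.nodup_src hs)).of_map _

theorem IsPath.src_inj {e f : E} (he : e ∈ P) (hf : f ∈ P) (h : N.src e = N.src f) : e = f :=
  List.inj_on_of_nodup_map (List.Nodup.of_append_left (hP.nodup_src hs)) he hf h

theorem IsPath.tgt_inj {e f : E} (he : e ∈ P) (hf : f ∈ P) (h : N.tgt e = N.tgt f) : e = f :=
  List.inj_on_of_nodup_map (List.nodup_cons.1 (hP.nodup_tgt hs)).2 he hf h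

theorem IsPath.src_ne {e : E} (he : e ∈ P) : N.src e ≠ Sum.inl j := by
  intro h
  have := List.disjoint_of_nodup_append (hP.nodup_src hs) (List.mem_map_of_mem (f := N.src) he)
  rw [h] at this
  simp at this

theorem IsPath.tgt_ne {e : E} (he : e ∈ P) : N.tgt e ≠ Sum.inl i := by
  intro h
  have := (List.nodup_cons.1 (hP.nodup_tgt hs)).1
  rw [← h] at this
  exact this (List.mem_map_of_mem he)

theorem IsPath.ne : i ≠ j := by
  rintro rfl
  obtain ⟨e, he⟩ := List.exists_mem_of_ne_nil P hP.ne_nil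
  have hl := hP.2.2
  cases hq : P.getLast? with
  | none => rw [hq] at hl; simp at hl
  | some f =>
    rw [hq] at hl
    simp only [Option.map_some, Option.some.injEq] at hl
    exact hP.tgt_ne hs (List.mem_of_getLast? hq) hl

omit hs in
theorem IsPath.exists_src {e : E} (he : e ∈ P) (h : N.tgt e ≠ Sum.inl j) :
    ∃ f ∈ P, N.src f = N.tgt e := by
  have : N.tgt e ∈ P.map N.src ++ [Sum.inl j] := by
    rw [hP.map_src_append]; exact List.mem_cons_of_mem _ (List.mem_map_of_mem he)
  simpa [h] using this

omit hs in
theorem IsPath.exists_tgt {e : E} (he : e ∈ P) (h : N.src e ≠ Sum.inl i) :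
    ∃ f ∈ P, N.tgt f = N.src e := by
  have : N.src e ∈ Sum.inl i :: P.map N.tgt := by
    rw [← hP.map_src_append]; exact List.mem_append_left _ (List.mem_map_of_mem he)
  simpa [h] using this

omit hs in
theorem IsPath.exists_first : ∃ e ∈ P, N.src e = Sum.inl i := by
  have hl := hP.2.1
  cases hq : P.head? with
  | none => rw [hq] at hl; simp at hl
  | some f => 
    rw [hq] at hl
    simp only [Option.map_some, Option.some.injEq] at hl
    exact ⟨f, List.mem_of_head? hq, hl⟩

omit hs in
theorem IsPath.exists_last : ∃ e ∈ P, N.tgt e = Sum.inl j := by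
  have hl := hP.2.2
  cases hq : P.getLast? with
  | none => rw [hq] at hl; simp at hl
  | some f => 
    rw [hq] at hl
    simp only [Option.map_some, Option.some.injEq] at hl
    exact ⟨f, List.mem_of_getLast? hq, hl⟩

end Path

section Degrees

variable {N : AnnularGraph n V₀ E} {i j : Fin n} {P : List E}

theorem IsSource.not_isSink {t : Fin n} (h : N.IsSource t) : ¬ N.IsSink t := by
  rintro ⟨h1, h2⟩
  rw [h.1] at h1; exact one_ne_zero h1

theorem tgt_ne_of_isSource [Finite E] {t : Fin n} (h : N.IsSource t) (e : E) :
    N.tgt e ≠ Sum.inl t := by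
  intro he
  have := (Set.ncard_eq_zero (Set.toFinite _)).1 h.2
  exact (Set.eq_empty_iff_forall_notMem.1 this e) he

theorem src_ne_of_isSink [Finite E] {t : Fin n} (h : N.IsSink t) (e : E) :
    N.src e ≠ Sum.inl t := by
  intro he
  have := (Set.ncard_eq_zero (Set.toFinite _)).1 h.1
  exact (Set.eq_empty_iff_forall_notMem.1 this e) he

theorem exists_src_of_isSource {t : Fin n} (h : N.IsSource t) :
    ∃ e, N.src e = Sum.inl t ∧ ∀ f, N.src f = Sum.inl t → f = e := by
  obtain ⟨e, he⟩ := Set.ncard_eq_one.1 h.1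
  refine ⟨e, ?_, fun f hf => ?_⟩
  · have : e ∈ {e | N.src e = Sum.inl t} := by rw [he]; rfl
    exact this
  · have : f ∈ {e | N.src e = Sum.inl t} := hf
    rw [he] at this; exact this

theorem exists_tgt_of_isSink {t : Fin n} (h : N.IsSink t) :
    ∃ e, N.tgt e = Sum.inl t ∧ ∀ f, N.tgt f = Sum.inl t → f = e := by
  obtain ⟨e, he⟩ := Set.ncard_eq_one.1 h.2
  refine ⟨e, ?_, fun f hf => ?_⟩
  · have : e ∈ {e | N.tgt e = Sum.inl t} := by rw [he]; rfl
    exact this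
  · have : f ∈ {e | N.tgt e = Sum.inl t} := hf
    rw [he] at this; exact this

theorem reverse_src_of_mem {e : E} (he : e ∈ P) : (N.reverse P).src e = N.tgt e := if_pos he

theorem reverse_src_of_notMem {e : E} (he : e ∉ P) : (N.reverse P).src e = N.src e := if_neg he

theorem reverse_tgt_of_mem {e : E} (he : e ∈ P) : (N.reverse P).tgt e = N.src e := if_pos he

theorem reverse_tgt_of_notMem {e : E} (he : e ∉ P) : (N.reverse P).tgt e = N.tgt e := if_neg he

theorem reverse_curve_of_mem {e : E} (he : e ∈ P) :
    (N.reverse P).curve e = (N.curve e).rev := if_pos he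

theorem reverse_curve_of_notMem {e : E} (he : e ∉ P) :
    (N.reverse P).curve e = N.curve e := if_neg he

variable [Finite E]

theorem IsPerfect.isSource_of_src (hN : N.IsPerfect) {e : E} {t : Fin n}
    (h : N.src e = Sum.inl t) : N.IsSource t :=
  (hN.boundary_degree t).resolve_right fun h' => src_ne_of_isSink h' e h

theorem IsPerfect.isSink_of_tgt (hN : N.IsPerfect) {e : E} {t : Fin n}
    (h : N.tgt e = Sum.inl t) : N.IsSink t :=
  (hN.boundary_degree t).resolve_left fun h' => tgt_ne_of_isSource h' e h

omit [Finite E] in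
theorem IsPerfect.not_isSource_iff (hN : N.IsPerfect) {t : Fin n} : ¬ N.IsSource t ↔ N.IsSink t :=
  ⟨(hN.boundary_degree t).resolve_left, fun h h' => h'.not_isSink h⟩

theorem IsPath.isSource (hN : N.IsPerfect) (hP : N.IsPath i j P) : N.IsSource i := by
  obtain ⟨e, -, he⟩ := hP.exists_first
  exact hN.isSource_of_src he

theorem IsPath.isSink (hN : N.IsPerfect) (hP : N.IsPath i j P) : N.IsSink j := by
  obtain ⟨e, -, he⟩ := hP.exists_last
  exact hN.isSink_of_tgt he

theorem IsPath.src_eq_inl (hN : N.IsPerfect) (hP : N.IsPath i j P) {e : E} {t : Fin n}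
    (he : e ∈ P) (h : N.src e = Sum.inl t) : t = i := by
  by_contra hne
  obtain ⟨f, -, hf⟩ := hP.exists_tgt he (by rw [h]; simpa using hne)
  exact tgt_ne_of_isSource (hN.isSource_of_src h) f (hf.trans h)

theorem IsPath.tgt_eq_inl (hN : N.IsPerfect) (hP : N.IsPath i j P) {e : E} {t : Fin n}
    (he : e ∈ P) (h : N.tgt e = Sum.inl t) : t = j := by
  by_contra hne
  obtain ⟨f, -, hf⟩ := hP.exists_src he (by rw [h]; simpa using hne)
  exact src_ne_of_isSink (hN.isSink_of_tgt h) f (hf.trans h)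

theorem ncard_split (f : E → Fin n ⊕ V₀) (P : List E) (v : Fin n ⊕ V₀) :
    {e | f e = v}.ncard = {e | e ∉ P ∧ f e = v}.ncard + {e | e ∈ P ∧ f e = v}.ncard := by
  rw [← Set.ncard_union_eq]
  · congr 1; ext e; simp only [Set.mem_ofPred_eq, Set.mem_union]; tauto
  · rw [Set.disjoint_left]; rintro e ⟨h, -⟩ ⟨h', -⟩; exact h h'

/-- The edges of `P` exchange their ends. The balance is written with sums because subtraction of
natural numbers truncates. -/
theorem reverse_degrees (N : AnnularGraph n V₀ E) (P : List E) (v : Fin n ⊕ V₀) :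
    (N.reverse P).outDeg v + {e | e ∈ P ∧ N.src e = v}.ncard =
      N.outDeg v + {e | e ∈ P ∧ N.tgt e = v}.ncard ∧
    (N.reverse P).inDeg v + {e | e ∈ P ∧ N.tgt e = v}.ncard =
      N.inDeg v + {e | e ∈ P ∧ N.src e = v}.ncard := by
  have a1 : {e | e ∉ P ∧ (N.reverse P).src e = v} = {e | e ∉ P ∧ N.src e = v} := by
    ext e; simp only [Set.mem_ofPred_eq]
    exact and_congr_right fun h => by rw [reverse_src_of_notMem h]
  have a2 : {e | e ∈ P ∧ (N.reverse P).src e = v} = {e | e ∈ P ∧ N.tgt e = v} := by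
    ext e; simp only [Set.mem_ofPred_eq]
    exact and_congr_right fun h => by rw [reverse_src_of_mem h]
  have b1 : {e | e ∉ P ∧ (N.reverse P).tgt e = v} = {e | e ∉ P ∧ N.tgt e = v} := by
    ext e; simp only [Set.mem_ofPred_eq]
    exact and_congr_right fun h => by rw [reverse_tgt_of_notMem h]
  have b2 : {e | e ∈ P ∧ (N.reverse P).tgt e = v} = {e | e ∈ P ∧ N.src e = v} := by
    ext e; simp only [Set.mem_ofPred_eq]
    exact and_congr_right fun h => by rw [reverse_tgt_of_mem h]
  unfold outDeg inDeg
  rw [ncard_split (N.reverse P).src P, ncard_split (N.reverse P).tgt P, ncard_split N.src P,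
    ncard_split N.tgt P, a1, a2, b1, b2]
  omega

omit [Finite E] in
theorem IsPath.ncard_src (hP : N.IsPath i j P) (hs : N.IsSimplePath P) {v : Fin n ⊕ V₀}
    (h : ∃ e ∈ P, N.src e = v) : {e | e ∈ P ∧ N.src e = v}.ncard = 1 := by
  obtain ⟨e, he, rfl⟩ := h
  rw [Set.ncard_eq_one]
  refine ⟨e, ?_⟩
  ext f
  simp only [Set.mem_ofPred_eq, Set.mem_singleton_iff]
  exact ⟨fun h => hP.src_inj hs h.1 he h.2, by rintro rfl; exact ⟨he, rfl⟩⟩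

omit [Finite E] in
theorem IsPath.ncard_tgt (hP : N.IsPath i j P) (hs : N.IsSimplePath P) {v : Fin n ⊕ V₀}
    (h : ∃ e ∈ P, N.tgt e = v) : {e | e ∈ P ∧ N.tgt e = v}.ncard = 1 := by
  obtain ⟨e, he, rfl⟩ := h
  rw [Set.ncard_eq_one]
  refine ⟨e, ?_⟩
  ext f
  simp only [Set.mem_ofPred_eq, Set.mem_singleton_iff]
  exact ⟨fun h => hP.tgt_inj hs h.1 he h.2, by rintro rfl; exact ⟨he, rfl⟩⟩

theorem ncard_eq_zero_of_forall {p : E → Prop} (h : ∀ e, ¬ p e) : {e | p e}.ncard = 0 := by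
  rw [Set.ncard_eq_zero]; exact Set.eq_empty_iff_forall_notMem.2 h

/-- The path enters such a vertex as often as it leaves it, once or never, so the exchange of ends
has no effect on the degrees. -/
theorem reverse_degrees_of_ne (hP : N.IsPath i j P) (hs : N.IsSimplePath P) {v : Fin n ⊕ V₀}
    (hi : v ≠ Sum.inl i) (hj : v ≠ Sum.inl j) :
    (N.reverse P).outDeg v = N.outDeg v ∧ (N.reverse P).inDeg v = N.inDeg v := by
  have h := reverse_degrees N P v
  have : {e | e ∈ P ∧ N.src e = v}.ncard = {e | e ∈ P ∧ N.tgt e = v}.ncard := by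
    by_cases h1 : ∃ e ∈ P, N.src e = v
    · obtain ⟨e, he, rfl⟩ := id h1
      obtain ⟨f, hf, hfe⟩ := hP.exists_tgt he hi
      rw [hP.ncard_src hs h1, hP.ncard_tgt hs ⟨f, hf, hfe⟩]
    · have h2 : ¬ ∃ e ∈ P, N.tgt e = v := by
        rintro ⟨e, he, rfl⟩
        obtain ⟨f, hf, hfe⟩ := hP.exists_src he hj
        exact h1 ⟨f, hf, hfe⟩
      push Not at h1 h2
      rw [ncard_eq_zero_of_forall (fun e h => h1 e h.1 h.2),
        ncard_eq_zero_of_forall (fun e h => h2 e h.1 h.2)]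
  omega

theorem reverse_isSink (hN : N.IsPerfect) (hP : N.IsPath i j P) (hs : N.IsSimplePath P) :
    (N.reverse P).IsSink i := by
  have h := reverse_degrees N P (Sum.inl i)
  have h1 := hP.ncard_src hs hP.exists_first
  have h2 : {e | e ∈ P ∧ N.tgt e = Sum.inl i}.ncard = 0 :=
    ncard_eq_zero_of_forall fun e h => hP.tgt_ne hs h.1 h.2
  have h3 := hP.isSource hN
  unfold IsSource at h3
  unfold IsSink
  omega

theorem reverse_isSource (hN : N.IsPerfect) (hP : N.IsPath i j P) (hs : N.IsSimplePath P) :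
    (N.reverse P).IsSource j := by
  have h := reverse_degrees N P (Sum.inl j)
  have h1 := hP.ncard_tgt hs hP.exists_last
  have h2 : {e | e ∈ P ∧ N.src e = Sum.inl j}.ncard = 0 :=
    ncard_eq_zero_of_forall fun e h => hP.src_ne hs h.1 h.2
  have h3 := hP.isSink hN
  unfold IsSink at h3
  unfold IsSource
  omega

theorem reverse_isSource_iff (hP : N.IsPath i j P) (hs : N.IsSimplePath P) {t : Fin n}
    (hi : t ≠ i) (hj : t ≠ j) : (N.reverse P).IsSource t ↔ N.IsSource t := by
  have := reverse_degrees_of_ne hP hs (v := Sum.inl t) (by simpa using hi) (by simpa using hj)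
  rw [IsSource, IsSource, this.1, this.2]

theorem reverse_isSink_iff (hP : N.IsPath i j P) (hs : N.IsSimplePath P) {t : Fin n}
    (hi : t ≠ i) (hj : t ≠ j) : (N.reverse P).IsSink t ↔ N.IsSink t := by
  have := reverse_degrees_of_ne hP hs (v := Sum.inl t) (by simpa using hi) (by simpa using hj)
  rw [IsSink, IsSink, this.1, this.2]

omit [Finite E] in
theorem reverse_carrier (N : AnnularGraph n V₀ E) (P : List E) (e : E) :
    ((N.reverse P).curve e).carrier = (N.curve e).carrier := by
  by_cases he : e ∈ P
  · rw [reverse_curve_of_mem he, Polyline.rev_carrier]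
  · rw [reverse_curve_of_notMem he]

omit [Finite E] in
theorem reverse_len (N : AnnularGraph n V₀ E) (P : List E) (e : E) :
    ((N.reverse P).curve e).len = (N.curve e).len := by
  by_cases he : e ∈ P
  · rw [reverse_curve_of_mem he]; rfl
  · rw [reverse_curve_of_notMem he]

omit [Finite E] in
theorem IsPerfect.reverse_dirS (hN : N.IsPerfect) {e : E} (he : e ∈ P) :
    (N.reverse P).dirS e = -N.dirT e := by
  rw [dirS, reverse_curve_of_mem he, Polyline.rev_dir _ (hN.embedded.len_pos e)]; rfl

omit [Finite E] in
theorem IsPerfect.reverse_dirT (hN : N.IsPerfect) {e : E} (he : e ∈ P) :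
    (N.reverse P).dirT e = -N.dirS e := by
  have := hN.embedded.len_pos e
  rw [dirT, reverse_curve_of_mem he]
  change (N.curve e).rev.dir ((N.curve e).len - 1) = _
  rw [Polyline.rev_dir _ (by omega), Nat.sub_self]; rfl

omit [Finite E] in
theorem reverse_dirS_of_notMem {e : E} (he : e ∉ P) : (N.reverse P).dirS e = N.dirS e := by
  rw [dirS, reverse_curve_of_notMem he, dirS]

omit [Finite E] in
theorem reverse_dirT_of_notMem {e : E} (he : e ∉ P) : (N.reverse P).dirT e = N.dirT e := by
  rw [dirT, reverse_curve_of_notMem he, dirT]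

theorem dot_neg (u v : ℂ) : dot u (-v) = -dot u v := by simp [dot]; ring

/-- Reversing a simple path between boundary vertices yields a perfect network. -/
theorem IsPerfect.reverse (hN : N.IsPerfect) (hP : N.IsPath i j P) (hs : N.IsSimplePath P) :
    (N.reverse P).IsPerfect where
  r_pos := hN.r_pos
  r_lt_R := hN.r_lt_R
  n₁_le := hN.n₁_le
  boundary_degree t := by
    by_cases hi : t = i
    · subst hi; exact Or.inr (reverse_isSink hN hP hs)
    by_cases hj : t = j
    · subst hj; exact Or.inl (reverse_isSource hN hP hs)
    rw [reverse_isSource_iff hP hs hi hj, reverse_isSink_iff hP hs hi hj]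
    exact hN.boundary_degree t
  internal_degree v := by
    have := reverse_degrees_of_ne hP hs (v := Sum.inr v) (by simp) (by simp)
    rw [this.1, this.2]
    exact hN.internal_degree v
  pos_injective := hN.pos_injective
  curve_start e := by
    by_cases he : e ∈ P
    · rw [reverse_curve_of_mem he, reverse_src_of_mem he]
      exact hN.curve_end e
    · rw [reverse_curve_of_notMem he, reverse_src_of_notMem he]
      exact hN.curve_start e
  curve_end e := by
    by_cases he : e ∈ P
    · rw [reverse_curve_of_mem he, reverse_tgt_of_mem he]
      change (N.curve e).pt ((N.curve e).len - (N.curve e).len) = _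
      rw [Nat.sub_self]
      exact hN.curve_start e
    · rw [reverse_curve_of_notMem he, reverse_tgt_of_notMem he]
      exact hN.curve_end e
  embedded := by
    convert hN.embedded.rev (· ∈ P) using 2 with e
    simp only [AnnularGraph.reverse]
    congr
  pos_outer := hN.pos_outer
  pos_inner := hN.pos_inner
  curve_mem e z hz := hN.curve_mem e z (by rwa [reverse_carrier] at hz)
  src_transversal e t h := by
    by_cases he : e ∈ P
    · rw [reverse_src_of_mem he] at h
      change dot (N.pos (Sum.inl t)) ((N.reverse P).dirS e) ≠ 0
      rw [hN.reverse_dirS he, dot_neg, neg_ne_zero]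
      exact hN.tgt_transversal e t h
    · rw [reverse_src_of_notMem he] at h
      rw [reverse_curve_of_notMem he]
      exact hN.src_transversal e t h
  tgt_transversal e t h := by
    by_cases he : e ∈ P
    · rw [reverse_tgt_of_mem he] at h
      change dot (N.pos (Sum.inl t)) ((N.reverse P).dirT e) ≠ 0
      rw [hN.reverse_dirT he, dot_neg, neg_ne_zero]
      exact hN.src_transversal e t h
    · rw [reverse_tgt_of_notMem he] at h
      rw [reverse_curve_of_notMem he]
      exact hN.tgt_transversal e t h
  cut_simple := hN.cut_simple
  cut_start := hN.cut_start
  cut_end := hN.cut_end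
  cut_mem := hN.cut_mem
  cut_start_transversal := hN.cut_start_transversal
  cut_end_transversal := hN.cut_end_transversal
  pt_notMem_cut e k hk := by
    by_cases he : e ∈ P
    · rw [reverse_curve_of_mem he]
      exact hN.pt_notMem_cut e _ (Nat.sub_le _ _)
    · rw [reverse_curve_of_notMem he] at hk ⊢
      exact hN.pt_notMem_cut e k hk
  cut_pt_notMem e m hm := by
    rw [reverse_carrier]; exact hN.cut_pt_notMem e m hm
  cut_transversal e k m hk hm h := by
    by_cases he : e ∈ P
    · rw [reverse_len] at hk
      rw [reverse_curve_of_mem he] at h ⊢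
      rw [Polyline.rev_openSeg _ hk] at h
      rw [Polyline.rev_dir _ hk]
      have := hN.cut_transversal e _ m (by omega) hm h
      intro h0
      apply this
      change cross (-((N.curve e).dir ((N.curve e).len - 1 - k))) (N.cut.dir m) = 0 at h0
      simp only [cross, Complex.neg_re, Complex.neg_im] at h0 ⊢
      linarith
    · rw [reverse_curve_of_notMem he] at hk h ⊢
      exact hN.cut_transversal e k m hk hm h
  label_outer := hN.label_outer
  label_inner := hN.label_inner

end Degrees

end AnnularGraph

end AnnularNet

end

noncomputable section

namespace AnnularNet

open Filter Topology

/-! ### Products of half-angles of chords -/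

/-- The product of the half-angles under which the chords `c k`, `c (k + 1)` are seen from `z`. -/
def sightProd (c : ℕ → ℂ) (S : Finset ℕ) (z : ℂ) : ℂ := ∏ k ∈ S, sight (c k) (c (k + 1)) z

/-- The limit of `sightProd` at `v` along the ray in the direction `u`. -/
def sightProdDir (c : ℕ → ℂ) (S : Finset ℕ) (v u : ℂ) : ℂ :=
  ∏ k ∈ S, sightDir (c k) (c (k + 1)) v u

theorem sightProd_ne_zero (c : ℕ → ℂ) (S : Finset ℕ) (z : ℂ) : sightProd c S z ≠ 0 :=
  Finset.prod_ne_zero_iff.2 fun _ _ => sight_ne_zero _ _ _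

/-- The squares telescope: the square depends on the ends of the curve only, while the sign of the
product remembers the curve between them. -/
theorem sightProd_mul_self {c : ℕ → ℂ} {n : ℕ} {z : ℂ} (h : ∀ k ≤ n, z ≠ c k) :
    sightProd c (Finset.range n) z * sightProd c (Finset.range n) z =
      unitDir (c n - z) / unitDir (c 0 - z) := by
  induction n with
  | zero =>
    have := unitDir_ne_zero (sub_ne_zero.2 (h 0 le_rfl).symm)
    simp [sightProd, this]
  | succ n ih =>
    have ih := ih fun k hk => h k (by omega)
    have h1 := sight_mul_self (h n (by omega)) (h (n + 1) le_rfl)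
    have n0 := unitDir_ne_zero (sub_ne_zero.2 (h 0 (by omega)).symm)
    have n1 := unitDir_ne_zero (sub_ne_zero.2 (h n (by omega)).symm)
    simp only [sightProd, Finset.prod_range_succ] at ih ⊢
    rw [mul_mul_mul_comm, ih, h1]
    field_simp

theorem continuousOn_sightProd {c : ℕ → ℂ} {S : Finset ℕ} {A : Set ℂ}
    (h : ∀ z ∈ A, ∀ k ∈ S, z ∉ segment ℝ (c k) (c (k + 1))) : ContinuousOn (sightProd c S) A := by
  unfold sightProd
  refine continuousOn_finsetProd _ fun k hk => (continuousOn_sight _ _).mono fun z hz => h z hz k hk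

theorem sightProdDir_of_notMem {c : ℕ → ℂ} {S : Finset ℕ} {v : ℂ} (u : ℂ)
    (h : ∀ k ∈ S, v ≠ c k ∧ v ≠ c (k + 1)) : sightProdDir c S v u = sightProd c S v := by
  unfold sightProdDir sightProd
  refine Finset.prod_congr rfl fun k hk => ?_
  rw [sightDir, if_neg (h k hk).2, if_neg (h k hk).1]

/-- A continuous branch of the square root of a constant along an open segment has the same limits
at both ends. -/
theorem sightProdDir_eq_of_segment {c : ℕ → ℂ} {S : Finset ℕ} {a b : ℂ} (hab : a ≠ b)
    (hc : ∀ k ∈ S, c k ≠ c (k + 1)) (ha : ∀ k ∈ S, Leaves (c k) (c (k + 1)) a (b - a))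
    (hb : ∀ k ∈ S, Leaves (c k) (c (k + 1)) b (a - b))
    (hd : ∀ k ∈ S, ∀ z ∈ openSegment ℝ a b, z ∉ segment ℝ (c k) (c (k + 1)))
    {B : ℂ → ℂ} (hB : ContinuousOn B (openSegment ℝ a b)) {Ba Bb : ℂ}
    (hBa : Tendsto (fun t : ℝ => B (a + t * (b - a))) (𝓝[>] 0) (𝓝 Ba))
    (hBb : Tendsto (fun t : ℝ => B (b + t * (a - b))) (𝓝[>] 0) (𝓝 Bb)) {s : ℂ} (hs : s ≠ 0)
    (hsq : ∀ z ∈ openSegment ℝ a b,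
      (sightProd c S z * B z) * (sightProd c S z * B z) = s) :
    sightProdDir c S a (b - a) * Ba = sightProdDir c S b (a - b) * Bb := by
  have hcont : ContinuousOn (fun z => sightProd c S z * B z) (openSegment ℝ a b) :=
    (continuousOn_sightProd fun z hz k hk => hd k hk z hz).mul hB
  have hpre : IsPreconnected (openSegment ℝ a b) := (convex_openSegment a b).isPreconnected
  have hta : Tendsto (fun t : ℝ => sightProd c S (a + t * (b - a)) * B (a + t * (b - a))) (𝓝[>] 0)
      (𝓝 (sightProdDir c S a (b - a) * Ba)) := by
    refine Tendsto.mul ?_ hBa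
    unfold sightProd sightProdDir
    exact tendsto_finsetProd _ fun k hk => tendsto_sight (hc k hk) (sub_ne_zero.2 hab.symm) (ha k hk)
  have htb : Tendsto (fun t : ℝ => sightProd c S (b + t * (a - b)) * B (b + t * (a - b))) (𝓝[>] 0)
      (𝓝 (sightProdDir c S b (a - b) * Bb)) := by
    refine Tendsto.mul ?_ hBb
    unfold sightProd sightProdDir
    exact tendsto_finsetProd _ fun k hk => tendsto_sight (hc k hk) (sub_ne_zero.2 hab) (hb k hk)
  have hlt : ∀ᶠ t : ℝ in 𝓝[>] 0, 0 < t ∧ t < 1 :=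
    Ioo_mem_nhdsGT zero_lt_one
  refine tendsto_nhds_unique hta (htb.congr' ?_)
  filter_upwards [hlt] with t ht
  refine IsPreconnected.eq_of_sq_const hpre hcont hs hsq ?_ (lineMap_mem_openSegment ht.1 ht.2)
  rw [openSegment_symm]
  exact lineMap_mem_openSegment ht.1 ht.2

/-! ### Simple polygonal arcs -/

/-- A simple polygonal arc. -/
structure Polyline.IsArc (Γ : Polyline) : Prop where
  embedded : IsEmbeddedFamily fun _ : Unit => Γ
  inj : ∀ k m, k ≤ Γ.len → m ≤ Γ.len → Γ.pt k = Γ.pt m → k = m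

namespace Polyline.IsArc

variable {Γ : Polyline} (h : Γ.IsArc)

include h

theorem len_pos : 0 < Γ.len := h.embedded.len_pos ()

theorem slit {k : ℕ} (hk : k + 1 < Γ.len) : Γ.dir (k + 1) / Γ.dir k ∈ Complex.slitPlane :=
  h.embedded.noCusp_interior (i := ()) hk

theorem pt_ne_succ {k : ℕ} (hk : k < Γ.len) : Γ.pt k ≠ Γ.pt (k + 1) :=
  h.embedded.pt_ne_succ (i := ()) hk

theorem pt_notMem_segment {n k : ℕ} (hn : n ≤ Γ.len) (hk : k < Γ.len) (h1 : n ≠ k)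
    (h2 : n ≠ k + 1) : Γ.pt n ∉ segment ℝ (Γ.pt k) (Γ.pt (k + 1)) := by
  intro hm
  refine h.embedded.pt_notMem () () n k hn hk (mem_openSegment_of_mem_segment hm ?_ ?_)
  · exact fun he => h1 (h.inj n k hn hk.le he)
  · exact fun he => h2 (h.inj n (k + 1) hn hk he)

theorem openSeg_notMem_segment {n k : ℕ} (hn : n < Γ.len) (hk : k < Γ.len) (hnk : k ≠ n) {z : ℂ}
    (hz : z ∈ Γ.openSeg n) : z ∉ segment ℝ (Γ.pt k) (Γ.pt (k + 1)) := by
  intro hm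
  have := h.embedded.seg_disjoint () () n k hn hk (Or.inr hnk.symm)
  refine Set.disjoint_left.1 this hz (mem_openSegment_of_mem_segment hm ?_ ?_)
  · rintro rfl; exact h.embedded.pt_notMem () () k n hk.le hn hz
  · rintro rfl; exact h.embedded.pt_notMem () () (k + 1) n hk hn hz

theorem leaves_start {n k : ℕ} (hn : n < Γ.len) (hk : k < Γ.len) (hnk : k ≠ n) :
    Leaves (Γ.pt k) (Γ.pt (k + 1)) (Γ.pt n) (Γ.pt (n + 1) - Γ.pt n) := by
  refine ⟨fun he => ?_, fun he => ?_, fun h1 h2 => ?_⟩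
  · have := h.inj n (k + 1) hn.le hk he
    subst this
    exact h.slit hn
  · exact absurd (h.inj n k hn.le hk.le he).symm hnk
  · exact h.pt_notMem_segment hn.le hk (fun e => h2 (by rw [e])) (fun e => h1 (by rw [e]))

theorem leaves_end {n k : ℕ} (hn : n < Γ.len) (hk : k < Γ.len) (hnk : k ≠ n) :
    Leaves (Γ.pt k) (Γ.pt (k + 1)) (Γ.pt (n + 1)) (Γ.pt n - Γ.pt (n + 1)) := by
  refine ⟨fun he => ?_, fun he => ?_, fun h1 h2 => ?_⟩
  · have := h.inj (n + 1) (k + 1) hn hk he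
    omega
  · have := h.inj (n + 1) k hn hk.le he
    subst this
    have := h.slit hk
    rwa [← neg_div_neg_eq, neg_neg, neg_sub]
  · exact h.pt_notMem_segment hn hk (fun e => h2 (by rw [e])) (fun e => h1 (by rw [e]))

theorem openSeg_ne_pt {n k : ℕ} (hn : n < Γ.len) (hk : k ≤ Γ.len) {z : ℂ} (hz : z ∈ Γ.openSeg n) :
    z ≠ Γ.pt k := by
  rintro rfl; exact h.embedded.pt_notMem () () k n hk hn hz

/-- From an inner point the two ends of a chord are seen in opposite directions. -/
theorem sight_sq_of_mem_openSeg {n : ℕ} (hn : n < Γ.len) {z : ℂ} (hz : z ∈ Γ.openSeg n) :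
    sight (Γ.pt n) (Γ.pt (n + 1)) z * sight (Γ.pt n) (Γ.pt (n + 1)) z = -1 := by
  have h1 := h.openSeg_ne_pt hn hn.le hz
  have h2 := h.openSeg_ne_pt hn (k := n + 1) hn hz
  obtain ⟨t, t0, t1, rfl⟩ := exists_lineMap_of_mem_openSegment hz
  have hd : Γ.pt (n + 1) - Γ.pt n ≠ 0 := sub_ne_zero.2 (h.pt_ne_succ hn).symm
  have ht : (t : ℂ) ≠ 0 := by exact_mod_cast t0.ne'
  have e : (Γ.pt (n + 1) - (Γ.pt n + t * (Γ.pt (n + 1) - Γ.pt n))) /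
      (Γ.pt n - (Γ.pt n + t * (Γ.pt (n + 1) - Γ.pt n))) = -(((1 - t) / t : ℝ) : ℂ) := by
    rw [div_eq_iff (sub_ne_zero.2 h1.symm)]
    push_cast; field_simp; ring
  rw [sight_mul_self h1 h2, ← unitDir_div, e, unitDir_neg, unitDir_of_pos (div_pos (by linarith) t0)]

/-- The common value, along a simple arc, of the product of the half-angles of its other segments
with a suitable function `B`, in the neighbourhood of the corner `n`. -/
theorem dir_step {B : ℂ → ℂ} {n : ℕ} (hn : n < Γ.len)
    (hB : ContinuousOn B (Γ.openSeg n)) {Ba Bb : ℂ}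
    (hBa : Tendsto (fun t : ℝ => B (Γ.pt n + t * (Γ.pt (n + 1) - Γ.pt n))) (𝓝[>] 0) (𝓝 Ba))
    (hBb : Tendsto (fun t : ℝ => B (Γ.pt (n + 1) + t * (Γ.pt n - Γ.pt (n + 1)))) (𝓝[>] 0) (𝓝 Bb))
    {s : ℂ} (hs : s ≠ 0) (hsq : ∀ z ∈ Γ.openSeg n,
      B z * B z * (unitDir (Γ.pt Γ.len - z) / unitDir (Γ.pt 0 - z)) = s) :
    sightProdDir Γ.pt ((Finset.range Γ.len).erase n) (Γ.pt n) (Γ.pt (n + 1) - Γ.pt n) * Ba =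
    sightProdDir Γ.pt ((Finset.range Γ.len).erase n) (Γ.pt (n + 1)) (Γ.pt n - Γ.pt (n + 1)) * Bb := by
  have hmem : ∀ k ∈ (Finset.range Γ.len).erase n, k < Γ.len ∧ k ≠ n := by
    intro k hk
    rw [Finset.mem_erase, Finset.mem_range] at hk
    exact ⟨hk.2, hk.1⟩
  refine sightProdDir_eq_of_segment (c := Γ.pt) (h.pt_ne_succ hn) (fun k hk => h.pt_ne_succ (hmem k hk).1)
    (fun k hk => h.leaves_start hn (hmem k hk).1 (hmem k hk).2)
    (fun k hk => h.leaves_end hn (hmem k hk).1 (hmem k hk).2)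
    (fun k hk z hz => h.openSeg_notMem_segment hn (hmem k hk).1 (hmem k hk).2 hz) hB hBa hBb
    -- The omitted factor has the square -1 on its own segment, so the remaining product has the
    -- square `-s`.
    (neg_ne_zero.2 hs) fun z hz => ?_
  have h1 := sightProd_mul_self (c := Γ.pt) (n := Γ.len) (z := z)
    fun k hk => h.openSeg_ne_pt hn hk hz
  have h2 : sightProd Γ.pt (Finset.range Γ.len) z =
      sight (Γ.pt n) (Γ.pt (n + 1)) z * sightProd Γ.pt ((Finset.range Γ.len).erase n) z :=
    (Finset.mul_prod_erase _ _ (Finset.mem_range.2 hn)).symm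
  have h3 := h.sight_sq_of_mem_openSeg hn hz
  rw [h2] at h1
  have h4 := hsq z hz
  rw [← h1] at h4
  linear_combination (sightProd Γ.pt ((Finset.range Γ.len).erase n) z * B z) ^ 2 * h3 - h4

/-- The product of the half-angles of the segments that do not meet the corner `n`. -/
def _root_.AnnularNet.Polyline.farProd (Γ : Polyline) (n : ℕ) : ℂ :=
  sightProd Γ.pt ((Finset.range Γ.len).filter fun k => k ≠ n ∧ k + 1 ≠ n) (Γ.pt n)

omit h in
theorem erase_eq_insert {n : ℕ} (hn : n + 1 < Γ.len) :
    (Finset.range Γ.len).erase n = insert (n + 1)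
      ((Finset.range Γ.len).filter fun k => k ≠ n + 1 ∧ k + 1 ≠ n + 1) := by
  ext k; simp only [Finset.mem_erase, Finset.mem_range, Finset.mem_insert, Finset.mem_filter]; omega

omit h in
theorem erase_succ_eq_insert {n : ℕ} (hn : n + 1 < Γ.len) :
    (Finset.range Γ.len).erase (n + 1) = insert n
      ((Finset.range Γ.len).filter fun k => k ≠ n + 1 ∧ k + 1 ≠ n + 1) := by
  ext k; simp only [Finset.mem_erase, Finset.mem_range, Finset.mem_insert, Finset.mem_filter]; omega

omit h in
theorem range_eq_insert {n : ℕ} (hn : n + 1 < Γ.len) :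
    Finset.range Γ.len = insert n (insert (n + 1)
      ((Finset.range Γ.len).filter fun k => k ≠ n + 1 ∧ k + 1 ≠ n + 1)) := by
  ext k; simp only [Finset.mem_range, Finset.mem_insert, Finset.mem_filter]; omega

/-- The corner is not an end of any of these chords, so the direction of approach plays no role. -/
theorem far_dir {n : ℕ} (hn : n ≤ Γ.len) (u : ℂ) :
    sightProdDir Γ.pt ((Finset.range Γ.len).filter fun k => k ≠ n ∧ k + 1 ≠ n) (Γ.pt n) u =
      Γ.farProd n := by
  refine sightProdDir_of_notMem u fun k hk => ?_
  rw [Finset.mem_filter, Finset.mem_range] at hk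
  exact ⟨fun he => hk.2.1 (h.inj n k hn hk.1.le he).symm,
    fun he => hk.2.2 (h.inj n (k + 1) hn hk.1 he).symm⟩

/-- Along segment `n` the only other chord at the corner is number `n + 1`; along segment `n + 1` it
is number `n`. Both limits (see `dir_start`) contain the half-angle of the corner, so the constant
passes through it. -/
theorem dir_end {n : ℕ} (hn : n + 1 < Γ.len) :
    sightProdDir Γ.pt ((Finset.range Γ.len).erase n) (Γ.pt (n + 1)) (Γ.pt n - Γ.pt (n + 1)) =
      halfDir (Γ.dir (n + 1) / Γ.dir n) * Γ.farProd (n + 1) := by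
  rw [erase_eq_insert hn, sightProdDir, Finset.prod_insert (by simp)]
  have := h.far_dir hn.le (Γ.pt n - Γ.pt (n + 1))
  unfold sightProdDir at this
  rw [this, sightDir, if_neg (h.pt_ne_succ hn), if_pos rfl]
  congr 2
  rw [← neg_div_neg_eq, neg_neg, neg_sub]; rfl

theorem dir_start {n : ℕ} (hn : n + 1 < Γ.len) :
    sightProdDir Γ.pt ((Finset.range Γ.len).erase (n + 1)) (Γ.pt (n + 1))
      (Γ.pt (n + 1 + 1) - Γ.pt (n + 1)) =
      halfDir (Γ.dir (n + 1) / Γ.dir n) * Γ.farProd (n + 1) := by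
  rw [erase_succ_eq_insert hn, sightProdDir, Finset.prod_insert (by simp)]
  have := h.far_dir hn.le (Γ.pt (n + 1 + 1) - Γ.pt (n + 1))
  unfold sightProdDir at this
  rw [this, sightDir, if_pos rfl]
  rfl

/-- Off the arc both chords at the corner contribute, and the value depends on the direction in
which the corner is left. -/
theorem dir_all {n : ℕ} (hn : n + 1 < Γ.len) (u : ℂ) :
    sightProdDir Γ.pt (Finset.range Γ.len) (Γ.pt (n + 1)) u =
      halfDir (u / Γ.dir n) * halfDir (-Γ.dir (n + 1) / u) * Γ.farProd (n + 1) := by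
  rw [range_eq_insert hn, sightProdDir, Finset.prod_insert (by simp), Finset.prod_insert (by simp)]
  have := h.far_dir hn.le u
  unfold sightProdDir at this
  rw [this, sightDir, if_pos rfl, sightDir, if_neg (h.pt_ne_succ hn), if_pos rfl, ← mul_assoc]
  rfl

/-- The common value along a simple arc, from its start to its end. -/
theorem exists_const {B : ℂ → ℂ} (hB : ∀ n < Γ.len, ContinuousOn B (Γ.openSeg n))
    (hB' : ∀ n, n + 1 < Γ.len → ContinuousAt B (Γ.pt (n + 1))) {B₀ B₁ : ℂ} (h0 : B₀ ≠ 0)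
    (hB₀ : Tendsto (fun t : ℝ => B (Γ.pt 0 + t * Γ.dir 0)) (𝓝[>] 0) (𝓝 B₀))
    (hB₁ : Tendsto (fun t : ℝ => B (Γ.pt Γ.len + t * -Γ.dir (Γ.len - 1))) (𝓝[>] 0) (𝓝 B₁))
    {s : ℂ} (hs : s ≠ 0) (hsq : ∀ n < Γ.len, ∀ z ∈ Γ.openSeg n,
      B z * B z * (unitDir (Γ.pt Γ.len - z) / unitDir (Γ.pt 0 - z)) = s) :
    ∃ e : ℂ, e ≠ 0 ∧ e = Γ.farProd 0 * B₀ ∧ e = Γ.farProd Γ.len * B₁ ∧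
      ∀ n, n + 1 < Γ.len →
        e = halfDir (Γ.dir (n + 1) / Γ.dir n) * Γ.farProd (n + 1) * B (Γ.pt (n + 1)) := by
  have hl := h.len_pos
  have hfar0 : ∀ u, sightProdDir Γ.pt ((Finset.range Γ.len).erase 0) (Γ.pt 0) u = Γ.farProd 0 := by
    intro u
    rw [← h.far_dir (Nat.zero_le _) u]
    congr 1
    ext k; simp only [Finset.mem_erase, Finset.mem_range, Finset.mem_filter]; omega
  have e1 : Γ.len - 1 + 1 = Γ.len := by omega
  have hfar1 : ∀ u, sightProdDir Γ.pt ((Finset.range Γ.len).erase (Γ.len - 1)) (Γ.pt Γ.len) u =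
      Γ.farProd Γ.len := by
    intro u
    rw [← h.far_dir le_rfl u]
    congr 1
    ext k; simp only [Finset.mem_erase, Finset.mem_range, Finset.mem_filter]; omega
  have hstart : ∀ n, n < Γ.len → Tendsto (fun t : ℝ => B (Γ.pt n + t * (Γ.pt (n + 1) - Γ.pt n)))
      (𝓝[>] 0) (𝓝 (if n = 0 then B₀ else B (Γ.pt n))) := by
    intro n hn
    split_ifs with hn0
    · subst hn0; exact hB₀
    · obtain ⟨m, rfl⟩ : ∃ m, n = m + 1 := ⟨n - 1, by omega⟩
      exact (hB' m hn).tendsto.comp (tendsto_ray _ _)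
  have hend : ∀ n, n < Γ.len →
      Tendsto (fun t : ℝ => B (Γ.pt (n + 1) + t * (Γ.pt n - Γ.pt (n + 1))))
      (𝓝[>] 0) (𝓝 (if n + 1 = Γ.len then B₁ else B (Γ.pt (n + 1)))) := by
    intro n hn
    split_ifs with hn0
    · have e : n = Γ.len - 1 := by omega
      subst e
      simp only [Polyline.dir, e1, neg_sub] at hB₁
      simp only [e1]
      exact hB₁
    · exact (hB' n (by omega)).tendsto.comp (tendsto_ray _ _)
  have step := fun n (hn : n < Γ.len) => h.dir_step hn (hB n hn) (hstart n hn) (hend n hn) hs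
    (hsq n hn)
  -- `dir_step` carries the value along a segment; `dir_end` and `dir_start` identify the limits on
  -- both sides of a corner.
  have all : ∀ n, n < Γ.len → Γ.farProd 0 * B₀ =
      sightProdDir Γ.pt ((Finset.range Γ.len).erase n) (Γ.pt n) (Γ.pt (n + 1) - Γ.pt n) *
        (if n = 0 then B₀ else B (Γ.pt n)) := by
    intro n
    induction n with
    | zero => intro hn; rw [hfar0, if_pos rfl]
    | succ n ih =>
      intro hn
      rw [ih (by omega), step n (by omega), if_neg (by omega), if_neg (by omega), h.dir_end hn,
        h.dir_start hn]
  refine ⟨Γ.farProd 0 * B₀, mul_ne_zero (sightProd_ne_zero _ _ _) h0, rfl, ?_, fun n hn => ?_⟩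
  · have := all (Γ.len - 1) (by omega)
    rw [step (Γ.len - 1) (by omega), if_pos e1, e1, hfar1] at this
    exact this
  · have := all (n + 1) hn
    rw [h.dir_start hn, if_neg (by omega)] at this
    exact this

end Polyline.IsArc

/-! ### The polygonal curve of a path -/

namespace AnnularGraph

variable {n : ℕ} {V₀ E : Type*} {N : AnnularGraph n V₀ E}

/-- Consecutive curves are glued at their common vertices. `o f` is the index at which the edge `f`
begins; it is well defined because no edge is repeated. -/
theorem exists_concat (hN : N.IsPerfect) (P : List E) (e : E)
    (hc : (e :: P).IsChain (fun e f => N.tgt e = N.src f)) (hnd : (e :: P).Nodup) (v : Fin n ⊕ V₀)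
    (hv : (e :: P).getLast?.map N.tgt = some v) :
    ∃ (Γ : Polyline) (o : E → ℕ),
      (∀ f ∈ e :: P, o f + (N.curve f).len ≤ Γ.len ∧
        ∀ m ≤ (N.curve f).len, Γ.pt (o f + m) = (N.curve f).pt m) ∧
      (∀ k < Γ.len, ∃ f ∈ e :: P, ∃ m < (N.curve f).len, k = o f + m) ∧
      Γ.pt 0 = N.pos (N.src e) ∧ Γ.pt Γ.len = N.pos v := by
  classical
  induction P generalizing e with
  | nil =>
    refine ⟨N.curve e, fun _ => 0, ?_, ?_, hN.curve_start e, ?_⟩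
    · intro f hf
      obtain rfl : f = e := by simpa using hf
      exact ⟨by simp, fun m _ => by rw [Nat.zero_add]⟩
    · exact fun k hk => ⟨e, by simp, k, hk, by simp⟩
    · rw [hN.curve_end]
      simp only [List.getLast?_singleton, Option.map_some, Option.some.injEq] at hv
      rw [hv]
  | cons f P ih =>
    rw [List.isChain_cons_cons] at hc
    obtain ⟨Γ, o, h1, h2, h3, h4⟩ := ih f hc.2 (List.nodup_cons.1 hnd).2 (by simpa using hv)
    have hne : ∀ g ∈ f :: P, g ≠ e := by
      rintro g hg rfl; exact (List.nodup_cons.1 hnd).1 hg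
    refine ⟨⟨(N.curve e).len + Γ.len, fun k => if k ≤ (N.curve e).len then (N.curve e).pt k else
      Γ.pt (k - (N.curve e).len)⟩, fun g => if g = e then 0 else (N.curve e).len + o g,
      ?_, ?_, ?_, ?_⟩
    · intro g hg
      rcases List.mem_cons.1 hg with rfl | hg
      · refine ⟨by simp, fun m hm => ?_⟩
        simp [hm]
      · have hge := hne g hg
        refine ⟨?_, fun m hm => ?_⟩
        · simp only [if_neg hge]
          have := (h1 g hg).1
          omega
        · simp only [if_neg hge]
          have h5 := (h1 g hg).2 m hm
          -- The first case is the junction: its index is that of the end of `e`, and both curves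
          -- list this point.
          split_ifs with h6
          · have h7 : o g + m = 0 := by omega
            rw [h7, h3] at h5
            rw [← h5, add_assoc, h7, add_zero, hN.curve_end, hc.1]
          · rw [← h5]; congr 1; omega
    · intro k hk
      by_cases hke : k < (N.curve e).len
      · exact ⟨e, by simp, k, hke, by simp⟩
      · obtain ⟨g, hg, m, hm, hgm⟩ := h2 (k - (N.curve e).len) (by simp only at hk; omega)
        refine ⟨g, List.mem_cons_of_mem _ hg, m, hm, ?_⟩
        simp only [if_neg (hne g hg)]
        omega
    · simp [hN.curve_start]
    · have := hN.embedded.len_pos e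
      by_cases h0 : Γ.len = 0
      · exfalso
        have := (h1 f (by simp)).1
        have := hN.embedded.len_pos f
        omega
      · simp only
        rw [if_neg (by omega), Nat.add_sub_cancel_left, h4]

/-- The polygonal curve `Γ` runs through the curves of the edges of `P`; the curve of the edge `e`
starts at the point `o e` of `Γ`. -/
structure IsConcat (N : AnnularGraph n V₀ E) (i j : Fin n) (P : List E) (Γ : Polyline)
    (o : E → ℕ) : Prop where
  le_len : ∀ e ∈ P, o e + (N.curve e).len ≤ Γ.len
  pt_eq : ∀ e ∈ P, ∀ m ≤ (N.curve e).len, Γ.pt (o e + m) = (N.curve e).pt m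
  exists_edge : ∀ k < Γ.len, ∃ e ∈ P, ∃ m < (N.curve e).len, k = o e + m
  pt_zero : Γ.pt 0 = N.pos (Sum.inl i)
  pt_len : Γ.pt Γ.len = N.pos (Sum.inl j)
  isArc : Γ.IsArc

/-- Edges meet at common ends only, and a simple path visits each vertex once, so the glued curve
does not meet itself. -/
theorem IsPath.exists_isConcat (hN : N.IsPerfect) {i j : Fin n} {P : List E}
    (hP : N.IsPath i j P) (hs : N.IsSimplePath P) : ∃ Γ o, N.IsConcat i j P Γ o := by
  have hnd := hP.nodup hs
  obtain ⟨e, P, rfl⟩ : ∃ e P', P = e :: P' := List.exists_cons_of_ne_nil hP.ne_nil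
  obtain ⟨Γ, o, h1, h2, h3, h4⟩ := exists_concat hN P e hP.1 hnd _ hP.2.2
  have hh : N.src e = Sum.inl i := by simpa using hP.2.1
  rw [hh] at h3
  have hseg : ∀ k < Γ.len, ∃ f ∈ e :: P, ∃ m < (N.curve f).len, k = o f + m ∧
      Γ.openSeg k = (N.curve f).openSeg m := by
    intro k hk
    obtain ⟨f, hf, m, hm, rfl⟩ := h2 k hk
    refine ⟨f, hf, m, hm, rfl, ?_⟩
    rw [Polyline.openSeg, (h1 f hf).2 m hm.le, add_assoc, (h1 f hf).2 (m + 1) hm]; rfl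
  have hlen : 0 < Γ.len := by
    have := (h1 e (by simp)).1
    have := hN.embedded.len_pos e
    omega
  obtain ⟨g, hg, hgj⟩ := hP.exists_last
  have hpt : ∀ k ≤ Γ.len, ∃ f ∈ e :: P, ∃ m ≤ (N.curve f).len, Γ.pt k = (N.curve f).pt m := by
    intro k hk
    rcases hk.lt_or_eq with hk | rfl
    · obtain ⟨f, hf, m, hm, rfl⟩ := h2 k hk
      exact ⟨f, hf, m, hm.le, (h1 f hf).2 m hm.le⟩
    · exact ⟨g, hg, _, le_rfl, by rw [h4, hN.curve_end, hgj]⟩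
  have hj : ∀ k < Γ.len, Γ.pt k ≠ Γ.pt Γ.len := by
    intro k hk he
    obtain ⟨f, hf, m, hm, rfl⟩ := h2 k hk
    rw [(h1 f hf).2 m hm.le, h4, ← hgj, ← hN.curve_end] at he
    rcases hN.embedded.pt_inj f g m _ hm.le le_rfl he with ⟨rfl, h5⟩ | ⟨h5 | h5, h6⟩
    · omega
    · rw [h5, hN.curve_start, hN.curve_end] at he
      have := hN.pos_injective he
      rw [hgj] at this
      exact hP.src_ne hs hf this
    · omega
  have hinj : ∀ k m, k ≤ Γ.len → m ≤ Γ.len → Γ.pt k = Γ.pt m → k = m := by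
    intro k m hk hm he
    rcases hk.lt_or_eq with hk | rfl
    · rcases hm.lt_or_eq with hm | rfl
      · obtain ⟨f, hf, k, hk', rfl⟩ := h2 k hk
        obtain ⟨f', hf', m, hm', rfl⟩ := h2 m hm
        rw [(h1 f hf).2 k hk'.le, (h1 f' hf').2 m hm'.le] at he
        rcases hN.embedded.pt_inj f f' k m hk'.le hm'.le he with ⟨rfl, h5⟩ | ⟨h5 | h5, h6 | h6⟩
        · rw [h5]
        · rw [h5, h6, hN.curve_start, hN.curve_start] at he
          have := hP.src_inj hs hf hf' (hN.pos_injective he)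
          rw [this, h5, h6]
        all_goals omega
      · exact absurd he (hj k hk)
    · rcases hm.lt_or_eq with hm | rfl
      · exact absurd he.symm (hj m hm)
      · rfl
  refine ⟨Γ, o, fun f hf => (h1 f hf).1, fun f hf => (h1 f hf).2, h2, h3, h4, ⟨?_, hinj⟩⟩
  refine ⟨fun _ => hlen, ?_, ?_, ?_⟩
  · intro _ _ k m hk hm he
    exact Or.inl ⟨rfl, hinj k m hk hm he⟩
  · intro _ _ k m hk hm
    obtain ⟨f, hf, k', hk', hfk⟩ := hpt k hk
    obtain ⟨f', hf', m', hm', -, hfm⟩ := hseg m hm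
    simp only [hfk, hfm]
    exact hN.embedded.pt_notMem f f' k' m' hk' hm'
  · intro _ _ k m hk hm hne
    obtain ⟨f, hf, k', hk', hfk', hfk⟩ := hseg k hk
    obtain ⟨f', hf', m', hm', hfm', hfm⟩ := hseg m hm
    simp only [hfk, hfm]
    refine hN.embedded.seg_disjoint f f' k' m' hk' hm' ?_
    by_contra hcon
    push Not at hcon
    obtain ⟨rfl, rfl⟩ := hcon
    rcases hne with hne | hne
    · exact hne rfl
    · omega

end AnnularGraph

end AnnularNet

end

noncomputable section

namespace AnnularNet

open Filter Topology

namespace AnnularGraph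

variable {n : ℕ} {V₀ E : Type*}

/-! ### The background function in the annulus -/

/-- The closed annulus. -/
def annulus (N : AnnularGraph n V₀ E) : Set ℂ := {z | N.r ≤ ‖z‖ ∧ ‖z‖ ≤ N.R}

/-- The position of a boundary vertex. -/
def bd (N : AnnularGraph n V₀ E) (t : Fin n) : ℂ := N.pos (Sum.inl t)

open Classical in
/-- A continuous square root, in the annulus, of the direction from a point on one of the circles. -/
def rimRoot (b : ℂ) (outer : Prop) (z : ℂ) : ℂ :=
  if outer then halfDir (1 - z / b) else halfDir (1 - b / z)

open Classical in
/-- The limit of `rimRoot b` at `b` along the direction `u`. -/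
def rimRootDir (b : ℂ) (outer : Prop) (u : ℂ) : ℂ :=
  if outer then halfDir (-u / b) else halfDir (u / b)

/-- A branch of the square root in the annulus, obtained from a branch `k` along the cut. -/
def cutRoot (N : AnnularGraph n V₀ E) (k : ℂ → ℂ) (z : ℂ) : ℂ :=
  k z * rimRoot N.baseInner False z / rimRoot N.baseOuter True z

open Classical in
/-- The part of the background function that jumps across the cut. -/
def cutPart (N : AnnularGraph n V₀ E) (i j : Fin n) (k : ℂ → ℂ) (z : ℂ) : ℂ :=
  if N.OnOuter i ↔ N.OnOuter j then 1 else if N.OnOuter i then N.cutRoot k z else (N.cutRoot k z)⁻¹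

/-- A square root of the direction of the closing curve of a path from `b_i` to `b_j`. -/
def background (N : AnnularGraph n V₀ E) (i j : Fin n) (k : ℂ → ℂ) (z : ℂ) : ℂ :=
  rimRoot (N.bd i) (N.OnOuter i) z / rimRoot (N.bd j) (N.OnOuter j) z * N.cutPart i j k z

/-- The half-angle of the cut. -/
def cutSight (N : AnnularGraph n V₀ E) : ℂ → ℂ := sightProd N.cut.pt (Finset.range N.cut.len)

theorem rimRoot_ne_zero (b : ℂ) (o : Prop) (z : ℂ) : rimRoot b o z ≠ 0 := by
  unfold rimRoot; split_ifs <;> exact halfDir_ne_zero _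

theorem cutRoot_ne_zero (N : AnnularGraph n V₀ E) {k : ℂ → ℂ} {z : ℂ} (hk : k z ≠ 0) :
    N.cutRoot k z ≠ 0 :=
  div_ne_zero (mul_ne_zero hk (rimRoot_ne_zero _ _ _)) (rimRoot_ne_zero _ _ _)

theorem cutPart_ne_zero (N : AnnularGraph n V₀ E) (i j : Fin n) {k : ℂ → ℂ} {z : ℂ} (hk : k z ≠ 0) :
    N.cutPart i j k z ≠ 0 := by
  unfold cutPart
  split_ifs
  · exact one_ne_zero
  · exact N.cutRoot_ne_zero hk
  · exact inv_ne_zero (N.cutRoot_ne_zero hk)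

theorem cutSight_ne_zero (N : AnnularGraph n V₀ E) (z : ℂ) : N.cutSight z ≠ 0 :=
  sightProd_ne_zero _ _ _

/-- The extra factor is constant for the outer circle, but for the inner circle it is the direction
of `z`, which has no continuous root in the annulus. It cancels for two ends on one circle;
otherwise the cut is needed. -/
theorem rimRoot_mul_self {b z : ℂ} {o : Prop} (hb : b ≠ 0) (hz : z ≠ 0) (hzb : z ≠ b) :
    (o → rimRoot b o z * rimRoot b o z = unitDir (b - z) / unitDir b) ∧
    (¬ o → rimRoot b o z * rimRoot b o z = -(unitDir (b - z) / unitDir z)) := by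
  refine ⟨fun ho => ?_, fun ho => ?_⟩
  · have e : 1 - z / b = (b - z) / b := by field_simp
    rw [rimRoot, if_pos ho, e, halfDir_mul_self (div_ne_zero (sub_ne_zero.2 hzb.symm) hb), unitDir_div]
  · have e : 1 - b / z = -((b - z) / z) := by field_simp; ring
    rw [rimRoot, if_neg ho, e,
      halfDir_mul_self (neg_ne_zero.2 (div_ne_zero (sub_ne_zero.2 hzb.symm) hz)), unitDir_neg,
      unitDir_div]

theorem continuousAt_rimRoot {b z : ℂ} {o : Prop} (hb : b ≠ 0) (hz : z ≠ 0) (hzb : z ≠ b)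
    (h1 : o → ‖z‖ ≤ ‖b‖) (h2 : ¬ o → ‖b‖ ≤ ‖z‖) : ContinuousAt (rimRoot b o) z := by
  have hs : ∀ w : ℂ, 0 < w.re → ContinuousAt halfDir w := fun w hw =>
    continuousOn_halfDir.continuousAt (Complex.isOpen_slitPlane.mem_nhds (Or.inl hw))
  by_cases ho : o
  · have e : rimRoot b o = fun z => halfDir (1 - z / b) := by funext z; rw [rimRoot, if_pos ho]
    rw [e]
    exact ContinuousAt.comp (g := halfDir) (hs _ (one_sub_div_mem hb (h1 ho) hzb)) (by fun_prop)
  · have e : rimRoot b o = fun z => halfDir (1 - b / z) := by funext z; rw [rimRoot, if_neg ho]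
    rw [e]
    refine ContinuousAt.comp (g := halfDir) (hs _ (one_sub_div_mem hz (h2 ho) hzb.symm)) ?_
    exact continuousAt_const.sub (continuousAt_const.div continuousAt_id hz)

theorem tendsto_rimRoot_curve {b u₀ : ℂ} {u : ℝ → ℂ} {o : Prop} (hb : b ≠ 0)
    (hu : Tendsto u (𝓝[>] 0) (𝓝 u₀)) (h1 : o → -u₀ / b ∈ Complex.slitPlane)
    (h2 : ¬ o → u₀ / b ∈ Complex.slitPlane) :
    Tendsto (fun t : ℝ => rimRoot b o (b + t * u t)) (𝓝[>] 0) (𝓝 (rimRootDir b o u₀)) := by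
  have hpos : ∀ᶠ t : ℝ in 𝓝[>] 0, 0 < t := self_mem_nhdsWithin
  by_cases ho : o
  · rw [rimRootDir, if_pos ho]
    have hs : ContinuousAt halfDir (-u₀ / b) :=
      continuousOn_halfDir.continuousAt (Complex.isOpen_slitPlane.mem_nhds (h1 ho))
    have hq : Tendsto (fun t : ℝ => -u t / b) (𝓝[>] 0) (𝓝 (-u₀ / b)) := hu.neg.div_const b
    refine (hs.tendsto.comp hq).congr' ?_
    filter_upwards [hpos] with t ht
    rw [rimRoot, if_pos ho, Function.comp_apply, ← halfDir_real_mul ht]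
    congr 1; field_simp; ring
  · rw [rimRootDir, if_neg ho]
    have hs : ContinuousAt halfDir (u₀ / b) :=
      continuousOn_halfDir.continuousAt (Complex.isOpen_slitPlane.mem_nhds (h2 ho))
    have hq : Tendsto (fun t : ℝ => u t / (b + t * u t)) (𝓝[>] 0) (𝓝 (u₀ / b)) :=
      hu.div (tendsto_curve _ hu) hb
    have hne : ∀ᶠ t : ℝ in 𝓝[>] 0, b + t * u t ≠ 0 := (tendsto_curve b hu).eventually_ne hb
    refine (hs.tendsto.comp hq).congr' ?_
    filter_upwards [hpos, hne] with t ht hne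
    rw [rimRoot, if_neg ho, Function.comp_apply, ← halfDir_real_mul ht]
    congr 1; field_simp; ring

theorem tendsto_rimRoot {b u : ℂ} {o : Prop} (hb : b ≠ 0) (h1 : o → 0 < (-u / b).re)
    (h2 : ¬ o → 0 < (u / b).re) :
    Tendsto (fun t : ℝ => rimRoot b o (b + t * u)) (𝓝[>] 0) (𝓝 (rimRootDir b o u)) :=
  tendsto_rimRoot_curve hb tendsto_const_nhds (fun h => Or.inl (h1 h)) fun h => Or.inl (h2 h)

theorem rimRootDir_ne_zero (b : ℂ) (o : Prop) (u : ℂ) : rimRootDir b o u ≠ 0 := by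
  unfold rimRootDir; split_ifs <;> exact halfDir_ne_zero _

section Perfect

variable {N : AnnularGraph n V₀ E} (hN : N.IsPerfect)

include hN

theorem IsPerfect.ne_zero_of_mem {z : ℂ} (hz : z ∈ N.annulus) : z ≠ 0 := by
  rintro rfl
  have := hz.1
  rw [norm_zero] at this
  linarith [hN.r_pos]

theorem IsPerfect.norm_bd (t : Fin n) :
    (N.OnOuter t → ‖N.bd t‖ = N.R) ∧ (¬ N.OnOuter t → ‖N.bd t‖ = N.r) :=
  ⟨hN.pos_outer t, hN.pos_inner t⟩

theorem IsPerfect.bd_mem (t : Fin n) : N.bd t ∈ N.annulus := by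
  have h := hN.r_lt_R.le
  by_cases ht : N.OnOuter t
  · rw [annulus, Set.mem_ofPred_eq, (hN.norm_bd t).1 ht]; exact ⟨h, le_rfl⟩
  · rw [annulus, Set.mem_ofPred_eq, (hN.norm_bd t).2 ht]; exact ⟨le_rfl, h⟩

theorem IsPerfect.bd_ne_zero (t : Fin n) : N.bd t ≠ 0 := hN.ne_zero_of_mem (hN.bd_mem t)

theorem IsPerfect.bd_inj {s t : Fin n} (h : N.bd s = N.bd t) : s = t := by
  simpa using hN.pos_injective h

theorem IsPerfect.continuousAt_bdRoot {t : Fin n} {z : ℂ} (hz : z ∈ N.annulus) (h : z ≠ N.bd t) :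
    ContinuousAt (rimRoot (N.bd t) (N.OnOuter t)) z := by
  refine continuousAt_rimRoot (hN.bd_ne_zero t) (hN.ne_zero_of_mem hz) h (fun ho => ?_) fun ho => ?_
  · rw [(hN.norm_bd t).1 ho]; exact hz.2
  · rw [(hN.norm_bd t).2 ho]; exact hz.1

theorem IsPerfect.baseInner_mem : N.baseInner ∈ N.annulus := by
  rw [annulus, Set.mem_ofPred_eq, hN.cut_start]; exact ⟨le_rfl, hN.r_lt_R.le⟩

theorem IsPerfect.baseOuter_mem : N.baseOuter ∈ N.annulus := by
  rw [annulus, Set.mem_ofPred_eq, hN.cut_end]; exact ⟨hN.r_lt_R.le, le_rfl⟩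

/-- Continuity is relative to a set because the branches `k` used along an edge are continuous on a
single segment only. -/
theorem IsPerfect.continuousWithinAt_cutPart {i j : Fin n} {k : ℂ → ℂ} {A : Set ℂ} {z : ℂ}
    (hz : z ∈ N.annulus)
    (h : ¬ (N.OnOuter i ↔ N.OnOuter j) → z ≠ N.baseInner ∧ z ≠ N.baseOuter ∧ k z ≠ 0 ∧
      ContinuousWithinAt k A z) : ContinuousWithinAt (N.cutPart i j k) A z := by
  by_cases hs : N.OnOuter i ↔ N.OnOuter j
  · have e : N.cutPart i j k = fun _ => 1 := by funext z; rw [cutPart, if_pos hs]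
    rw [e]; exact continuousWithinAt_const
  · obtain ⟨h1, h2, h3, h4⟩ := h hs
    have z0 := hN.ne_zero_of_mem hz
    have hc : ContinuousWithinAt (N.cutRoot k) A z := by
      refine (h4.mul (ContinuousAt.continuousWithinAt ?_)).div (ContinuousAt.continuousWithinAt ?_)
        (rimRoot_ne_zero _ _ _)
      · exact continuousAt_rimRoot (hN.ne_zero_of_mem hN.baseInner_mem) z0 h1 (fun h => h.elim)
          fun _ => by rw [hN.cut_start]; exact hz.1
      · exact continuousAt_rimRoot (hN.ne_zero_of_mem hN.baseOuter_mem) z0 h2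
          (fun _ => by rw [hN.cut_end]; exact hz.2) fun h => (h trivial).elim
    by_cases hi : N.OnOuter i
    · have e : N.cutPart i j k = N.cutRoot k := by funext z; rw [cutPart, if_neg hs, if_pos hi]
      rw [e]; exact hc
    · have e : N.cutPart i j k = fun z => (N.cutRoot k z)⁻¹ := by
        funext z; rw [cutPart, if_neg hs, if_neg hi]
      rw [e]; exact hc.inv₀ (N.cutRoot_ne_zero h3)

theorem IsPerfect.continuousWithinAt_background {i j : Fin n} {k : ℂ → ℂ} {A : Set ℂ} {z : ℂ}
    (hz : z ∈ N.annulus) (hi : z ≠ N.bd i) (hj : z ≠ N.bd j)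
    (h : ¬ (N.OnOuter i ↔ N.OnOuter j) → z ≠ N.baseInner ∧ z ≠ N.baseOuter ∧ k z ≠ 0 ∧
      ContinuousWithinAt k A z) : ContinuousWithinAt (N.background i j k) A z :=
  ((hN.continuousAt_bdRoot hz hi).continuousWithinAt.div
    (hN.continuousAt_bdRoot hz hj).continuousWithinAt (rimRoot_ne_zero _ _ _)).mul
    (hN.continuousWithinAt_cutPart hz h)

/-- Up to a constant, `background` is a root of the inverse of the direction quotient that belongs
to a path. Multiplied by the `sightProd` of the path it has a constant square, so only its sign is
left, and this distinguishes the sides. -/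
theorem IsPerfect.background_sq (i j : Fin n) (k : ℂ → ℂ) {s : ℂ} (hs : s ≠ 0) :
    ∃ C : ℂ, C ≠ 0 ∧ ∀ z ∈ N.annulus, z ≠ N.bd i → z ≠ N.bd j →
      (¬ (N.OnOuter i ↔ N.OnOuter j) → z ≠ N.baseInner ∧ z ≠ N.baseOuter ∧
        k z * k z = s * (unitDir (N.baseOuter - z) / unitDir (N.baseInner - z))) →
      N.background i j k z * N.background i j k z *
        (unitDir (N.bd j - z) / unitDir (N.bd i - z)) = C := by
  have ui := unitDir_ne_zero (hN.bd_ne_zero i)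
  have uj := unitDir_ne_zero (hN.bd_ne_zero j)
  have bo0 := hN.ne_zero_of_mem hN.baseOuter_mem
  have bi0 := hN.ne_zero_of_mem hN.baseInner_mem
  have ubo := unitDir_ne_zero bo0
  -- The root along the cut leaves a constant over the direction of `z`. This cancels the extra
  -- factor when exactly one end lies on the inner circle.
  have cr : ∀ z ∈ N.annulus, z ≠ N.baseInner ∧ z ≠ N.baseOuter ∧
      k z * k z = s * (unitDir (N.baseOuter - z) / unitDir (N.baseInner - z)) →
      N.cutRoot k z * N.cutRoot k z = -(s * unitDir N.baseOuter / unitDir z) := by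
    rintro z hz ⟨h1, h2, h3⟩
    have z0 := hN.ne_zero_of_mem hz
    have r1 := (rimRoot_mul_self (o := False) bi0 z0 h1).2 (fun h => h)
    have r2 := (rimRoot_mul_self (o := True) bo0 z0 h2).1 trivial
    have n1 := unitDir_ne_zero (sub_ne_zero.2 h1.symm)
    have n2 := unitDir_ne_zero (sub_ne_zero.2 h2.symm)
    have n3 := unitDir_ne_zero z0
    unfold cutRoot
    rw [div_mul_div_comm, mul_mul_mul_comm, h3, r1, r2]
    field_simp
  by_cases hi : N.OnOuter i <;> by_cases hj : N.OnOuter j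
  · refine ⟨unitDir (N.bd j) / unitDir (N.bd i), div_ne_zero uj ui, fun z hz zi zj _ => ?_⟩
    have z0 := hN.ne_zero_of_mem hz
    have ri := (rimRoot_mul_self (o := N.OnOuter i) (hN.bd_ne_zero i) z0 zi).1 hi
    have rj := (rimRoot_mul_self (o := N.OnOuter j) (hN.bd_ne_zero j) z0 zj).1 hj
    have n1 := unitDir_ne_zero (sub_ne_zero.2 zi.symm)
    have n2 := unitDir_ne_zero (sub_ne_zero.2 zj.symm)
    rw [background, cutPart, if_pos (iff_of_true hi hj), mul_one, div_mul_div_comm, ri, rj]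
    field_simp
  · have hij : ¬ (N.OnOuter i ↔ N.OnOuter j) := by tauto
    refine ⟨s * unitDir N.baseOuter / unitDir (N.bd i), div_ne_zero (mul_ne_zero hs ubo) ui,
      fun z hz zi zj h => ?_⟩
    have z0 := hN.ne_zero_of_mem hz
    have ri := (rimRoot_mul_self (o := N.OnOuter i) (hN.bd_ne_zero i) z0 zi).1 hi
    have rj := (rimRoot_mul_self (o := N.OnOuter j) (hN.bd_ne_zero j) z0 zj).2 hj
    have n1 := unitDir_ne_zero (sub_ne_zero.2 zi.symm)
    have n2 := unitDir_ne_zero (sub_ne_zero.2 zj.symm)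
    have n3 := unitDir_ne_zero z0
    rw [background, cutPart, if_neg hij, if_pos hi, mul_mul_mul_comm, div_mul_div_comm, ri, rj,
      cr z hz (h hij)]
    field_simp
  · have hij : ¬ (N.OnOuter i ↔ N.OnOuter j) := by tauto
    refine ⟨unitDir (N.bd j) / (s * unitDir N.baseOuter), div_ne_zero uj (mul_ne_zero hs ubo),
      fun z hz zi zj h => ?_⟩
    have z0 := hN.ne_zero_of_mem hz
    have ri := (rimRoot_mul_self (o := N.OnOuter i) (hN.bd_ne_zero i) z0 zi).2 hi
    have rj := (rimRoot_mul_self (o := N.OnOuter j) (hN.bd_ne_zero j) z0 zj).1 hj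
    have n1 := unitDir_ne_zero (sub_ne_zero.2 zi.symm)
    have n2 := unitDir_ne_zero (sub_ne_zero.2 zj.symm)
    have n3 := unitDir_ne_zero z0
    rw [background, cutPart, if_neg hij, if_neg hi, mul_mul_mul_comm, div_mul_div_comm, ri, rj,
      ← mul_inv, cr z hz (h hij)]
    field_simp
  · refine ⟨1, one_ne_zero, fun z hz zi zj _ => ?_⟩
    have z0 := hN.ne_zero_of_mem hz
    have ri := (rimRoot_mul_self (o := N.OnOuter i) (hN.bd_ne_zero i) z0 zi).2 hi
    have rj := (rimRoot_mul_self (o := N.OnOuter j) (hN.bd_ne_zero j) z0 zj).2 hj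
    have n1 := unitDir_ne_zero (sub_ne_zero.2 zi.symm)
    have n2 := unitDir_ne_zero (sub_ne_zero.2 zj.symm)
    have n3 := unitDir_ne_zero z0
    rw [background, cutPart, if_pos (iff_of_false hi hj), mul_one, div_mul_div_comm, ri, rj]
    field_simp

/-! ### Points on the edges -/

theorem IsPerfect.carrier_mem {e : E} {z : ℂ} (hz : z ∈ (N.curve e).carrier) : z ∈ N.annulus := by
  rcases hN.curve_mem e z hz with h | ⟨t, rfl⟩
  · exact ⟨h.1.le, h.2.le⟩
  · exact hN.bd_mem t

theorem IsPerfect.carrier_ne_base {e : E} {z : ℂ} (hz : z ∈ (N.curve e).carrier) :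
    z ≠ N.baseInner ∧ z ≠ N.baseOuter := by
  constructor
  · rintro rfl; exact hN.cut_pt_notMem e 0 (Nat.zero_le _) hz
  · rintro rfl; exact hN.cut_pt_notMem e _ le_rfl hz

omit hN in
theorem exists_of_mem_carrier {γ : Polyline} {z : ℂ} (hz : z ∈ γ.carrier) :
    (∃ k ≤ γ.len, z = γ.pt k) ∨ ∃ k < γ.len, z ∈ γ.openSeg k := by
  simp only [Polyline.carrier, Set.mem_iUnion] at hz
  obtain ⟨k, hk, hz⟩ := hz
  by_cases h1 : z = γ.pt k
  · exact Or.inl ⟨k, hk.le, h1⟩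
  by_cases h2 : z = γ.pt (k + 1)
  · exact Or.inl ⟨k + 1, hk, h2⟩
  · exact Or.inr ⟨k, hk, mem_openSegment_of_mem_segment hz h1 h2⟩

/-- A curve passes through a vertex only at its ends. -/
theorem IsPerfect.incident_of_mem_carrier {e f : E} {v : Fin n ⊕ V₀}
    (hf : N.src f = v ∨ N.tgt f = v) (hz : N.pos v ∈ (N.curve e).carrier) :
    N.src e = v ∨ N.tgt e = v := by
  obtain ⟨k, hk, hv, hk'⟩ : ∃ k ≤ (N.curve f).len, N.pos v = (N.curve f).pt k ∧
      (N.curve f).IsEnd k := by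
    rcases hf with rfl | rfl
    · exact ⟨0, Nat.zero_le _, (hN.curve_start f).symm, Or.inl rfl⟩
    · exact ⟨_, le_rfl, (hN.curve_end f).symm, Or.inr rfl⟩
  have fin : ∀ m, (N.curve e).IsEnd m → N.pos v = (N.curve e).pt m → N.src e = v ∨ N.tgt e = v := by
    intro m hm he
    rcases hm with rfl | rfl
    · left; rw [hN.curve_start] at he; exact (hN.pos_injective he).symm
    · right; rw [hN.curve_end] at he; exact (hN.pos_injective he).symm
  rcases exists_of_mem_carrier hz with ⟨m, hm, he⟩ | ⟨m, hm, he⟩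
  · rcases hN.embedded.pt_inj f e k m hk hm (hv ▸ he) with ⟨rfl, rfl⟩ | ⟨-, h⟩
    · exact fin _ hk' he
    · exact fin _ h he
  · rw [hv] at he
    exact absurd he (hN.embedded.pt_notMem f e k m hk hm)

theorem IsPerfect.exists_incident (t : Fin n) : ∃ f, N.src f = Sum.inl t ∨ N.tgt f = Sum.inl t := by
  rcases hN.boundary_degree t with h | h
  · obtain ⟨e, he, -⟩ := exists_src_of_isSource h
    exact ⟨e, Or.inl he⟩
  · obtain ⟨e, he, -⟩ := exists_tgt_of_isSink h
    exact ⟨e, Or.inr he⟩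

theorem IsPerfect.bd_notMem_carrier {e : E} {t : Fin n} (h1 : N.src e ≠ Sum.inl t)
    (h2 : N.tgt e ≠ Sum.inl t) : N.bd t ∉ (N.curve e).carrier := by
  intro hz
  obtain ⟨f, hf⟩ := hN.exists_incident t
  rcases hN.incident_of_mem_carrier hf hz with h | h
  · exact h1 h
  · exact h2 h

theorem IsPerfect.base_ne_bd (t : Fin n) : N.bd t ≠ N.baseInner ∧ N.bd t ≠ N.baseOuter := by
  obtain ⟨f, hf⟩ := hN.exists_incident t
  apply hN.carrier_ne_base (e := f)
  have h0 := hN.embedded.len_pos f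
  rcases hf with h | h
  · rw [bd, ← h, ← hN.curve_start]; exact Polyline.pt_mem_carrier _ h0 (Nat.zero_le _)
  · rw [bd, ← h, ← hN.curve_end]; exact Polyline.pt_mem_carrier _ h0 le_rfl

theorem IsPerfect.bd_notMem_cut (t : Fin n) : N.bd t ∉ N.cut.carrier := by
  obtain ⟨f, hf⟩ := hN.exists_incident t
  rcases hf with h | h
  · rw [bd, ← h, ← hN.curve_start]; exact hN.pt_notMem_cut f 0 (Nat.zero_le _)
  · rw [bd, ← h, ← hN.curve_end]; exact hN.pt_notMem_cut f _ le_rfl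

omit hN in
theorem continuousAt_cutSight {z : ℂ} (hz : z ∉ N.cut.carrier) : ContinuousAt N.cutSight z := by
  unfold cutSight sightProd
  refine tendsto_finsetProd _ fun k hk => continuousAt_sight fun hm => hz ?_
  exact N.cut.segment_subset_carrier (Finset.mem_range.1 hk) hm

theorem IsPerfect.cutSight_sq {z : ℂ} (hz : z ∉ N.cut.carrier) :
    N.cutSight z * N.cutSight z =
      1 * (unitDir (N.baseOuter - z) / unitDir (N.baseInner - z)) := by
  rw [cutSight, sightProd_mul_self, one_mul]; · rfl
  rintro k hk rfl
  exact hz (N.cut.pt_mem_carrier (hN.cut_simple.len_pos ()) hk)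

/-! ### Inward directions at the boundary -/

omit hN in
theorem re_div_eq_dot (u b : ℂ) : (u / b).re = dot b u / Complex.normSq b := by
  rw [Complex.div_re, dot]; ring

omit hN in
theorem normSq_ray (b u : ℂ) (t : ℝ) : ‖b + t * u‖ ^ 2 = ‖b‖ ^ 2 + t * (2 * dot b u + t * ‖u‖ ^ 2) := by
  rw [Complex.sq_norm, Complex.sq_norm, Complex.sq_norm, Complex.normSq_apply, Complex.normSq_apply,
    Complex.normSq_apply, dot]
  simp; ring

/-- The segment stays in the annulus, so its radial component does not point outwards, and
transversality excludes zero. -/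
theorem IsPerfect.inward {t : Fin n} {u : ℂ} (hd : dot (N.bd t) u ≠ 0)
    (h : ∀ s : ℝ, 0 < s → s < 1 → N.bd t + s * u ∈ N.annulus) :
    (N.OnOuter t → 0 < (-u / N.bd t).re) ∧ (¬ N.OnOuter t → 0 < (u / N.bd t).re) := by
  have hn : 0 < Complex.normSq (N.bd t) := Complex.normSq_pos.2 (hN.bd_ne_zero t)
  have u0 : 0 ≤ ‖u‖ ^ 2 := by positivity
  have hr := hN.r_pos
  constructor
  · intro ho
    rw [neg_div, Complex.neg_re, re_div_eq_dot, neg_pos]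
    refine div_neg_of_neg_of_pos (lt_of_le_of_ne ?_ hd) hn
    have h1 := (h (1 / 2) (by norm_num) (by norm_num)).2
    have h2 := normSq_ray (N.bd t) u (1 / 2)
    rw [(hN.norm_bd t).1 ho] at h2
    have h3 : ‖N.bd t + ((1 / 2 : ℝ) : ℂ) * u‖ ^ 2 ≤ N.R ^ 2 := 
      pow_le_pow_left₀ (norm_nonneg _) h1 2
    rw [h2] at h3
    linarith
  · intro ho
    rw [re_div_eq_dot]
    refine div_pos (lt_of_le_of_ne ?_ hd.symm) hn
    by_contra hneg
    push Not at hneg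
    have key : ∀ s : ℝ, 0 < s → s < 1 → 0 ≤ 2 * dot (N.bd t) u + s * ‖u‖ ^ 2 := by
      intro s s0 s1
      have h1 := (h s s0 s1).1
      have h2 := normSq_ray (N.bd t) u s
      rw [(hN.norm_bd t).2 ho] at h2
      have h3 : N.r ^ 2 ≤ ‖N.bd t + (s : ℂ) * u‖ ^ 2 := pow_le_pow_left₀ hr.le h1 2
      rw [h2] at h3
      by_contra hc
      push Not at hc
      have := mul_neg_of_pos_of_neg s0 hc
      linarith
    have hU : 0 < 1 + ‖u‖ ^ 2 := by positivity
    -- So small that the quadratic term cannot outweigh the negative linear term.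
    set s := min (1 / 2) (-dot (N.bd t) u / (1 + ‖u‖ ^ 2)) with hs
    have s0 : 0 < s := lt_min (by norm_num) (div_pos (by linarith) hU)
    have s1 : s < 1 := lt_of_le_of_lt (min_le_left _ _) (by norm_num)
    have s2 : s * (1 + ‖u‖ ^ 2) ≤ -dot (N.bd t) u := by
      rw [← le_div_iff₀ hU]; exact min_le_right _ _
    have := key s s0 s1
    nlinarith

theorem IsPerfect.inward_src {e : E} {t : Fin n} (h : N.src e = Sum.inl t) :
    (N.OnOuter t → 0 < (-N.dirS e / N.bd t).re) ∧ (¬ N.OnOuter t → 0 < (N.dirS e / N.bd t).re) := by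
  have hl := hN.embedded.len_pos e
  refine hN.inward (hN.src_transversal e t h) fun s s0 s1 => ?_
  apply hN.carrier_mem (e := e)
  apply Polyline.segment_subset_carrier _ hl
  apply openSegment_subset_segment
  have := lineMap_mem_openSegment (a := (N.curve e).pt 0) (b := (N.curve e).pt (0 + 1)) s0 s1
  simp only [dirS, Polyline.dir]
  have e2 : N.bd t = (N.curve e).pt 0 := by rw [hN.curve_start, h]; rfl
  rw [e2]
  exact this

theorem IsPerfect.inward_tgt {e : E} {t : Fin n} (h : N.tgt e = Sum.inl t) :
    (N.OnOuter t → 0 < (- -N.dirT e / N.bd t).re) ∧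
      (¬ N.OnOuter t → 0 < (-N.dirT e / N.bd t).re) := by
  have hl := hN.embedded.len_pos e
  have e1 : (N.curve e).len - 1 + 1 = (N.curve e).len := by omega
  refine hN.inward (by rw [dot_neg]; exact neg_ne_zero.2 (hN.tgt_transversal e t h))
    fun s s0 s1 => ?_
  apply hN.carrier_mem (e := e)
  apply Polyline.segment_subset_carrier _ (k := (N.curve e).len - 1) (by omega)
  apply openSegment_subset_segment
  rw [openSegment_symm, e1]
  have := lineMap_mem_openSegment (a := (N.curve e).pt (N.curve e).len)
    (b := (N.curve e).pt ((N.curve e).len - 1)) s0 s1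
  simp only [dirT, Polyline.dir, e1, neg_sub]
  have e2 : N.bd t = (N.curve e).pt (N.curve e).len := by rw [hN.curve_end, h]; rfl
  rw [e2]
  exact this

end Perfect

end AnnularGraph

end AnnularNet

end

noncomputable section

namespace AnnularNet

open Filter Topology

/-! ### Square roots along the edges off a path -/

theorem segSign_mul_self (a b : ℂ) (δ : Polyline) : segSign a b δ * segSign a b δ = 1 := by
  classical
  unfold segSign
  rw [← Finset.prod_mul_distrib]
  refine Finset.prod_eq_one fun m _ => ?_
  split_ifs <;> norm_num

namespace AnnularGraph

variable {n : ℕ} {V₀ E : Type*} {N : AnnularGraph n V₀ E}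

/-- Along a segment of an edge, the half-angle of the cut has a continuous branch, which changes its
sign at each crossing. -/
theorem IsPerfect.exists_branch (hN : N.IsPerfect) (e : E) {m : ℕ} (hm : m < (N.curve e).len) :
    ∃ (k : ℂ → ℂ) (s : ℂ), s ≠ 0 ∧
      ContinuousOn k (segment ℝ ((N.curve e).pt m) ((N.curve e).pt (m + 1))) ∧
      (∀ z ∈ segment ℝ ((N.curve e).pt m) ((N.curve e).pt (m + 1)),
        k z * k z = s * (unitDir (N.baseOuter - z) / unitDir (N.baseInner - z))) ∧
      k ((N.curve e).pt m) = N.cutSight ((N.curve e).pt m) ∧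
      k ((N.curve e).pt (m + 1)) = segSign ((N.curve e).pt m) ((N.curve e).pt (m + 1)) N.cut *
        N.cutSight ((N.curve e).pt (m + 1)) := by
  classical
  set a := (N.curve e).pt m with ha
  set b := (N.curve e).pt (m + 1) with hb
  have hsub : segment ℝ a b ⊆ (N.curve e).carrier := Polyline.segment_subset_carrier _ hm
  have hcs : ∀ l < N.cut.len, segment ℝ (N.cut.pt l) (N.cut.pt (l + 1)) ⊆ N.cut.carrier :=
    fun l hl => Polyline.segment_subset_carrier _ hl
  have hpt : ∀ l ≤ N.cut.len, N.cut.pt l ∉ segment ℝ a b := fun l hl h =>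
    hN.cut_pt_notMem e l hl (hsub h)
  have hex : ∀ l, l < N.cut.len → ∃ (k : ℂ → ℂ) (s : ℂ), s ≠ 0 ∧ ContinuousOn k (segment ℝ a b) ∧
      (∀ z ∈ segment ℝ a b, k z * k z =
        s * (unitDir (N.cut.pt (l + 1) - z) / unitDir (N.cut.pt l - z))) ∧
      k a = sight (N.cut.pt l) (N.cut.pt (l + 1)) a ∧
      k b = (if (openSegment ℝ a b ∩ N.cut.openSeg l).Nonempty then -1 else 1) *
        sight (N.cut.pt l) (N.cut.pt (l + 1)) b := by
    intro l hl
    obtain ⟨k, h1, ⟨s, h2, h3⟩, h4, h5⟩ := exists_branch_sight (a := a) (b := b) (c := N.cut.pt l)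
      (c' := N.cut.pt (l + 1)) (fun h => hN.pt_notMem_cut e m hm.le (hcs l hl h))
      (fun h => hN.pt_notMem_cut e (m + 1) hm (hcs l hl h)) (hpt l hl.le) (hpt (l + 1) hl)
      (fun h => hN.cut_transversal e m l hm hl h)
    exact ⟨k, s, h2, h1, h3, h4, h5⟩
  choose! k s h1 h2 h3 h4 h5 using hex
  refine ⟨fun z => ∏ l ∈ Finset.range N.cut.len, k l z, ∏ l ∈ Finset.range N.cut.len, s l,
    ?_, ?_, ?_, ?_, ?_⟩
  · exact Finset.prod_ne_zero_iff.2 fun l hl => h1 l (Finset.mem_range.1 hl)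
  · exact continuousOn_finsetProd _ fun l hl => h2 l (Finset.mem_range.1 hl)
  · intro z hz
    have hzc : ∀ l ≤ N.cut.len, z ≠ N.cut.pt l := by
      rintro l hl rfl; exact hpt l hl hz
    have := sightProd_mul_self hzc
    rw [baseOuter, baseInner, ← this, sightProd, ← Finset.prod_mul_distrib, ← Finset.prod_mul_distrib,
      ← Finset.prod_mul_distrib]
    refine Finset.prod_congr rfl fun l hl => ?_
    have hl := Finset.mem_range.1 hl
    rw [h3 l hl z hz, sight_mul_self (hzc l hl.le) (hzc (l + 1) hl)]
  · exact Finset.prod_congr rfl fun l hl => h4 l (Finset.mem_range.1 hl)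
  · rw [segSign, cutSight, sightProd, ← Finset.prod_mul_distrib]
    exact Finset.prod_congr rfl fun l hl => h5 l (Finset.mem_range.1 hl)

-- A sign is its own inverse, so it comes out in the same way whether `cutRoot` enters directly or
-- inverted.
open Classical in
theorem background_smul (N : AnnularGraph n V₀ E) (i j : Fin n) {k k' : ℂ → ℂ} {z σ : ℂ}
    (hσ : σ * σ = 1) (h : k z = σ * k' z) : N.background i j k z =
      (if N.OnOuter i ↔ N.OnOuter j then 1 else σ) * N.background i j k' z := by
  have hinv : σ⁻¹ = σ := inv_eq_of_mul_eq_one_right hσ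
  unfold background cutPart cutRoot
  rw [h]
  split_ifs
  · ring
  · ring
  · have : (σ * k' z * rimRoot N.baseInner False z / rimRoot N.baseOuter True z)⁻¹ =
        σ⁻¹ * (k' z * rimRoot N.baseInner False z / rimRoot N.baseOuter True z)⁻¹ := by
      rw [← mul_inv]; congr 1; ring
    rw [this, hinv]; ring

section Path

variable {i j : Fin n} {P : List E} {Γ : Polyline} {o : E → ℕ}

theorem IsConcat.exists_seg (h : N.IsConcat i j P Γ o) {k : ℕ} (hk : k < Γ.len) :
    ∃ f ∈ P, ∃ m < (N.curve f).len, k = o f + m ∧ Γ.pt k = (N.curve f).pt m ∧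
      Γ.pt (k + 1) = (N.curve f).pt (m + 1) := by
  obtain ⟨f, hf, m, hm, rfl⟩ := h.exists_edge k hk
  exact ⟨f, hf, m, hm, rfl, h.pt_eq f hf m hm.le, by rw [add_assoc]; exact h.pt_eq f hf _ hm⟩

theorem IsConcat.exists_pt (h : N.IsConcat i j P Γ o) {k : ℕ} (hk : k ≤ Γ.len) :
    ∃ f ∈ P, ∃ m ≤ (N.curve f).len, Γ.pt k = (N.curve f).pt m := by
  have h0 := h.isArc.len_pos
  rcases hk.lt_or_eq with hk | rfl
  · obtain ⟨f, hf, m, hm, -, h1, -⟩ := h.exists_seg hk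
    exact ⟨f, hf, m, hm.le, h1⟩
  · obtain ⟨f, hf, m, hm, -, -, h1⟩ := h.exists_seg (k := Γ.len - 1) (by omega)
    rw [Nat.sub_add_cancel h0] at h1
    exact ⟨f, hf, m + 1, hm, h1⟩

theorem IsConcat.seg_subset (h : N.IsConcat i j P Γ o) {k : ℕ} (hk : k < Γ.len) :
    ∃ f ∈ P, segment ℝ (Γ.pt k) (Γ.pt (k + 1)) ⊆ (N.curve f).carrier := by
  obtain ⟨f, hf, m, hm, -, h1, h2⟩ := h.exists_seg hk
  exact ⟨f, hf, by rw [h1, h2]; exact Polyline.segment_subset_carrier _ hm⟩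

theorem IsConcat.pt_mem (hN : N.IsPerfect) (h : N.IsConcat i j P Γ o) {k : ℕ} (hk : k ≤ Γ.len) :
    ∃ f ∈ P, Γ.pt k ∈ (N.curve f).carrier := by
  obtain ⟨f, hf, m, hm, h1⟩ := h.exists_pt hk
  exact ⟨f, hf, by rw [h1]; exact Polyline.pt_mem_carrier _ (hN.embedded.len_pos f) hm⟩

theorem IsConcat.offset_succ (hN : N.IsPerfect) (h : N.IsConcat i j P Γ o) {p q : E} (hp : p ∈ P)
    (hq : q ∈ P) (hpq : N.tgt p = N.src q) : o q = o p + (N.curve p).len := by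
  have h1 := h.le_len p hp
  have h2 := h.le_len q hq
  apply h.isArc.inj _ _ (by omega) h1
  rw [h.pt_eq p hp _ le_rfl, hN.curve_end, hpq, ← hN.curve_start]
  exact h.pt_eq q hq 0 (Nat.zero_le _)

theorem IsConcat.offset_first (hN : N.IsPerfect) (h : N.IsConcat i j P Γ o) {p : E} (hp : p ∈ P)
    (hi : N.src p = Sum.inl i) : o p = 0 := by
  have h1 := h.le_len p hp
  apply h.isArc.inj _ _ (by omega) (Nat.zero_le _)
  rw [h.pt_zero, ← hi, ← hN.curve_start]
  exact h.pt_eq p hp 0 (Nat.zero_le _)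

theorem IsConcat.offset_last (hN : N.IsPerfect) (h : N.IsConcat i j P Γ o) {p : E} (hp : p ∈ P)
    (hj : N.tgt p = Sum.inl j) : o p + (N.curve p).len = Γ.len := by
  apply h.isArc.inj _ _ (h.le_len p hp) le_rfl
  rw [h.pt_eq p hp _ le_rfl, h.pt_len, hN.curve_end, hj]

theorem IsConcat.dir_eq (h : N.IsConcat i j P Γ o) {f : E} (hf : f ∈ P) {m : ℕ}
    (hm : m < (N.curve f).len) : Γ.dir (o f + m) = (N.curve f).dir m := by
  rw [Polyline.dir, Polyline.dir, add_assoc, h.pt_eq f hf _ hm, h.pt_eq f hf _ hm.le]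

theorem IsConcat.dir_offset (hN : N.IsPerfect) (h : N.IsConcat i j P Γ o) {f : E} (hf : f ∈ P) :
    Γ.dir (o f) = N.dirS f := h.dir_eq hf (hN.embedded.len_pos f)

theorem IsConcat.dir_offset_last (hN : N.IsPerfect) (h : N.IsConcat i j P Γ o) {f : E}
    (hf : f ∈ P) : Γ.dir (o f + (N.curve f).len - 1) = N.dirT f := by
  have := hN.embedded.len_pos f
  rw [Nat.add_sub_assoc this, h.dir_eq hf (by omega)]; rfl

/-- A vertex on the curve of a path is visited by the path. -/
theorem IsConcat.incident (hN : N.IsPerfect) (h : N.IsConcat i j P Γ o) {v : Fin n ⊕ V₀} {f : E}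
    (hf : N.src f = v ∨ N.tgt f = v) {k : ℕ} (hk : k ≤ Γ.len) (hv : N.pos v = Γ.pt k) :
    ∃ g ∈ P, N.src g = v ∨ N.tgt g = v := by
  obtain ⟨g, hg, hm⟩ := h.pt_mem hN hk
  rw [← hv] at hm
  exact ⟨g, hg, hN.incident_of_mem_carrier hf hm⟩

/-- The curve of a path passes between two corners of `Γ` away from the other edges. -/
theorem IsConcat.seg_notMem (hN : N.IsPerfect) (h : N.IsConcat i j P Γ o) {e : E} (he : e ∉ P)
    {m k : ℕ} (hm : m < (N.curve e).len) (hk : k < Γ.len) {z : ℂ}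
    (hz : z ∈ (N.curve e).openSeg m) : z ∉ segment ℝ (Γ.pt k) (Γ.pt (k + 1)) := by
  obtain ⟨f, hf, l, hl, -, h1, h2⟩ := h.exists_seg hk
  rw [h1, h2]
  intro hz'
  have hne : e ≠ f := by rintro rfl; exact he hf
  refine Set.disjoint_left.1 (hN.embedded.seg_disjoint e f m l hm hl (Or.inl hne)) hz
    (mem_openSegment_of_mem_segment hz' ?_ ?_)
  · rintro rfl; exact hN.embedded.pt_notMem f e l m hl.le hm hz
  · rintro rfl; exact hN.embedded.pt_notMem f e (l + 1) m hl hm hz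

/-- An edge off the path touches a chord of the path at a common vertex at most, and there the
absence of cusps separates the directions. -/
theorem IsConcat.leaves_start (hN : N.IsPerfect) (h : N.IsConcat i j P Γ o) {e : E} (he : e ∉ P)
    {m k : ℕ} (hm : m < (N.curve e).len) (hk : k < Γ.len) :
    Leaves (Γ.pt k) (Γ.pt (k + 1)) ((N.curve e).pt m)
      ((N.curve e).pt (m + 1) - (N.curve e).pt m) := by
  obtain ⟨f, hf, l, hl, -, h1, h2⟩ := h.exists_seg hk
  have hne : e ≠ f := by rintro rfl; exact he hf
  rw [h1, h2]
  refine ⟨fun hv => ?_, fun hv => ?_, fun hv hv' hmem => ?_⟩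
  · rcases hN.embedded.pt_inj e f m (l + 1) hm.le hl hv with ⟨h3, -⟩ | ⟨h3 | h3, h4 | h4⟩
    · exact absurd h3 hne
    · omega
    · subst h3
      rw [h4, hN.curve_start, hN.curve_end] at hv
      have := hN.slit_succ (hN.pos_injective hv).symm
      have e1 : l = (N.curve f).len - 1 := by omega
      subst e1
      exact this
    · omega
    · omega
  · rcases hN.embedded.pt_inj e f m l hm.le hl.le hv with ⟨h3, -⟩ | ⟨h3 | h3, h4 | h4⟩
    · exact absurd h3 hne
    · subst h3 h4
      rw [hN.curve_start, hN.curve_start] at hv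
      have := hN.slit_src hne.symm (hN.pos_injective hv).symm
      rw [← neg_div] at this
      exact this
    all_goals omega
  · exact hN.embedded.pt_notMem e f m l hm.le hl (mem_openSegment_of_mem_segment hmem hv' hv)

theorem IsConcat.leaves_end (hN : N.IsPerfect) (h : N.IsConcat i j P Γ o) {e : E} (he : e ∉ P)
    {m k : ℕ} (hm : m < (N.curve e).len) (hk : k < Γ.len) :
    Leaves (Γ.pt k) (Γ.pt (k + 1)) ((N.curve e).pt (m + 1))
      ((N.curve e).pt m - (N.curve e).pt (m + 1)) := by
  obtain ⟨f, hf, l, hl, -, h1, h2⟩ := h.exists_seg hk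
  have hne : e ≠ f := by rintro rfl; exact he hf
  rw [h1, h2]
  refine ⟨fun hv => ?_, fun hv => ?_, fun hv hv' hmem => ?_⟩
  · rcases hN.embedded.pt_inj e f (m + 1) (l + 1) hm hl hv with ⟨h3, -⟩ | ⟨h3 | h3, h4 | h4⟩
    · exact absurd h3 hne
    · omega
    · omega
    · omega
    · rw [h3, h4, hN.curve_end, hN.curve_end] at hv
      have := hN.slit_tgt hne (hN.pos_injective hv)
      have e1 : l = (N.curve f).len - 1 := by omega
      have e2 : m = (N.curve e).len - 1 := by omega
      subst e1 e2
      rw [← neg_div] at this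
      simpa only [dirT, Polyline.dir, neg_sub] using this
  · rcases hN.embedded.pt_inj e f (m + 1) l hm hl.le hv with ⟨h3, -⟩ | ⟨h3 | h3, h4 | h4⟩
    · exact absurd h3 hne
    · omega
    · omega
    · subst h4
      rw [h3, hN.curve_start, hN.curve_end] at hv
      have := hN.slit_succ (hN.pos_injective hv)
      have e2 : m = (N.curve e).len - 1 := by omega
      subst e2
      rw [← neg_div_neg_eq] at this
      simpa only [dirT, dirS, Polyline.dir, neg_sub] using this
    · omega
  · exact hN.embedded.pt_notMem e f (m + 1) l hm hl (mem_openSegment_of_mem_segment hmem hv' hv)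

/-- The continuous branch of the square root of the direction of the closed curve of a path, at the
point `v` in the direction `u`. -/
def sideRoot (N : AnnularGraph n V₀ E) (i j : Fin n) (Γ : Polyline) (v u : ℂ) : ℂ :=
  sightProdDir Γ.pt (Finset.range Γ.len) v u * N.background i j N.cutSight v

theorem IsPath.bd_notMem [Finite E] (hN : N.IsPerfect) (hP : N.IsPath i j P) {e : E} (he : e ∉ P) :
    N.bd i ∉ (N.curve e).carrier ∧ N.bd j ∉ (N.curve e).carrier := by
  obtain ⟨f, hf, hfi⟩ := hP.exists_first
  obtain ⟨g, hg, hgj⟩ := hP.exists_last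
  have hi := hP.isSource hN
  have hj := hP.isSink hN
  constructor
  · refine hN.bd_notMem_carrier (fun h => ?_) (tgt_ne_of_isSource hi e)
    obtain ⟨a, -, ha⟩ := exists_src_of_isSource hi
    exact he (((ha e h).trans (ha f hfi).symm) ▸ hf)
  · refine hN.bd_notMem_carrier (src_ne_of_isSink hj e) (fun h => ?_)
    obtain ⟨a, -, ha⟩ := exists_tgt_of_isSink hj
    exact he (((ha e h).trans (ha g hgj).symm) ▸ hg)

-- `cutSight` jumps where the segment crosses the cut. It is replaced by the branch of
-- `exists_branch`, continuous on the segment, which agrees with it at the first end and differs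
-- from it by `segSign` at the second.
open Classical in
theorem IsConcat.sideRoot_segment [Finite E] (hN : N.IsPerfect) (hP : N.IsPath i j P)
    (h : N.IsConcat i j P Γ o) {e : E} (he : e ∉ P) {m : ℕ} (hm : m < (N.curve e).len) :
    N.sideRoot i j Γ ((N.curve e).pt m) ((N.curve e).pt (m + 1) - (N.curve e).pt m) =
      (if N.OnOuter i ↔ N.OnOuter j then 1 else
        segSign ((N.curve e).pt m) ((N.curve e).pt (m + 1)) N.cut) *
      N.sideRoot i j Γ ((N.curve e).pt (m + 1)) ((N.curve e).pt m - (N.curve e).pt (m + 1)) := by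
  obtain ⟨k, s, hs, k1, k2, k3, k4⟩ := hN.exists_branch e hm
  obtain ⟨C, hC, hsq⟩ := hN.background_sq i j k hs
  set a := (N.curve e).pt m with ha
  set b := (N.curve e).pt (m + 1) with hb
  have hab : a ≠ b := hN.embedded.pt_ne_succ hm
  have hsub : segment ℝ a b ⊆ (N.curve e).carrier := Polyline.segment_subset_carrier _ hm
  obtain ⟨ni, nj⟩ := hP.bd_notMem hN he
  have hzi : ∀ z ∈ segment ℝ a b, z ≠ N.bd i := by rintro z hz rfl; exact ni (hsub hz)
  have hzj : ∀ z ∈ segment ℝ a b, z ≠ N.bd j := by rintro z hz rfl; exact nj (hsub hz)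
  have hbase : ∀ z ∈ segment ℝ a b, z ≠ N.baseInner ∧ z ≠ N.baseOuter := fun z hz =>
    hN.carrier_ne_base (hsub hz)
  have hk0 : ∀ z ∈ segment ℝ a b, k z ≠ 0 := by
    intro z hz h0
    have h1 := k2 z hz
    rw [h0, mul_zero] at h1
    exact mul_ne_zero hs (div_ne_zero (unitDir_ne_zero (sub_ne_zero.2 (hbase z hz).2.symm))
      (unitDir_ne_zero (sub_ne_zero.2 (hbase z hz).1.symm))) h1.symm
  have hB : ContinuousOn (N.background i j k) (segment ℝ a b) := fun z hz =>
    hN.continuousWithinAt_background (hN.carrier_mem (hsub hz)) (hzi z hz) (hzj z hz) fun _ =>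
      ⟨(hbase z hz).1, (hbase z hz).2, hk0 z hz, k1 z hz⟩
  have hlt : ∀ᶠ t : ℝ in 𝓝[>] 0, 0 < t ∧ t < 1 := Ioo_mem_nhdsGT zero_lt_one
  have lim : ∀ x y : ℂ, segment ℝ x y = segment ℝ a b → 
      Tendsto (fun t : ℝ => N.background i j k (x + t * (y - x))) (𝓝[>] 0)
        (𝓝 (N.background i j k x)) := by
    intro x y hxy
    have hx : x ∈ segment ℝ a b := by rw [← hxy]; exact left_mem_segment ℝ _ _
    refine (hB x hx).tendsto.comp (tendsto_nhdsWithin_iff.2 ⟨tendsto_ray _ _, ?_⟩)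
    filter_upwards [hlt] with t ht
    rw [← hxy]
    exact openSegment_subset_segment _ _ _ (lineMap_mem_openSegment ht.1 ht.2)
  have key := sightProdDir_eq_of_segment (c := Γ.pt) (S := Finset.range Γ.len) hab
    (fun k hk => h.isArc.pt_ne_succ (Finset.mem_range.1 hk))
    (fun k hk => h.leaves_start hN he hm (Finset.mem_range.1 hk))
    (fun k hk => h.leaves_end hN he hm (Finset.mem_range.1 hk))
    (fun k hk z hz => h.seg_notMem hN he hm (Finset.mem_range.1 hk) hz)
    (hB.mono (openSegment_subset_segment _ _ _)) (lim a b rfl) (lim b a (segment_symm ℝ _ _)) hC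
    (fun z hz => by
      have hz' := openSegment_subset_segment ℝ a b hz
      rw [← hsq z (hN.carrier_mem (hsub hz')) (hzi z hz') (hzj z hz')
        (fun _ => ⟨(hbase z hz').1, (hbase z hz').2, k2 z hz'⟩)]
      have : ∀ l ≤ Γ.len, z ≠ Γ.pt l := by
        rintro l hl rfl
        obtain ⟨f, hf, l', hl', h1⟩ := h.exists_pt hl
        rw [h1] at hz
        exact hN.embedded.pt_notMem f e l' m hl' hm hz
      have h2 := sightProd_mul_self this
      rw [h.pt_zero, h.pt_len] at h2
      rw [mul_mul_mul_comm, h2]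
      simp only [bd]; ring)
  have ea : N.background i j k a = N.background i j N.cutSight a := by
    unfold background cutPart cutRoot; rw [k3]
  have eb := N.background_smul i j (segSign_mul_self a b N.cut) k4
  rw [ea, eb] at key
  unfold sideRoot
  rw [key]; ring

theorem sideRoot_congr {v : ℂ} (hv : ∀ k ≤ Γ.len, v ≠ Γ.pt k)
    (u u' : ℂ) : N.sideRoot i j Γ v u = N.sideRoot i j Γ v u' := by
  have hh : ∀ k ∈ Finset.range Γ.len, v ≠ Γ.pt k ∧ v ≠ Γ.pt (k + 1) := fun k hk =>
    ⟨hv k (Finset.mem_range.1 hk).le, hv (k + 1) (Finset.mem_range.1 hk)⟩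
  rw [sideRoot, sideRoot, sightProdDir_of_notMem u hh, sightProdDir_of_notMem u' hh]

open Classical in
/-- The side of an edge with respect to a path changes at the crossings with the cut. -/
theorem IsConcat.sideRoot_edge [Finite E] (hN : N.IsPerfect) (hP : N.IsPath i j P)
    (h : N.IsConcat i j P Γ o) {e : E} (he : e ∉ P) :
    N.sideRoot i j Γ (N.pos (N.src e)) (N.dirS e) =
      (if N.OnOuter i ↔ N.OnOuter j then 1 else (-1) ^ (N.curve e).ind N.cut) *
      N.sideRoot i j Γ (N.pos (N.tgt e)) (-N.dirT e) := by
  have hl := hN.embedded.len_pos e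
  have e1 : (N.curve e).len - 1 + 1 = (N.curve e).len := by omega
  have main : ∀ m, m < (N.curve e).len →
      N.sideRoot i j Γ ((N.curve e).pt 0) ((N.curve e).pt (0 + 1) - (N.curve e).pt 0) =
      (if N.OnOuter i ↔ N.OnOuter j then 1 else ∏ k ∈ Finset.range (m + 1),
        segSign ((N.curve e).pt k) ((N.curve e).pt (k + 1)) N.cut) *
      N.sideRoot i j Γ ((N.curve e).pt (m + 1)) ((N.curve e).pt m - (N.curve e).pt (m + 1)) := by
    intro m
    induction m with
    | zero =>
      intro hm
      rw [h.sideRoot_segment hN hP he hm, Finset.prod_range_one]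
    | succ m ih =>
      intro hm
      have hv : ∀ k ≤ Γ.len, (N.curve e).pt (m + 1) ≠ Γ.pt k := by
        intro k hk hv
        obtain ⟨f, hf, l, hl, h1⟩ := h.exists_pt hk
        rw [h1] at hv
        rcases hN.embedded.pt_inj e f (m + 1) l hm.le hl hv with ⟨rfl, -⟩ | ⟨h3 | h3, -⟩
        · exact he hf
        · omega
        · omega
      -- An inner corner of the edge is not on the path, so the direction of approach may be changed
      -- there.
      rw [ih (by omega), sideRoot_congr hv _ ((N.curve e).pt (m + 1 + 1) - (N.curve e).pt (m + 1)),
        h.sideRoot_segment hN hP he hm, Finset.prod_range_succ _ (m + 1)]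
      split_ifs
      · ring
      · ring
  have := main ((N.curve e).len - 1) (by omega)
  rw [e1] at this
  rw [neg_one_zpow_ind (fun k m hk hm => hN.cut_transversal e k m hk hm), ← hN.curve_start,
    ← hN.curve_end, dirS, dirT, Polyline.dir, Polyline.dir, e1, neg_sub]
  exact this

/-- The constant value of the square root along a path. -/
theorem IsConcat.exists_const (hN : N.IsPerfect)
    (hcut : N.AvoidsCut P) (h : N.IsConcat i j P Γ o) {p q : E} (hp : p ∈ P)
    (hpi : N.src p = Sum.inl i) (hq : q ∈ P) (hqj : N.tgt q = Sum.inl j) (hij : i ≠ j) :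
    ∃ c : ℂ, c ≠ 0 ∧
      c = Γ.farProd 0 * (rimRootDir (N.bd i) (N.OnOuter i) (N.dirS p) /
        rimRoot (N.bd j) (N.OnOuter j) (N.bd i) * N.cutPart i j N.cutSight (N.bd i)) ∧
      c = Γ.farProd Γ.len * (rimRoot (N.bd i) (N.OnOuter i) (N.bd j) /
        rimRootDir (N.bd j) (N.OnOuter j) (-N.dirT q) * N.cutPart i j N.cutSight (N.bd j)) ∧
      ∀ k, k + 1 < Γ.len → c = halfDir (Γ.dir (k + 1) / Γ.dir k) * Γ.farProd (k + 1) *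
        N.background i j N.cutSight (Γ.pt (k + 1)) := by
  obtain ⟨C, hC, hsq⟩ := hN.background_sq i j N.cutSight one_ne_zero
  have h0 : Γ.pt 0 = N.bd i := h.pt_zero
  have h1 : Γ.pt Γ.len = N.bd j := h.pt_len
  have hbij : N.bd i ≠ N.bd j := fun he => hij (hN.bd_inj he)
  have hd0 : Γ.dir 0 = N.dirS p := by rw [← h.dir_offset hN hp, h.offset_first hN hp hpi]
  have hd1 : Γ.dir (Γ.len - 1) = N.dirT q := by
    rw [← h.dir_offset_last hN hq, h.offset_last hN hq hqj]
  -- The path avoids the cut, so `cutSight` itself is continuous along it and no other branch is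
  -- needed.
  have hcar : ∀ f ∈ P, ∀ z ∈ (N.curve f).carrier, z ∉ N.cut.carrier := fun f hf z hz hz' =>
    Set.disjoint_left.1 (hcut f hf) hz hz'
  have hcont : ∀ f ∈ P, ∀ z ∈ (N.curve f).carrier, z ≠ N.bd i → z ≠ N.bd j →
      ContinuousAt (N.background i j N.cutSight) z := by
    intro f hf z hz hzi hzj
    rw [← continuousWithinAt_univ]
    exact hN.continuousWithinAt_background (hN.carrier_mem hz) hzi hzj fun _ =>
      ⟨(hN.carrier_ne_base hz).1, (hN.carrier_ne_base hz).2, N.cutSight_ne_zero z,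
        (continuousAt_cutSight (hcar f hf z hz)).continuousWithinAt⟩
  have hcp : ∀ t, ContinuousAt (N.cutPart i j N.cutSight) (N.bd t) := by
    intro t
    rw [← continuousWithinAt_univ]
    exact hN.continuousWithinAt_cutPart (hN.bd_mem t) fun _ => ⟨(hN.base_ne_bd t).1,
      (hN.base_ne_bd t).2, N.cutSight_ne_zero _,
      (continuousAt_cutSight (hN.bd_notMem_cut t)).continuousWithinAt⟩
  have hseg : ∀ k < Γ.len, ∀ z ∈ Γ.openSeg k, z ≠ N.bd i ∧ z ≠ N.bd j := fun k hk z hz =>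
    ⟨by rw [← h0]; exact h.isArc.openSeg_ne_pt hk (Nat.zero_le _) hz,
      by rw [← h1]; exact h.isArc.openSeg_ne_pt hk le_rfl hz⟩
  have main := h.isArc.exists_const (B := N.background i j N.cutSight) (s := C)
    (B₀ := rimRootDir (N.bd i) (N.OnOuter i) (N.dirS p) /
        rimRoot (N.bd j) (N.OnOuter j) (N.bd i) * N.cutPart i j N.cutSight (N.bd i))
    (B₁ := rimRoot (N.bd i) (N.OnOuter i) (N.bd j) /
        rimRootDir (N.bd j) (N.OnOuter j) (-N.dirT q) * N.cutPart i j N.cutSight (N.bd j))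
    ?_ ?_ ?_ ?_ ?_ hC ?_
  · exact main
  · intro k hk z hz
    obtain ⟨f, hf, hsub⟩ := h.seg_subset hk
    exact (hcont f hf z (hsub (openSegment_subset_segment _ _ _ hz)) (hseg k hk z hz).1
      (hseg k hk z hz).2).continuousWithinAt
  · intro k hk
    obtain ⟨f, hf, hz⟩ := h.pt_mem hN (k := k + 1) hk.le
    refine hcont f hf _ hz ?_ ?_
    · rw [← h0]; intro he; have := h.isArc.inj _ _ hk.le (Nat.zero_le _) he; omega
    · rw [← h1]; intro he; have := h.isArc.inj _ _ hk.le le_rfl he; omega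
  · exact mul_ne_zero (div_ne_zero (rimRootDir_ne_zero _ _ _) (rimRoot_ne_zero _ _ _))
      (N.cutPart_ne_zero i j (N.cutSight_ne_zero _))
  · rw [h0, hd0]
    exact ((tendsto_rimRoot (hN.bd_ne_zero i) (hN.inward_src hpi).1 (hN.inward_src hpi).2).div
      ((hN.continuousAt_bdRoot (hN.bd_mem i) hbij).tendsto.comp (tendsto_ray _ _))
      (rimRoot_ne_zero _ _ _)).mul ((hcp i).tendsto.comp (tendsto_ray _ _))
  · rw [h1, hd1]
    refine ((((hN.continuousAt_bdRoot (hN.bd_mem j) hbij.symm).tendsto.comp (tendsto_ray _ _))).div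
      (tendsto_rimRoot (hN.bd_ne_zero j) (hN.inward_tgt hqj).1 (hN.inward_tgt hqj).2)
      (rimRootDir_ne_zero _ _ _)).mul ((hcp j).tendsto.comp (tendsto_ray _ _))
  · intro k hk z hz
    obtain ⟨f, hf, hsub⟩ := h.seg_subset hk
    have hz' := hsub (openSegment_subset_segment _ _ _ hz)
    rw [h0, h1]
    exact hsq z (hN.carrier_mem hz') (hseg k hk z hz).1 (hseg k hk z hz).2 fun _ =>
      ⟨(hN.carrier_ne_base hz').1, (hN.carrier_ne_base hz').2, hN.cutSight_sq (hcar f hf z hz')⟩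

section Corner

variable {c : ℂ} (hN : N.IsPerfect) (h : N.IsConcat i j P Γ o)
  (hc : ∀ k, k + 1 < Γ.len → c = halfDir (Γ.dir (k + 1) / Γ.dir k) * Γ.farProd (k + 1) *
        N.background i j N.cutSight (Γ.pt (k + 1)))
  {p q : E} (hp : p ∈ P) (hq : q ∈ P) (hpq : N.tgt p = N.src q)

include hN h hc hp hq hpq

/-- The constant `c` and the side root at the corner share the distant chords and the background.
These cancel and leave half-angles between the directions at the vertex. -/
theorem IsConcat.sideRoot_corner (u : ℂ) :
    N.sideRoot i j Γ (N.pos (N.tgt p)) u * halfDir (N.dirS q / N.dirT p) =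
      c * (halfDir (u / N.dirT p) * halfDir (-N.dirS q / u)) := by
  have l1 := hN.embedded.len_pos p
  have l2 := hN.embedded.len_pos q
  have h1 := h.le_len p hp
  have h2 := h.le_len q hq
  have ho := h.offset_succ hN hp hq hpq
  have e1 : o p + (N.curve p).len - 1 + 1 = o q := by omega
  have hlt : o p + (N.curve p).len - 1 + 1 < Γ.len := by omega
  have hv : N.pos (N.tgt p) = Γ.pt (o p + (N.curve p).len - 1 + 1) := by
    rw [e1, hpq, ← hN.curve_start]; exact (h.pt_eq q hq 0 (Nat.zero_le _)).symm
  have hc' := hc _ hlt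
  rw [sideRoot, hv, h.isArc.dir_all hlt u]
  rw [h.dir_offset_last hN hp, e1, h.dir_offset hN hq] at hc' ⊢
  rw [hc']; ring

/-- An edge that leaves a path: the square roots on its two sides. -/
theorem IsConcat.sideRoot_out {f : E} (hf : f ∉ P) (hpf : N.src f = N.tgt p) :
    N.sideRoot i j Γ (N.pos (N.src f)) (N.dirS f) * halfDir (-N.dirS f / N.dirS q) =
      c * (halfDir (N.dirT p / N.dirS q) * halfDir (N.dirS f / N.dirT p)) := by
  have hqf : f ≠ q := by rintro rfl; exact hf hq
  have a1 := halfDir_mul_inv (hN.slit_src hqf (hpf.trans hpq))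
  have a2 := halfDir_mul_inv (hN.slit_succ hpq)
  have key := h.sideRoot_corner hN hc hp hq hpq (N.dirS f)
  rw [← hpf] at key
  rw [inv_div] at a2
  have e1 : (-(N.dirS f / N.dirS q))⁻¹ = -N.dirS q / N.dirS f := by
    rw [inv_neg, inv_div, neg_div]
  rw [e1] at a1
  rw [neg_div]
  linear_combination halfDir (-(N.dirS f / N.dirS q)) * halfDir (N.dirT p / N.dirS q) * key
    - N.sideRoot i j Γ (N.pos (N.src f)) (N.dirS f) * halfDir (-(N.dirS f / N.dirS q)) * a2
    + c * halfDir (N.dirT p / N.dirS q) * halfDir (N.dirS f / N.dirT p) * a1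

/-- An edge that enters a path: the square roots on its two sides. -/
theorem IsConcat.sideRoot_in {e : E} (he : e ∉ P) (hep : N.tgt e = N.tgt p) :
    N.sideRoot i j Γ (N.pos (N.tgt e)) (-N.dirT e) * halfDir (N.dirS q / N.dirT e) =
      -c * (halfDir (-N.dirT p / N.dirT e) * halfDir (N.dirS q / N.dirT p)) := by
  have hne : e ≠ p := by rintro rfl; exact he hp
  have a1 := halfDir_mul_inv (hN.slit_tgt hne hep)
  have a2 := halfDir_mul_inv (hN.slit_succ hpq)
  have key := h.sideRoot_corner hN hc hp hq hpq (-N.dirT e)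
  rw [← hep] at key
  rw [inv_div] at a2
  have e1 : (-(N.dirT e / N.dirT p))⁻¹ = -N.dirT p / N.dirT e := by
    rw [inv_neg, inv_div, neg_div]
  have ne1 := hN.dirT_ne_zero e
  have np := hN.dirT_ne_zero p
  have nq := hN.dirS_ne_zero q
  have s1 := halfDir_mul_self (div_ne_zero nq ne1)
  have s2 := halfDir_mul_self (div_ne_zero nq np)
  have s3 := halfDir_mul_self (neg_ne_zero.2 (div_ne_zero ne1 np))
  rw [e1] at a1
  rw [neg_div_neg_eq, neg_div] at key
  -- Only squares of half-angles enter here, and their relation carries the minus sign by which an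
  -- entering edge differs from a leaving one.
  have u1 : unitDir (-(N.dirT e / N.dirT p)) * unitDir (N.dirS q / N.dirT e) =
      -unitDir (N.dirS q / N.dirT p) := by
    rw [← unitDir_mul, ← unitDir_neg]; congr 1; field_simp
  have hq0 := halfDir_ne_zero (N.dirS q / N.dirT p)
  have hx0 := halfDir_ne_zero (-(N.dirT e / N.dirT p))
  refine mul_left_cancel₀ (mul_ne_zero hx0 hq0) ?_
  rw [← s1, ← s2, ← s3] at u1
  linear_combination halfDir (-(N.dirT e / N.dirT p)) * halfDir (N.dirS q / N.dirT e) * key +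
    c * u1 + c * halfDir (N.dirS q / N.dirT p) ^ 2 * a1

end Corner

end Path

end AnnularGraph

end AnnularNet

end

noncomputable section

namespace AnnularNet

open Filter Topology

/-! ### Points on a circle -/

/-- The point at the angle `x` counterclockwise from `z`. -/
def turnBy (z : ℂ) (x : ℝ) : ℂ := z * Complex.exp ((x : ℂ) * Complex.I)

theorem norm_turnBy (z : ℂ) (x : ℝ) : ‖turnBy z x‖ = ‖z‖ := by
  rw [turnBy, norm_mul, Complex.norm_exp_ofReal_mul_I, mul_one]

theorem turnBy_add (z : ℂ) (x y : ℝ) : turnBy z (x + y) = turnBy (turnBy z x) y := by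
  unfold turnBy; push_cast; rw [add_mul, Complex.exp_add, mul_assoc]

theorem turnBy_zero (z : ℂ) : turnBy z 0 = z := by simp [turnBy]

theorem turnBy_two_pi (z : ℂ) (x : ℝ) : turnBy z (x + 2 * Real.pi) = turnBy z x := by
  rw [turnBy_add, turnBy, turnBy]; push_cast; rw [Complex.exp_two_pi_mul_I, mul_one]

theorem turnBy_inj {z : ℂ} (hz : z ≠ 0) {x y : ℝ} (h : |x - y| < 2 * Real.pi)
    (he : turnBy z x = turnBy z y) : x = y := by
  have h1 := mul_left_cancel₀ hz he
  obtain ⟨m, hm⟩ := Complex.exp_eq_exp_iff_exists_int.1 h1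
  have h2 : (x : ℂ) = ((y + m * (2 * Real.pi) : ℝ) : ℂ) := by
    have : ((x : ℂ) - (y + m * (2 * Real.pi))) * Complex.I = 0 := by linear_combination hm
    rcases mul_eq_zero.1 this with h | h
    · push_cast; linear_combination h
    · exact absurd h Complex.I_ne_zero
  have h3 : x = y + m * (2 * Real.pi) := by exact_mod_cast h2
  have hp := Real.two_pi_pos
  rw [h3, add_sub_cancel_left, abs_mul, abs_of_pos hp] at h
  have h4 : |(m : ℝ)| < 1 := by
    by_contra hc; push Not at hc; nlinarith
  have h5 : m = 0 := by
    have : |m| < 1 := by exact_mod_cast h4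
    exact Int.abs_lt_one_iff.1 this
  rw [h3, h5]; simp

theorem eq_turnBy_ccw {z x : ℂ} (h : ‖x‖ = ‖z‖) : x = turnBy z (ccw z x) := by
  have e2 : Complex.exp (((ccw z x : ℝ) : ℂ) * Complex.I) =
      Complex.exp (((x.arg - z.arg : ℝ) : ℂ) * Complex.I) := by
    rw [ccw_eq]
    split_ifs
    · rfl
    · push_cast
      rw [add_mul, Complex.exp_add, Complex.exp_two_pi_mul_I, mul_one]
  rw [turnBy, e2]
  push_cast
  rw [sub_mul, Complex.exp_sub]
  conv_lhs => rw [← Complex.norm_mul_exp_arg_mul_I x]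
  conv_rhs =>
    enter [1]
    rw [← Complex.norm_mul_exp_arg_mul_I z]
  rw [h]
  have := Complex.exp_ne_zero (z.arg * Complex.I)
  field_simp

/-- The quotient plays the role of `u t` in `tendsto_curve`: an arc is treated as a curve with the
initial direction `s * I * z`. -/
theorem tendsto_turnBy (z : ℂ) (s : ℝ) :
    Tendsto (fun t : ℝ => (turnBy z (s * t) - z) / t) (𝓝[>] 0) (𝓝 (s * Complex.I * z)) := by
  have h1 : HasDerivAt (fun t : ℝ => turnBy z (s * t)) (s * Complex.I * z) 0 := by
    have h2 : HasDerivAt (fun t : ℝ => ((s * t : ℝ) : ℂ)) s 0 := by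
      have := ((hasDerivAt_id (0 : ℝ)).const_mul s).ofReal_comp
      simpa using this
    have h3 := ((h2.mul_const Complex.I).cexp).const_mul z
    refine h3.congr_deriv ?_
    simp only [mul_zero, Complex.ofReal_zero, zero_mul, Complex.exp_zero]
    ring
  have := h1.tendsto_slope_zero_right
  refine this.congr fun t => ?_
  simp only [zero_add, mul_zero, turnBy_zero, Complex.real_smul]
  push_cast
  field_simp

theorem continuous_turnBy (z : ℂ) : Continuous (turnBy z) := by unfold turnBy; fun_prop

/-- Used for the cut, along which values are carried from one circle to the other. -/
theorem Polyline.isPreconnected_carrier (γ : Polyline) : IsPreconnected γ.carrier := by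
  unfold carrier
  induction γ.len with
  | zero => simp [isPreconnected_empty]
  | succ m ih =>
    rw [Set.biUnion_lt_succ]
    have h1 : IsPreconnected (segment ℝ (γ.pt m) (γ.pt (m + 1))) :=
      (convex_segment _ _).isPreconnected
    rcases m with _ | m
    · simpa using h1
    · refine ih.union (γ.pt (m + 1)) ?_ (left_mem_segment ℝ _ _) h1
      exact Set.mem_biUnion (Nat.lt_succ_self m) (right_mem_segment ℝ _ _)

namespace AnnularGraph

variable {n : ℕ} {V₀ E : Type*} {N : AnnularGraph n V₀ E}

/-- The continuous branch of the square root of the direction of the closed curve of a path, at a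
point that does not lie on the path. -/
def sideVal (N : AnnularGraph n V₀ E) (i j : Fin n) (Γ : Polyline) (z : ℂ) : ℂ :=
  sightProd Γ.pt (Finset.range Γ.len) z * N.background i j N.cutSight z

theorem sideRoot_eq_sideVal {i j : Fin n} {Γ : Polyline} {v : ℂ} (hv : ∀ k ≤ Γ.len, v ≠ Γ.pt k)
    (u : ℂ) : N.sideRoot i j Γ v u = N.sideVal i j Γ v := by
  rw [sideRoot, sightProdDir_of_notMem u fun k hk => ?_]
  · rfl
  · exact ⟨hv k (Finset.mem_range.1 hk).le, hv (k + 1) (Finset.mem_range.1 hk)⟩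

/-! ### The side of a point with respect to a path -/

section Path

variable [Finite E] {i j : Fin n} {P : List E} {Γ : Polyline} {o : E → ℕ} (hN : N.IsPerfect)
  (hP : N.IsPath i j P) (h : N.IsConcat i j P Γ o)

include hN h

/-- The boundary circles meet the curve of a path at its ends only. -/
theorem IsConcat.notMem_of_norm (hP : N.IsPath i j P) {z : ℂ} (hz : ‖z‖ = N.r ∨ ‖z‖ = N.R)
    (hi : z ≠ N.bd i) (hj : z ≠ N.bd j) {k : ℕ} (hk : k < Γ.len) :
    z ∉ segment ℝ (Γ.pt k) (Γ.pt (k + 1)) := by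
  obtain ⟨f, hf, hsub⟩ := h.seg_subset hk
  intro hm
  have hm := hsub hm
  rcases hN.curve_mem f z hm with h1 | ⟨t, rfl⟩
  · rcases hz with h2 | h2 <;> linarith [h1.1, h1.2]
  · by_cases hs : N.src f = Sum.inl t
    · exact hi (by rw [hP.src_eq_inl hN hf hs]; rfl)
    by_cases ht : N.tgt f = Sum.inl t
    · exact hj (by rw [hP.tgt_eq_inl hN hf ht]; rfl)
    · exact hN.bd_notMem_carrier hs ht hm

-- `sideVal` is continuous with constant square away from the path and, if the ends lie on different
-- circles, away from the cut; so it is constant on connected sets there.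
omit [Finite E] in
theorem IsConcat.sideVal_eq {S : Set ℂ} (hS : IsPreconnected S) (h1 : ∀ z ∈ S, z ∈ N.annulus)
    (h2 : ∀ z ∈ S, ∀ k < Γ.len, z ∉ segment ℝ (Γ.pt k) (Γ.pt (k + 1)))
    (h3 : ¬ (N.OnOuter i ↔ N.OnOuter j) → ∀ z ∈ S, z ∉ N.cut.carrier) {x y : ℂ} (hx : x ∈ S)
    (hy : y ∈ S) : N.sideVal i j Γ x = N.sideVal i j Γ y := by
  obtain ⟨C, hC, hsq⟩ := hN.background_sq i j N.cutSight one_ne_zero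
  have hpt : ∀ z ∈ S, ∀ k ≤ Γ.len, z ≠ Γ.pt k := by
    rintro z hz k hk rfl
    have hl := h.isArc.len_pos
    rcases hk.lt_or_eq with hk | rfl
    · exact h2 _ hz k hk (left_mem_segment ℝ _ _)
    · refine h2 _ hz (Γ.len - 1) (by omega) ?_
      rw [Nat.sub_add_cancel hl]; exact right_mem_segment ℝ _ _
  have hi : ∀ z ∈ S, z ≠ N.bd i := fun z hz he =>
    hpt z hz 0 (Nat.zero_le _) (he.trans h.pt_zero.symm)
  have hj : ∀ z ∈ S, z ≠ N.bd j := fun z hz he => hpt z hz _ le_rfl (he.trans h.pt_len.symm)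
  have hcl := hN.cut_simple.len_pos ()
  have hb : ∀ z, z ∉ N.cut.carrier → z ≠ N.baseInner ∧ z ≠ N.baseOuter := by
    intro z hz
    refine ⟨?_, ?_⟩ <;> rintro rfl <;> apply hz
    · exact N.cut.pt_mem_carrier hcl (Nat.zero_le _)
    · exact N.cut.pt_mem_carrier hcl le_rfl
  refine IsPreconnected.eq_of_sq_const hS (f := N.sideVal i j Γ) (c := C) ?_ hC ?_ hx hy
  · refine (continuousOn_sightProd fun z hz k hk => h2 z hz k (Finset.mem_range.1 hk)).mul
      fun z hz => hN.continuousWithinAt_background (h1 z hz) (hi z hz) (hj z hz) fun hm => ?_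
    have := h3 hm z hz
    exact ⟨(hb z this).1, (hb z this).2, N.cutSight_ne_zero z,
      (continuousAt_cutSight this).continuousWithinAt⟩
  · intro z hz
    have e := sightProd_mul_self (c := Γ.pt) (n := Γ.len) (z := z) (hpt z hz)
    rw [h.pt_zero, h.pt_len] at e
    rw [← hsq z (h1 z hz) (hi z hz) (hj z hz) fun hm => ⟨(hb z (h3 hm z hz)).1,
      (hb z (h3 hm z hz)).2, hN.cutSight_sq (h3 hm z hz)⟩, sideVal, mul_mul_mul_comm, e]
    simp only [bd]; ring

/-- The value along an arc of a boundary circle that starts at a boundary vertex `b` is the limit at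
`b`. -/
theorem IsConcat.sideVal_arc (hP : N.IsPath i j P) {b : ℂ} (hb : ‖b‖ = N.r ∨ ‖b‖ = N.R) {s θ : ℝ}
    (h0 : 0 < θ)
    (h1 : ∀ x : ℝ, 0 < x → x ≤ θ → turnBy b (s * x) ≠ N.bd i ∧ turnBy b (s * x) ≠ N.bd j ∧
      (¬ (N.OnOuter i ↔ N.OnOuter j) →
        turnBy b (s * x) ≠ N.baseInner ∧ turnBy b (s * x) ≠ N.baseOuter))
    {L : ℂ} (hL : Tendsto (fun t : ℝ => N.sideVal i j Γ (turnBy b (s * t))) (𝓝[>] 0) (𝓝 L)) :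
    N.sideVal i j Γ (turnBy b (s * θ)) = L := by
  have hcirc : ∀ x : ℝ, ‖turnBy b (s * x)‖ = N.r ∨ ‖turnBy b (s * x)‖ = N.R := by
    intro x; rwa [norm_turnBy]
  have hrR := hN.r_lt_R
  have hpre : IsPreconnected ((fun x : ℝ => turnBy b (s * x)) '' Set.Ioc 0 θ) :=
    isPreconnected_Ioc.image _ ((continuous_turnBy b).comp (continuous_const_mul s)).continuousOn
  have hconst : ∀ x : ℝ, 0 < x → x ≤ θ →
      N.sideVal i j Γ (turnBy b (s * θ)) = N.sideVal i j Γ (turnBy b (s * x)) := by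
    intro x hx hx'
    refine h.sideVal_eq hN hpre ?_ ?_ ?_ ⟨θ, ⟨h0, le_rfl⟩, rfl⟩ ⟨x, ⟨hx, hx'⟩, rfl⟩
    · rintro _ ⟨y, -, rfl⟩
      rcases hcirc y with h2 | h2 <;> constructor <;> simp only [h2] <;> linarith
    · rintro _ ⟨y, hy, rfl⟩ k hk
      exact h.notMem_of_norm hN hP (hcirc y) (h1 y hy.1 hy.2).1 (h1 y hy.1 hy.2).2.1 hk
    · rintro hm _ ⟨y, hy, rfl⟩ hc
      rcases hN.cut_mem _ hc with h2 | h2 | h2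
      · simp only at h2
        rcases hcirc y with h3 | h3 <;> linarith [h2.1, h2.2]
      · exact ((h1 y hy.1 hy.2).2.2 hm).1 h2
      · exact ((h1 y hy.1 hy.2).2.2 hm).2 h2
  have hlt : ∀ᶠ t : ℝ in 𝓝[>] 0, 0 < t ∧ t < θ := Ioo_mem_nhdsGT h0
  refine tendsto_nhds_unique (tendsto_const_nhds.congr' ?_) hL
  filter_upwards [hlt] with t ht
  exact hconst t ht.1 ht.2.le

omit h [Finite E] in
theorem IsPerfect.continuousAt_cutPart_bd (t : Fin n) :
    ContinuousAt (N.cutPart i j N.cutSight) (N.bd t) := by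
  rw [← continuousWithinAt_univ]
  exact hN.continuousWithinAt_cutPart (hN.bd_mem t) fun _ => ⟨(hN.base_ne_bd t).1,
    (hN.base_ne_bd t).2, N.cutSight_ne_zero _,
    (continuousAt_cutSight (hN.bd_notMem_cut t)).continuousWithinAt⟩

-- The edge is transversal to the circle, so both quotients have a nonzero imaginary part.
omit hN h [Finite E] in
theorem tangent_slit {b d : ℂ} {s : ℝ} (hs : s = 1 ∨ s = -1) (hb : b ≠ 0) (hd : (d / b).re ≠ 0) :
    -d / (s * Complex.I * b) ∈ Complex.slitPlane ∧ (s * Complex.I * b) / d ∈ Complex.slitPlane := by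
  have hd0 : d ≠ 0 := by rintro rfl; simp at hd
  have key : -d / (s * Complex.I * b) = s * (Complex.I * (d / b)) := by
    have hss : (s : ℂ) * s = 1 := by rcases hs with rfl | rfl <;> norm_num
    have hs0 : (s : ℂ) ≠ 0 := by rcases hs with rfl | rfl <;> norm_num
    have := Complex.I_ne_zero
    rw [div_eq_iff (by simp [*])]
    field_simp
    linear_combination hss - (s : ℂ) ^ 2 * Complex.I_sq
  have h1 : -d / (s * Complex.I * b) ∈ Complex.slitPlane := by
    right
    rw [key]
    rcases hs with rfl | rfl <;> simpa using hd
  refine ⟨h1, ?_⟩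
  have e : (s * Complex.I * b) / d = (-(-d / (s * Complex.I * b)))⁻¹ := by
    rw [neg_div, neg_neg, inv_div]
  rw [e]
  right
  rw [Complex.inv_im, key]
  have hn : Complex.normSq (-(s * (Complex.I * (d / b)))) ≠ 0 := by
    rw [Ne, Complex.normSq_eq_zero, neg_eq_zero]
    rcases hs with rfl | rfl <;> simp [hb, hd0]
  refine div_ne_zero ?_ hn
  rcases hs with rfl | rfl <;> simpa using hd

omit [Finite E] in
/-- The limits at the initial vertex of a path along the boundary circle. -/
theorem IsConcat.tendsto_sideVal_start {p : E} (hp : p ∈ P) (hpi : N.src p = Sum.inl i)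
    (hij : i ≠ j) {c : ℂ}
    (hc : c = Γ.farProd 0 * (rimRootDir (N.bd i) (N.OnOuter i) (N.dirS p) /
        rimRoot (N.bd j) (N.OnOuter j) (N.bd i) * N.cutPart i j N.cutSight (N.bd i)))
    {s : ℝ} (hs : s = 1 ∨ s = -1) :
    Tendsto (fun t : ℝ => N.sideVal i j Γ (turnBy (N.bd i) (s * t))) (𝓝[>] 0)
      (𝓝 (halfDir (-N.dirS p / (s * Complex.I * N.bd i)) *
        rimRootDir (N.bd i) (N.OnOuter i) (s * Complex.I * N.bd i) /
        rimRootDir (N.bd i) (N.OnOuter i) (N.dirS p) * c)) := by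
  have hl := h.isArc.len_pos
  have b0 := hN.bd_ne_zero i
  have h0 : Γ.pt 0 = N.bd i := h.pt_zero
  have hd0 : Γ.dir 0 = N.dirS p := by rw [← h.dir_offset hN hp, h.offset_first hN hp hpi]
  have hbij : N.bd i ≠ N.bd j := fun he => hij (hN.bd_inj he)
  have hre : (N.dirS p / N.bd i).re ≠ 0 := by
    have := hN.inward_src hpi
    by_cases ho : N.OnOuter i
    · have := this.1 ho; rw [neg_div, Complex.neg_re] at this; linarith
    · exact (this.2 ho).ne'
  have hs0 : (s : ℂ) ≠ 0 := by rcases hs with rfl | rfl <;> norm_num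
  have hu0 : s * Complex.I * N.bd i ≠ 0 := by simp [hs0, b0]
  have hu := tendsto_turnBy (N.bd i) s
  have hpos : ∀ᶠ t : ℝ in 𝓝[>] 0, 0 < t := self_mem_nhdsWithin
  have hform : ∀ᶠ t : ℝ in 𝓝[>] 0,
      N.bd i + t * ((turnBy (N.bd i) (s * t) - N.bd i) / t) = turnBy (N.bd i) (s * t) := by
    filter_upwards [hpos] with t ht
    have : (t : ℂ) ≠ 0 := by exact_mod_cast ht.ne'
    field_simp; ring
  have hcurve := tendsto_curve (N.bd i) hu
  have leaves : ∀ k ∈ Finset.range Γ.len, Leaves (Γ.pt k) (Γ.pt (k + 1)) (N.bd i)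
      (s * Complex.I * N.bd i) := by
    intro k hk
    have hk := Finset.mem_range.1 hk
    rw [← h0]
    refine ⟨fun he => ?_, fun he => ?_, fun e1 e2 => ?_⟩
    · have := h.isArc.inj _ _ (Nat.zero_le _) hk he
      omega
    · have := h.isArc.inj _ _ (Nat.zero_le _) hk.le he
      subst this
      change -Γ.dir 0 / _ ∈ _
      rw [hd0, h0]
      exact (tangent_slit hs b0 hre).1
    · exact h.isArc.pt_notMem_segment (Nat.zero_le _) hk (fun e => e2 (by rw [e]))
        (fun e => e1 (by rw [e]))
  have t1 : Tendsto (fun t : ℝ => sightProd Γ.pt (Finset.range Γ.len)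
      (N.bd i + t * ((turnBy (N.bd i) (s * t) - N.bd i) / t))) (𝓝[>] 0)
      (𝓝 (sightProdDir Γ.pt (Finset.range Γ.len) (N.bd i) (s * Complex.I * N.bd i))) := by
    unfold sightProd sightProdDir
    exact tendsto_finsetProd _ fun k hk => tendsto_sight_curve
      (h.isArc.pt_ne_succ (Finset.mem_range.1 hk)) hu0 hu (leaves k hk)
  have eI : s * Complex.I * N.bd i / N.bd i = s * Complex.I := by field_simp
  have t2 := tendsto_rimRoot_curve (o := N.OnOuter i) b0 hu
    (fun _ => by rw [neg_div, eI]; right; rcases hs with rfl | rfl <;> simp)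
    (fun _ => by rw [eI]; right; rcases hs with rfl | rfl <;> simp)
  have t3 := (hN.continuousAt_bdRoot (hN.bd_mem i) hbij).tendsto.comp hcurve
  have t4 := (hN.continuousAt_cutPart_bd (i := i) (j := j) i).tendsto.comp hcurve
  have all := t1.mul ((t2.div t3 (rimRoot_ne_zero _ _ _)).mul t4)
  -- `b_i` is an end of chord number 0 only; the other chords form `farProd 0`.
  have hfac : sightProdDir Γ.pt (Finset.range Γ.len) (N.bd i) (s * Complex.I * N.bd i) =
      halfDir (-N.dirS p / (s * Complex.I * N.bd i)) * Γ.farProd 0 := by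
    have hins : Finset.range Γ.len = insert 0
        ((Finset.range Γ.len).filter fun k => k ≠ 0 ∧ k + 1 ≠ 0) := by
      ext k; simp only [Finset.mem_range, Finset.mem_insert, Finset.mem_filter]; omega
    rw [hins, sightProdDir, Finset.prod_insert (by simp)]
    have := h.isArc.far_dir (Nat.zero_le _) (s * Complex.I * N.bd i)
    unfold sightProdDir at this
    rw [h0] at this
    rw [this, ← h0, sightDir, if_neg (h.isArc.pt_ne_succ hl), if_pos rfl, ← hd0]
    rfl
  have hval : sightProdDir Γ.pt (Finset.range Γ.len) (N.bd i) (s * Complex.I * N.bd i) *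
      (rimRootDir (N.bd i) (N.OnOuter i) (s * Complex.I * N.bd i) /
        rimRoot (N.bd j) (N.OnOuter j) (N.bd i) * N.cutPart i j N.cutSight (N.bd i)) =
      halfDir (-N.dirS p / (s * Complex.I * N.bd i)) *
        rimRootDir (N.bd i) (N.OnOuter i) (s * Complex.I * N.bd i) /
        rimRootDir (N.bd i) (N.OnOuter i) (N.dirS p) * c := by
    rw [hfac, hc]
    have := rimRootDir_ne_zero (N.bd i) (N.OnOuter i) (N.dirS p)
    field_simp
  rw [hval] at all
  refine all.congr' ?_
  filter_upwards [hform] with t ht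
  simp only [Function.comp_apply, Pi.div_apply, ht]
  rfl

omit [Finite E] in
/-- The limits at the final vertex of a path along the boundary circle. -/
theorem IsConcat.tendsto_sideVal_end {q : E} (hq : q ∈ P) (hqj : N.tgt q = Sum.inl j)
    (hij : i ≠ j) {c : ℂ}
    (hc : c = Γ.farProd Γ.len * (rimRoot (N.bd i) (N.OnOuter i) (N.bd j) /
        rimRootDir (N.bd j) (N.OnOuter j) (-N.dirT q) * N.cutPart i j N.cutSight (N.bd j)))
    {s : ℝ} (hs : s = 1 ∨ s = -1) :
    Tendsto (fun t : ℝ => N.sideVal i j Γ (turnBy (N.bd j) (s * t))) (𝓝[>] 0)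
      (𝓝 (halfDir ((s * Complex.I * N.bd j) / N.dirT q) *
        rimRootDir (N.bd j) (N.OnOuter j) (-N.dirT q) /
        rimRootDir (N.bd j) (N.OnOuter j) (s * Complex.I * N.bd j) * c)) := by
  have hl := h.isArc.len_pos
  have b0 := hN.bd_ne_zero j
  have h0 : Γ.pt Γ.len = N.bd j := h.pt_len
  have e1 : Γ.len - 1 + 1 = Γ.len := by omega
  have hd0 : Γ.dir (Γ.len - 1) = N.dirT q := by
    rw [← h.dir_offset_last hN hq, h.offset_last hN hq hqj]
  have hbij : N.bd j ≠ N.bd i := fun he => hij (hN.bd_inj he).symm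
  have hre : (N.dirT q / N.bd j).re ≠ 0 := by
    have := hN.inward_tgt hqj
    by_cases ho : N.OnOuter j
    · have := this.1 ho; rw [neg_neg] at this; exact this.ne'
    · have := this.2 ho; rw [neg_div, Complex.neg_re] at this; linarith
  have hs0 : (s : ℂ) ≠ 0 := by rcases hs with rfl | rfl <;> norm_num
  have hu0 : s * Complex.I * N.bd j ≠ 0 := by simp [hs0, b0]
  have hu := tendsto_turnBy (N.bd j) s
  have hpos : ∀ᶠ t : ℝ in 𝓝[>] 0, 0 < t := self_mem_nhdsWithin
  have hform : ∀ᶠ t : ℝ in 𝓝[>] 0,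
      N.bd j + t * ((turnBy (N.bd j) (s * t) - N.bd j) / t) = turnBy (N.bd j) (s * t) := by
    filter_upwards [hpos] with t ht
    have : (t : ℂ) ≠ 0 := by exact_mod_cast ht.ne'
    field_simp; ring
  have hcurve := tendsto_curve (N.bd j) hu
  have leaves : ∀ k ∈ Finset.range Γ.len, Leaves (Γ.pt k) (Γ.pt (k + 1)) (N.bd j)
      (s * Complex.I * N.bd j) := by
    intro k hk
    have hk := Finset.mem_range.1 hk
    rw [← h0]
    refine ⟨fun he => ?_, fun he => ?_, fun e1 e2 => ?_⟩
    · have := h.isArc.inj _ _ le_rfl hk he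
      have hk1 : k = Γ.len - 1 := by omega
      subst hk1
      change _ / Γ.dir (Γ.len - 1) ∈ _
      rw [hd0, h0]
      exact (tangent_slit hs b0 hre).2
    · have := h.isArc.inj _ _ le_rfl hk.le he
      omega
    · exact h.isArc.pt_notMem_segment le_rfl hk (fun e => e2 (by rw [e]))
        (fun e => e1 (by rw [e]))
  have t1 : Tendsto (fun t : ℝ => sightProd Γ.pt (Finset.range Γ.len)
      (N.bd j + t * ((turnBy (N.bd j) (s * t) - N.bd j) / t))) (𝓝[>] 0)
      (𝓝 (sightProdDir Γ.pt (Finset.range Γ.len) (N.bd j) (s * Complex.I * N.bd j))) := by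
    unfold sightProd sightProdDir
    exact tendsto_finsetProd _ fun k hk => tendsto_sight_curve
      (h.isArc.pt_ne_succ (Finset.mem_range.1 hk)) hu0 hu (leaves k hk)
  have eI : s * Complex.I * N.bd j / N.bd j = s * Complex.I := by field_simp
  have t2 := tendsto_rimRoot_curve (o := N.OnOuter j) b0 hu
    (fun _ => by rw [neg_div, eI]; right; rcases hs with rfl | rfl <;> simp)
    (fun _ => by rw [eI]; right; rcases hs with rfl | rfl <;> simp)
  have t3 := (hN.continuousAt_bdRoot (hN.bd_mem j) hbij).tendsto.comp hcurve
  have t4 := (hN.continuousAt_cutPart_bd (i := i) (j := j) j).tendsto.comp hcurve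
  have all := t1.mul ((t3.div t2 (rimRootDir_ne_zero _ _ _)).mul t4)
  have hfac : sightProdDir Γ.pt (Finset.range Γ.len) (N.bd j) (s * Complex.I * N.bd j) =
      halfDir ((s * Complex.I * N.bd j) / N.dirT q) * Γ.farProd Γ.len := by
    have hins : Finset.range Γ.len = insert (Γ.len - 1)
        ((Finset.range Γ.len).filter fun k => k ≠ Γ.len ∧ k + 1 ≠ Γ.len) := by
      ext k; simp only [Finset.mem_range, Finset.mem_insert, Finset.mem_filter]; omega
    rw [hins, sightProdDir, Finset.prod_insert (by simp [e1])]
    have := h.isArc.far_dir le_rfl (s * Complex.I * N.bd j)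
    unfold sightProdDir at this
    rw [h0] at this
    rw [this, ← h0, e1, sightDir, if_pos rfl, ← hd0, Polyline.dir, e1]
  have hval : sightProdDir Γ.pt (Finset.range Γ.len) (N.bd j) (s * Complex.I * N.bd j) *
      (rimRoot (N.bd i) (N.OnOuter i) (N.bd j) /
        rimRootDir (N.bd j) (N.OnOuter j) (s * Complex.I * N.bd j) *
        N.cutPart i j N.cutSight (N.bd j)) =
      halfDir ((s * Complex.I * N.bd j) / N.dirT q) *
        rimRootDir (N.bd j) (N.OnOuter j) (-N.dirT q) /
        rimRootDir (N.bd j) (N.OnOuter j) (s * Complex.I * N.bd j) * c := by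
    rw [hfac, hc]
    have := rimRootDir_ne_zero (N.bd j) (N.OnOuter j) (-N.dirT q)
    field_simp
  rw [hval] at all
  refine all.congr' ?_
  filter_upwards [hform] with t ht
  simp only [Function.comp_apply, Pi.div_apply, ht]
  rfl

end Path

open Classical in
/-- `1` on the outer circle and `-1` on the inner circle. -/
def rimSign (N : AnnularGraph n V₀ E) (t : Fin n) : ℝ := if N.OnOuter t then 1 else -1

theorem rimSign_congr {t u : Fin n} (h : N.OnOuter t ↔ N.OnOuter u) : N.rimSign t = N.rimSign u := by
  unfold rimSign
  by_cases hu : N.OnOuter u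
  · rw [if_pos hu, if_pos (h.2 hu)]
  · rw [if_neg hu, if_neg fun ht => hu (h.1 ht)]

/-- An inward direction is within a quarter turn of the normal, where `halfDir` is compatible with
multiplication by `I` and `-I`. The direction of the edge drops out; the side and the circle remain.
-/
theorem start_scalar {b d : ℂ} {o : Prop} [Decidable o] {s : ℝ} (hs : s = 1 ∨ s = -1) (hb : b ≠ 0)
    (h1 : o → 0 < (-d / b).re) (h2 : ¬ o → 0 < (d / b).re) :
    halfDir (-d / (s * Complex.I * b)) * rimRootDir b o (s * Complex.I * b) / rimRootDir b o d =
      -Complex.I * (s * if o then 1 else -1 : ℝ) := by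
  have hI := Complex.I_ne_zero
  have e1 : -d / ((1 : ℝ) * Complex.I * b) = -Complex.I * (-d / b) ∧
      -d / ((1 : ℝ) * Complex.I * b) = Complex.I * (d / b) := by
    constructor <;> field_simp <;> simp
  have e2 : -d / ((-1 : ℝ) * Complex.I * b) = Complex.I * (-d / b) ∧
      -d / ((-1 : ℝ) * Complex.I * b) = -Complex.I * (d / b) := by
    constructor <;> field_simp <;> simp
  have e3 : -((1 : ℝ) * Complex.I * b) / b = -Complex.I ∧ (1 : ℝ) * Complex.I * b / b = Complex.I ∧
      -((-1 : ℝ) * Complex.I * b) / b = Complex.I ∧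
      ((-1 : ℝ) * Complex.I * b) / b = -Complex.I := by
    refine ⟨?_, ?_, ?_, ?_⟩ <;> field_simp <;> simp
  have key : ∀ w : ℂ, 0 < w.re →
      halfDir (-Complex.I * w) * halfDir (-Complex.I) / halfDir w = -Complex.I ∧
      halfDir (Complex.I * w) * halfDir Complex.I / halfDir w = Complex.I := by
    intro w hw
    have := halfDir_ne_zero w
    constructor
    · rw [halfDir_neg_I_mul_of_re_pos hw, mul_right_comm, halfDir_neg_I_sq]; field_simp
    · rw [halfDir_I_mul_of_re_pos hw, mul_right_comm, halfDir_I_sq]; field_simp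
  by_cases ho : o
  · have hk := key _ (h1 ho)
    simp only [rimRootDir, if_pos ho]
    rcases hs with rfl | rfl
    · rw [e1.1, e3.1, hk.1]; simp
    · rw [e2.1, e3.2.2.1, hk.2]; simp
  · have hk := key _ (h2 ho)
    simp only [rimRootDir, if_neg ho]
    rcases hs with rfl | rfl
    · rw [e1.2, e3.2.1, hk.2]; simp
    · rw [e2.2, e3.2.2.2, hk.1]; simp

/-- As `start_scalar`, with the opposite sign, because the path leaves the circle at its start and
reaches it at its end. -/
theorem end_scalar {b d : ℂ} {o : Prop} [Decidable o] {s : ℝ} (hs : s = 1 ∨ s = -1) (hb : b ≠ 0)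
    (h1 : o → 0 < (d / b).re) (h2 : ¬ o → 0 < (-d / b).re) :
    halfDir (s * Complex.I * b / d) * rimRootDir b o (-d) / rimRootDir b o (s * Complex.I * b) =
      Complex.I * (s * if o then 1 else -1 : ℝ) := by
  have hI := Complex.I_ne_zero
  have e3 : -((1 : ℝ) * Complex.I * b) / b = -Complex.I ∧ (1 : ℝ) * Complex.I * b / b = Complex.I ∧
      -((-1 : ℝ) * Complex.I * b) / b = Complex.I ∧
      ((-1 : ℝ) * Complex.I * b) / b = -Complex.I := by
    refine ⟨?_, ?_, ?_, ?_⟩ <;> field_simp <;> simp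
  have hII := halfDir_mul_inv (z := Complex.I) (by right; simp)
  rw [Complex.inv_I] at hII
  have key : ∀ w : ℂ, 0 < w.re →
      halfDir (-Complex.I * w⁻¹) * halfDir w / halfDir Complex.I = -Complex.I ∧
      halfDir (Complex.I * w⁻¹) * halfDir w / halfDir (-Complex.I) = Complex.I := by
    intro w hw
    have hw0 : w ≠ 0 := by rintro rfl; simp at hw
    have hw' : 0 < (w⁻¹).re := by
      rw [Complex.inv_re]; exact div_pos hw (Complex.normSq_pos.2 hw0)
    have hm := halfDir_mul_inv (Complex.mem_slitPlane_iff.2 (Or.inl hw))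
    constructor
    · rw [halfDir_neg_I_mul_of_re_pos hw', div_eq_iff (halfDir_ne_zero _)]
      linear_combination halfDir (-Complex.I) * hm +
        halfDir Complex.I * halfDir_neg_I_sq - halfDir (-Complex.I) * hII
    · rw [halfDir_I_mul_of_re_pos hw', div_eq_iff (halfDir_ne_zero _)]
      linear_combination halfDir Complex.I * hm +
        halfDir (-Complex.I) * halfDir_I_sq - halfDir Complex.I * hII
  by_cases ho : o
  · have hk := key _ (h1 ho)
    have hd : d ≠ 0 := by rintro rfl; simpa using h1 ho
    simp only [rimRootDir, if_pos ho, neg_neg]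
    rcases hs with rfl | rfl
    · rw [e3.1, show (1 : ℝ) * Complex.I * b / d = Complex.I * (d / b)⁻¹ by
        field_simp; simp, hk.2]; simp
    · rw [e3.2.2.1, show (-1 : ℝ) * Complex.I * b / d = -Complex.I * (d / b)⁻¹ by
        field_simp; simp, hk.1]; simp
  · have hk := key _ (h2 ho)
    have hd : d ≠ 0 := by rintro rfl; simpa using h2 ho
    simp only [rimRootDir, if_neg ho]
    rcases hs with rfl | rfl
    · rw [e3.2.1, show (1 : ℝ) * Complex.I * b / d = -Complex.I * (-d / b)⁻¹ by
        field_simp; simp, hk.1]; simp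
    · rw [e3.2.2.2, show (-1 : ℝ) * Complex.I * b / d = Complex.I * (-d / b)⁻¹ by
        field_simp; simp, hk.2]; simp

/-! ### Angles of the boundary vertices -/

open Classical in
/-- The base point of the circle of `b_t`. -/
def rimBase (N : AnnularGraph n V₀ E) (t : Fin n) : ℂ :=
  if N.OnOuter t then N.baseOuter else N.baseInner

/-- The angle of `b_t`, counterclockwise from the base point. -/
def rimAngle (N : AnnularGraph n V₀ E) (t : Fin n) : ℝ := ccw (N.rimBase t) (N.bd t)

section Angle

variable (hN : N.IsPerfect)
include hN

theorem IsPerfect.norm_rimBase (t : Fin n) : ‖N.rimBase t‖ = ‖N.bd t‖ := by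
  unfold rimBase bd
  split_ifs with h
  · rw [hN.cut_end, hN.pos_outer t h]
  · rw [hN.cut_start, hN.pos_inner t h]

theorem IsPerfect.bd_eq_turnBy (t : Fin n) : N.bd t = turnBy (N.rimBase t) (N.rimAngle t) :=
  eq_turnBy_ccw (hN.norm_rimBase t).symm

theorem IsPerfect.rimAngle_mem [Finite E] (t : Fin n) :
    0 < N.rimAngle t ∧ N.rimAngle t < 2 * Real.pi := by
  have h1 := toIcoMod_mem_Ico Real.two_pi_pos 0 ((N.bd t).arg - (N.rimBase t).arg)
  have h2 : 0 ≤ N.rimAngle t ∧ N.rimAngle t < 2 * Real.pi := by simpa [rimAngle, ccw] using h1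
  refine ⟨h2.1.lt_of_ne fun he => ?_, h2.2⟩
  have h3 := hN.bd_eq_turnBy t
  rw [← he, turnBy_zero] at h3
  have := hN.base_ne_bd t
  unfold rimBase at h3
  split_ifs at h3
  · exact this.2 h3
  · exact this.1 h3

omit hN in
theorem rimBase_congr {t u : Fin n} (h : N.OnOuter t ↔ N.OnOuter u) : N.rimBase t = N.rimBase u := by
  unfold rimBase
  by_cases hu : N.OnOuter u
  · rw [if_pos hu, if_pos (h.2 hu)]
  · rw [if_neg hu, if_neg fun ht => hu (h.1 ht)]

theorem IsPerfect.rimAngle_lt_outer {t u : Fin n} (hu : N.OnOuter u) (h : t < u) :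
    N.rimAngle t < N.rimAngle u := by
  have ht : N.OnOuter t := lt_trans (Fin.lt_def.1 h) hu
  have := hN.label_outer t u h hu
  simpa only [rimAngle, rimBase, bd, if_pos hu, if_pos ht] using this

theorem IsPerfect.rimAngle_lt_inner {t u : Fin n} (ht : ¬ N.OnOuter t) (h : t < u) :
    N.rimAngle u < N.rimAngle t := by
  have hu : ¬ N.OnOuter u := fun hu => ht (lt_trans (Fin.lt_def.1 h) hu)
  have := hN.label_inner t u h ht
  simpa only [rimAngle, rimBase, bd, if_neg hu, if_neg ht] using this

omit hN in
theorem lt_of_outer_inner {t u : Fin n} (ht : N.OnOuter t) (hu : ¬ N.OnOuter u) : t < u :=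
  Fin.lt_def.2 (lt_of_lt_of_le ht (not_lt.1 hu))

theorem IsPerfect.turnBy_bd (t u : Fin n) (h : N.OnOuter t ↔ N.OnOuter u) :
    N.bd u = turnBy (N.bd t) (N.rimAngle u - N.rimAngle t) := by
  rw [hN.bd_eq_turnBy t, ← turnBy_add, add_sub_cancel, rimBase_congr h]
  exact hN.bd_eq_turnBy u

theorem IsPerfect.turnBy_ne_base [Finite E] (t : Fin n) {x : ℝ} (h0 : 0 < N.rimAngle t + x)
    (h1 : N.rimAngle t + x < 2 * Real.pi) :
    turnBy (N.bd t) x ≠ N.baseInner ∧ turnBy (N.bd t) x ≠ N.baseOuter := by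
  have hb := hN.bd_ne_zero t
  have hnorm : ‖turnBy (N.bd t) x‖ = ‖N.bd t‖ := norm_turnBy _ _
  have key : turnBy (N.bd t) x ≠ N.rimBase t := by
    rw [hN.bd_eq_turnBy t, ← turnBy_add]
    intro he
    have h0' : N.rimBase t ≠ 0 := by
      rw [← norm_ne_zero_iff, hN.norm_rimBase]; exact norm_ne_zero_iff.2 hb
    have := turnBy_inj h0' (x := N.rimAngle t + x) (y := 0)
      (by rw [sub_zero, abs_of_pos h0]; exact h1) (by rw [turnBy_zero]; exact he)
    linarith
  have hrR := hN.r_lt_R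
  by_cases ho : N.OnOuter t
  · rw [rimBase, if_pos ho] at key
    refine ⟨fun he => ?_, key⟩
    rw [he, hN.cut_start, bd, hN.pos_outer t ho] at hnorm
    linarith
  · rw [rimBase, if_neg ho] at key
    refine ⟨key, fun he => ?_⟩
    rw [he, hN.cut_end, bd, hN.pos_inner t ho] at hnorm
    linarith

theorem IsPerfect.turnBy_ne_bd_of_ne (t u : Fin n) (h : ¬ (N.OnOuter t ↔ N.OnOuter u)) (x : ℝ) :
    turnBy (N.bd t) x ≠ N.bd u := by
  intro he
  have hnorm : ‖turnBy (N.bd t) x‖ = ‖N.bd t‖ := norm_turnBy _ _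
  have hrR := hN.r_lt_R
  rw [he, bd, bd] at hnorm
  by_cases ho : N.OnOuter t <;> by_cases hu : N.OnOuter u
  · exact h (by simp [ho, hu])
  · rw [hN.pos_outer t ho, hN.pos_inner u hu] at hnorm; linarith
  · rw [hN.pos_inner t ho, hN.pos_outer u hu] at hnorm; linarith
  · exact h (by simp [ho, hu])

end Angle

/-! ### The side on which a boundary vertex lies -/

section Boundary

variable [Finite E] {i j : Fin n} {P : List E} {Γ : Polyline} {o : E → ℕ} (hN : N.IsPerfect)
  (hP : N.IsPath i j P) (h : N.IsConcat i j P Γ o) {p q : E} (hp : p ∈ P)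
  (hpi : N.src p = Sum.inl i) (hq : q ∈ P) (hqj : N.tgt q = Sum.inl j) (hij : i ≠ j) {c : ℂ}
  (hc : c = Γ.farProd 0 * (rimRootDir (N.bd i) (N.OnOuter i) (N.dirS p) /
        rimRoot (N.bd j) (N.OnOuter j) (N.bd i) * N.cutPart i j N.cutSight (N.bd i)))
  (hc' : c = Γ.farProd Γ.len * (rimRoot (N.bd i) (N.OnOuter i) (N.bd j) /
        rimRootDir (N.bd j) (N.OnOuter j) (-N.dirT q) * N.cutPart i j N.cutSight (N.bd j)))

include hN hP h hij

section Start
include hp hpi hc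

/-- The limit at `b_i` is kept along the circle up to the other end of the path or, for ends on
different circles, up to the base point of the cut. -/
theorem IsConcat.sideVal_start {s θ : ℝ} (hs : s = 1 ∨ s = -1) (h0 : 0 < θ)
    (h1 : θ < 2 * Real.pi) (h2 : ∀ x : ℝ, 0 < x → x ≤ θ → turnBy (N.bd i) (s * x) ≠ N.bd j)
    (h3 : ¬ (N.OnOuter i ↔ N.OnOuter j) → 0 < N.rimAngle i + s * θ ∧
      N.rimAngle i + s * θ < 2 * Real.pi) :
    N.sideVal i j Γ (turnBy (N.bd i) (s * θ)) = -Complex.I * (s * N.rimSign i : ℝ) * c := by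
  have hnorm : ‖N.bd i‖ = N.r ∨ ‖N.bd i‖ = N.R := by
    by_cases ho : N.OnOuter i
    · right; exact hN.pos_outer i ho
    · left; exact hN.pos_inner i ho
  have hlim := h.tendsto_sideVal_start hN hp hpi hij hc hs
  classical
  rw [start_scalar hs (hN.bd_ne_zero i) (hN.inward_src hpi).1 (hN.inward_src hpi).2] at hlim
  have key := h.sideVal_arc hN hP hnorm h0 (s := s) ?_ hlim
  · rw [key, rimSign]
  · intro x hx hx'
    have habs : |s * x| = x := by
      rcases hs with rfl | rfl
      · rw [one_mul, abs_of_pos hx]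
      · rw [neg_one_mul, abs_neg, abs_of_pos hx]
    refine ⟨fun he => ?_, h2 x hx hx', fun hm => ?_⟩
    · have := turnBy_inj (hN.bd_ne_zero i) (x := s * x) (y := 0)
        (by rw [sub_zero, habs]; linarith) (by rw [turnBy_zero]; exact he)
      rw [this, abs_zero] at habs; linarith
    · have ha := hN.rimAngle_mem i
      have hb := h3 hm
      rcases hs with rfl | rfl
      · exact hN.turnBy_ne_base i (by linarith) (by linarith)
      · exact hN.turnBy_ne_base i (by linarith) (by linarith)

end Start

section End
include hq hqj hc'

theorem IsConcat.sideVal_end {s θ : ℝ} (hs : s = 1 ∨ s = -1) (h0 : 0 < θ)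
    (h1 : θ < 2 * Real.pi) (h2 : ∀ x : ℝ, 0 < x → x ≤ θ → turnBy (N.bd j) (s * x) ≠ N.bd i)
    (h3 : ¬ (N.OnOuter i ↔ N.OnOuter j) → 0 < N.rimAngle j + s * θ ∧
      N.rimAngle j + s * θ < 2 * Real.pi) :
    N.sideVal i j Γ (turnBy (N.bd j) (s * θ)) = Complex.I * (s * N.rimSign j : ℝ) * c := by
  have hnorm : ‖N.bd j‖ = N.r ∨ ‖N.bd j‖ = N.R := by
    by_cases ho : N.OnOuter j
    · right; exact hN.pos_outer j ho
    · left; exact hN.pos_inner j ho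
  have hlim := h.tendsto_sideVal_end hN hq hqj hij hc' hs
  classical
  have hin := hN.inward_tgt hqj
  rw [neg_neg] at hin
  rw [end_scalar hs (hN.bd_ne_zero j) hin.1 hin.2] at hlim
  have key := h.sideVal_arc hN hP hnorm h0 (s := s) ?_ hlim
  · rw [key, rimSign]
  · intro x hx hx'
    have habs : |s * x| = x := by
      rcases hs with rfl | rfl
      · rw [one_mul, abs_of_pos hx]
      · rw [neg_one_mul, abs_neg, abs_of_pos hx]
    refine ⟨h2 x hx hx', fun he => ?_, fun hm => ?_⟩
    · have := turnBy_inj (hN.bd_ne_zero j) (x := s * x) (y := 0)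
        (by rw [sub_zero, habs]; linarith) (by rw [turnBy_zero]; exact he)
      rw [this, abs_zero] at habs; linarith
    · have ha := hN.rimAngle_mem j
      have hb := h3 hm
      rcases hs with rfl | rfl
      · exact hN.turnBy_ne_base j (by linarith) (by linarith)
      · exact hN.turnBy_ne_base j (by linarith) (by linarith)

end End

section Both
include hp hpi hc hq hqj hc'

/-- The values on the circle of both ends of a path, at the angle `x` from the base point. -/
theorem IsConcat.sideVal_same (hs : N.OnOuter i ↔ N.OnOuter j) {x : ℝ} (hx0 : 0 ≤ x)
    (hx1 : x < 2 * Real.pi) (hxi : x ≠ N.rimAngle i) (hxj : x ≠ N.rimAngle j) :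
    N.sideVal i j Γ (turnBy (N.rimBase i) x) =
      -Complex.I * (N.rimSign i * (if (N.rimAngle i < x ∧ x < N.rimAngle j) ∨
        (x < N.rimAngle j ∧ N.rimAngle j < N.rimAngle i) ∨
        (N.rimAngle j < N.rimAngle i ∧ N.rimAngle i < x) then 1 else -1) : ℝ) * c := by
  have hai := hN.rimAngle_mem i
  have haj := hN.rimAngle_mem j
  have hsign : N.rimSign j = N.rimSign i := rimSign_congr hs.symm
  have hbi := hN.bd_eq_turnBy i
  have hbj := hN.bd_eq_turnBy j
  rw [← rimBase_congr hs] at hbj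
  have hb0 : N.rimBase i ≠ 0 := by
    rw [← norm_ne_zero_iff, hN.norm_rimBase]; exact norm_ne_zero_iff.2 (hN.bd_ne_zero i)
  have haij : N.rimAngle i ≠ N.rimAngle j := fun he => by
    rw [he, ← hbj] at hbi; exact hij (hN.bd_inj hbi)
  have avoid : ∀ a y A : ℝ, a < A → A < a + 2 * Real.pi → 0 < y → a + y < A →
      turnBy (N.rimBase i) (a + y) ≠ turnBy (N.rimBase i) A := by
    intro a y A h1 h2 h3 h4 he
    have := turnBy_inj hb0 (by rw [abs_lt]; constructor <;> linarith) he
    linarith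
  have start : ∀ θ A : ℝ, 0 < θ → N.rimAngle i + θ < A → A < N.rimAngle i + 2 * Real.pi →
      turnBy (N.rimBase i) A = N.bd j →
      N.sideVal i j Γ (turnBy (N.rimBase i) (N.rimAngle i + θ)) =
        -Complex.I * (N.rimSign i : ℝ) * c := by
    intro θ A h1 h2 h3 h4
    have := h.sideVal_start hN hP hp hpi hij hc (s := 1) (θ := θ) (Or.inl rfl) h1 (by linarith) ?_
      (fun hm => absurd hs hm)
    · rwa [one_mul, one_mul, hbi, ← turnBy_add] at this
    · intro y hy hy'
      rw [one_mul, hbi, ← turnBy_add, ← h4]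
      exact avoid _ _ _ (by linarith) h3 hy (by linarith)
  have endd : ∀ θ A : ℝ, 0 < θ → N.rimAngle j + θ < A → A < N.rimAngle j + 2 * Real.pi →
      turnBy (N.rimBase i) A = N.bd i →
      N.sideVal i j Γ (turnBy (N.rimBase i) (N.rimAngle j + θ)) =
        Complex.I * (N.rimSign i : ℝ) * c := by
    intro θ A h1 h2 h3 h4
    have := h.sideVal_end hN hP hq hqj hij hc' (s := 1) (θ := θ) (Or.inl rfl) h1 (by linarith) ?_
      (fun hm => absurd hs hm)
    · rwa [one_mul, one_mul, hbj, ← turnBy_add, hsign] at this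
    · intro y hy hy'
      rw [one_mul, hbj, ← turnBy_add, ← h4]
      exact avoid _ _ _ (by linarith) h3 hy (by linarith)
  have hbi' : turnBy (N.rimBase i) (N.rimAngle i + 2 * Real.pi) = N.bd i := by
    rw [turnBy_two_pi, hbi]
  have hbj' : turnBy (N.rimBase i) (N.rimAngle j + 2 * Real.pi) = N.bd j := by
    rw [turnBy_two_pi, hbj]
  have two : ∀ a : ℝ, turnBy (N.rimBase i) (a + (x + 2 * Real.pi - a)) = turnBy (N.rimBase i) x := by
    intro a; rw [add_sub_cancel, turnBy_two_pi]
  have one : ∀ a : ℝ, turnBy (N.rimBase i) (a + (x - a)) = turnBy (N.rimBase i) x := by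
    intro a; rw [add_sub_cancel]
  -- The condition means that the point lies on the counterclockwise arc from `b_i` to `b_j`. It is
  -- then reached from `b_i`, otherwise from `b_j` with the opposite sign; if the arc passes the
  -- base point, 2π is added to an angle.
  split_ifs with hcyc
  · rw [mul_one]
    rcases hcyc with ⟨h1, h2⟩ | ⟨h1, h2⟩ | ⟨h1, h2⟩
    · rw [← one (N.rimAngle i)]
      exact start _ _ (by linarith) (by linarith) (by linarith) hbj.symm
    · rw [← two (N.rimAngle i)]
      exact start _ _ (by linarith) (by linarith) (by linarith) hbj'
    · rw [← one (N.rimAngle i)]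
      exact start _ _ (by linarith) (by linarith) (by linarith) hbj'
  · push_cast
    have e : -Complex.I * (N.rimSign i * (-1 : ℂ)) * c = Complex.I * (N.rimSign i : ℝ) * c := by ring
    rw [e]
    rcases lt_or_gt_of_ne hxi with h1 | h1 <;> rcases lt_or_gt_of_ne hxj with h2 | h2 <;>
    rcases lt_or_gt_of_ne haij with h3 | h3
    · rw [← two (N.rimAngle j)]
      exact endd _ _ (by linarith) (by linarith) (by linarith) hbi'
    · exact absurd (Or.inr (Or.inl ⟨h2, h3⟩)) hcyc
    · linarith
    · rw [← one (N.rimAngle j)]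
      exact endd _ _ (by linarith) (by linarith) (by linarith) hbi.symm
    · exact absurd (Or.inl ⟨h1, h2⟩) hcyc
    · linarith
    · rw [← one (N.rimAngle j)]
      exact endd _ _ (by linarith) (by linarith) (by linarith) hbi'
    · exact absurd (Or.inr (Or.inr ⟨h3, h1⟩)) hcyc

/-- The values at the boundary vertices: the sign depends on the cyclic order of the labels. -/
theorem IsConcat.sideVal_bd (hcut : N.AvoidsCut P) {t : Fin n} (hti : t ≠ i) (htj : t ≠ j) :
    N.sideVal i j Γ (N.bd t) =
      -Complex.I * (if (i < t ∧ t < j) ∨ (t < j ∧ j < i) ∨ (j < i ∧ i < t) then 1 else -1) * c := by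
  have hai := hN.rimAngle_mem i
  have haj := hN.rimAngle_mem j
  have hat := hN.rimAngle_mem t
  have hinj : ∀ u v : Fin n, u ≠ v → (N.OnOuter u ↔ N.OnOuter v) → N.rimAngle u ≠ N.rimAngle v := by
    intro u v huv ho he
    have h1 := hN.bd_eq_turnBy u
    rw [he, rimBase_congr ho, ← hN.bd_eq_turnBy v] at h1
    exact huv (hN.bd_inj h1)
  have lt_out : ∀ u v : Fin n, N.OnOuter u → N.OnOuter v → (N.rimAngle u < N.rimAngle v ↔ u < v) := by
    intro u v hu hv
    refine ⟨fun hlt => ?_, hN.rimAngle_lt_outer hv⟩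
    rcases lt_trichotomy u v with h1 | rfl | h1
    · exact h1
    · exact absurd hlt (lt_irrefl _)
    · exact absurd (hN.rimAngle_lt_outer hu h1) hlt.le.not_gt
  have lt_in : ∀ u v : Fin n, ¬ N.OnOuter u → ¬ N.OnOuter v →
      (N.rimAngle u < N.rimAngle v ↔ v < u) := by
    intro u v hu hv
    refine ⟨fun hlt => ?_, hN.rimAngle_lt_inner hv⟩
    rcases lt_trichotomy u v with h1 | rfl | h1
    · exact absurd (hN.rimAngle_lt_inner hu h1) hlt.le.not_gt
    · exact absurd hlt (lt_irrefl _)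
    · exact h1
  by_cases hs : N.OnOuter i ↔ N.OnOuter j
  · -- both ends on the same circle
    have main : ∀ x : ℝ, 0 ≤ x → x < 2 * Real.pi → x ≠ N.rimAngle i → x ≠ N.rimAngle j → _ :=
      fun x => h.sideVal_same hN hP hp hpi hq hqj hij hc hc' hs (x := x)
    by_cases hst : N.OnOuter i ↔ N.OnOuter t
    · have key := main (N.rimAngle t) hat.1.le hat.2 (hinj t i hti hst.symm)
        (hinj t j htj (hst.symm.trans hs))
      rw [rimBase_congr hst, ← hN.bd_eq_turnBy t] at key
      rw [key]
      by_cases ho : N.OnOuter i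
      · have hoj := hs.1 ho
        have hot := hst.1 ho
        simp only [lt_out _ _ ho hot, lt_out _ _ hot hoj, lt_out _ _ hoj ho, rimSign, if_pos ho]
        split_ifs <;> simp
      · have hoj := fun hh => ho (hs.2 hh)
        have hot := fun hh => ho (hst.2 hh)
        simp only [lt_in _ _ ho hot, lt_in _ _ hot hoj, lt_in _ _ hoj ho, rimSign, if_neg ho]
        -- Labels run clockwise on the inner circle, which reverses the cyclic order; `rimSign` is
        -- -1 there and compensates for it.
        have e : ((t < i ∧ j < t) ∨ (j < t ∧ i < j) ∨ (i < j ∧ t < i)) ↔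
            ¬ ((i < t ∧ t < j) ∨ (t < j ∧ j < i) ∨ (j < i ∧ i < t)) := by
          simp only [Fin.lt_def]
          have := Fin.val_ne_of_ne hti
          have := Fin.val_ne_of_ne htj
          have := Fin.val_ne_of_ne hij
          omega
        simp only [e]
        split_ifs <;> simp
    · -- along the other circle to the cut, and along the cut
      have key := main 0 le_rfl Real.two_pi_pos hai.1.ne haj.1.ne
      rw [turnBy_zero] at key
      have avoid : ∀ z ∈ N.cut.carrier, ∀ k < Γ.len, z ∉ segment ℝ (Γ.pt k) (Γ.pt (k + 1)) := by
        intro z hz k hk hm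
        obtain ⟨f, hf, hsub⟩ := h.seg_subset hk
        exact Set.disjoint_left.1 (hcut f hf) (hsub hm) hz
      have hcm : ∀ z ∈ N.cut.carrier, z ∈ N.annulus := by
        intro z hz
        rcases hN.cut_mem z hz with h1 | rfl | rfl
        · exact ⟨h1.1.le, h1.2.le⟩
        · exact hN.baseInner_mem
        · exact hN.baseOuter_mem
      have hcl := hN.cut_simple.len_pos ()
      have hin : N.baseInner ∈ N.cut.carrier := N.cut.pt_mem_carrier hcl (Nat.zero_le _)
      have hout : N.baseOuter ∈ N.cut.carrier := N.cut.pt_mem_carrier hcl le_rfl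
      have hbase : ∀ u, N.rimBase u ∈ N.cut.carrier := by
        intro u; unfold rimBase; split_ifs <;> assumption
      have e1 : N.sideVal i j Γ (N.rimBase t) = N.sideVal i j Γ (N.rimBase i) :=
        h.sideVal_eq hN (Polyline.isPreconnected_carrier _) hcm avoid (fun hm => absurd hs hm)
          (hbase t) (hbase i)
      have e2 : N.sideVal i j Γ (N.bd t) = N.sideVal i j Γ (N.rimBase t) := by
        have hpre : IsPreconnected ((fun x : ℝ => turnBy (N.bd t) x) '' Set.univ) :=
          isPreconnected_univ.image _ (continuous_turnBy _).continuousOn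
        have hnorm : ∀ x : ℝ, ‖turnBy (N.bd t) x‖ = N.r ∨ ‖turnBy (N.bd t) x‖ = N.R := by
          intro x
          rw [norm_turnBy]
          by_cases ho : N.OnOuter t
          · right; exact hN.pos_outer t ho
          · left; exact hN.pos_inner t ho
        have hrR := hN.r_lt_R
        refine h.sideVal_eq hN hpre ?_ ?_ (fun hm => absurd hs hm)
          ⟨0, trivial, turnBy_zero _⟩ ⟨-N.rimAngle t, trivial, ?_⟩
        · rintro _ ⟨y, -, rfl⟩
          rcases hnorm y with h2 | h2 <;> constructor <;> simp only [h2] <;> linarith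
        · rintro _ ⟨y, -, rfl⟩ k hk
          exact h.notMem_of_norm hN hP (hnorm y)
            (hN.turnBy_ne_bd_of_ne t i (fun hh => hst hh.symm) y)
            (hN.turnBy_ne_bd_of_ne t j (fun hh => hst (hs.trans hh.symm)) y) hk
        · change turnBy (N.bd t) _ = _
          rw [hN.bd_eq_turnBy t, ← turnBy_add, add_neg_cancel, turnBy_zero]
      rw [e2, e1, key]
      have n1 : ¬ N.rimAngle i < 0 := hai.1.le.not_gt
      by_cases ho : N.OnOuter i
      · have hoj := hs.1 ho
        have hot := fun hh => hst ⟨fun _ => hh, fun _ => ho⟩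
        have l1 := lt_of_outer_inner ho hot
        have l2 := lt_of_outer_inner hoj hot
        simp only [n1, haj.1, lt_out _ _ hoj ho, rimSign, if_pos ho, l1, l2.not_gt]
        rcases lt_or_gt_of_ne hij with h1 | h1
        · simp [h1.not_gt]
        · simp [h1]
      · have hoj := fun hh => ho (hs.2 hh)
        have hot : N.OnOuter t := by by_contra hh; exact hst (by simp [ho, hh])
        have l1 := lt_of_outer_inner hot ho
        have l2 := lt_of_outer_inner hot hoj
        simp only [n1, haj.1, lt_in _ _ hoj ho, rimSign, if_neg ho, l1.not_gt, l2]
        rcases lt_or_gt_of_ne hij with h1 | h1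
        · simp [h1, h1.not_gt]
        · simp [h1, h1.not_gt]
  -- With ends on different circles, `t` shares its circle with exactly one of them and is reached
  -- from it without passing the base point; `s` is the sense of travel.
  · have start : ∀ s : ℝ, (s = 1 ∨ s = -1) → (N.OnOuter i ↔ N.OnOuter t) →
        0 < s * (N.rimAngle t - N.rimAngle i) →
        N.sideVal i j Γ (N.bd t) = -Complex.I * (s * N.rimSign i : ℝ) * c := by
      intro s hs1 hst hpos
      have e : s * (s * (N.rimAngle t - N.rimAngle i)) = N.rimAngle t - N.rimAngle i := by
        rcases hs1 with rfl | rfl <;> ring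
      have := h.sideVal_start hN hP hp hpi hij hc hs1 hpos
        (by rcases hs1 with rfl | rfl <;> linarith)
        (fun x _ _ => hN.turnBy_ne_bd_of_ne i j hs _) (fun _ => by rw [e]; constructor <;> linarith)
      rwa [e, ← hN.turnBy_bd i t hst] at this
    have endd : ∀ s : ℝ, (s = 1 ∨ s = -1) → (N.OnOuter j ↔ N.OnOuter t) →
        0 < s * (N.rimAngle t - N.rimAngle j) →
        N.sideVal i j Γ (N.bd t) = Complex.I * (s * N.rimSign j : ℝ) * c := by
      intro s hs1 hst hpos
      have e : s * (s * (N.rimAngle t - N.rimAngle j)) = N.rimAngle t - N.rimAngle j := by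
        rcases hs1 with rfl | rfl <;> ring
      have := h.sideVal_end hN hP hq hqj hij hc' hs1 hpos
        (by rcases hs1 with rfl | rfl <;> linarith)
        (fun x _ _ => hN.turnBy_ne_bd_of_ne j i (fun hh => hs hh.symm) _)
        (fun _ => by rw [e]; constructor <;> linarith)
      rwa [e, ← hN.turnBy_bd j t hst] at this
    have sgn : ∀ a b : Fin n, N.rimAngle a ≠ N.rimAngle b →
        (N.rimAngle a < N.rimAngle b ∧ 0 < (1 : ℝ) * (N.rimAngle b - N.rimAngle a)) ∨
        (N.rimAngle b < N.rimAngle a ∧ 0 < (-1 : ℝ) * (N.rimAngle b - N.rimAngle a)) := by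
      intro a b hab
      rcases lt_or_gt_of_ne hab with h1 | h1
      · left; constructor <;> linarith
      · right; constructor <;> linarith
    by_cases ho : N.OnOuter i <;> by_cases hoj : N.OnOuter j
    · exact absurd (by simp [ho, hoj]) hs
    · have lij := lt_of_outer_inner ho hoj
      by_cases hot : N.OnOuter t
      · have ltj := lt_of_outer_inner hot hoj
        have hst : N.OnOuter i ↔ N.OnOuter t := by simp [ho, hot]
        rcases sgn i t (hinj i t hti.symm hst) with ⟨h1, h2⟩ | ⟨h1, h2⟩
        · rw [start _ (Or.inl rfl) hst h2]
          simp [rimSign, ho, (lt_out _ _ ho hot).1 h1, ltj]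
        · rw [start _ (Or.inr rfl) hst h2]
          simp [rimSign, ho, ((lt_out _ _ hot ho).1 h1).not_gt, lij.not_gt]
      · have lit := lt_of_outer_inner ho hot
        have hst : N.OnOuter j ↔ N.OnOuter t := by simp [hoj, hot]
        rcases sgn j t (hinj j t htj.symm hst) with ⟨h1, h2⟩ | ⟨h1, h2⟩
        · rw [endd _ (Or.inl rfl) hst h2]
          simp [rimSign, hoj, (lt_in _ _ hoj hot).1 h1, lit]
        · rw [endd _ (Or.inr rfl) hst h2]
          simp [rimSign, hoj, ((lt_in _ _ hot hoj).1 h1).not_gt, lij.not_gt]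
    · have lji := lt_of_outer_inner hoj ho
      by_cases hot : N.OnOuter t
      · have lti := lt_of_outer_inner hot ho
        have hst : N.OnOuter j ↔ N.OnOuter t := by simp [hoj, hot]
        rcases sgn j t (hinj j t htj.symm hst) with ⟨h1, h2⟩ | ⟨h1, h2⟩
        · rw [endd _ (Or.inl rfl) hst h2]
          simp [rimSign, hoj, ((lt_out _ _ hoj hot).1 h1).not_gt, lti.not_gt]
        · rw [endd _ (Or.inr rfl) hst h2]
          simp [rimSign, hoj, (lt_out _ _ hot hoj).1 h1, lji]
      · have ljt := lt_of_outer_inner hoj hot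
        have hst : N.OnOuter i ↔ N.OnOuter t := by simp [ho, hot]
        rcases sgn i t (hinj i t hti.symm hst) with ⟨h1, h2⟩ | ⟨h1, h2⟩
        · rw [start _ (Or.inl rfl) hst h2]
          simp [rimSign, ho, ((lt_in _ _ ho hot).1 h1).not_gt, ljt.not_gt]
        · rw [start _ (Or.inr rfl) hst h2]
          simp [rimSign, ho, (lt_in _ _ hot ho).1 h1, lji]
    · exact absurd (by simp [ho, hoj]) hs

end Both

end Boundary

end AnnularGraph

end AnnularNet

end

noncomputable section

namespace AnnularNet

theorem inv_mem_slitPlane {z : ℂ} (hz : z ∈ Complex.slitPlane) : z⁻¹ ∈ Complex.slitPlane := by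
  rw [Complex.mem_slitPlane_iff_arg] at hz ⊢
  rw [Complex.arg_inv, if_neg hz.1]
  refine ⟨fun h => ?_, inv_ne_zero hz.2⟩
  have := Complex.neg_pi_lt_arg z
  linarith

/-! ### The total turning of a list of pieces -/

/-- The list of pieces has no cusps, it starts in the direction `a`, ends in the direction `b`, and
`T` is half of its total turning. -/
inductive Run : List Piece → ℂ → ℂ → ℂ → Prop
  | single (p : Piece) : Run [p] p.tStart p.tEnd p.halfTurn
  | cons (p : Piece) {L : List Piece} {a b T : ℂ} (h : Run L a b T) (hp : NoCusp p.tEnd a) :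
      Run (p :: L) p.tStart b (p.halfTurn * halfDir (a / p.tEnd) * T)

theorem Run.congr {C : List Piece} {a b T T' : ℂ} (h : Run C a b T) (hT : T' = T) :
    Run C a b T' := hT ▸ h

theorem Run.append {C C' : List Piece} {a b T a' b' T' : ℂ} (h : Run C a b T) (h' : Run C' a' b' T')
    (hb : NoCusp b a') : Run (C ++ C') a b' (T * halfDir (a' / b) * T') := by
  induction h with
  | single p => exact Run.cons p h' hb
  | cons p _ hp ih =>
    have := Run.cons p (ih hb) hp
    rw [List.cons_append]
    convert this using 1
    ring

theorem Run.smooth {p q : Piece} {L : List Piece} {a b T : ℂ} (h : Run (p :: L) a b T)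
    (hq : NoCusp b q.tStart) : a = p.tStart ∧ Smooth p (L ++ [q]) ∧
      p.halfTurn * turnAfter p (L ++ [q]) = T * halfDir (q.tStart / b) * q.halfTurn := by
  induction L generalizing p a T with
  | nil =>
    cases h with
    | single => simp [Smooth, hq, turnAfter, mul_assoc]
    | cons _ h => cases h
  | cons p' L ih =>
    cases h with
    | cons _ h hp =>
      obtain ⟨rfl, h1, h2⟩ := ih h
      refine ⟨rfl, ⟨hp, h1⟩, ?_⟩
      rw [List.cons_append, turnAfter]
      linear_combination p.halfTurn * halfDir (p'.tStart / p.tEnd) * h2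

theorem Piece.halfTurn_ne_zero (p : Piece) : p.halfTurn ≠ 0 := by
  cases p with
  | seg => exact one_ne_zero
  | arc => exact Complex.exp_ne_zero _

/-- A `Run` records the directions at both of its ends and composes under concatenation, so the path
and the closing curve can be treated separately. The last factor is the corner that closes the
curve. -/
theorem Run.parity_concordance {C : List Piece} {a b T : ℂ} (h : Run C a b T) (hb : NoCusp b a) :
    parity (concordance C) = T * halfDir (a / b) := by
  rcases C with _ | ⟨p, L⟩
  · cases h
  have ha : a = p.tStart := by cases h <;> rfl
  subst ha
  obtain ⟨-, h1, h2⟩ := h.smooth hb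
  rw [AnnularNet.parity_concordance p L h1]
  have := p.halfTurn_ne_zero
  apply mul_left_cancel₀ this
  rw [h2]; ring

/-- Half of the total turning of a polygonal curve. -/
def Polyline.turn (γ : Polyline) : ℂ :=
  ∏ k ∈ Finset.range (γ.len - 1), halfDir (γ.dir (k + 1) / γ.dir k)

theorem Polyline.turn_ne_zero (γ : Polyline) : γ.turn ≠ 0 :=
  Finset.prod_ne_zero_iff.2 fun _ _ => halfDir_ne_zero _

theorem Polyline.run_pieces {γ : Polyline} (hl : 0 < γ.len)
    (h : ∀ k, k + 1 < γ.len → γ.dir (k + 1) / γ.dir k ∈ Complex.slitPlane) :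
    Run γ.pieces (γ.dir 0) (γ.dir (γ.len - 1)) γ.turn := by
  obtain ⟨m, hm⟩ : ∃ m, γ.len = m + 1 := ⟨γ.len - 1, by omega⟩
  have aux : ∀ m, m + 1 ≤ γ.len → Run ((List.range (m + 1)).map fun k => 
      Piece.seg (γ.pt k) (γ.pt (k + 1))) (γ.dir 0) (γ.dir m)
      (∏ k ∈ Finset.range m, halfDir (γ.dir (k + 1) / γ.dir k)) := by
    intro m
    induction m with
    | zero => intro _; exact Run.single (Piece.seg (γ.pt 0) (γ.pt (0 + 1)))
    | succ m ih =>
      intro hm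
      rw [List.range_succ, List.map_append, Finset.prod_range_succ]
      have := (ih (by omega)).append (Run.single (Piece.seg (γ.pt (m + 1)) (γ.pt (m + 1 + 1))))
        (noCusp_of_mem_slitPlane (h m hm))
      simp only [Piece.halfTurn, mul_one] at this
      exact this
  have := aux m hm.ge
  rw [Polyline.pieces, Polyline.turn, hm]
  exact this

/-- Reversal lists the corners backwards and inverts the turning at each of them. -/
theorem Polyline.turn_rev {γ : Polyline}
    (h : ∀ k, k + 1 < γ.len → γ.dir (k + 1) / γ.dir k ∈ Complex.slitPlane) :
    γ.rev.turn * γ.turn = 1 := by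
  unfold Polyline.turn
  change (∏ k ∈ Finset.range (γ.len - 1), _) * _ = 1
  rw [← Finset.prod_range_reflect, ← Finset.prod_mul_distrib]
  refine Finset.prod_eq_one fun k hk => ?_
  have hk := Finset.mem_range.1 hk
  rw [Polyline.rev_dir _ (by omega), Polyline.rev_dir _ (by omega)]
  have e1 : γ.len - 1 - (γ.len - 1 - 1 - k + 1) = k := by omega
  have e2 : γ.len - 1 - (γ.len - 1 - 1 - k) = k + 1 := by omega
  rw [e1, e2, neg_div_neg_eq, ← inv_div, mul_comm]
  exact halfDir_mul_inv (h k (by omega))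

/-- The tangent turns by `y - x`, and by 2π more if the arc passes the base point; half of a full
turn is -1. -/
theorem halfTurn_arc {β : ℂ} (hβ : β ≠ 0) {x y : ℝ} (hx0 : 0 ≤ x) (hx : x < 2 * Real.pi)
    (hy0 : 0 ≤ y) (hy : y < 2 * Real.pi) :
    (Piece.arc (turnBy β x) (turnBy β y)).halfTurn =
      (if x ≤ y then 1 else -1) * (Complex.exp (-((x / 2 : ℝ) * Complex.I)) *
        Complex.exp ((y / 2 : ℝ) * Complex.I)) := by
  have key : ∀ θ : ℝ, 0 ≤ θ → θ < 2 * Real.pi → turnBy β y = turnBy (turnBy β x) θ →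
      ccw (Complex.I * turnBy β x) (Complex.I * turnBy β y) = θ := by
    intro θ h0 h1 he
    have hne : Complex.I * turnBy β x ≠ 0 :=
      mul_ne_zero Complex.I_ne_zero (by rw [← norm_ne_zero_iff, norm_turnBy]; simpa using hβ)
    have h2 := eq_turnBy_ccw (z := Complex.I * turnBy β x) (x := Complex.I * turnBy β y)
      (by simp [norm_turnBy])
    have h3 := ccw_mem (Complex.I * turnBy β x) (Complex.I * turnBy β y)
    refine turnBy_inj hne (by rw [abs_lt]; constructor <;> linarith) ?_
    rw [← h2, he]; unfold turnBy; ring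
  unfold Piece.halfTurn
  simp only
  split_ifs with h
  · rw [key (y - x) (by linarith) (by linarith) (by rw [← turnBy_add, add_sub_cancel]),
      ← Complex.exp_add, one_mul]
    congr 1; push_cast; ring
  · push Not at h
    rw [key (y - x + 2 * Real.pi) (by linarith) (by linarith)
      (by rw [← turnBy_add, ← add_assoc, add_sub_cancel, turnBy_two_pi]), ← Complex.exp_add,
      ← Complex.exp_pi_mul_I, ← Complex.exp_add]
    congr 1; push_cast; ring

namespace AnnularGraph

variable {n : ℕ} {V₀ E : Type*} {N : AnnularGraph n V₀ E}

/-! ### The turning of a path -/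

/-- Half of the total turning of an edge. -/
def turn (N : AnnularGraph n V₀ E) (e : E) : ℂ := (N.curve e).turn

/-- Half of the total turning of the path that starts with the edge `e` and continues with the edges
of a list. -/
def pathTurn (N : AnnularGraph n V₀ E) : E → List E → ℂ
  | e, [] => N.turn e
  | e, f :: p => N.turn e * halfDir (N.dirS f / N.dirT e) * N.pathTurn f p

theorem IsPerfect.slit_interior (hN : N.IsPerfect) (e : E) (k : ℕ) (hk : k + 1 < (N.curve e).len) :
    (N.curve e).dir (k + 1) / (N.curve e).dir k ∈ Complex.slitPlane :=
  hN.embedded.noCusp_interior hk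

theorem IsPerfect.run_edge (hN : N.IsPerfect) (e : E) :
    Run (N.curve e).pieces (N.dirS e) (N.dirT e) (N.turn e) :=
  Polyline.run_pieces (hN.embedded.len_pos e) (hN.slit_interior e)

theorem IsPerfect.run_path (hN : N.IsPerfect) {e q : E} {p : List E}
    (hp : (e :: p).IsChain fun e f => N.tgt e = N.src f) (hq : (e :: p).getLast? = some q) :
    Run ((e :: p).flatMap fun e => (N.curve e).pieces) (N.dirS e) (N.dirT q) (N.pathTurn e p) := by
  induction p generalizing e with
  | nil =>
    obtain rfl : e = q := by simpa using hq
    simpa [pathTurn] using hN.run_edge e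
  | cons f p ih =>
    rw [List.isChain_cons_cons] at hp
    rw [List.getLast?_cons_cons] at hq
    rw [List.flatMap_cons]
    exact (hN.run_edge e).append (ih hp.2 hq) (noCusp_of_mem_slitPlane (hN.slit_succ hp.1))

open Classical in
/-- The direction of the edge at a boundary vertex. -/
def rimDir (N : AnnularGraph n V₀ E) (t : Fin n) : ℂ :=
  if h : ∃ e, N.src e = Sum.inl t then N.dirS h.choose
  else if h : ∃ e, N.tgt e = Sum.inl t then N.dirT h.choose else 1

/-- The number of sources before a boundary vertex. -/
def sourcesBelow (N : AnnularGraph n V₀ E) (t : Fin n) : ℕ := {a | N.IsSource a ∧ a < t}.ncard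

/-- Half of the turning of the cut, including the corners with the boundary circles. -/
def cutTurn (N : AnnularGraph n V₀ E) : ℂ :=
  halfDir (N.cut.dir 0 / (Complex.I * N.baseInner)) * N.cut.turn *
    halfDir (Complex.I * N.baseOuter / N.cut.dir (N.cut.len - 1))

/-- The contribution of a boundary vertex to the turning of the closing curves. -/
def rimTurn (N : AnnularGraph n V₀ E) (t : Fin n) : ℂ :=
  halfDir (Complex.I * N.bd t / N.rimDir t) * Complex.exp (-((N.rimAngle t / 2 : ℝ) * Complex.I))

open Classical in
/-- The normalization of the value at a boundary vertex. -/
def gauge (N : AnnularGraph n V₀ E) (t : Fin n) : ℂ :=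
  (-1) ^ N.sourcesBelow t * N.rimTurn t *
    if N.OnOuter t then 1 else if N.IsSource t then -N.cutTurn else N.cutTurn

theorem cutTurn_ne_zero (N : AnnularGraph n V₀ E) : N.cutTurn ≠ 0 :=
  mul_ne_zero (mul_ne_zero (halfDir_ne_zero _) (Polyline.turn_ne_zero _)) (halfDir_ne_zero _)

theorem rimTurn_ne_zero (N : AnnularGraph n V₀ E) (t : Fin n) : N.rimTurn t ≠ 0 :=
  mul_ne_zero (halfDir_ne_zero _) (Complex.exp_ne_zero _)

theorem gauge_ne_zero (N : AnnularGraph n V₀ E) (t : Fin n) : N.gauge t ≠ 0 := by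
  refine mul_ne_zero (mul_ne_zero (pow_ne_zero _ (by norm_num)) (N.rimTurn_ne_zero t)) ?_
  split_ifs
  · exact one_ne_zero
  · exact neg_ne_zero.2 N.cutTurn_ne_zero
  · exact N.cutTurn_ne_zero

section Finite

variable [Finite E] (hN : N.IsPerfect)
include hN

theorem IsPerfect.rimDir_src {e : E} {t : Fin n} (h : N.src e = Sum.inl t) : 
    N.rimDir t = N.dirS e := by
  have hex : ∃ e, N.src e = Sum.inl t := ⟨e, h⟩
  obtain ⟨e', -, hu⟩ := exists_src_of_isSource (hN.isSource_of_src h)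
  rw [rimDir, dif_pos hex, hu e h, hu _ hex.choose_spec]

theorem IsPerfect.rimDir_tgt {e : E} {t : Fin n} (h : N.tgt e = Sum.inl t) :
    N.rimDir t = N.dirT e := by
  have hs := hN.isSink_of_tgt h
  have hex : ∃ e, N.tgt e = Sum.inl t := ⟨e, h⟩
  have hnex : ¬ ∃ e, N.src e = Sum.inl t := fun ⟨e, he⟩ => src_ne_of_isSink hs e he
  obtain ⟨e', -, hu⟩ := exists_tgt_of_isSink hs
  rw [rimDir, dif_neg hnex, dif_pos hex, hu e h, hu _ hex.choose_spec]

omit [Finite E] hN in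
theorem im_I_mul_div {b d : ℂ} : (Complex.I * b / d).im = (b / d).re := by
  rw [mul_div_assoc]; simp

omit [Finite E] hN in
theorem re_inv_pos {z : ℂ} : 0 < (z⁻¹).re ↔ 0 < z.re := by
  rw [Complex.inv_re]
  constructor
  · intro h
    by_contra hc
    exact absurd h (div_nonpos_of_nonpos_of_nonneg (not_lt.1 hc) (Complex.normSq_nonneg _)).not_gt
  · intro h
    exact div_pos h (Complex.normSq_pos.2 (by rintro rfl; simp at h))

omit [Finite E] in
/-- The side on which the edge at a boundary vertex lies. -/
theorem IsPerfect.im_rim_src {e : E} {t : Fin n} (h : N.src e = Sum.inl t) :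
    (N.OnOuter t → (Complex.I * N.bd t / N.dirS e).im < 0) ∧
    (¬ N.OnOuter t → 0 < (Complex.I * N.bd t / N.dirS e).im) := by
  rw [im_I_mul_div]
  have := hN.inward_src h
  refine ⟨fun ho => ?_, fun ho => ?_⟩
  · have := re_inv_pos.2 (this.1 ho)
    rw [neg_div, inv_neg, inv_div, Complex.neg_re] at this
    linarith
  · have := re_inv_pos.2 (this.2 ho)
    rwa [inv_div] at this

omit [Finite E] in
theorem IsPerfect.im_rim_tgt {e : E} {t : Fin n} (h : N.tgt e = Sum.inl t) :
    (N.OnOuter t → 0 < (Complex.I * N.bd t / N.dirT e).im) ∧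
    (¬ N.OnOuter t → (Complex.I * N.bd t / N.dirT e).im < 0) := by
  rw [im_I_mul_div]
  have := hN.inward_tgt h
  refine ⟨fun ho => ?_, fun ho => ?_⟩
  · have := re_inv_pos.2 (this.1 ho)
    rwa [neg_neg, inv_div] at this
  · have := re_inv_pos.2 (this.2 ho)
    rw [neg_div, inv_neg, inv_div, Complex.neg_re] at this
    linarith

omit [Finite E] in
theorem IsPerfect.slit_rim_src {e : E} {t : Fin n} (h : N.src e = Sum.inl t) :
    Complex.I * N.bd t / N.dirS e ∈ Complex.slitPlane := by
  right
  have := hN.im_rim_src h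
  by_cases ho : N.OnOuter t
  · exact (this.1 ho).ne
  · exact (this.2 ho).ne'

omit [Finite E] in
theorem IsPerfect.slit_rim_tgt {e : E} {t : Fin n} (h : N.tgt e = Sum.inl t) :
    Complex.I * N.bd t / N.dirT e ∈ Complex.slitPlane := by
  right
  have := hN.im_rim_tgt h
  by_cases ho : N.OnOuter t
  · exact (this.1 ho).ne'
  · exact (this.2 ho).ne

omit [Finite E] in
/-- The directions of the cut at its ends. -/
theorem IsPerfect.cut_dir_re : 0 < (N.cut.dir 0 / N.baseInner).re ∧
    0 < (N.cut.dir (N.cut.len - 1) / N.baseOuter).re := by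
  have hl := hN.cut_simple.len_pos ()
  have ann : ∀ z ∈ N.cut.carrier, N.r ≤ ‖z‖ ∧ ‖z‖ ≤ N.R := by
    intro z hz
    rcases hN.cut_mem z hz with h1 | rfl | rfl
    · exact ⟨h1.1.le, h1.2.le⟩
    · exact hN.baseInner_mem
    · exact hN.baseOuter_mem
  -- a transversal direction that stays on one side of the circle
  have key : ∀ (b u : ℂ), dot b u ≠ 0 → ∀ s : ℝ, (s = 1 ∨ s = -1) →
      (∀ t : ℝ, 0 ≤ t → t ≤ 1 → 0 ≤ s * (‖b + t * u‖ ^ 2 - ‖b‖ ^ 2)) → 0 < s * dot b u := by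
    intro b u hd s hs h
    have hs0 : s ≠ 0 := by rcases hs with rfl | rfl <;> norm_num
    refine lt_of_le_of_ne ?_ (mul_ne_zero hs0 hd).symm
    by_contra hc
    push Not at hc
    have hu : 0 < ‖u‖ ^ 2 := by
      have : u ≠ 0 := by rintro rfl; simp [dot] at hd
      positivity
    have h1 : ∀ t : ℝ, 0 < t → t ≤ 1 → 0 ≤ 2 * (s * dot b u) + t * ‖u‖ ^ 2 := by
      intro t ht ht1
      have h2 := h t ht.le ht1
      rw [normSq_ray] at h2
      have h3 : 0 ≤ t * (2 * (s * dot b u) + t * (s * ‖u‖ ^ 2)) := by linarith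
      have h4 := nonneg_of_mul_nonneg_right h3 ht
      have h5 : s * ‖u‖ ^ 2 ≤ ‖u‖ ^ 2 := by rcases hs with rfl | rfl <;> linarith
      nlinarith
    set A := -(s * dot b u) with hA
    have hA0 : 0 < A := by linarith
    have h2 := h1 (min 1 (A / ‖u‖ ^ 2)) (lt_min one_pos (by positivity)) (min_le_left _ _)
    have h3 : min 1 (A / ‖u‖ ^ 2) * ‖u‖ ^ 2 ≤ A := by
      calc _ ≤ A / ‖u‖ ^ 2 * ‖u‖ ^ 2 := by gcongr; exact min_le_right _ _
        _ = A := div_mul_cancel₀ _ hu.ne'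
    linarith
  constructor
  · have h0 : N.baseInner ≠ 0 := hN.ne_zero_of_mem hN.baseInner_mem
    have := key N.baseInner (N.cut.dir 0) hN.cut_start_transversal 1 (Or.inl rfl) ?_
    · rw [re_div_eq_dot]
      exact div_pos (by linarith) (Complex.normSq_pos.2 h0)
    · intro t ht ht1
      have hm : N.baseInner + t * N.cut.dir 0 ∈ N.cut.carrier := by
        refine N.cut.segment_subset_carrier hl ?_
        rw [segment_eq_image']
        exact ⟨t, ⟨ht, ht1⟩, by simp [Polyline.dir, baseInner]⟩
      have h1 := (ann _ hm).1
      rw [hN.cut_start]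
      have := hN.r_pos
      nlinarith
  · have h0 : N.baseOuter ≠ 0 := hN.ne_zero_of_mem hN.baseOuter_mem
    have hlast : N.cut.len - 1 + 1 = N.cut.len := by omega
    have := key N.baseOuter (-N.cut.dir (N.cut.len - 1)) (by
      have := hN.cut_end_transversal
      simp only [dot, Complex.neg_re, Complex.neg_im] at this ⊢
      intro hc; apply this; linarith) (-1) (Or.inr rfl) ?_
    · rw [re_div_eq_dot]
      refine div_pos ?_ (Complex.normSq_pos.2 h0)
      simp only [dot, Complex.neg_re, Complex.neg_im] at this ⊢
      linarith
    · intro t ht ht1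
      have hm : N.baseOuter + t * -N.cut.dir (N.cut.len - 1) ∈ N.cut.carrier := by
        refine N.cut.segment_subset_carrier (k := N.cut.len - 1) (by omega) ?_
        rw [segment_symm, segment_eq_image']
        refine ⟨t, ⟨ht, ht1⟩, ?_⟩
        simp only [Polyline.dir, baseOuter, hlast, Complex.real_smul]
        ring
      have h1 := (ann _ hm).2
      rw [hN.cut_end]
      have h2 := norm_nonneg (N.baseOuter + t * -N.cut.dir (N.cut.len - 1))
      nlinarith

omit [Finite E] in
theorem IsPerfect.run_cut : Run N.cut.pieces (N.cut.dir 0) (N.cut.dir (N.cut.len - 1)) N.cut.turn :=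
  Polyline.run_pieces (hN.cut_simple.len_pos ()) fun _ hk =>
    hN.cut_simple.noCusp_interior (i := ()) hk

omit [Finite E] in
theorem IsPerfect.run_cut_rev : Run N.cut.rev.pieces (-N.cut.dir (N.cut.len - 1)) (-N.cut.dir 0)
    (N.cut.turn)⁻¹ := by
  have hl := hN.cut_simple.len_pos ()
  have hs : ∀ k, k + 1 < N.cut.len → N.cut.dir (k + 1) / N.cut.dir k ∈ Complex.slitPlane :=
    fun _ hk => hN.cut_simple.noCusp_interior (i := ()) hk
  have h1 := Polyline.run_pieces (γ := N.cut.rev) hl fun k hk => by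
    change k + 1 < N.cut.len at hk
    rw [Polyline.rev_dir _ hk, Polyline.rev_dir _ (by omega), neg_div_neg_eq, ← inv_div,
      show N.cut.len - 1 - k = N.cut.len - 1 - (k + 1) + 1 by omega]
    exact inv_mem_slitPlane (hs _ (by omega))
  rw [eq_inv_of_mul_eq_one_left (Polyline.turn_rev hs)] at h1
  change Run _ _ (N.cut.rev.dir (N.cut.len - 1)) _ at h1
  rw [Polyline.rev_dir _ hl, Polyline.rev_dir _ (by omega), Nat.sub_zero, Nat.sub_self] at h1
  exact h1

theorem IsPerfect.halfTurn_arc_bd {a b : Fin n} (h : N.OnOuter a ↔ N.OnOuter b) :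
    (Piece.arc (N.bd b) (N.bd a)).halfTurn = (if N.rimAngle b ≤ N.rimAngle a then 1 else -1) *
      (Complex.exp (-((N.rimAngle b / 2 : ℝ) * Complex.I)) *
        Complex.exp ((N.rimAngle a / 2 : ℝ) * Complex.I)) := by
  have hb := hN.rimAngle_mem b
  have ha := hN.rimAngle_mem a
  have h0 : N.rimBase b ≠ 0 := by
    rw [← norm_ne_zero_iff, hN.norm_rimBase]; exact norm_ne_zero_iff.2 (hN.bd_ne_zero b)
  rw [← halfTurn_arc h0 hb.1.le hb.2 ha.1.le ha.2, ← hN.bd_eq_turnBy b, ← rimBase_congr h,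
    ← hN.bd_eq_turnBy a]

theorem IsPerfect.halfTurn_arc_to_base (b : Fin n) :
    (Piece.arc (N.bd b) (N.rimBase b)).halfTurn =
      -Complex.exp (-((N.rimAngle b / 2 : ℝ) * Complex.I)) := by
  have hb := hN.rimAngle_mem b
  have h0 : N.rimBase b ≠ 0 := by
    rw [← norm_ne_zero_iff, hN.norm_rimBase]; exact norm_ne_zero_iff.2 (hN.bd_ne_zero b)
  have := halfTurn_arc h0 hb.1.le hb.2 le_rfl Real.two_pi_pos
  rw [← hN.bd_eq_turnBy b, turnBy_zero, if_neg hb.1.not_ge] at this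
  rw [this]; simp

theorem IsPerfect.halfTurn_arc_of_base (a : Fin n) :
    (Piece.arc (N.rimBase a) (N.bd a)).halfTurn =
      Complex.exp ((N.rimAngle a / 2 : ℝ) * Complex.I) := by
  have ha := hN.rimAngle_mem a
  have h0 : N.rimBase a ≠ 0 := by
    rw [← norm_ne_zero_iff, hN.norm_rimBase]; exact norm_ne_zero_iff.2 (hN.bd_ne_zero a)
  have := halfTurn_arc h0 le_rfl Real.two_pi_pos ha.1.le ha.2
  rw [← hN.bd_eq_turnBy a, turnBy_zero, if_pos ha.1.le] at this
  rw [this]; simp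

open Classical in
/-- Half of the turning of the curve that closes a path. -/
theorem IsPerfect.run_closing {a b : Fin n} (hab : a ≠ b) :
    Run (N.closing a b) (Complex.I * N.bd b) (Complex.I * N.bd a)
      ((if a < b then -1 else 1) * (Complex.exp (-((N.rimAngle b / 2 : ℝ) * Complex.I)) *
        Complex.exp ((N.rimAngle a / 2 : ℝ) * Complex.I)) *
        ((if N.OnOuter b then 1 else N.cutTurn) / (if N.OnOuter a then 1 else -N.cutTurn))) := by
  have hK := N.cutTurn_ne_zero
  have c0 : 0 < (N.cut.dir 0 / N.baseInner).re := hN.cut_dir_re.1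
  have c1 : 0 < (N.cut.dir (N.cut.len - 1) / N.baseOuter).re := hN.cut_dir_re.2
  have i0 : (Complex.I * N.baseInner / N.cut.dir 0).im = (N.baseInner / N.cut.dir 0).re := 
    im_I_mul_div
  have i1 : (Complex.I * N.baseOuter / N.cut.dir (N.cut.len - 1)).im =
      (N.baseOuter / N.cut.dir (N.cut.len - 1)).re := im_I_mul_div
  have p0 : 0 < (Complex.I * N.baseInner / N.cut.dir 0).im := by
    rw [i0, ← inv_div]; exact re_inv_pos.2 c0
  have p1 : 0 < (Complex.I * N.baseOuter / N.cut.dir (N.cut.len - 1)).im := by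
    rw [i1, ← inv_div]; exact re_inv_pos.2 c1
  have s0 : Complex.I * N.baseInner / N.cut.dir 0 ∈ Complex.slitPlane := Or.inr p0.ne'
  have s1 : Complex.I * N.baseOuter / N.cut.dir (N.cut.len - 1) ∈ Complex.slitPlane := 
    Or.inr p1.ne'
  by_cases hs : N.OnOuter a ↔ N.OnOuter b
  -- The sign of the arc compares angles, the claimed formula compares labels. The two orders agree
  -- on the outer circle and are opposite on the inner one, where `cutTurn / -cutTurn` makes up for
  -- it.
  · rw [closing, if_pos hs]
    change Run [Piece.arc (N.bd b) (N.bd a)] _ _ _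
    refine (Run.single (Piece.arc (N.bd b) (N.bd a))).congr ?_
    rw [hN.halfTurn_arc_bd hs]
    by_cases ho : N.OnOuter a
    · have hob := hs.1 ho
      rw [if_pos ho, if_pos hob]
      rcases lt_or_gt_of_ne hab with h | h
      · rw [if_pos h, if_neg (hN.rimAngle_lt_outer hob h).not_ge]; ring
      · rw [if_neg h.not_gt, if_pos (hN.rimAngle_lt_outer ho h).le]; ring
    · have hob := fun hh => ho (hs.2 hh)
      rw [if_neg ho, if_neg hob]
      rcases lt_or_gt_of_ne hab with h | h
      · rw [if_pos h, if_pos (hN.rimAngle_lt_inner ho h).le]; field_simp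
      · rw [if_neg h.not_gt, if_neg (hN.rimAngle_lt_inner hob h).not_ge]; field_simp
  · have hbb := hN.halfTurn_arc_to_base b
    have haa := hN.halfTurn_arc_of_base a
    rw [closing, if_neg hs]
    by_cases hob : N.OnOuter b
    · have ho : ¬ N.OnOuter a := fun ho => hs (by simp [ho, hob])
      have hlt := lt_of_outer_inner hob ho
      rw [rimBase, if_pos hob] at hbb
      rw [rimBase, if_neg ho] at haa
      rw [if_pos hob, if_pos hob, if_neg ho, if_neg hlt.not_gt]
      have n1 : NoCusp (Complex.I * N.baseOuter) (-N.cut.dir (N.cut.len - 1)) := by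
        apply noCusp_of_mem_slitPlane
        rw [← inv_div]
        refine inv_mem_slitPlane (Or.inr ?_)
        rw [div_neg, Complex.neg_im]; linarith
      have n0 : NoCusp (-N.cut.dir 0) (Complex.I * N.baseInner) := by
        refine noCusp_of_mem_slitPlane (Or.inr ?_)
        rw [div_neg, Complex.neg_im]; linarith
      have r := (Run.single (Piece.arc (N.bd b) N.baseOuter)).append
        (hN.run_cut_rev.append (Run.single (Piece.arc N.baseInner (N.bd a))) n0) n1
      refine r.congr ?_
      rw [hbb, haa]
      simp only [Piece.tStart, Piece.tEnd]
      -- The cut is traversed backwards. Its corners with the circles acquire the factors `I` and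
      -- `-I`, whose product is 1, so the inverse of `cutTurn` is left.
      have e1 : halfDir (-N.cut.dir (N.cut.len - 1) / (Complex.I * N.baseOuter)) =
          Complex.I * (halfDir (Complex.I * N.baseOuter / N.cut.dir (N.cut.len - 1)))⁻¹ := by
        have : (N.cut.dir (N.cut.len - 1) / (Complex.I * N.baseOuter)).im < 0 := by
          rw [← inv_div, Complex.inv_im]
          exact div_neg_of_neg_of_pos (by linarith)
            (Complex.normSq_pos.2 (Complex.slitPlane_ne_zero s1))
        rw [neg_div, halfDir_neg_of_im_neg this, ← halfDir_inv s1, inv_div]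
      have e0 : halfDir (Complex.I * N.baseInner / -N.cut.dir 0) =
          -Complex.I * halfDir (Complex.I * N.baseInner / N.cut.dir 0) := by
        rw [div_neg, halfDir_neg_of_im_pos p0]
      have e2 : halfDir (N.cut.dir 0 / (Complex.I * N.baseInner)) =
          (halfDir (Complex.I * N.baseInner / N.cut.dir 0))⁻¹ := by
        rw [← halfDir_inv s0, inv_div]
      rw [e1, e0, cutTurn, e2]
      have h1 := halfDir_ne_zero (Complex.I * N.baseInner / N.cut.dir 0)
      have h2 := halfDir_ne_zero (Complex.I * N.baseOuter / N.cut.dir (N.cut.len - 1))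
      have h3 := N.cut.turn_ne_zero
      field_simp
      linear_combination -Complex.I_sq
    · have ho : N.OnOuter a := by by_contra ho; exact hs (by simp [ho, hob])
      have hlt := lt_of_outer_inner ho hob
      rw [rimBase, if_neg hob] at hbb
      rw [rimBase, if_pos ho] at haa
      rw [if_neg hob, if_neg hob, if_pos ho, if_pos hlt]
      have n1 : NoCusp (Complex.I * N.baseInner) (N.cut.dir 0) := by
        apply noCusp_of_mem_slitPlane
        rw [← inv_div]
        exact inv_mem_slitPlane s0
      have n0 : NoCusp (N.cut.dir (N.cut.len - 1)) (Complex.I * N.baseOuter) := 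
        noCusp_of_mem_slitPlane s1
      have r := (Run.single (Piece.arc (N.bd b) N.baseInner)).append
        (hN.run_cut.append (Run.single (Piece.arc N.baseOuter (N.bd a))) n0) n1
      refine r.congr ?_
      rw [hbb, haa]
      simp only [Piece.tStart, Piece.tEnd]
      rw [cutTurn]
      ring

-- Counting the sources below each end turns the sign of a pair into a product of signs of single
-- vertices. The correction for `a < b` comes from `a` itself, and the same sign occurs in
-- `run_closing`.
omit [Finite E] hN in
theorem sourcesBelow_eq {a b : Fin n} (ha : N.IsSource a) (hb : N.IsSink b) :
    ((-1 : ℂ)) ^ N.sourcesBelow b * (-1) ^ N.sourcesBelow a =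
      (if a < b then -1 else 1) * (-1) ^ N.between a b := by
  have hab : a ≠ b := by rintro rfl; exact ha.not_isSink hb
  have sq : ∀ k : ℕ, ((-1 : ℂ) ^ k) * (-1) ^ k = 1 := fun k => by
    rw [← mul_pow]; norm_num
  rcases lt_or_gt_of_ne hab with h | h
  · have e : N.sourcesBelow b = N.between a b + (N.sourcesBelow a + 1) := by
      unfold sourcesBelow between
      rw [min_eq_left h.le, max_eq_right h.le]
      have hnot : a ∉ {t | N.IsSource t ∧ t < a} := fun h => lt_irrefl _ h.2
      rw [← Set.ncard_insert_of_notMem hnot, ← Set.ncard_union_eq]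
      · congr 1
        ext t
        simp only [Set.mem_ofPred_eq, Set.mem_union, Set.mem_insert_iff]
        constructor
        · rintro ⟨h1, h2⟩
          rcases lt_trichotomy t a with h3 | h3 | h3
          · exact Or.inr (Or.inr ⟨h1, h3⟩)
          · exact Or.inr (Or.inl h3)
          · exact Or.inl ⟨h1, h3, h2⟩
        · rintro (⟨h1, -, h2⟩ | rfl | ⟨h1, h2⟩)
          · exact ⟨h1, h2⟩
          · exact ⟨ha, h⟩
          · exact ⟨h1, h2.trans h⟩
      · rw [Set.disjoint_left]
        rintro t ⟨-, h1, -⟩ (rfl | ⟨-, h2⟩)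
        · exact lt_irrefl _ h1
        · exact lt_asymm h1 h2
    rw [if_pos h, e, pow_add, pow_add, pow_one]
    linear_combination (-(-1 : ℂ) ^ N.between a b) * sq (N.sourcesBelow a)
  · have e : N.sourcesBelow a = N.between a b + N.sourcesBelow b := by
      unfold sourcesBelow between
      rw [min_eq_right h.le, max_eq_left h.le]
      rw [← Set.ncard_union_eq]
      · congr 1
        ext t
        simp only [Set.mem_ofPred_eq, Set.mem_union]
        constructor
        · rintro ⟨h1, h2⟩
          rcases lt_trichotomy t b with h3 | rfl | h3
          · exact Or.inr ⟨h1, h3⟩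
          · exact absurd hb h1.not_isSink
          · exact Or.inl ⟨h1, h3, h2⟩
        · rintro (⟨h1, -, h2⟩ | ⟨h1, h2⟩)
          · exact ⟨h1, h2⟩
          · exact ⟨h1, h2.trans h⟩
      · rw [Set.disjoint_left]
        rintro t ⟨-, h1, -⟩ ⟨-, h2⟩
        exact lt_asymm h1 h2
    rw [if_neg h.not_gt, e, pow_add]
    linear_combination ((-1 : ℂ) ^ N.between a b) * sq (N.sourcesBelow b)

omit [Finite E] hN in
theorem coe_pathSign (a b : Fin n) (p : List E) :
    ((N.pathSign a b p : ℤ) : ℂ) = -parity (concordance (N.closedCurve a b p)) := by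
  unfold pathSign
  have : ∀ c : ZMod 2, c = 0 ∨ c = 1 := by decide
  rcases this (concordance (N.closedCurve a b p)) with h | h
  · rw [h, parity_zero, show (0 : ZMod 2) - 1 = 1 by decide, uzpow_one]; simp
  · rw [h, parity_one, sub_self, uzpow_zero]; simp

/-- The sign of a path is, up to normalizations at its ends, half of its turning. -/
theorem IsPerfect.pathSign_eq {a b : Fin n} {e : E} {p : List E} (hp : N.IsPath a b (e :: p)) :
    (-1) ^ N.between a b * ((N.pathSign a b (e :: p) : ℤ) : ℂ) =
      -(N.gauge b / N.gauge a) * N.pathTurn e p := by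
  have ha := hp.isSource hN
  have hb := hp.isSink hN
  have hab : a ≠ b := by rintro rfl; exact ha.not_isSink hb
  obtain ⟨hc, h1, h2⟩ := hp
  have hea : N.src e = Sum.inl a := by simpa using h1
  obtain ⟨q, hq, hqb⟩ : ∃ q, (e :: p).getLast? = some q ∧ N.tgt q = Sum.inl b := by
    cases hq : (e :: p).getLast? with
    | none => rw [hq] at h2; simp at h2
    | some q => exact ⟨q, rfl, by rw [hq] at h2; simpa using h2⟩
  have sa := hN.slit_rim_src hea
  have sb := hN.slit_rim_tgt hqb
  have r1 := (hN.run_path hc hq).append (hN.run_closing hab) (noCusp_of_mem_slitPlane sb)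
  have r2 := r1.parity_concordance (noCusp_of_mem_slitPlane (by
    rw [← inv_div]; exact inv_mem_slitPlane sa))
  have e1 : halfDir (N.dirS e / (Complex.I * N.bd a)) =
      (halfDir (Complex.I * N.bd a / N.dirS e))⁻¹ := by rw [← halfDir_inv sa, inv_div]
  rw [coe_pathSign, closedCurve, r2, e1, gauge, gauge, rimTurn, rimTurn, hN.rimDir_src hea,
    hN.rimDir_tgt hqb, if_neg (fun h => IsSource.not_isSink h hb : ¬ N.IsSource b), if_pos ha]
  have key := sourcesBelow_eq ha hb
  have sq : ∀ k : ℕ, ((-1 : ℂ) ^ k) * (-1) ^ k = 1 := fun k => by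
    rw [← mul_pow]; norm_num
  have inv1 : ((-1 : ℂ) ^ N.sourcesBelow a)⁻¹ = (-1) ^ N.sourcesBelow a :=
    inv_eq_of_mul_eq_one_left (sq _)
  have key' : (-1 : ℂ) ^ N.sourcesBelow b / (-1) ^ N.sourcesBelow a =
      (if a < b then -1 else 1) * (-1) ^ N.between a b := by
    rw [div_eq_mul_inv, inv1, key]
  have ex : ∀ z, z / Complex.exp (-((N.rimAngle a / 2 : ℝ) * Complex.I)) =
      z * Complex.exp ((N.rimAngle a / 2 : ℝ) * Complex.I) := by
    intro z
    rw [div_eq_mul_inv, ← Complex.exp_neg, neg_neg]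
  rw [mul_div_mul_comm, mul_div_mul_comm, mul_div_mul_comm, key', ex]
  ring

end Finite

end AnnularGraph

end AnnularNet

end

noncomputable section

namespace AnnularNet

namespace AnnularGraph

variable {n : ℕ} {V₀ E : Type*} {N : AnnularGraph n V₀ E}

/-! ### The normalization after the reversal of a path -/

section Gauge

variable [Finite E] {i j : Fin n} {P : List E} (hN : N.IsPerfect) (hP : N.IsPath i j P)
  (hs : N.IsSimplePath P)

include hP hs in
theorem reverse_isSource_eq (hN : N.IsPerfect) (a : Fin n) :
    (N.reverse P).IsSource a ↔ (N.IsSource a ∧ a ≠ i) ∨ a = j := by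
  by_cases hai : a = i
  · subst hai
    have := (reverse_isSink hN hP hs)
    have hne := hP.ne hs
    constructor
    · intro h; exact absurd this h.not_isSink
    · rintro (⟨-, h⟩ | h)
      · exact absurd rfl h
      · exact absurd h hne
  by_cases haj : a = j
  · subst haj
    simp [reverse_isSource hN hP hs]
  · rw [reverse_isSource_iff hP hs hai haj]
    simp [hai, haj]

-- The source `i` is lost and the source `j` is gained; both counts are compared with the number of
-- the common sources below `t`.
include hP hs in
theorem sourcesBelow_reverse (hN : N.IsPerfect) (t : Fin n) :
    (-1 : ℂ) ^ (N.reverse P).sourcesBelow t * (if i < t then -1 else 1) =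
      (-1) ^ N.sourcesBelow t * (if j < t then -1 else 1) := by
  set B := {a | N.IsSource a ∧ a ≠ i ∧ a < t} with hB
  have hi := hP.isSource hN
  have hj := hP.isSink hN
  have h1 : (-1 : ℂ) ^ N.sourcesBelow t = (-1) ^ B.ncard * (if i < t then -1 else 1) := by
    unfold sourcesBelow
    split_ifs with h
    · have : {a | N.IsSource a ∧ a < t} = insert i B := by
        ext a
        simp only [hB, Set.mem_ofPred_eq, Set.mem_insert_iff]
        constructor
        · rintro ⟨h1, h2⟩
          by_cases ha : a = i
          · exact Or.inl ha
          · exact Or.inr ⟨h1, ha, h2⟩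
        · rintro (rfl | ⟨h1, -, h2⟩)
          · exact ⟨hi, h⟩
          · exact ⟨h1, h2⟩
      rw [this, Set.ncard_insert_of_notMem (fun h => h.2.1 rfl), pow_succ]
    · have : {a | N.IsSource a ∧ a < t} = B := by
        ext a
        simp only [hB, Set.mem_ofPred_eq]
        constructor
        · rintro ⟨h1, h2⟩
          exact ⟨h1, fun ha => h (ha ▸ h2), h2⟩
        · rintro ⟨h1, -, h2⟩
          exact ⟨h1, h2⟩
      rw [this, mul_one]
  have hsrc := reverse_isSource_eq hP hs hN
  have h2 : (-1 : ℂ) ^ (N.reverse P).sourcesBelow t = (-1) ^ B.ncard * (if j < t then -1 else 1) := by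
    unfold sourcesBelow
    simp only [hsrc]
    split_ifs with h
    · have : {a | ((N.IsSource a ∧ a ≠ i) ∨ a = j) ∧ a < t} = insert j B := by
        ext a
        simp only [hB, Set.mem_ofPred_eq, Set.mem_insert_iff]
        constructor
        · rintro ⟨⟨h1, h3⟩ | h1, h2⟩
          · exact Or.inr ⟨h1, h3, h2⟩
          · exact Or.inl h1
        · rintro (rfl | ⟨h1, h3, h2⟩)
          · exact ⟨Or.inr rfl, h⟩
          · exact ⟨Or.inl ⟨h1, h3⟩, h2⟩
      rw [this, Set.ncard_insert_of_notMem (fun h => h.1.not_isSink hj), pow_succ]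
    · have : {a | ((N.IsSource a ∧ a ≠ i) ∨ a = j) ∧ a < t} = B := by
        ext a
        simp only [hB, Set.mem_ofPred_eq]
        constructor
        · rintro ⟨⟨h1, h3⟩ | rfl, h2⟩
          · exact ⟨h1, h3, h2⟩
          · exact absurd h2 h
        · rintro ⟨h1, h3, h2⟩
          exact ⟨Or.inl ⟨h1, h3⟩, h2⟩
      rw [this, mul_one]
  rw [h1, h2]; ring

include hN hP

theorem rimDir_reverse (hs : N.IsSimplePath P) {t : Fin n} (hi : t ≠ i) (hj : t ≠ j) :
    (N.reverse P).rimDir t = N.rimDir t := by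
  have hN' := hN.reverse hP hs
  obtain ⟨f, hf | hf⟩ := hN.exists_incident t
  · have hfP : f ∉ P := fun h => hi (hP.src_eq_inl hN h hf)
    rw [hN.rimDir_src hf, hN'.rimDir_src (e := f) (by rw [reverse_src_of_notMem hfP, hf]),
      reverse_dirS_of_notMem hfP]
  · have hfP : f ∉ P := fun h => hj (hP.tgt_eq_inl hN h hf)
    rw [hN.rimDir_tgt hf, hN'.rimDir_tgt (e := f) (by rw [reverse_tgt_of_notMem hfP, hf]),
      reverse_dirT_of_notMem hfP]

include hs

theorem gauge_reverse_of_ne {t : Fin n} (hi : t ≠ i) (hj : t ≠ j) :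
    (N.reverse P).gauge t =
      (if i < t then -1 else 1) * (if j < t then -1 else 1) * N.gauge t := by
  have h1 : (-1 : ℂ) ^ (N.reverse P).sourcesBelow t =
      (if i < t then -1 else 1) * (if j < t then -1 else 1) * (-1) ^ N.sourcesBelow t := by
    have := sourcesBelow_reverse hP hs hN t
    split_ifs at this ⊢ <;> first | linear_combination this | linear_combination -this
  have h2 : (N.reverse P).rimTurn t = N.rimTurn t := by
    rw [rimTurn, rimDir_reverse hN hP hs hi hj]; rfl
  rw [gauge, h1, h2, gauge]
  have h3 : (N.reverse P).cutTurn = N.cutTurn := rfl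
  have h4 := reverse_isSource_iff hP hs hi hj
  rw [h3]
  by_cases ho : N.OnOuter t
  · rw [if_pos ho, if_pos (show (N.reverse P).OnOuter t from ho)]; ring
  · rw [if_neg ho, if_neg (show ¬ (N.reverse P).OnOuter t from ho)]
    by_cases ht : N.IsSource t
    · rw [if_pos ht, if_pos (h4.2 ht)]; ring
    · rw [if_neg ht, if_neg (fun h => ht (h4.1 h))]; ring

/-- Reversing the edge at `b_i` multiplies the half-angle by `I` on the outer circle and by `-I` on
the inner one. On the inner circle the sign of `cutTurn` changes too, since `b_i` is no longer a
source; so the factor is `I` in both cases. -/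
theorem gauge_reverse_start :
    (N.reverse P).gauge i = Complex.I * (if j < i then -1 else 1) * N.gauge i := by
  have h1 := sourcesBelow_reverse hP hs hN i
  rw [if_neg (lt_irrefl i), mul_one] at h1
  obtain ⟨p, hp, hpi⟩ := hP.exists_first
  have him := hN.im_rim_src hpi
  have hd : (N.reverse P).rimDir i = -N.dirS p := by
    rw [(hN.reverse hP hs).rimDir_tgt (e := p) (by rw [reverse_tgt_of_mem hp, hpi]),
      hN.reverse_dirT hp]
  have h3 : (N.reverse P).cutTurn = N.cutTurn := rfl
  have h5 : (N.reverse P).bd i = N.bd i := rfl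
  have h6 : (N.reverse P).rimAngle i = N.rimAngle i := rfl
  rw [gauge, gauge, h1, rimTurn, rimTurn, hd, hN.rimDir_src hpi, h3, h5, h6,
    if_neg (fun h => h.not_isSink (reverse_isSink hN hP hs) : ¬ (N.reverse P).IsSource i),
    if_pos (hP.isSource hN), div_neg]
  by_cases ho : N.OnOuter i
  · rw [halfDir_neg_of_im_neg (him.1 ho), if_pos ho,
      if_pos (show (N.reverse P).OnOuter i from ho)]; ring
  · rw [halfDir_neg_of_im_pos (him.2 ho), if_neg ho,
      if_neg (show ¬ (N.reverse P).OnOuter i from ho)]; ring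

theorem gauge_reverse_end :
    (N.reverse P).gauge j = -Complex.I * (if i < j then -1 else 1) * N.gauge j := by
  have h1 : (-1 : ℂ) ^ (N.reverse P).sourcesBelow j =
      (if i < j then -1 else 1) * (-1) ^ N.sourcesBelow j := by
    have := sourcesBelow_reverse hP hs hN j
    rw [if_neg (lt_irrefl j), mul_one] at this
    split_ifs at this ⊢ <;> first | linear_combination this | linear_combination -this
  obtain ⟨q, hq, hqj⟩ := hP.exists_last
  have him := hN.im_rim_tgt hqj
  have hd : (N.reverse P).rimDir j = -N.dirT q := by
    rw [(hN.reverse hP hs).rimDir_src (e := q) (by rw [reverse_src_of_mem hq, hqj]),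
      hN.reverse_dirS hq]
  have h3 : (N.reverse P).cutTurn = N.cutTurn := rfl
  have h5 : (N.reverse P).bd j = N.bd j := rfl
  have h6 : (N.reverse P).rimAngle j = N.rimAngle j := rfl
  rw [gauge, gauge, h1, rimTurn, rimTurn, hd, hN.rimDir_tgt hqj, h3, h5, h6,
    if_pos (reverse_isSource hN hP hs),
    if_neg (fun h => h.not_isSink (hP.isSink hN) : ¬ N.IsSource j), div_neg]
  by_cases ho : N.OnOuter j
  · rw [halfDir_neg_of_im_pos (him.1 ho), if_pos ho,
      if_pos (show (N.reverse P).OnOuter j from ho)]; ring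
  · rw [halfDir_neg_of_im_neg (him.2 ho), if_neg ho,
      if_neg (show ¬ (N.reverse P).OnOuter j from ho)]; ring

end Gauge

/-! ### States of a network -/

open Classical in
/-- The corner from the edge `e` to the edge `f`. -/
def link (N : AnnularGraph n V₀ E) (e f : E) : ℂ :=
  if N.src f = N.tgt e then halfDir (N.dirS f / N.dirT e) else 0

/-- The values `s e` at the ends of the edges and `Y t` at the boundary vertices that satisfy the
linear relations of the network with edge weights `x`. -/
structure IsState [Fintype E] (N : AnnularGraph n V₀ E) (x s : E → ℂ) (Y : Fin n → ℂ) : Prop where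
  tgt_bd : ∀ e t, N.tgt e = Sum.inl t → s e = Y t
  inner : ∀ e v, N.tgt e = Sum.inr v → s e = ∑ f, N.link e f * (x f * N.turn f * s f)
  src_bd : ∀ e t, N.src e = Sum.inl t → Y t = x e * N.turn e * s e

open Classical in
/-- The sign of an edge when the ends of a path lie on different circles: the parity of the number of
its crossings with the cut. -/
def crossSign (N : AnnularGraph n V₀ E) (i j : Fin n) (e : E) : ℤ :=
  if N.OnOuter i ↔ N.OnOuter j then 1 else ((-1 : ℤˣ) ^ (N.curve e).ind N.cut : ℤˣ)

theorem ind_eq_zero {γ δ : Polyline} (h : Disjoint γ.carrier δ.carrier) : γ.ind δ = 0 := by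
  refine Finset.sum_eq_zero fun k hk => Finset.sum_eq_zero fun m hm => if_neg ?_
  rintro ⟨z, h1, h2⟩
  exact Set.disjoint_left.1 h
    (γ.segment_subset_carrier (Finset.mem_range.1 hk) (openSegment_subset_segment _ _ _ h1))
    (δ.segment_subset_carrier (Finset.mem_range.1 hm) (openSegment_subset_segment _ _ _ h2))

theorem crossSign_of_mem {i j : Fin n} {P : List E} (hcut : N.AvoidsCut P) {e : E} (he : e ∈ P) :
    N.crossSign i j e = 1 := by
  rw [crossSign, ind_eq_zero (hcut e he)]; simp

theorem crossSign_mul_self (i j : Fin n) (e : E) : N.crossSign i j e * N.crossSign i j e = 1 := by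
  rw [crossSign]
  split_ifs
  · rfl
  · rw [← Units.val_mul, Int.units_mul_self]; rfl

open Classical in
theorem coe_crossSign (i j : Fin n) (e : E) : ((N.crossSign i j e : ℤ) : ℂ) =
    if N.OnOuter i ↔ N.OnOuter j then 1 else (-1) ^ (N.curve e).ind N.cut := by
  rw [crossSign]
  split_ifs
  · simp
  · rcases Int.even_or_odd ((N.curve e).ind N.cut) with h | h
    · rw [h.neg_one_zpow, h.neg_one_zpow]; simp
    · rw [h.neg_one_zpow, h.neg_one_zpow]; simp

theorem turn_ne_zero (N : AnnularGraph n V₀ E) (e : E) : N.turn e ≠ 0 := Polyline.turn_ne_zero _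

theorem reverse_turn_of_notMem {P : List E} {e : E} (he : e ∉ P) :
    (N.reverse P).turn e = N.turn e := by
  rw [turn, reverse_curve_of_notMem he, turn]

theorem IsPerfect.reverse_turn {P : List E} (hN : N.IsPerfect) {e : E} (he : e ∈ P) :
    (N.reverse P).turn e = (N.turn e)⁻¹ := by
  rw [turn, reverse_curve_of_mem he, turn]
  exact eq_inv_of_mul_eq_one_left (Polyline.turn_rev (hN.slit_interior e))

/-- At a vertex of a path, the third edge is either incoming or outgoing. -/
theorem IsPerfect.third_edge [Finite E] (hN : N.IsPerfect) {p q e f : E} {v : V₀}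
    (hp : N.tgt p = Sum.inr v) (hq : N.src q = Sum.inr v) (he : N.tgt e = Sum.inr v)
    (hf : N.src f = Sum.inr v) (hep : e ≠ p) (hfq : f ≠ q) : False := by
  have h1 : 2 ≤ N.inDeg (Sum.inr v) := by
    rw [inDeg, ← Set.ncard_pair hep]
    refine Set.ncard_le_ncard ?_ (Set.toFinite _)
    rintro x (rfl | rfl) <;> assumption
  have h2 : 2 ≤ N.outDeg (Sum.inr v) := by
    rw [outDeg, ← Set.ncard_pair hfq]
    refine Set.ncard_le_ncard ?_ (Set.toFinite _)
    rintro x (rfl | rfl) <;> assumption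
  rcases hN.internal_degree v with h | h <;> omega

open Classical in
/-- Reversal of a path transforms the states of a network into states of the reversed network. -/
theorem IsState.reverse [Fintype E] {i j : Fin n} {P : List E} (hN : N.IsPerfect)
    (hP : N.IsPath i j P) (hs : N.IsSimplePath P) (hcut : N.AvoidsCut P) {x s : E → ℂ}
    {Y : Fin n → ℂ} (hx : ∀ e, x e ≠ 0)
    (h : N.IsState (fun e => (N.crossSign i j e : ℂ) * x e) s Y) :
    ∃ s' Y', (N.reverse P).IsState (reverseWeights P x) s' Y' ∧ ∃ c : ℂ, c ≠ 0 ∧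
      Y' i = -c * Y i ∧ Y' j = -c * Y j ∧ ∀ t, t ≠ i → t ≠ j → Y' t = -Complex.I *
        (if (i < t ∧ t < j) ∨ (t < j ∧ j < i) ∨ (j < i ∧ i < t) then 1 else -1) * c * Y t := by
  obtain ⟨Γ, o, hΓ⟩ := hP.exists_isConcat hN hs
  obtain ⟨p₀, hp₀, hpi⟩ := hP.exists_first
  obtain ⟨q₀, hq₀, hqj⟩ := hP.exists_last
  have hij := hP.ne hs
  obtain ⟨c, hc0, hc, hc', hcor⟩ := hΓ.exists_const hN hcut hp₀ hpi hq₀ hqj hij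
  -- The value at the beginning of an edge, while `s` is the value at its end.
  set u : E → ℂ := fun e => (N.crossSign i j e : ℂ) * x e * N.turn e * s e with hu
  set sS : E → ℂ := fun e => N.sideRoot i j Γ (N.pos (N.src e)) (N.dirS e) with hsS
  set sT : E → ℂ := fun e => N.sideRoot i j Γ (N.pos (N.tgt e)) (-N.dirT e) with hsT
  -- Off the path a value is multiplied by the side on which the edge ends. On the path, where there
  -- is no side, the two ends of an edge exchange their values up to the factor `-c`.
  set s' : E → ℂ := fun e => if e ∈ P then -c * u e else sT e * s e with hs'
  set Y' : Fin n → ℂ := fun t => if t = i ∨ t = j then -c * Y t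
    else N.sideVal i j Γ (N.bd t) * Y t with hY'
  have cross_sq : ∀ e, (N.crossSign i j e : ℂ) * N.crossSign i j e = 1 := fun e => by
    exact_mod_cast crossSign_mul_self i j e
  -- The side may change at crossings with the cut; the factor `crossSign` of the weights absorbs
  -- this.
  have edge : ∀ e, e ∉ P → sS e = (N.crossSign i j e : ℂ) * sT e := by
    intro e he
    rw [coe_crossSign]
    exact hΓ.sideRoot_edge hN hP he
  -- the values at the beginnings of the edges
  have u_mem : ∀ e ∈ P, reverseWeights P x e * (N.reverse P).turn e * s' e = -c * s e := by
    intro e he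
    have h1 := N.turn_ne_zero e
    have h2 := hx e
    simp only [hs', hu, if_pos he, reverseWeights, hN.reverse_turn he, crossSign_of_mem hcut he]
    field_simp
    simp
  have u_notMem : ∀ e, e ∉ P → reverseWeights P x e * (N.reverse P).turn e * s' e = sS e * u e := by
    intro e he
    simp only [hs', hu, if_neg he, reverseWeights, reverse_turn_of_notMem he, edge e he]
    linear_combination (-x e * N.turn e * sT e * s e) * cross_sq e
  have off : ∀ t, t ≠ i → t ≠ j → ∀ k ≤ Γ.len, N.bd t ≠ Γ.pt k := by
    intro t hti htj k hk he
    obtain ⟨f, hf⟩ := hN.exists_incident t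
    obtain ⟨g, hg, hg'⟩ := hΓ.incident hN hf hk he
    rcases hg' with hg' | hg'
    · exact hti (hP.src_eq_inl hN hg hg')
    · exact htj (hP.tgt_eq_inl hN hg hg')
  -- the sum over the edges that leave a vertex
  have split : ∀ e, (∑ f, (N.reverse P).link e f * (reverseWeights P x f * (N.reverse P).turn f * s' f)) =
      (∑ f with f ∈ P ∧ N.tgt f = (N.reverse P).tgt e,
        halfDir (-N.dirT f / (N.reverse P).dirT e) * (-c * s f)) +
      ∑ f with f ∉ P ∧ N.src f = (N.reverse P).tgt e,
        halfDir (N.dirS f / (N.reverse P).dirT e) * (sS f * u f) := by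
    intro e
    rw [← Finset.sum_filter_add_sum_filter_not _ (fun f => f ∈ P)]
    congr 1
    · rw [← Finset.filter_filter, Finset.sum_filter (fun f => N.tgt f = _)]
      refine Finset.sum_congr rfl fun f hf => ?_
      have hf := (Finset.mem_filter.1 hf).2
      rw [u_mem f hf, link, reverse_src_of_mem hf, hN.reverse_dirS hf, ite_mul, zero_mul]
    · rw [← Finset.filter_filter, Finset.sum_filter (fun f => N.src f = _)]
      refine Finset.sum_congr rfl fun f hf => ?_
      have hf := (Finset.mem_filter.1 hf).2
      rw [u_notMem f hf, link, reverse_src_of_notMem hf, reverse_dirS_of_notMem hf, ite_mul, zero_mul]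
  have inner_N : ∀ e v, N.tgt e = Sum.inr v →
      s e = (∑ f with f ∈ P ∧ N.src f = Sum.inr v, halfDir (N.dirS f / N.dirT e) * u f) +
        ∑ f with f ∉ P ∧ N.src f = Sum.inr v, halfDir (N.dirS f / N.dirT e) * u f := by
    intro e v hv
    rw [h.inner e v hv, ← Finset.sum_filter_add_sum_filter_not _ (fun f => f ∈ P)]
    congr 1
    · rw [← Finset.filter_filter, Finset.sum_filter (fun f => N.src f = _)]
      refine Finset.sum_congr rfl fun f _ => ?_
      rw [link, hv, ite_mul, zero_mul]
    · rw [← Finset.filter_filter, Finset.sum_filter (fun f => N.src f = _)]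
      refine Finset.sum_congr rfl fun f _ => ?_
      rw [link, hv, ite_mul, zero_mul]
  have single_src : ∀ q ∈ P, ∀ F : E → ℂ,
      (∑ f with f ∈ P ∧ N.src f = N.src q, F f) = F q := by
    intro q hq F
    rw [show (Finset.univ.filter fun f => f ∈ P ∧ N.src f = N.src q) = {q} by
      ext f
      simp only [Finset.mem_filter, Finset.mem_univ, true_and, Finset.mem_singleton]
      exact ⟨fun hf => hP.src_inj hs hf.1 hq hf.2, by rintro rfl; exact ⟨hq, rfl⟩⟩, Finset.sum_singleton]
  have single_tgt : ∀ p ∈ P, ∀ F : E → ℂ,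
      (∑ f with f ∈ P ∧ N.tgt f = N.tgt p, F f) = F p := by
    intro p hp F
    rw [show (Finset.univ.filter fun f => f ∈ P ∧ N.tgt f = N.tgt p) = {p} by
      ext f
      simp only [Finset.mem_filter, Finset.mem_univ, true_and, Finset.mem_singleton]
      exact ⟨fun hf => hP.tgt_inj hs hf.1 hp hf.2, by rintro rfl; exact ⟨hp, rfl⟩⟩, Finset.sum_singleton]
  refine ⟨s', Y', ⟨?_, ?_, ?_⟩, c, hc0, ?_, ?_, ?_⟩
  · -- final vertices on the boundary
    intro e t ht
    by_cases he : e ∈ P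
    · rw [reverse_tgt_of_mem he] at ht
      obtain rfl := hP.src_eq_inl hN he ht
      simp only [hs', hY', if_pos he, true_or, if_true]
      rw [h.src_bd e t ht]
    · rw [reverse_tgt_of_notMem he] at ht
      have hti : t ≠ i := by
        rintro rfl; exact tgt_ne_of_isSource (hP.isSource hN) e ht
      have htj : t ≠ j := by
        rintro rfl
        obtain ⟨_, -, hu⟩ := exists_tgt_of_isSink (hP.isSink hN)
        exact he ((hu e ht).trans (hu q₀ hqj).symm ▸ hq₀)
      simp only [hs', hY', if_neg he, hti, htj, or_self, if_false]
      rw [h.tgt_bd e t ht, hsT]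
      simp only
      rw [ht, ← sideRoot_eq_sideVal (off t hti htj)]
      rfl
  · -- internal vertices
    intro e v hv
    rw [split e, hv]
    by_cases hvP : ∃ g ∈ P, N.src g = Sum.inr v ∨ N.tgt g = Sum.inr v
    · obtain ⟨p, q, hp, hq, hpv, hqv⟩ : ∃ p q, p ∈ P ∧ q ∈ P ∧ N.tgt p = Sum.inr v ∧
          N.src q = Sum.inr v := by
        obtain ⟨g, hg, h1 | h1⟩ := hvP
        · obtain ⟨f, hf, hf'⟩ := hP.exists_tgt hg (by rw [h1]; simp)
          exact ⟨f, g, hf, hg, hf'.trans h1, h1⟩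
        · obtain ⟨f, hf, hf'⟩ := hP.exists_src hg (by rw [h1]; simp)
          exact ⟨g, f, hg, hf, h1, hf'.trans h1⟩
      have hpq : N.tgt p = N.src q := hpv.trans hqv.symm
      have hsum1 := single_tgt p hp
      have hsum2 := single_src q hq
      rw [hpv] at hsum1
      rw [hqv] at hsum2
      rw [hsum1]
      have hNp := inner_N p v hpv
      rw [hsum2] at hNp
      by_cases he : e ∈ P
      · rw [reverse_tgt_of_mem he] at hv
        obtain rfl : e = q := hP.src_inj hs he hq (hv.trans hqv.symm)
        rw [hN.reverse_dirT he, neg_div_neg_eq]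
        -- In the reversed network `e` is followed by `p` and by the edges that leave the path here.
        -- The side roots turn the terms of the latter into multiples of those in the old relation
        -- for `p`.
        have out : ∀ f ∈ Finset.univ.filter (fun f => f ∉ P ∧ N.src f = Sum.inr v),
            halfDir (N.dirS f / -N.dirS e) * (sS f * u f) =
              c * halfDir (N.dirT p / N.dirS e) * (halfDir (N.dirS f / N.dirT p) * u f) := by
          intro f hf
          obtain ⟨hf, hfv⟩ := (Finset.mem_filter.1 hf).2
          have := hΓ.sideRoot_out hN hcor hp he hpq hf (hfv.trans hpv.symm)
          rw [div_neg, ← neg_div]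
          linear_combination (u f) * this
        rw [Finset.sum_congr rfl out, ← Finset.mul_sum]
        simp only [hs', if_pos he]
        have a2 := halfDir_mul_inv (hN.slit_succ hpq)
        rw [inv_div] at a2
        linear_combination (-c * halfDir (N.dirT p / N.dirS e)) * (-hNp) + (c * u e) * a2
      · rw [reverse_tgt_of_notMem he] at hv
        have hep : e ≠ p := by rintro rfl; exact he hp
        -- A vertex of degree 3 on the path has a single edge off the path, here `e`, which enters;
        -- so no edge but `q` leaves it.
        have hempty : Finset.univ.filter (fun f => f ∉ P ∧ N.src f = Sum.inr v) = ∅ := by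
          refine Finset.filter_eq_empty_iff.2 fun f _ hf => ?_
          exact hN.third_edge hpv hqv hv hf.2 hep (fun h => hf.1 (h ▸ hq))
        rw [hempty, Finset.sum_empty, add_zero] at hNp ⊢
        have hNe := inner_N e v hv
        rw [hsum2, hempty, Finset.sum_empty, add_zero] at hNe
        rw [reverse_dirT_of_notMem he]
        have := hΓ.sideRoot_in hN hcor hp hq hpq he (hv.trans hpv.symm)
        simp only [hs', if_neg he]
        rw [hNe, hNp]
        linear_combination (u q) * this
    · -- away from the path
      have he : e ∉ P := by
        intro he
        rw [reverse_tgt_of_mem he] at hv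
        exact hvP ⟨e, he, Or.inl hv⟩
      rw [reverse_tgt_of_notMem he] at hv
      have hempty : Finset.univ.filter (fun f => f ∈ P ∧ N.tgt f = Sum.inr v) = ∅ :=
        Finset.filter_eq_empty_iff.2 fun f _ hf => hvP ⟨f, hf.1, Or.inr hf.2⟩
      have hempty' : Finset.univ.filter (fun f => f ∈ P ∧ N.src f = Sum.inr v) = ∅ :=
        Finset.filter_eq_empty_iff.2 fun f _ hf => hvP ⟨f, hf.1, Or.inl hf.2⟩
      have hNe := inner_N e v hv
      rw [hempty', Finset.sum_empty, zero_add] at hNe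
      rw [hempty, Finset.sum_empty, zero_add, reverse_dirT_of_notMem he]
      simp only [hs', if_neg he]
      rw [hNe, Finset.mul_sum]
      refine Finset.sum_congr rfl fun f hf => ?_
      obtain ⟨hf, hfv⟩ := (Finset.mem_filter.1 hf).2
      have hoff : ∀ k ≤ Γ.len, N.pos (Sum.inr v) ≠ Γ.pt k := by
        intro k hk he'
        exact hvP (hΓ.incident hN (Or.inl hfv) hk he')
      -- At a vertex off the path the side root does not depend on the direction.
      have : sT e = sS f := by
        simp only [hsT, hsS, hv, hfv]
        exact sideRoot_congr hoff _ _
      rw [this]; ring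
  · -- initial vertices on the boundary
    intro e t ht
    by_cases he : e ∈ P
    · rw [u_mem e he]
      rw [reverse_src_of_mem he] at ht
      obtain rfl := hP.tgt_eq_inl hN he ht
      simp only [hY', or_true, if_true]
      rw [h.tgt_bd e t ht]
    · rw [u_notMem e he]
      rw [reverse_src_of_notMem he] at ht
      have htj : t ≠ j := by
        rintro rfl; exact src_ne_of_isSink (hP.isSink hN) e ht
      have hti : t ≠ i := by
        rintro rfl
        obtain ⟨_, -, hu⟩ := exists_src_of_isSource (hP.isSource hN)
        exact he ((hu e ht).trans (hu p₀ hpi).symm ▸ hp₀)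
      simp only [hY', hti, htj, or_self, if_false]
      rw [h.src_bd e t ht, hsS]
      simp only
      rw [ht, ← sideRoot_eq_sideVal (off t hti htj) (N.dirS e)]
      rfl
  · simp [hY']
  · simp [hY']
  · intro t hti htj
    simp only [hY', hti, htj, or_self, if_false]
    rw [hΓ.sideVal_bd hN hP hp₀ hpi hq₀ hqj hij hc hc' hcut hti htj]

end AnnularGraph

end AnnularNet

end

noncomputable section

namespace AnnularNet

/-! ### Power series that count lists -/

section ListSeries

variable {E R : Type*} [CommRing R]

open Classical in
/-- The sum over all lists of the monomials with coefficients `g`. -/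
def listSeries (g : List E → R) : MvPowerSeries E R := fun m =>
  ∑ p ∈ (Multiset.lists (Finsupp.toMultiset m)).toFinset, g p

theorem listSeries_const_mul (c : R) (g : List E → R) :
    listSeries (fun p => c * g p) = MvPowerSeries.C c * listSeries g := by
  ext m
  rw [MvPowerSeries.coeff_C_mul]
  change ∑ p ∈ _, _ = c * ∑ p ∈ _, _
  rw [Finset.mul_sum]

/-- Splitting off the first entries of the lists. -/
theorem listSeries_eq [Fintype E] (g : List E → R) :
    listSeries g = MvPowerSeries.C (g []) +
      ∑ f, MvPowerSeries.X f * listSeries fun p => g (f :: p) := by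
  classical
  ext m
  rw [map_add, map_sum, MvPowerSeries.coeff_C]
  change ∑ p ∈ (Multiset.lists (Finsupp.toMultiset m)).toFinset, g p = _
  rw [← Finset.sum_fiberwise (g := fun p : List E => p.head?), Fintype.sum_option]
  have mem : ∀ (m : E →₀ ℕ) (p : List E), p ∈ (Multiset.lists (Finsupp.toMultiset m)).toFinset ↔
      Finsupp.toMultiset m = (p : Multiset E) := by
    intro m p
    rw [Multiset.mem_toFinset, Multiset.mem_lists_iff]; rfl
  congr 1
  · have hfil : (Multiset.lists (Finsupp.toMultiset m)).toFinset.filter (fun p => p.head? = none) =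
        if m = 0 then {[]} else ∅ := by
      ext p
      rw [Finset.mem_filter, mem]
      split_ifs with h
      · subst h
        simp only [map_zero, Finset.mem_singleton, List.head?_eq_none_iff]
        exact ⟨fun h => h.2, fun h => ⟨by rw [h]; rfl, h⟩⟩
      · simp only [List.head?_eq_none_iff, Finset.notMem_empty, iff_false]
        rintro ⟨h1, rfl⟩
        refine h ?_
        rw [← Finsupp.toMultiset_toFinsupp m, h1]
        exact map_zero _
    rw [hfil]
    split_ifs <;> simp
  · refine Finset.sum_congr rfl fun f _ => ?_
    rw [MvPowerSeries.X_def, MvPowerSeries.coeff_monomial_mul, one_mul]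
    split_ifs with h
    · change _ = ∑ p ∈ (Multiset.lists (Finsupp.toMultiset (m - Finsupp.single f 1))).toFinset, _
      have hm : Finsupp.toMultiset m = f ::ₘ Finsupp.toMultiset (m - Finsupp.single f 1) := by
        conv_lhs => rw [← add_tsub_cancel_of_le h]
        rw [map_add, Finsupp.toMultiset_single, one_smul, Multiset.singleton_add]
      refine Finset.sum_nbij' List.tail (fun p => f :: p) ?_ ?_ ?_ ?_ ?_
      · intro p hp
        rw [Finset.mem_filter, mem] at hp
        rw [mem]
        obtain ⟨h1, h2⟩ := hp
        rcases p with _ | ⟨e, p⟩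
        · simp at h2
        · obtain rfl : e = f := by simpa using h2
          rw [hm, ← Multiset.cons_coe, Multiset.cons_inj_right] at h1
          exact h1
      · intro p hp
        rw [mem] at hp
        rw [Finset.mem_filter, mem, hm, hp]
        exact ⟨rfl, rfl⟩
      · intro p hp
        rw [Finset.mem_filter] at hp
        rcases p with _ | ⟨e, p⟩
        · simp at hp
        · obtain rfl : e = f := by simpa using hp.2
          rfl
      · intro p _; rfl
      · intro p hp
        rw [Finset.mem_filter] at hp
        rcases p with _ | ⟨e, p⟩
        · simp at hp
        · obtain rfl : e = f := by simpa using hp.2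
          rfl
    · rw [Finset.filter_eq_empty_iff.2, Finset.sum_empty]
      intro p hp hhead
      rw [mem] at hp
      rcases p with _ | ⟨e, p⟩
      · simp at hhead
      · obtain rfl : e = f := by simpa using hhead
        apply h
        rw [Finsupp.single_le_iff, ← Finsupp.count_toMultiset, hp, Multiset.coe_count]
        simp

end ListSeries

/-- Cramer's rule for a system of linear equations after a change of rings. -/
theorem cramer_map {ι R S : Type*} [Fintype ι] [DecidableEq ι] [CommRing R] [CommRing S]
    (φ : R →+* S) (M : Matrix ι ι R) {W u : ι → S} (h : ∀ e, ∑ f, φ (M e f) * W f = u e) (e : ι) :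
    φ M.det * W e = ∑ f, φ (M.adjugate e f) * u f := by
  have h1 : (M.map φ).mulVec W = u := funext h
  rw [← h1]
  have h2 : (M.adjugate.map φ).mulVec ((M.map φ).mulVec W) e = φ M.det * W e := by
    rw [Matrix.mulVec_mulVec, ← Matrix.map_mul, Matrix.adjugate_mul]
    simp [Matrix.mulVec, dotProduct, Matrix.one_apply, apply_ite]
  rw [← h2]
  rfl

namespace AnnularGraph

variable {n : ℕ} {V₀ E : Type*} {N : AnnularGraph n V₀ E}

/-! ### The response of a network -/

section Response

open Classical in
/-- The weight of a walk that continues the edge `e` and ends at `b_t`. -/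
def walkWeight (N : AnnularGraph n V₀ E) (t : Fin n) : E → List E → ℂ
  | e, [] => if N.tgt e = Sum.inl t then 1 else 0
  | e, f :: p => N.link e f * N.turn f * N.walkWeight t f p

-- `link` vanishes on edges that are not consecutive, so a sum over all lists of edges is a sum over
-- paths.
open Classical in
theorem walkWeight_eq (t : Fin n) (e : E) (p : List E) :
    N.turn e * N.walkWeight t e p = if (e :: p).IsChain (fun e f => N.tgt e = N.src f) ∧
      (e :: p).getLast?.map N.tgt = some (Sum.inl t) then N.pathTurn e p else 0 := by
  induction p generalizing e with
  | nil => simp [walkWeight, pathTurn]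
  | cons f p ih =>
    simp only [walkWeight, pathTurn, List.isChain_cons_cons, List.getLast?_cons_cons]
    have h1 := ih f
    have h2 : N.turn e * (N.link e f * N.turn f * N.walkWeight t f p) =
        N.turn e * N.link e f * (N.turn f * N.walkWeight t f p) := by ring
    rw [h2, h1, link]
    by_cases h : N.src f = N.tgt e
    · simp only [h, if_true, true_and]
      split_ifs <;> simp
    · have h' : ¬ N.tgt e = N.src f := fun hh => h hh.symm
      simp [h, h']

variable [Fintype E]

open Classical in
/-- The matrix of the linear relations of a network. -/
def relMatrix (N : AnnularGraph n V₀ E) : Matrix E E (MvPolynomial E ℂ) :=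
  1 - Matrix.of fun e f => MvPolynomial.C (N.link e f * N.turn f) * MvPolynomial.X f

open Classical in
/-- The edges that end at `b_t`. -/
def sinkVec (N : AnnularGraph n V₀ E) (t : Fin n) (e : E) : MvPolynomial E ℂ :=
  if N.tgt e = Sum.inl t then 1 else 0

open Classical in
/-- The determinant of the linear relations of a network. -/
def relDet (N : AnnularGraph n V₀ E) : MvPolynomial E ℂ := N.relMatrix.det

open Classical in
/-- The values at the ends of the edges in terms of the value at `b_t`, by Cramer's rule. -/
def cramerVec (N : AnnularGraph n V₀ E) (t : Fin n) : E → MvPolynomial E ℂ :=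
  N.relMatrix.adjugate.mulVec (N.sinkVec t)

/-- At zero weights the matrix of the relations is the identity. -/
theorem relDet_ne_zero (N : AnnularGraph n V₀ E) : N.relDet ≠ 0 := by
  classical
  intro h
  have h1 : MvPolynomial.constantCoeff N.relDet = 1 := by
    rw [relDet, RingHom.map_det]
    have : (MvPolynomial.constantCoeff (R := ℂ) (σ := E)).mapMatrix N.relMatrix = 1 := by
      ext e f
      simp [relMatrix, Matrix.one_apply, apply_ite]
    rw [this, Matrix.det_one]
  rw [h, map_zero] at h1
  exact zero_ne_one h1

open Classical in
theorem sum_relMatrix {S : Type*} [CommRing S] (φ : MvPolynomial E ℂ →+* S) (W : E → S) (e : E) :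
    ∑ f, φ (N.relMatrix e f) * W f = W e -
      ∑ f, φ (MvPolynomial.C (N.link e f * N.turn f)) * φ (MvPolynomial.X f) * W f := by
  simp only [relMatrix, Matrix.sub_apply, Matrix.of_apply, map_sub, map_mul φ, sub_mul,
    Finset.sum_sub_distrib]
  congr 1
  simp [Matrix.one_apply, apply_ite]

-- An edge that ends at a sink has no continuation. Hence the equations for all edges form one
-- system with the matrix `relMatrix` and with the values at the sinks on the right-hand side.
open Classical in
theorem IsState.relDet_mul {x s : E → ℂ} {Y : Fin n → ℂ} (hN : N.IsPerfect) (h : N.IsState x s Y)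
    (e : E) : MvPolynomial.eval x N.relDet * s e =
      ∑ t, MvPolynomial.eval x (N.cramerVec t e) * Y t := by
  have key := cramer_map (MvPolynomial.eval x) N.relMatrix (W := s)
    (u := fun e => ∑ t, MvPolynomial.eval x (N.sinkVec t e) * Y t) (fun e => ?_) e
  · rw [relDet, key]
    simp only [cramerVec, Matrix.mulVec, dotProduct, map_sum, map_mul, Finset.mul_sum,
      Finset.sum_mul]
    rw [Finset.sum_comm]
    simp only [mul_assoc]
  · rw [sum_relMatrix]
    simp only [MvPolynomial.eval_C, MvPolynomial.eval_X]
    cases hv : N.tgt e with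
    | inl t =>
      have h2 : ∀ f, N.link e f = 0 := fun f => by
        rw [link, hv, if_neg]
        exact src_ne_of_isSink (hN.isSink_of_tgt hv) f
      simp [h2, sinkVec, hv, h.tgt_bd e t hv, apply_ite]
    | inr v =>
      rw [h.inner e v hv, sub_eq_zero.2 (Finset.sum_congr rfl fun f _ => by ring)]
      simp [sinkVec, hv]

-- If the determinant does not vanish, the values at the sinks can be prescribed, and those at the
-- sources are read off from their unique edges.
open Classical in
theorem exists_isState (hN : N.IsPerfect) {x : E → ℂ} (hx : MvPolynomial.eval x N.relDet ≠ 0)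
    (y : Fin n → ℂ) : ∃ s Y, N.IsState x s Y ∧ ∀ t, N.IsSink t → Y t = y t := by
  set M := N.relMatrix.map (MvPolynomial.eval x) with hM
  have hdet : M.det = MvPolynomial.eval x N.relDet := by
    rw [relDet, RingHom.map_det]; rfl
  have hu : IsUnit M.det := by rw [hdet]; exact isUnit_iff_ne_zero.2 hx
  set δ : E → ℂ := fun e => ∑ t, MvPolynomial.eval x (N.sinkVec t e) * y t with hδ
  set s := M⁻¹.mulVec δ with hs
  have hMs : M.mulVec s = δ := by
    rw [hs, Matrix.mulVec_mulVec, Matrix.mul_nonsing_inv _ hu, Matrix.one_mulVec]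
  have hrow : ∀ e, s e = δ e + ∑ f, N.link e f * (x f * N.turn f * s f) := by
    intro e
    have h1 : M.mulVec s e = s e - ∑ f, N.link e f * (x f * N.turn f * s f) := by
      rw [hM]
      refine (sum_relMatrix (MvPolynomial.eval x) s e).trans ?_
      simp only [MvPolynomial.eval_C, MvPolynomial.eval_X]
      congr 1
      exact Finset.sum_congr rfl fun f _ => by ring
    rw [hMs] at h1
    rw [h1]; ring
  refine ⟨s, fun t => if h : ∃ e, N.src e = Sum.inl t then
    x h.choose * N.turn h.choose * s h.choose else y t, ⟨?_, ?_, ?_⟩, ?_⟩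
  · intro e t ht
    have hsink := hN.isSink_of_tgt ht
    have hno : ¬ ∃ e, N.src e = Sum.inl t := fun ⟨e, he⟩ => src_ne_of_isSink hsink e he
    have h2 : ∀ f, N.link e f = 0 := fun f => by
      rw [link, ht, if_neg]
      exact src_ne_of_isSink hsink f
    rw [dif_neg hno, hrow e]
    simp [h2, hδ, sinkVec, ht, apply_ite]
  · intro e v hv
    rw [hrow e]
    simp [hδ, sinkVec, hv]
  · intro e t ht
    have hex : ∃ e, N.src e = Sum.inl t := ⟨e, ht⟩
    obtain ⟨e', -, hu⟩ := exists_src_of_isSource (hN.isSource_of_src ht)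
    rw [dif_pos hex, hu e ht, hu _ hex.choose_spec]
  · intro t ht
    have hno : ¬ ∃ e, N.src e = Sum.inl t := fun ⟨e, he⟩ => src_ne_of_isSink ht e he
    exact dif_neg hno

open Classical in
/-- The power series that count walks satisfy the linear relations. -/
theorem relDet_mul_listSeries (t : Fin n) (e : E) :
    (N.relDet : MvPowerSeries E ℂ) * listSeries (N.walkWeight t e) = (N.cramerVec t e : _) := by
  set W : E → MvPowerSeries E ℂ := fun e => listSeries (N.walkWeight t e) with hW
  set φ := MvPolynomial.coeToMvPowerSeries.ringHom (σ := E) (R := ℂ) with hφ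
  -- A walk that continues `e` either stops or proceeds to some edge `f`.
  have hrec : ∀ e, W e = φ (N.sinkVec t e) +
      ∑ f, MvPowerSeries.C (N.link e f * N.turn f) * MvPowerSeries.X f * W f := by
    intro e
    simp only [hW]
    rw [listSeries_eq]
    congr 1
    · simp only [walkWeight, sinkVec, hφ]
      split_ifs <;> simp
    · refine Finset.sum_congr rfl fun f _ => ?_
      have : (fun p => N.walkWeight t e (f :: p)) =
          fun p => (N.link e f * N.turn f) * N.walkWeight t f p := rfl
      rw [this, listSeries_const_mul]; ring
  have key := cramer_map φ N.relMatrix (W := W) (u := fun e => φ (N.sinkVec t e)) (fun e => ?_) e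
  · refine key.trans ?_
    change _ = φ (N.cramerVec t e)
    simp only [cramerVec, Matrix.mulVec, dotProduct, map_sum, map_mul]
  · rw [sum_relMatrix, hrec e]
    simp only [hφ, MvPolynomial.coeToMvPowerSeries.ringHom_apply, MvPolynomial.coe_C,
      MvPolynomial.coe_X]
    ring

/-- The values `c` at the boundary vertices, in their normalization, belong to a state. -/
def Balanced (N : AnnularGraph n V₀ E) (x : E → ℂ) (c : Fin n → ℂ) : Prop :=
  ∃ s, N.IsState x s fun t => N.gauge t * c t

theorem IsState.smul {x s : E → ℂ} {Y : Fin n → ℂ} (h : N.IsState x s Y) (k : ℂ) :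
    N.IsState x (fun e => k * s e) fun t => k * Y t where
  tgt_bd e t ht := by rw [h.tgt_bd e t ht]
  inner e v hv := by
    rw [h.inner e v hv, Finset.mul_sum]
    exact Finset.sum_congr rfl fun f _ => by ring
  src_bd e t ht := by rw [h.src_bd e t ht]; ring

/-- The balanced values at the boundary are the same for a network and the network with a reversed
path. -/
theorem Balanced.reverse {i j : Fin n} {P : List E} (hN : N.IsPerfect) (hP : N.IsPath i j P)
    (hs : N.IsSimplePath P) (hcut : N.AvoidsCut P) {x : E → ℂ} (hx : ∀ e, x e ≠ 0)
    {c : Fin n → ℂ} (h : N.Balanced (fun e => (N.crossSign i j e : ℂ) * x e) c) :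
    (N.reverse P).Balanced (reverseWeights P x) c := by
  obtain ⟨s, h⟩ := h
  obtain ⟨s', Y', h', k, hk, h1, h2, h3⟩ := h.reverse hN hP hs hcut hx
  -- Forced by the comparison at `b_i`; the remaining cases show that the same constant serves all
  -- boundary vertices.
  set κ : ℂ := Complex.I * (if j < i then -1 else 1) * k with hκ
  have hκ0 : κ ≠ 0 := by
    refine mul_ne_zero (mul_ne_zero Complex.I_ne_zero ?_) hk
    split_ifs <;> norm_num
  have hij := hP.ne hs
  have hII := Complex.I_mul_I
  refine ⟨fun e => κ⁻¹ * s' e, ?_⟩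
  have key : (fun t => (N.reverse P).gauge t * c t) = fun t => κ⁻¹ * Y' t := by
    ext t
    rw [eq_inv_mul_iff_mul_eq₀ hκ0]
    by_cases hti : t = i
    · subst hti
      rw [h1, gauge_reverse_start hN hP hs, hκ]
      split_ifs <;> linear_combination (k * N.gauge t * c t) * hII
    by_cases htj : t = j
    · subst htj
      rw [h2, gauge_reverse_end hN hP hs, hκ]
      rcases lt_or_gt_of_ne hij with hl | hl
      · rw [if_neg hl.not_gt, if_pos hl]; linear_combination (k * N.gauge t * c t) * hII
      · rw [if_pos hl, if_neg hl.not_gt]; linear_combination (k * N.gauge t * c t) * hII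
    -- The sign given by the cyclic order of `i`, `t`, `j` is, up to a global minus, the product of
    -- the signs of the three pairwise comparisons.
    · rw [h3 t hti htj, gauge_reverse_of_ne hN hP hs hti htj, hκ]
      rcases lt_or_gt_of_ne hij with hl | hl <;> rcases lt_or_gt_of_ne hti with h4 | h4 <;>
        rcases lt_or_gt_of_ne htj with h5 | h5 <;>
        simp only [hl, h4, h5, hl.not_gt, h4.not_gt, h5.not_gt, if_true, if_false, and_self,
          and_true, and_false, or_false, or_true, or_self] <;>
        first
          | exact absurd (h4.trans hl) h5.not_gt
          | exact absurd (h5.trans hl) h4.not_gt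
          | ring
  rw [key]
  exact h'.smul _

open Classical in
/-- The boundary response of a network: the signed boundary measurements are rational functions, and
they express the balanced values at the sources in terms of those at the sinks. -/
theorem IsPerfect.exists_response (hN : N.IsPerfect) :
    ∃ (Q : MvPolynomial E ℂ) (A : Fin n → Fin n → MvPolynomial E ℂ), Q ≠ 0 ∧
      (∀ a b, N.IsSource a → N.IsSink b → (Q : MvPowerSeries E ℂ) *
        ((-1) ^ N.between a b * MvPowerSeries.map (Int.castRingHom ℂ) (N.measSeries a b)) =
          (A a b : MvPowerSeries E ℂ)) ∧
      (∀ x c, N.Balanced x c → ∀ a, N.IsSource a → MvPolynomial.eval x Q * c a =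
        -∑ b with N.IsSink b, MvPolynomial.eval x (A a b) * c b) ∧
      ∀ x, MvPolynomial.eval x Q ≠ 0 → ∀ y : Fin n → ℂ,
        ∃ c, N.Balanced x c ∧ ∀ b, N.IsSink b → c b = y b := by
  -- The numerator sums Cramer's solution over the edges that leave `b_a`, normalized by the gauges
  -- as in `pathSign_eq`.
  refine ⟨N.relDet, fun a b => -(MvPolynomial.C (N.gauge b / N.gauge a) *
    ∑ f with N.src f = Sum.inl a, MvPolynomial.C (N.turn f) * MvPolynomial.X f * N.cramerVec b f),
    N.relDet_ne_zero, ?_, ?_, ?_⟩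
  · intro a b ha hb
    have h1 : (-1) ^ N.between a b * MvPowerSeries.map (Int.castRingHom ℂ) (N.measSeries a b) =
        listSeries fun p => if N.IsPath a b p then
          (-1) ^ N.between a b * ((N.pathSign a b p : ℤ) : ℂ) else 0 := by
      have : (-1 : MvPowerSeries E ℂ) ^ N.between a b = MvPowerSeries.C ((-1) ^ N.between a b) := by
        simp
      rw [this]
      ext m
      rw [MvPowerSeries.coeff_C_mul, MvPowerSeries.coeff_map]
      change _ * Int.castRingHom ℂ (∑ p ∈ Finset.filter _ _, _) = ∑ p ∈ _, _
      rw [map_sum, Finset.mul_sum, Finset.sum_filter]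
      rfl
    have h2 : ∀ f p, (if N.IsPath a b (f :: p) then
          (-1) ^ N.between a b * ((N.pathSign a b (f :: p) : ℤ) : ℂ) else 0) =
        (if N.src f = Sum.inl a then -(N.gauge b / N.gauge a) * N.turn f else 0) *
          N.walkWeight b f p := by
      intro f p
      rw [ite_mul, zero_mul, mul_assoc, walkWeight_eq]
      by_cases hp : N.IsPath a b (f :: p)
      · have hs : N.src f = Sum.inl a := by simpa using hp.2.1
        rw [if_pos hp, if_pos hs, if_pos ⟨hp.1, hp.2.2⟩, hN.pathSign_eq hp]
      · rw [if_neg hp]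
        split_ifs with h3 h4
        · exact absurd ⟨h4.1, by simp [h3], h4.2⟩ hp
        · rw [mul_zero]
        · rfl
    have hnil : ¬ N.IsPath a b [] := fun h => h.ne_nil rfl
    rw [h1, listSeries_eq, if_neg hnil, map_zero, zero_add]
    simp only [h2, listSeries_const_mul]
    rw [Finset.mul_sum]
    have h3 : ∀ f, (N.relDet : MvPowerSeries E ℂ) * (MvPowerSeries.X f *
        (MvPowerSeries.C (if N.src f = Sum.inl a then -(N.gauge b / N.gauge a) * N.turn f else 0) *
          listSeries fun p => N.walkWeight b f p)) =
        MvPolynomial.coeToMvPowerSeries.ringHom (if N.src f = Sum.inl a then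
          -(MvPolynomial.C (N.gauge b / N.gauge a) *
            (MvPolynomial.C (N.turn f) * MvPolynomial.X f * N.cramerVec b f)) else 0) := by
      intro f
      have h4 := relDet_mul_listSeries (N := N) b f
      split_ifs
      · rw [map_neg, map_mul, map_mul, map_mul, map_mul, map_neg]
        simp only [MvPolynomial.coeToMvPowerSeries.ringHom_apply, MvPolynomial.coe_C,
          MvPolynomial.coe_X]
        rw [← h4]
        ring
      · simp
    rw [Finset.sum_congr rfl fun f _ => h3 f, ← map_sum, ← Finset.sum_filter,
      Finset.sum_neg_distrib, ← Finset.mul_sum]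
    rfl
  · rintro x c ⟨s, h⟩ a ha
    obtain ⟨e, he, hu⟩ := exists_src_of_isSource ha
    have h1 := h.src_bd e a he
    have h2 := h.relDet_mul hN e
    have hfil : Finset.univ.filter (fun f => N.src f = Sum.inl a) = {e} := by
      ext f
      simp only [Finset.mem_filter, Finset.mem_univ, true_and, Finset.mem_singleton]
      exact ⟨hu f, fun hf => hf ▸ he⟩
    simp only [hfil, Finset.sum_singleton, map_neg, map_mul, MvPolynomial.eval_C,
      MvPolynomial.eval_X]
    have hD := N.gauge_ne_zero a
    apply mul_left_cancel₀ hD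
    -- Cramer's vector is zero for a boundary vertex at which no edge ends.
    have h3 : ∑ t, MvPolynomial.eval x (N.cramerVec t e) * (N.gauge t * c t) =
        ∑ t with N.IsSink t, MvPolynomial.eval x (N.cramerVec t e) * (N.gauge t * c t) := by
      rw [Finset.sum_filter]
      refine Finset.sum_congr rfl fun t _ => ?_
      split_ifs with ht
      · rfl
      · have : N.sinkVec t = 0 := by
          ext1 f
          rw [sinkVec, if_neg]
          · rfl
          · intro hf; exact ht (hN.isSink_of_tgt hf)
        rw [cramerVec, this]; simp
    rw [h3] at h2
    calc N.gauge a * (MvPolynomial.eval x N.relDet * c a)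
        = MvPolynomial.eval x N.relDet * (N.gauge a * c a) := by ring
      _ = x e * N.turn e * (MvPolynomial.eval x N.relDet * s e) := by rw [h1]; ring
      _ = _ := by
        rw [h2, ← Finset.sum_neg_distrib, Finset.mul_sum, Finset.mul_sum]
        refine Finset.sum_congr rfl fun t _ => ?_
        field_simp
  · intro x hx y
    obtain ⟨s, Y, h, hY⟩ := exists_isState hN hx fun t => N.gauge t * y t
    refine ⟨fun t => Y t / N.gauge t, ⟨s, ?_⟩, fun b hb => ?_⟩
    · have : (fun t => N.gauge t * (Y t / N.gauge t)) = Y := by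
        ext t; rw [mul_div_cancel₀ _ (N.gauge_ne_zero t)]
      rwa [this]
    · change Y b / N.gauge b = y b
      rw [hY b hb, mul_div_cancel_left₀ _ (N.gauge_ne_zero b)]

end Response

end AnnularGraph

end AnnularNet

end

noncomputable section

namespace AnnularNet

/-! ### Exchanging a sink and a source -/

open Classical in
/-- The coefficients of a system of linear equations after the exchange of the variables `i` and
`j`. -/
def pivot {n : ℕ} {F : Type*} [Field F] (A : Fin n → Fin n → F) (i j a b : Fin n) : F :=
  if a = j then if b = i then 1 / A i j else A i b / A i j
  else if b = i then -A a j / A i j else A a b - A a j * A i b / A i j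

section Pivot

variable {n : ℕ} {F : Type*} [Field F] {S S' : Fin n → Prop} {i j : Fin n}

-- Both systems hold on `B`, and there the variables outside `S` take arbitrary values, so one
-- suitable vector determines each new coefficient.
open Classical in
theorem eq_pivot (hi : S i) (hj : ¬ S j) (hS : ∀ t, S' t ↔ (S t ∧ t ≠ i) ∨ t = j)
    {A A' : Fin n → Fin n → F} (hA : A i j ≠ 0) {B : (Fin n → F) → Prop}
    (hex : ∀ y : Fin n → F, ∃ c, B c ∧ ∀ b, ¬ S b → c b = y b)
    (hB : ∀ c, B c → ∀ a, S a → c a = -∑ b with ¬ S b, A a b * c b)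
    (hB' : ∀ c, B c → ∀ a, S' a → c a = -∑ b with ¬ S' b, A' a b * c b)
    {a b : Fin n} (ha : S' a) (hb : ¬ S' b) : A' a b = pivot A i j a b := by
  have hij : i ≠ j := by rintro rfl; exact hj hi
  have hbj : b ≠ j := fun h => hb ((hS b).2 (Or.inr h))
  -- the values for which `b` is the only nonzero independent variable after the exchange
  obtain ⟨c, hc, hcb⟩ := hex fun t =>
    if t = j then (if b = i then -1 / A i j else -A i b / A i j) else if t = b then 1 else 0
  have hcj : c j = if b = i then -1 / A i j else -A i b / A i j := by
    rw [hcb j hj, if_pos rfl]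
  have expand : ∀ a, S a → c a = -(A a j * c j + if b = i then 0 else A a b) := by
    intro a ha
    rw [hB c hc a ha]
    congr 1
    rw [← Finset.add_sum_erase _ _ (show j ∈ Finset.univ.filter (fun b => ¬ S b) by simp [hj])]
    congr 1
    have hz : ∀ t ∈ (Finset.univ.filter (fun b => ¬ S b)).erase j, A a t * c t =
        if t = b then A a b else 0 := by
      intro t ht
      obtain ⟨h1, h2⟩ := Finset.mem_erase.1 ht
      rw [hcb t (Finset.mem_filter.1 h2).2]
      simp only [if_neg h1]
      split_ifs with h
      · rw [h, mul_one]
      · rw [mul_zero]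
    rw [Finset.sum_congr rfl hz, Finset.sum_ite_eq']
    by_cases hbi : b = i
    · rw [if_pos hbi, if_neg]
      simp [hbi, hi]
    · rw [if_neg hbi, if_pos]
      simp only [Finset.mem_erase, Finset.mem_filter, Finset.mem_univ, true_and]
      exact ⟨hbj, fun h => hb ((hS b).2 (Or.inl ⟨h, hbi⟩))⟩
  -- The value prescribed at `j` was chosen for this: among the new independent variables only that
  -- of `b` is nonzero.
  have hci : c i = if b = i then 1 else 0 := by
    rw [expand i hi, hcj]
    split_ifs <;> field_simp <;> ring
  have hone : c a = -A' a b := by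
    rw [hB' c hc a ha]
    congr 1
    have hz : ∀ t ∈ Finset.univ.filter (fun b => ¬ S' b), A' a t * c t =
        if t = b then A' a b else 0 := by
      intro t ht
      have ht := (Finset.mem_filter.1 ht).2
      have htj : t ≠ j := fun h => ht ((hS t).2 (Or.inr h))
      have hct : c t = if t = b then 1 else 0 := by
        by_cases hti : t = i
        · rw [hti, hci]; simp only [eq_comm]
        · rw [hcb t fun h => ht ((hS t).2 (Or.inl ⟨h, hti⟩)), if_neg htj]
      rw [hct]
      split_ifs with h
      · rw [h, mul_one]
      · rw [mul_zero]
    rw [Finset.sum_congr rfl hz, Finset.sum_ite_eq', if_pos (by simp [hb])]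
  have hA' : A' a b = -c a := by rw [hone, neg_neg]
  rw [hA', pivot]
  by_cases haj : a = j
  · subst haj
    rw [if_pos rfl, hcj]
    split_ifs <;> ring
  · rw [if_neg haj, expand a ((hS a).1 ha |>.resolve_right haj).1, hcj]
    split_ifs <;> ring

open Classical in
/-- The exchange of two variables does not change the space of the solutions. -/
theorem span_pivot (hi : S i) (hj : ¬ S j) (hS : ∀ t, S' t ↔ (S t ∧ t ≠ i) ∨ t = j)
    {A A' : Fin n → Fin n → F} (hA : A i j ≠ 0)
    (hA' : ∀ a b, S' a → ¬ S' b → A' a b = pivot A i j a b) :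
    Submodule.span F (Set.range fun (a : {a // S a}) t =>
        if S t then (if (a : Fin n) = t then 1 else 0) else A a t) =
      Submodule.span F (Set.range fun (a : {a // S' a}) t =>
        if S' t then (if (a : Fin n) = t then 1 else 0) else A' a t) := by
  have hij : i ≠ j := by rintro rfl; exact hj hi
  set row : {a // S a} → Fin n → F := fun a t =>
    if S t then (if (a : Fin n) = t then 1 else 0) else A a t with hrow
  set row' : {a // S' a} → Fin n → F := fun a t =>
    if S' t then (if (a : Fin n) = t then 1 else 0) else A' a t with hrow'
  have hSj : S' j := (hS j).2 (Or.inr rfl)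
  have hSi : ¬ S' i := fun h => ((hS i).1 h).elim (fun h => h.2 rfl) hij
  -- One step of elimination: the old row `i` is a multiple of the new row `j`, and each other old
  -- row differs from its new version by a multiple of that row.
  have e1 : row ⟨i, hi⟩ = A i j • row' ⟨j, hSj⟩ := by
    ext t
    simp only [hrow, hrow', Pi.smul_apply, smul_eq_mul]
    by_cases hti : t = i
    · subst hti
      rw [if_pos hi, if_pos rfl, if_neg hSi, hA' _ _ hSj hSi, pivot, if_pos rfl, if_pos rfl]
      field_simp
    by_cases htj : t = j
    · subst htj
      rw [if_neg hj, if_pos hSj, if_pos rfl, mul_one]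
    have hst : S' t ↔ S t := by rw [hS]; simp [hti, htj]
    by_cases ht : S t
    · rw [if_pos ht, if_pos (hst.2 ht), if_neg (Ne.symm hti), if_neg (Ne.symm htj), mul_zero]
    · rw [if_neg ht, if_neg (fun h => ht (hst.1 h)), hA' _ _ hSj (fun h => ht (hst.1 h)), pivot,
        if_pos rfl, if_neg hti]
      field_simp
  have e2 : ∀ (a : Fin n) (h : S a) (h' : S' a),
      row ⟨a, h⟩ = row' ⟨a, h'⟩ + A a j • row' ⟨j, hSj⟩ := by
    intro a h h'
    have haj : a ≠ j := by rintro rfl; exact hj h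
    have hai : a ≠ i := by rintro rfl; exact hSi h'
    ext t
    simp only [hrow, hrow', Pi.add_apply, Pi.smul_apply, smul_eq_mul]
    by_cases hti : t = i
    · subst hti
      rw [if_pos hi, if_neg hai, if_neg hSi, if_neg hSi, hA' _ _ h' hSi, hA' _ _ hSj hSi, pivot,
        pivot, if_neg haj, if_pos rfl, if_pos rfl, if_pos rfl]
      field_simp; ring
    by_cases htj : t = j
    · subst htj
      rw [if_neg hj, if_pos hSj, if_pos hSj, if_neg haj, if_pos rfl]
      ring
    have hst : S' t ↔ S t := by rw [hS]; simp [hti, htj]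
    by_cases ht : S t
    · rw [if_pos ht, if_pos (hst.2 ht), if_pos (hst.2 ht), if_neg (Ne.symm htj)]; ring
    · have ht' : ¬ S' t := fun h => ht (hst.1 h)
      rw [if_neg ht, if_neg ht', if_neg ht', hA' _ _ h' ht', hA' _ _ hSj ht', pivot, pivot,
        if_neg haj, if_neg hti, if_pos rfl, if_neg hti]
      ring
  have mem : ∀ a, row a ∈ Submodule.span F (Set.range row) := fun a =>
    Submodule.subset_span ⟨a, rfl⟩
  have mem' : ∀ a, row' a ∈ Submodule.span F (Set.range row') := fun a =>
    Submodule.subset_span ⟨a, rfl⟩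
  have e1' : row' ⟨j, hSj⟩ = (A i j)⁻¹ • row ⟨i, hi⟩ := by
    rw [e1, smul_smul, inv_mul_cancel₀ hA, one_smul]
  apply le_antisymm
  · rw [Submodule.span_le]
    rintro _ ⟨⟨a, ha⟩, rfl⟩
    by_cases hai : a = i
    · subst hai
      rw [SetLike.mem_coe, e1]
      exact Submodule.smul_mem _ _ (mem' _)
    · rw [SetLike.mem_coe, e2 a ha ((hS a).2 (Or.inl ⟨ha, hai⟩))]
      exact Submodule.add_mem _ (mem' _) (Submodule.smul_mem _ _ (mem' _))
  · have hj' : row' ⟨j, hSj⟩ ∈ Submodule.span F (Set.range row) := by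
      rw [e1']; exact Submodule.smul_mem _ _ (mem _)
    rw [Submodule.span_le]
    rintro _ ⟨⟨a, ha⟩, rfl⟩
    rcases (hS a).1 ha with h | h
    · rw [SetLike.mem_coe, eq_sub_of_add_eq (e2 a h.1 ha).symm]
      exact Submodule.sub_mem _ (mem _) (Submodule.smul_mem _ _ hj')
    · subst h
      exact hj'

end Pivot

section PivotPoly

variable {n : ℕ} {E : Type*} (p q : Fin n → Fin n → MvPolynomial E ℤ) (i j a b : Fin n)

open Classical in
/-- The numerator of the pivot formula for a matrix of fractions. -/
def pivotNum : MvPolynomial E ℤ :=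
  if a = j then if b = i then q i j else p i b * q i j
  else if b = i then -(p a j * q i j)
  else p a b * (q a j * q i b * p i j) - p a j * p i b * q i j * q a b

open Classical in
/-- The denominator of the pivot formula for a matrix of fractions. -/
def pivotDen : MvPolynomial E ℤ :=
  if a = j then if b = i then p i j else q i b * p i j
  else if b = i then q a j * p i j
  else q a b * (q a j * q i b * p i j)

variable {p q i j}

/-- Besides the old denominators only the numerator of the entry `(i, j)` has to be nonzero. -/
theorem aeval_pivot {F : Type*} [Field F] {x : E → F}
    (hq : ∀ a b, MvPolynomial.aeval x (q a b) ≠ 0) (hp : MvPolynomial.aeval x (p i j) ≠ 0) :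
    MvPolynomial.aeval x (pivotDen p q i j a b) ≠ 0 ∧
    MvPolynomial.aeval x (pivotNum p q i j a b) / MvPolynomial.aeval x (pivotDen p q i j a b) =
      pivot (fun a b => MvPolynomial.aeval x (p a b) / MvPolynomial.aeval x (q a b)) i j a b := by
  have h1 := hq i j
  have h2 := hq i b
  have h3 := hq a j
  have h4 := hq a b
  unfold pivotDen pivotNum pivot
  split_ifs
  · refine ⟨hp, ?_⟩
    field_simp
  · rw [map_mul, map_mul]
    refine ⟨mul_ne_zero h2 hp, ?_⟩
    field_simp
  · rw [map_neg, map_mul, map_mul]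
    refine ⟨mul_ne_zero h3 hp, ?_⟩
    field_simp
  · simp only [map_sub, map_mul]
    refine ⟨mul_ne_zero h4 (mul_ne_zero (mul_ne_zero h3 h2) hp), ?_⟩
    field_simp

end PivotPoly

/-! ### Inversion of variables in polynomials -/

section Flip

variable {E : Type*} [Fintype E] {R : Type*} [CommRing R]

open Classical in
/-- The polynomial that is obtained from `g` by the substitution of `σ e * X e` for `X e`, or of
`σ e / X e` if `e ∈ P`, after multiplication with the `M`-th powers of these variables. -/
def flipPoly (P : List E) (σ : E → ℤ) (M : ℕ) (g : MvPolynomial E R) : MvPolynomial E R :=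
  ∑ m ∈ g.support, MvPolynomial.C (g.coeff m) * ∏ e, (σ e : MvPolynomial E R) ^ m e *
    if e ∈ P then MvPolynomial.X e ^ (M - m e) else MvPolynomial.X e ^ m e

-- The degree bound makes the exponents `M - m e` genuine differences. The clearing factor does not
-- depend on `g`, so it cancels between a numerator and a denominator with the same `M`.
open Classical in
theorem aeval_flipPoly {F : Type*} [Field F] [Algebra R F] {P : List E} {σ : E → ℤ} {M : ℕ}
    {g : MvPolynomial E R} (hM : g.totalDegree ≤ M) {x : E → F} (hx : ∀ e, x e ≠ 0) :
    MvPolynomial.aeval x (flipPoly P σ M g) = (∏ e, if e ∈ P then x e ^ M else 1) *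
      MvPolynomial.aeval (fun e => (σ e : F) * reverseWeights P x e) g := by
  rw [flipPoly, map_sum, MvPolynomial.aeval_def (f := fun e => _), MvPolynomial.eval₂_eq',
    Finset.mul_sum]
  refine Finset.sum_congr rfl fun m hm => ?_
  rw [map_mul, MvPolynomial.aeval_C, map_prod, mul_left_comm, ← Finset.prod_mul_distrib]
  congr 1
  refine Finset.prod_congr rfl fun e _ => ?_
  have hle : m e ≤ M := ((MvPolynomial.monomial_le_degreeOf e hm).trans
    (MvPolynomial.degreeOf_le_totalDegree g e)).trans hM
  rw [map_mul, map_pow, map_intCast, reverseWeights]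
  split_ifs with he
  · rw [map_pow, MvPolynomial.aeval_X, mul_pow, inv_pow, mul_left_comm, pow_sub₀ _ (hx e) hle]
  · rw [map_pow, MvPolynomial.aeval_X, mul_pow, one_mul]

theorem exists_eval_ne_zero {g : MvPolynomial E ℂ} (hg : g ≠ 0) :
    ∃ x : E → ℂ, MvPolynomial.eval x g ≠ 0 ∧ ∀ e, x e ≠ 0 := by
  have h : g * ∏ e, MvPolynomial.X e ≠ 0 :=
    mul_ne_zero hg (Finset.prod_ne_zero_iff.2 fun e _ => MvPolynomial.X_ne_zero e)
  by_contra! hc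
  apply h
  apply MvPolynomial.funext
  intro x
  rw [map_mul, map_prod, map_zero]
  by_cases hx : MvPolynomial.eval x g = 0
  · rw [hx, zero_mul]
  · obtain ⟨e, he⟩ := hc x hx
    rw [Finset.prod_eq_zero (Finset.mem_univ e) (by rw [MvPolynomial.eval_X, he]), mul_zero]

omit [Fintype E] in
theorem reverseWeights_reverseWeights {F : Type*} [Field F] (P : List E) (x : E → F) :
    reverseWeights P (reverseWeights P x) = x := by
  ext e
  unfold reverseWeights
  split_ifs <;> simp

theorem flipPoly_ne_zero {P : List E} {σ : E → ℤ} (hσ : ∀ e, σ e * σ e = 1)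
    {g : MvPolynomial E ℂ} (hg : g ≠ 0) : flipPoly P σ g.totalDegree g ≠ 0 := by
  classical
  obtain ⟨x, hx, hx0⟩ := exists_eval_ne_zero hg
  have hσ' : ∀ e, (σ e : ℂ) * σ e = 1 := fun e => by exact_mod_cast hσ e
  have hσ0 : ∀ e, (σ e : ℂ) ≠ 0 := fun e h => by have := hσ' e; rw [h, mul_zero] at this; simp at this
  intro h
  -- The substitution sends `y` to the point `x`, at which `g` does not vanish.
  set y := reverseWeights P fun e => (σ e : ℂ) * x e with hy
  have hy0 : ∀ e, y e ≠ 0 := by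
    intro e
    rw [hy, reverseWeights]
    split_ifs
    · exact inv_ne_zero (mul_ne_zero (hσ0 e) (hx0 e))
    · exact mul_ne_zero (hσ0 e) (hx0 e)
  have key := aeval_flipPoly (P := P) (σ := σ) (g := g) le_rfl hy0
  have e1 : (fun e => (σ e : ℂ) * reverseWeights P y e) = x := by
    rw [hy, reverseWeights_reverseWeights]
    ext e
    rw [← mul_assoc, hσ' e, one_mul]
  rw [h, map_zero, e1, MvPolynomial.aeval_eq_eval] at key
  refine mul_ne_zero (Finset.prod_ne_zero_iff.2 fun e _ => ?_) hx key.symm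
  split_ifs
  · exact pow_ne_zero _ (hy0 e)
  · exact one_ne_zero

end Flip

end AnnularNet

end

noncomputable section

/-! ### From complex weights to integral power series and arbitrary fields -/

namespace AnnularNet

/-- Polynomials are determined by their values off a hypersurface, so all denominators may be
assumed to be nonzero. -/
theorem eq_of_eval_eq_of_ne_zero {E : Type*} {g f h : MvPolynomial E ℂ} (hg : g ≠ 0)
    (H : ∀ x, MvPolynomial.eval x g ≠ 0 → MvPolynomial.eval x f = MvPolynomial.eval x h) :
    f = h := by
  apply mul_left_cancel₀ hg
  apply MvPolynomial.funext
  intro x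
  rw [map_mul, map_mul]
  by_cases hx : MvPolynomial.eval x g = 0
  · rw [hx, zero_mul, zero_mul]
  · rw [H x hx]

theorem eval_map_intCast {E : Type*} (x : E → ℂ) (g : MvPolynomial E ℤ) :
    MvPolynomial.eval x (MvPolynomial.map (Int.castRingHom ℂ) g) = MvPolynomial.aeval x g := by
  rw [MvPolynomial.eval_map, MvPolynomial.aeval_def]; rfl

theorem map_intCast_injective {E : Type*} :
    Function.Injective (MvPowerSeries.map (σ := E) (Int.castRingHom ℂ)) := by
  intro f g h
  ext m
  have := congrArg (MvPowerSeries.coeff m) h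
  simpa [MvPowerSeries.coeff_map] using this

theorem map_coe_intCast {E : Type*} (g : MvPolynomial E ℤ) :
    MvPowerSeries.map (Int.castRingHom ℂ) (g : MvPowerSeries E ℤ) =
      (MvPolynomial.map (Int.castRingHom ℂ) g : MvPowerSeries E ℂ) := by
  ext m
  simp [MvPowerSeries.coeff_map, MvPolynomial.coeff_map]

theorem aeval_comp_ringHom {E F : Type*} [Field F] (θ : F →+* F) (v : E → F)
    (g : MvPolynomial E ℤ) :
    MvPolynomial.aeval (fun e => θ (v e)) g = θ (MvPolynomial.aeval v g) := by
  have := MvPolynomial.map_aeval v θ g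
  rw [this, MvPolynomial.aeval_def, MvPolynomial.coe_eval₂Hom]
  congr 1
  exact RingHom.ext_int _ _

theorem HasRatValue.ratValue_eq {E F : Type*} [Field F] {f : MvPowerSeries E ℤ} {v : E → F}
    {x : F} (h : HasRatValue f v x) : ratValue f v = x := by
  have hx : ∃ x, HasRatValue f v x := ⟨x, h⟩
  rw [ratValue, dif_pos hx]
  exact hx.choose_spec.unique h

namespace AnnularGraph

variable {n : ℕ} {V₀ E : Type*} {N : AnnularGraph n V₀ E}

/-! ### Boundary measurements after the reversal of a path -/

/-- The boundary measurements of the network with a reversed path, as rational functions of the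
weights. -/
theorem reverse_measSeries [Fintype E] {i j : Fin n} {P : List E} (hN : N.IsPerfect)
    (hP : N.IsPath i j P) (hs : N.IsSimplePath P) (hcut : N.AvoidsCut P)
    {p q : Fin n → Fin n → MvPolynomial E ℤ} (hq : ∀ a b, q a b ≠ 0) (hp : p i j ≠ 0)
    (hpq : ∀ a b, N.IsSource a → N.IsSink b →
      (q a b : MvPowerSeries E ℤ) * ((-1) ^ N.between a b * N.measSeries a b) = p a b)
    {a b : Fin n} (ha : (N.reverse P).IsSource a) (hb : (N.reverse P).IsSink b) {M : ℕ}
    (hM1 : (pivotNum p q i j a b).totalDegree ≤ M)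
    (hM2 : (pivotDen p q i j a b).totalDegree ≤ M) :
    (flipPoly P (N.crossSign i j) M (pivotDen p q i j a b) : MvPowerSeries E ℤ) *
      ((-1) ^ (N.reverse P).between a b * (N.reverse P).measSeries a b) =
      flipPoly P (N.crossSign i j) M (pivotNum p q i j a b) := by
  classical
  set φ := Int.castRingHom ℂ with hφ
  have hN' := hN.reverse hP hs
  obtain ⟨Q, A, hQ0, hQA, hA, hex⟩ := hN.exists_response
  obtain ⟨Q', A', hQ0', hQA', hA', -⟩ := hN'.exists_response
  set σ := N.crossSign i j with hσ
  have hσσ : ∀ e, σ e * σ e = 1 := crossSign_mul_self i j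
  have φinj : Function.Injective (MvPolynomial.map (σ := E) φ) :=
    MvPolynomial.map_injective φ Int.cast_injective
  -- Two fractions that represent the same power series.
  have hcross : ∀ a b, N.IsSource a → N.IsSink b →
      Q * MvPolynomial.map φ (p a b) = MvPolynomial.map φ (q a b) * A a b := by
    intro a b ha hb
    apply MvPolynomial.coe_injective
    rw [MvPolynomial.coe_mul, MvPolynomial.coe_mul, ← hQA a b ha hb, ← map_coe_intCast,
      ← map_coe_intCast, ← hpq a b ha hb]
    simp only [map_mul, map_pow, map_neg, map_one]
    ring
  set fl : MvPolynomial E ℂ → MvPolynomial E ℂ := fun g => flipPoly P σ g.totalDegree g with hfl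
  have fl0 : ∀ {g : MvPolynomial E ℂ}, g ≠ 0 → fl g ≠ 0 := fun hg => flipPoly_ne_zero hσσ hg
  have mapne : ∀ {g : MvPolynomial E ℤ}, g ≠ 0 → MvPolynomial.map φ g ≠ 0 := fun hg h =>
    hg (φinj (by rw [h, map_zero]))
  -- It is enough to check this at complex points where the edge weights and all denominators,
  -- pulled back by the substitution where necessary, are nonzero.
  have key : A' a b * MvPolynomial.map φ (flipPoly P σ M (pivotDen p q i j a b)) =
      MvPolynomial.map φ (flipPoly P σ M (pivotNum p q i j a b)) * Q' := by
    refine eq_of_eval_eq_of_ne_zero (g := (∏ e, MvPolynomial.X e) * fl Q * Q' *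
      (∏ a, ∏ b, fl (MvPolynomial.map φ (q a b))) * fl (MvPolynomial.map φ (p i j))) ?_ ?_
    · refine mul_ne_zero (mul_ne_zero (mul_ne_zero (mul_ne_zero ?_ (fl0 hQ0)) hQ0') ?_)
        (fl0 (mapne hp))
      · exact Finset.prod_ne_zero_iff.2 fun e _ => MvPolynomial.X_ne_zero e
      · exact Finset.prod_ne_zero_iff.2 fun a _ => Finset.prod_ne_zero_iff.2 fun b _ =>
          fl0 (mapne (hq a b))
    intro y hy
    simp only [map_mul, map_prod, MvPolynomial.eval_X, mul_ne_zero_iff, Finset.prod_ne_zero_iff,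
      Finset.mem_univ, true_imp_iff] at hy
    obtain ⟨⟨⟨⟨hy0, hyQ⟩, hyQ'⟩, hyq⟩, hyp⟩ := hy
    -- The twisted weights of the original network that correspond to the weights `y` of the
    -- reversed one.
    set z : E → ℂ := fun e => (σ e : ℂ) * reverseWeights P y e with hz
    have unflip : ∀ {g : MvPolynomial E ℂ}, MvPolynomial.eval y (fl g) ≠ 0 →
        MvPolynomial.eval z g ≠ 0 := by
      intro g hg h0
      apply hg
      have := aeval_flipPoly (P := P) (σ := σ) (g := g) le_rfl hy0
      rw [MvPolynomial.aeval_eq_eval] at this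
      rw [hfl, this]
      rw [MvPolynomial.aeval_eq_eval, h0, mul_zero]
    have zQ := unflip hyQ
    have zq : ∀ a b, MvPolynomial.aeval z (q a b) ≠ 0 := fun a b => by
      rw [← eval_map_intCast]; exact unflip (hyq a b)
    have zp : MvPolynomial.aeval z (p i j) ≠ 0 := by
      rw [← eval_map_intCast]; exact unflip hyp
    have resp : ∀ a b, N.IsSource a → N.IsSink b →
        MvPolynomial.eval z (A a b) / MvPolynomial.eval z Q =
          MvPolynomial.aeval z (p a b) / MvPolynomial.aeval z (q a b) := by
      intro a b ha hb
      rw [div_eq_div_iff zQ (zq a b)]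
      have := congrArg (MvPolynomial.eval z) (hcross a b ha hb)
      rw [map_mul, map_mul, eval_map_intCast, eval_map_intCast] at this
      linear_combination -this
    have hi := hP.isSource hN
    have hj := hP.isSink hN
    -- A vector that is balanced for `N` at `z` is balanced for the reversed network at `y`; this
    -- forces the pivot relation between the two responses.
    have piv := eq_pivot (S := N.IsSource) (S' := (N.reverse P).IsSource) (i := i) (j := j)
      (A := fun a b => MvPolynomial.aeval z (p a b) / MvPolynomial.aeval z (q a b))
      (A' := fun a b => MvPolynomial.eval y (A' a b) / MvPolynomial.eval y Q')
      (B := N.Balanced z) hi (fun h => h.not_isSink hj) (reverse_isSource_eq hP hs hN)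
      (div_ne_zero zp (zq i j))
      (fun t => by
        obtain ⟨c, h1, h2⟩ := hex z zQ t
        exact ⟨c, h1, fun b hb => h2 b (hN.not_isSource_iff.1 hb)⟩)
      (fun c hc a ha => by
        have := hA z c hc a ha
        have e : c a = (MvPolynomial.eval z Q)⁻¹ * (MvPolynomial.eval z Q * c a) := by
          rw [← mul_assoc, inv_mul_cancel₀ zQ, one_mul]
        rw [e, this, mul_neg, Finset.mul_sum]
        congr 1
        refine Finset.sum_congr (Finset.filter_congr fun b _ => hN.not_isSource_iff.symm)
          fun b hb => ?_
        simp only [Finset.mem_filter, Finset.mem_univ, true_and] at hb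
        rw [← resp a b ha (hN.not_isSource_iff.1 hb)]
        ring)
      (fun c hc a ha => by
        have hc' : (N.reverse P).Balanced y c := by
          have hr : ∀ e, reverseWeights P y e ≠ 0 := fun e => by
            rw [reverseWeights]
            split_ifs
            · exact inv_ne_zero (hy0 e)
            · exact hy0 e
          have := Balanced.reverse hN hP hs hcut hr (c := c) hc
          rwa [reverseWeights_reverseWeights] at this
        have := hA' y c hc' a ha
        have e : c a = (MvPolynomial.eval y Q')⁻¹ * (MvPolynomial.eval y Q' * c a) := by
          rw [← mul_assoc, inv_mul_cancel₀ hyQ', one_mul]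
        rw [e, this, mul_neg, Finset.mul_sum]
        congr 1
        refine Finset.sum_congr (Finset.filter_congr fun b _ => hN'.not_isSource_iff.symm)
          fun b hb => ?_
        ring)
      ha (hN'.not_isSource_iff.2 hb)
    obtain ⟨hden, hnum⟩ := aeval_pivot a b zq zp
    rw [← hnum, div_eq_div_iff hyQ' hden] at piv
    rw [map_mul, map_mul, eval_map_intCast, eval_map_intCast, aeval_flipPoly hM1 hy0,
      aeval_flipPoly hM2 hy0]
    linear_combination (∏ e, if e ∈ P then y e ^ M else 1) * piv
  have hQ'' : (Q' : MvPowerSeries E ℂ) ≠ 0 := fun h => hQ0' (MvPolynomial.coe_injective _ _ (by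
    rw [h, MvPolynomial.coe_zero]))
  apply map_intCast_injective
  -- The denominator `Q'` is auxiliary; complex power series form a domain, so it can be cancelled.
  apply mul_left_cancel₀ hQ''
  have k2 := congrArg (fun g : MvPolynomial E ℂ => (g : MvPowerSeries E ℂ)) key
  simp only [MvPolynomial.coe_mul] at k2
  rw [map_mul, map_coe_intCast, map_coe_intCast]
  have e3 : MvPowerSeries.map φ ((-1) ^ (N.reverse P).between a b * (N.reverse P).measSeries a b) =
      (-1) ^ (N.reverse P).between a b * MvPowerSeries.map φ ((N.reverse P).measSeries a b) := by
    simp only [map_mul, map_pow, map_neg, map_one]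
  rw [e3]
  linear_combination (MvPolynomial.map φ (flipPoly P σ M (pivotDen p q i j a b)) :
    MvPowerSeries E ℂ) * hQA' a b ha hb + k2

/-! ### The substitution in the variable of the cut -/

section Twist

variable {K : Type*} [Field K]

theorem negVar_C (c : K) : negVar K (RatFunc.C c) = RatFunc.C c :=
  (negVar K).commutes c

theorem negVar_X : negVar K RatFunc.X = -RatFunc.X := by
  have h := RatFunc.map_apply_div
    (Polynomial.algEquivAevalNegX : Polynomial K ≃ₐ[K] Polynomial K).toAlgHom
    (nonZeroDivisors_le_comap_nonZeroDivisors_of_injective _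
      (Polynomial.algEquivAevalNegX : Polynomial K ≃ₐ[K] Polynomial K).injective) Polynomial.X 1
  rw [negVar, RatFunc.coe_mapAlgHom_eq_coe_map]
  simpa using h

open Classical in
/-- The substitution in rational functions that belongs to a path from `b_i` to `b_j`. -/
def cutTwist (N : AnnularGraph n V₀ E) (K : Type*) [Field K] (i j : Fin n) :
    RatFunc K →+* RatFunc K :=
  if N.OnOuter i ↔ N.OnOuter j then RingHom.id _ else (negVar K : RatFunc K →+* RatFunc K)

/-- Replacing `λ` by `-λ` multiplies `λ ^ ind` by `(-1) ^ ind`, which is the sign that the side of a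
path acquires along the edge. -/
theorem cutTwist_modWeight (i j : Fin n) (w : E → K) (e : E) :
    N.cutTwist K i j (N.modWeight w e) = (N.crossSign i j e : RatFunc K) * N.modWeight w e := by
  rw [cutTwist, crossSign, modWeight]
  split_ifs
  · simp
  · rw [RingHom.coe_coe, map_mul, map_zpow₀, negVar_C, negVar_X]
    rcases Int.even_or_odd ((N.curve e).ind N.cut) with h | h
    · rw [h.neg_zpow, h.neg_one_zpow]; simp
    · rw [h.neg_zpow, h.neg_one_zpow]; simp

theorem loopTwist_span (i j : Fin n) {ι : Type*} (r : ι → Fin n → RatFunc K) :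
    N.loopTwist i j (Submodule.span (RatFunc K) (Set.range r)) =
      Submodule.span (RatFunc K) (Set.range fun a t => N.cutTwist K i j (r a t)) := by
  rw [loopTwist, cutTwist]
  split_ifs
  · rfl
  · apply le_antisymm
    · rw [negLoop, Submodule.span_le]
      rintro _ ⟨x, hx, rfl⟩
      rw [SetLike.mem_coe] at hx ⊢
      induction hx using Submodule.span_induction with
      | mem x hx =>
        obtain ⟨a, rfl⟩ := hx
        exact Submodule.subset_span ⟨a, rfl⟩
      | zero => simp only [Pi.zero_apply, map_zero]; exact Submodule.zero_mem _
      | add x y _ _ hx hy =>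
        simp only [Pi.add_apply, map_add]
        exact Submodule.add_mem _ hx hy
      | smul c x _ hx =>
        simp only [Pi.smul_apply, smul_eq_mul, map_mul]
        exact Submodule.smul_mem _ (negVar K c) hx
    · rw [Submodule.span_le]
      rintro _ ⟨a, rfl⟩
      exact Submodule.subset_span ⟨r a, Submodule.subset_span ⟨a, rfl⟩, rfl⟩

/-- The edges of `P` have index 0 before and after the reversal, so their weights contain no power
of `λ`; the other edges do not change. -/
theorem reverse_modWeight {P : List E} (hcut : N.AvoidsCut P) (w : E → K) :
    (N.reverse P).modWeight (reverseWeights P w) = reverseWeights P (N.modWeight w) := by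
  ext e
  have hc : (N.reverse P).cut = N.cut := rfl
  rw [modWeight, reverseWeights, reverseWeights, modWeight, hc]
  split_ifs with he
  · rw [ind_eq_zero (hcut e he), ind_eq_zero]
    · simp
    · rw [reverse_carrier]; exact hcut e he
  · rw [reverse_curve_of_notMem he]

theorem modWeight_ne_zero {w : E → K} (hw : ∀ e, w e ≠ 0) (e : E) : N.modWeight w e ≠ 0 :=
  mul_ne_zero (by simpa using hw e) (zpow_ne_zero _ RatFunc.X_ne_zero)

end Twist

/-! ### The Grassmannian boundary measurement after the reversal of a path -/

/-- The integral identity of `reverse_measSeries` is evaluated in an arbitrary field. The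
endomorphism `θ` realizes the signs `crossSign` on the weights, so the old values enter through `θ`;
`m i j ≠ 0` keeps the pivot denominators from vanishing. -/
theorem hasRatValue_reverse {F : Type*} [Field F] [Fintype E] {i j : Fin n} {P : List E}
    (hN : N.IsPerfect) (hP : N.IsPath i j P) (hs : N.IsSimplePath P) (hcut : N.AvoidsCut P)
    {v : E → F} (hv0 : ∀ e, v e ≠ 0) {m : Fin n → Fin n → F}
    (hm : ∀ a b, N.IsSource a → N.IsSink b → HasRatValue (N.measSeries a b) v (m a b))
    (hmij : m i j ≠ 0) (θ : F →+* F) (hθ : ∀ e, θ (v e) = (N.crossSign i j e : F) * v e)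
    {a b : Fin n} (ha : (N.reverse P).IsSource a) (hb : (N.reverse P).IsSink b) :
    HasRatValue ((N.reverse P).measSeries a b) (reverseWeights P v)
      ((-1) ^ (N.reverse P).between a b *
        pivot (fun a b => θ ((-1) ^ N.between a b * m a b)) i j a b) := by
  classical
  have hi := hP.isSource hN
  have hj := hP.isSink hN
  have hv : ∀ a b, ∃ p q : MvPolynomial E ℤ, MvPolynomial.aeval v q ≠ 0 ∧
      (N.IsSource a → N.IsSink b →
        (q : MvPowerSeries E ℤ) * ((-1) ^ N.between a b * N.measSeries a b) = p ∧
        (-1) ^ N.between a b * m a b =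
          MvPolynomial.aeval v p / MvPolynomial.aeval v q) := by
    intro a b
    by_cases h : N.IsSource a ∧ N.IsSink b
    · obtain ⟨p, q, h1, h2, h3⟩ := hm a b h.1 h.2
      refine ⟨(-1) ^ N.between a b * p, q, h2, fun _ _ => ⟨?_, ?_⟩⟩
      · rw [MvPolynomial.coe_mul, ← h1, MvPolynomial.coe_pow, ← MvPolynomial.C_1, ← map_neg,
          MvPolynomial.coe_C]
        simp only [map_neg, map_one]
        ring
      · rw [h3]
        simp only [map_mul, map_pow, map_neg, map_one]
        ring
    · exact ⟨0, 1, by simp, fun ha hb => absurd ⟨ha, hb⟩ h⟩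
  choose p q hq hpq using hv
  have hpv : MvPolynomial.aeval v (p i j) ≠ 0 := by
    intro h
    have := (hpq i j hi hj).2
    rw [h, zero_div] at this
    exact mul_ne_zero (pow_ne_zero _ (neg_ne_zero.2 one_ne_zero)) hmij this
  have hz : (fun e => (N.crossSign i j e : F) *
      reverseWeights P (reverseWeights P v) e) = fun e => θ (v e) := by
    ext e
    rw [reverseWeights_reverseWeights, hθ]
  have hθ0 : ∀ {x}, x ≠ 0 → θ x ≠ 0 := fun hx h => hx (by simpa using h)
  obtain ⟨hden, hnum⟩ := aeval_pivot (p := p) (q := q) (i := i) (j := j)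
    (x := fun e => θ (v e)) a b
    (fun a b => by rw [aeval_comp_ringHom]; exact hθ0 (hq a b))
    (by rw [aeval_comp_ringHom]; exact hθ0 hpv)
  have hr0 : ∀ e, reverseWeights P v e ≠ 0 := fun e => by
    rw [reverseWeights]
    split_ifs
    · exact inv_ne_zero (hv0 e)
    · exact hv0 e
  -- One exponent for both polynomials, so that their clearing factors cancel.
  set M := max (pivotNum p q i j a b).totalDegree (pivotDen p q i j a b).totalDegree with hMdef
  have hM1 : (pivotNum p q i j a b).totalDegree ≤ M := le_max_left _ _
  have hM2 : (pivotDen p q i j a b).totalDegree ≤ M := le_max_right _ _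
  have hser := reverse_measSeries hN hP hs hcut (p := p) (q := q)
    (fun a b h => hq a b (by rw [h, map_zero])) (fun h => hpv (by rw [h, map_zero]))
    (fun a b ha hb => (hpq a b ha hb).1) ha hb hM1 hM2
  set κ : F := ∏ e, if e ∈ P then reverseWeights P v e ^ M else 1 with hκ
  have hκ0 : κ ≠ 0 := by
    refine Finset.prod_ne_zero_iff.2 fun e _ => ?_
    split_ifs
    · exact pow_ne_zero _ (hr0 e)
    · exact one_ne_zero
  have hsq : ∀ {R : Type _} [CommRing R] (m : ℕ), (-1 : R) ^ m * (-1) ^ m = 1 := fun m => by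
    rw [← mul_pow]; simp
  refine ⟨(-1) ^ (N.reverse P).between a b * flipPoly P (N.crossSign i j) M (pivotNum p q i j a b),
    flipPoly P (N.crossSign i j) M (pivotDen p q i j a b), ?_, ?_, ?_⟩
  · rw [MvPolynomial.coe_mul, ← hser, MvPolynomial.coe_pow, ← MvPolynomial.C_1, ← map_neg,
      MvPolynomial.coe_C]
    simp only [map_neg, map_one]
    rw [mul_left_comm, ← mul_assoc ((-1) ^ _) ((-1) ^ _), hsq, one_mul]
  · rw [aeval_flipPoly hM2 hr0, hz]
    exact mul_ne_zero hκ0 hden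
  · rw [map_mul, aeval_flipPoly hM1 hr0, aeval_flipPoly hM2 hr0, hz,
      mul_div_assoc, mul_div_mul_left _ _ hκ0, hnum]
    simp only [map_pow, map_neg, map_one]
    have hconv : ∀ a b, N.IsSource a → N.IsSink b →
        MvPolynomial.aeval (fun e => θ (v e)) (p a b) /
          MvPolynomial.aeval (fun e => θ (v e)) (q a b) = θ ((-1) ^ N.between a b * m a b) := by
      intro a b ha hb
      rw [aeval_comp_ringHom, aeval_comp_ringHom, ← map_div₀, (hpq a b ha hb).2]
    have ha' := (reverse_isSource_eq hP hs hN a).1 ha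
    have hb' : b ≠ i → N.IsSink b := fun hbi => by
      rw [← hN.not_isSource_iff]
      intro h
      exact ((reverse_isSource_eq hP hs hN b).2 (Or.inl ⟨h, hbi⟩)).not_isSink hb
    congr 1
    unfold pivot
    by_cases haj : a = j
    · by_cases hbi : b = i
      · simp only [if_pos haj, if_pos hbi, hconv i j hi hj]
      · simp only [if_pos haj, if_neg hbi, hconv i j hi hj, hconv i b hi (hb' hbi)]
    · have hsa := (ha'.resolve_right haj).1
      by_cases hbi : b = i
      · simp only [if_neg haj, if_pos hbi, hconv i j hi hj, hconv a j hsa hj]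
      · simp only [if_neg haj, if_neg hbi, hconv i j hi hj, hconv a j hsa hj,
          hconv i b hi (hb' hbi), hconv a b hsa (hb' hbi)]

end AnnularGraph

end AnnularNet

end

/-! ### The path reversal theorem -/

theorem theorem4p1 {n : ℕ} {V₀ E K : Type*} [Finite V₀] [Finite E] [Field K]
    (N : AnnularNet.AnnularGraph n V₀ E) (hN : N.IsPerfect)
    (w : E → K) (hw : ∀ e, w e ≠ 0) (hreg : N.Regular w)
    (i j : Fin n) (P : List E) (hP : N.IsPath i j P) (hsimple : N.IsSimplePath P)
    (hcut : N.AvoidsCut P) (hM : N.meas w i j ≠ 0) :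
    (N.reverse P).Regular (AnnularNet.reverseWeights P w) ∧
    N.loopTwist i j (N.grassMeas w) =
      (N.reverse P).grassMeas (AnnularNet.reverseWeights P w) := by
  have := Fintype.ofFinite E
  have hi := hP.isSource hN
  have hj := hP.isSink hN
  have hm : ∀ a b, N.IsSource a → N.IsSink b →
      AnnularNet.HasRatValue (N.measSeries a b) (N.modWeight w) (N.meas w a b) := by
    intro a b ha hb
    obtain ⟨x, hx⟩ := hreg a b ha hb
    rwa [AnnularNet.AnnularGraph.meas, hx.ratValue_eq]
  have hval := fun {a b : Fin n} (ha : (N.reverse P).IsSource a) (hb : (N.reverse P).IsSink b) =>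
    AnnularNet.AnnularGraph.hasRatValue_reverse hN hP hsimple hcut
      (AnnularNet.AnnularGraph.modWeight_ne_zero hw) hm hM (N.cutTwist K i j)
      (AnnularNet.AnnularGraph.cutTwist_modWeight i j w) ha hb
  rw [← AnnularNet.AnnularGraph.reverse_modWeight hcut] at hval
  refine ⟨fun a b ha hb => ⟨_, hval ha hb⟩, ?_⟩
  rw [AnnularNet.AnnularGraph.grassMeas, AnnularNet.AnnularGraph.loopTwist_span,
    AnnularNet.AnnularGraph.grassMeas]
  -- The new signed measurements are the pivot of the twisted old ones, so the two row spaces agree.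
  have hspan := AnnularNet.span_pivot (S := N.IsSource) (S' := (N.reverse P).IsSource)
    (i := i) (j := j) (A := fun a b => N.cutTwist K i j ((-1) ^ N.between a b * N.meas w a b))
    (A' := fun a b => (-1) ^ (N.reverse P).between a b *
      (N.reverse P).meas (AnnularNet.reverseWeights P w) a b) hi (fun h => h.not_isSink hj)
    (AnnularNet.AnnularGraph.reverse_isSource_eq hP hsimple hN)
    (by
      rw [map_ne_zero]
      exact mul_ne_zero (pow_ne_zero _ (neg_ne_zero.2 one_ne_zero)) hM)
    (fun a b ha hb => by
      have h := (hval ha ((hN.reverse hP hsimple).not_isSource_iff.1 hb)).ratValue_eq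
      rw [AnnularNet.AnnularGraph.meas, h, ← mul_assoc, ← mul_pow]
      simp)
  refine Eq.trans ?_ hspan
  congr 2
  ext a t
  simp only [AnnularNet.AnnularGraph.extMatrix, Matrix.row, Matrix.of_apply]
  split_ifs <;> simp
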